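/- **Setting.** Let $R>0$, let $M=\{x\in\mathbb R^3:|x|\le R\}$ with the flat metric $\delta$, let $n=x/|x|$, $r=|x|$. All vector fields $\sigma$ on $M$ are smooth up to the boundary. For each $\ell\ge 0$ let $Y_{\ell m}$ ($2\ell+1$ values of $m$) be an orthonormal basis in $L^2(S^2)$ of the real spherical harmonics of degree $\ell$, extended to $x\neq0$ by $Y_{\ell m}(x/|x|)$; such bases exist, and the statements hold for each of them. The momentum constraint is $\partial^i\partial_{[i}\sigma_{j]}=0$, equivalently $\nabla\times\nabla\times\sigma=0$; the Hamiltonian constraint is $(\partial_i\sigma^i)^2-\partial_{(i}\sigma_{j)}\partial^i\sigma^j=0$; $\sigma$ is boundary preserving if $n\cdot\sigma=0$ on $\partial M$. A *solution* is a boundary preserving $\sigma$ satisfying the momentum constraint. With $\delta h_{ij}=\partial_i\sigma_j+\partial_j\sigma_i$ the metric is $$\mathrm g(\sigma^{(1)},\sigma^{(2)})=\tfrac12\int_M\big(\delta^{ik}\delta^{jl}-\delta^{ij}\delta^{kl}\big)\,\delta h^{(1)}_{ij}\,\delta h^{(2)}_{kl}\,dV .$$ On $\partial M$ put $\mathbb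 D\sigma=D^\perp\sigma-\mathscr K\sigma$, where $D^\perp\sigma$ is the tangential part of $\nabla_n$ of the tangential part of $\sigma$, and $\mathscr K(v)=\nabla_v n$ is the extrinsic curvature. **Mode expansion.** A vector field $\sigma$ satisfies the momentum constraint if and only if $$\sigma=\sum_{\ell,m}\Big(a_{\ell m}\,r^\ell\,\vec r\times\nabla Y_{\ell m}+\nabla\big(f_{\ell m}(r)Y_{\ell m}\big)\Big)$$ for some constants $a_{\ell m}$ and radial functions $f_{\ell m}$ with each $f_{\ell m}(r)Y_{\ell m}$ smooth on $M$, the series converging unconditionally and uniformly on $M$. Given such an expansion, $\sigma$ is boundary preserving if and only if $f_{\ell m}'(R)=0$ for all $\ell,m$. **Metric.** For solutions $\sigma^{(1)},\sigma^{(2)}$ with such expansions, $$\mathrm g(\sigma^{(1)},\sigma^{(2)})=R^3\sum_{\ell,m}\ell(\ell+1)\Big((\ell-1)\,\hat a^{(1)}_{\ell m}\hat a^{(2)}_{\ell m}-2\,\hat f^{(1)}_{\ell m}\hat f^{(2)}_{\ell m}\Big),\qquad \hat a_{\ell m}=R^{\ell-1}a_{\ell m},\quad \hat f_{\ell m}=R^{-2}f_{\ell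 m}(R),$$ with an unconditionally convergent sum. (For $R=1$ the summand is $\ell(\ell+1)\big((\ell-1)a^{(1)}_{\ell m}a^{(2)}_{\ell m}-2f^{(1)}_{\ell m}(1)f^{(2)}_{\ell m}(1)\big)$.) **Mixing.** A solution of the Hamiltonian constraint has $\mathrm g(\sigma,\sigma)=0$. If a solution $\sigma$ has $\mathrm g(\sigma,\sigma)=0$ and $\sigma|_{\partial M}$ is not an infinitesimal rotation $x\mapsto w\times x$, then some $a_{\ell m}$ with $\ell\ge2$ and some $f_{\ell m}(R)$ with $\ell\ge1$ are nonzero. The same holds if $\sigma$ is a solution that also satisfies the Hamiltonian constraint and is not an infinitesimal rotation on $M$. **The operator $\mathbb D$ and its kernel.** Every smooth tangent vector field $\zeta$ on $\partial M$ is the boundary value of a solution $\sigma$, and $\mathbb D\zeta:=\mathbb D\sigma$ does not depend on the choice of $\sigma$. One has $\mathrm g(\sigma^{(1)},\sigma^{(2)})=\oint_{\partial M}\sigma^{(1)}\cdot\mathbb D\sigma^{(2)}\,dA$. For a solution, $\mathbb D\sigma=0$ if and only if $a_{\ell m}=0$ for all $\ell>1$ and $f_{\ell m}(R)=0$ for all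 $\ell\ge1$. Hence $$\ker\mathbb D=\Big\{\sum_m a_{1m}\,R\,\vec R\times\nabla Y_{1m}\Big\}=\{x\mapsto w\times x:\ w\in\mathbb R^3\},\qquad \vec R=x\in\partial M .$$ **Space of vacua.** The group $\mathrm{biso}(\delta)$ of diffeomorphisms of $\partial M\cong S^2$ induced by the orientation preserving isometries of $M$ is $\mathrm{SO}(3)$, acting faithfully by rotations. So, identifying $\varphi$ with $S\circ\varphi$ for $S\in\mathrm{biso}(\delta)$, the space of vacua is $\mathcal V=\mathrm{Diff}(\partial M)/\mathrm{biso}(\delta)=\mathrm{Diff}(S^2)/\mathrm{SO}(3)$. The form $(V,W)\mapsto\mathrm g(\sigma,\tau)$ on $T_\varphi\mathrm{Diff}(S^2)$, where $\sigma,\tau$ are solutions with boundary values $V\circ\varphi^{-1},W\circ\varphi^{-1}$ (scaled to radius $R$), descends to a symmetric nondegenerate bilinear form on $T_\varphi\mathrm{Diff}(S^2)/T_\varphi(\mathrm{SO}(3)\circ\varphi)$ for every $\varphi$, and these forms are invariant under $\varphi\mapsto A\circ\varphi$, $A\in\mathrm{SO}(3)$; that is, they define a nondegenerate metric on $\mathcal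 V$. -/

import Mathlib

open Set Metric MeasureTheory Filter Topology
open scoped Manifold ContDiff InnerProductSpace

namespace RoundBall

/-- Euclidean three-space. -/
abbrev E3 : Type := EuclideanSpace ℝ (Fin 3)

/-- The unit two-sphere; the boundary of the ball of radius `R` is `{R • q | q ∈ S²}`. -/
abbrev S2 : Type := sphere (0 : E3) 1

/-- The closed ball of radius `R`, i.e. the spatial manifold with boundary. -/
abbrev ball (R : ℝ) : Set E3 := closedBall (0 : E3) R

/-- Area measure of the unit sphere (total mass `4π`). -/
noncomputable abbrev area : Measure S2 := (volume : Measure E3).toSphere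

/-- The cross product. -/
noncomputable def cross (u v : E3) : E3 :=
  WithLp.toLp 2 (crossProduct u.ofLp v.ofLp)

/-! ### Fields on the ball -/

/-- Standard basis vector. -/
noncomputable def basisVec (i : Fin 3) : E3 := EuclideanSpace.single i 1

/-- Partial derivative of a scalar function on the closed ball (one-sided at the boundary). -/
noncomputable def pd (R : ℝ) (i : Fin 3) (u : E3 → ℝ) (x : E3) : ℝ :=
  fderivWithin ℝ u (ball R) x (basisVec i)

/-- `∂_i σ_j`. -/
noncomputable def dcomp (R : ℝ) (σ : E3 → E3) (i j : Fin 3) (x : E3) : ℝ :=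
  pd R i (fun y => σ y j) x

/-- Curl of a vector field. -/
noncomputable def curl (R : ℝ) (σ : E3 → E3) (x : E3) : E3 :=
  !₂[dcomp R σ 1 2 x - dcomp R σ 2 1 x,
     dcomp R σ 2 0 x - dcomp R σ 0 2 x,
     dcomp R σ 0 1 x - dcomp R σ 1 0 x]

/-- The momentum constraint `∇^i ∇_[i σ_j] = 0` for the flat metric on the ball. -/
def MomentumConstraint (R : ℝ) (σ : E3 → E3) : Prop :=
  ∀ x ∈ ball R, ∀ j : Fin 3,
    ∑ i : Fin 3, pd R i (fun y => (1 / 2) * (dcomp R σ i j y - dcomp R σ j i y)) x = 0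

/-- The Hamiltonian constraint `(∇_i σ^i)² - ∇_(i σ_j) ∇^i σ^j = 0` for the flat metric. -/
def HamiltonianConstraint (R : ℝ) (σ : E3 → E3) : Prop :=
  ∀ x ∈ ball R,
    (∑ i : Fin 3, dcomp R σ i i x) ^ 2
      - ∑ i : Fin 3, ∑ j : Fin 3,
          (1 / 2) * (dcomp R σ i j x + dcomp R σ j i x) * dcomp R σ i j x = 0

/-- `n_i σ^i = 0` on the boundary. -/
def BoundaryPreserving (R : ℝ) (σ : E3 → E3) : Prop :=
  ∀ q : S2, ⟪σ (R • (q : E3)), (q : E3)⟫_ℝ = 0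

/-- Smooth boundary preserving vector fields that solve the momentum constraint. -/
structure IsSolution (R : ℝ) (σ : E3 → E3) : Prop where
  smooth : ContDiffOn ℝ ∞ σ (ball R)
  momentum : MomentumConstraint R σ
  boundary : BoundaryPreserving R σ

/-- The variation `δh_ij = ∂_i σ_j + ∂_j σ_i` of the flat metric along `σ`. -/
noncomputable def deltaH (R : ℝ) (σ : E3 → E3) (i j : Fin 3) (x : E3) : ℝ :=
  dcomp R σ i j x + dcomp R σ j i x

/-- The metric on the space of vacua:
`½ ∫_M (h^{ik} h^{jl} - h^{ij} h^{kl}) δ₁h_ij δ₂h_kl dV`, for the flat metric `h = δ`. -/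
noncomputable def vacuaMetric (R : ℝ) (σ τ : E3 → E3) : ℝ :=
  (1 / 2) * ∫ x in ball R,
    ((∑ i : Fin 3, ∑ j : Fin 3, deltaH R σ i j x * deltaH R τ i j x)
      - (∑ i : Fin 3, deltaH R σ i i x) * (∑ j : Fin 3, deltaH R τ j j x))

/-! ### The boundary operator -/

/-- The unit normal of the concentric spheres. -/
noncomputable def normal (x : E3) : E3 := ‖x‖⁻¹ • x

/-- Projection of the vector `v` at `x` to the sphere through `x`. -/
noncomputable def tangential (x v : E3) : E3 := v - ⟪v, normal x⟫_ℝ • normal x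

/-- The normal derivative `D^⊥`: for `σ^T = σ^a e_a` the tangential part of `σ`, this is
`e^a · ∇_n (σ^b e_b) = n(σ^a) + Γ^a_b σ^b`. -/
noncomputable def normalDeriv (R : ℝ) (σ : E3 → E3) (x : E3) : E3 :=
  tangential x (fderivWithin ℝ (fun y => tangential y (σ y)) (ball R) x (normal x))

/-- The extrinsic curvature of the spheres as an endomorphism, `v ↦ ∇_v n`. -/
noncomputable def extrinsicCurvature (x v : E3) : E3 := fderiv ℝ normal x v

/-- `𝔻 σ = D^⊥ σ - K σ`, at the boundary point `R • q`. -/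
noncomputable def opD (R : ℝ) (σ : E3 → E3) (q : S2) : E3 :=
  normalDeriv R σ (R • (q : E3)) - extrinsicCurvature (R • (q : E3)) (σ (R • (q : E3)))

/-- Smooth tangent vector fields of the boundary sphere; `ζ q` is the vector at `R • q`. -/
def IsTangentField (ζ : S2 → E3) : Prop :=
  ContMDiff (𝓡 2) 𝓘(ℝ, E3) ∞ ζ ∧ ∀ q : S2, ⟪ζ q, (q : E3)⟫_ℝ = 0

/-- `σ` restricts to `ζ` on the boundary. -/
def HasBoundaryValue (R : ℝ) (σ : E3 → E3) (ζ : S2 → E3) : Prop :=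
  ∀ q : S2, σ (R • (q : E3)) = ζ q

/-- `ker 𝔻`, where `𝔻 ζ` is computed with a solution `σ` that has boundary value `ζ`. -/
def kerD (R : ℝ) : Set (S2 → E3) :=
  {ζ | IsTangentField ζ ∧
    ∃ σ : E3 → E3, IsSolution R σ ∧ HasBoundaryValue R σ ζ ∧ ∀ q : S2, opD R σ q = 0}

/-! ### Spherical harmonics and the mode expansion -/

/-- `x ↦ P (x / |x|)`, for a polynomial `P`. -/
noncomputable def angular (P : MvPolynomial (Fin 3) ℝ) (x : E3) : ℝ :=
  MvPolynomial.eval (fun i => (‖x‖⁻¹ • x) i) P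

/-- Harmonic homogeneous polynomials of degree `ℓ`; their restrictions to the unit sphere are
the real spherical harmonics of degree `ℓ`. -/
def IsSolidHarmonic (ℓ : ℕ) (P : MvPolynomial (Fin 3) ℝ) : Prop :=
  P.IsHomogeneous ℓ ∧
    ∑ i : Fin 3, MvPolynomial.pderiv i (MvPolynomial.pderiv i P) = 0

/-- For each `ℓ`, the `2ℓ+1` functions `Y_{ℓm} = angular (Y ℓ m)` form an orthonormal basis, with
respect to the area measure of the unit sphere, of the real spherical harmonics of degree `ℓ`. -/
structure IsHarmonicBasis (Y : (ℓ : ℕ) → Fin (2 * ℓ + 1) → MvPolynomial (Fin 3) ℝ) : Prop where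
  harmonic : ∀ ℓ m, IsSolidHarmonic ℓ (Y ℓ m)
  orthonormal : ∀ ℓ m m',
    ∫ q : S2, angular (Y ℓ m) q * angular (Y ℓ m') q ∂area = if m = m' then 1 else 0
  spans : ∀ ℓ P, IsSolidHarmonic ℓ P → P ∈ Submodule.span ℝ (range (Y ℓ))

/-- The index set of the pairs `(ℓ, m)`. -/
abbrev ModeIdx : Type := Σ ℓ : ℕ, Fin (2 * ℓ + 1)

/-- `r × ∇Y`. -/
noncomputable def coexactHarmonic (P : MvPolynomial (Fin 3) ℝ) (x : E3) : E3 :=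
  cross x (gradient (angular P) x)

/-- The scalar function `f(r) Y`. -/
noncomputable def scalarMode (P : MvPolynomial (Fin 3) ℝ) (f : ℝ → ℝ) (x : E3) : ℝ :=
  f ‖x‖ * angular P x

/-- The vector field `a r^ℓ r × ∇Y + ∇(f(r) Y)`. -/
noncomputable def modeField (R : ℝ) (ℓ : ℕ) (P : MvPolynomial (Fin 3) ℝ) (a : ℝ) (f : ℝ → ℝ)
    (x : E3) : E3 :=
  (a * ‖x‖ ^ ℓ) • coexactHarmonic P x + gradientWithin (scalarMode P f) (ball R) x

/-- `σ = ∑_{ℓm} (a_{ℓm} r^ℓ r × ∇Y_{ℓm} + ∇(f_{ℓm}(r) Y_{ℓm}))`, unconditionally and uniformly on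
the closed ball, where each `f_{ℓm}(r) Y_{ℓm}` is a smooth function on the closed ball. -/
structure HasModeExpansion (R : ℝ) (Y : (ℓ : ℕ) → Fin (2 * ℓ + 1) → MvPolynomial (Fin 3) ℝ)
    (σ : E3 → E3) (a : (ℓ : ℕ) → Fin (2 * ℓ + 1) → ℝ)
    (f : (ℓ : ℕ) → Fin (2 * ℓ + 1) → ℝ → ℝ) : Prop where
  smooth : ∀ ℓ m, ContDiffOn ℝ ∞ (scalarMode (Y ℓ m) (f ℓ m)) (ball R)
  tendsto : TendstoUniformlyOn
    (fun (s : Finset ModeIdx) (x : E3) =>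
      ∑ p ∈ s, modeField R p.1 (Y p.1 p.2) (a p.1 p.2) (f p.1 p.2) x)
    σ atTop (ball R)

/-- Both towers are excited: some `a_{ℓm}` with `ℓ ≥ 2` and some `f_{ℓm}(R)` with `ℓ ≥ 1` is not
zero. (The modes `a_{1m}` are rotations; `a_{00}` and the constant `f_{00}(R)` do not contribute
to the boundary value.) -/
def BothTowers (R : ℝ) (a : (ℓ : ℕ) → Fin (2 * ℓ + 1) → ℝ)
    (f : (ℓ : ℕ) → Fin (2 * ℓ + 1) → ℝ → ℝ) : Prop :=
  (∃ ℓ m, 2 ≤ ℓ ∧ a ℓ m ≠ 0) ∧ (∃ ℓ m, 1 ≤ ℓ ∧ f ℓ m R ≠ 0)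

/-! ### Diffeomorphisms of the boundary and the space of vacua -/

/-- `Diff(S²)`. -/
abbrev DiffS2 : Type := S2 ≃ₘ^∞⟮𝓡 2, 𝓡 2⟯ S2

/-- The group structure of `Diff(S²)`: `(φ * ψ) q = φ (ψ q)`. -/
noncomputable instance : Group DiffS2 where
  mul φ ψ := ψ.trans φ
  one := Diffeomorph.refl (𝓡 2) S2 ∞
  inv φ := φ.symm
  mul_assoc _ _ _ := rfl
  one_mul _ := rfl
  mul_one _ := rfl
  inv_mul_cancel φ := Diffeomorph.ext fun q => φ.symm_apply_apply q

/-- The group `SO(3)`. -/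
abbrev SO3 : Type := Matrix.specialOrthogonalGroup (Fin 3) ℝ

/-- The linear action of a matrix on Euclidean three-space. -/
noncomputable abbrev act (A : Matrix (Fin 3) (Fin 3) ℝ) : E3 →L[ℝ] E3 :=
  Matrix.toEuclideanCLM (n := Fin 3) (𝕜 := ℝ) A

theorem act_mul (A B : Matrix (Fin 3) (Fin 3) ℝ) (x : E3) : act (A * B) x = act A (act B x) := by
  simp [act]

theorem act_mem (A : SO3) (q : S2) : act A (q : E3) ∈ sphere (0 : E3) 1 := by
  have hA := (Matrix.mem_specialOrthogonalGroup_iff.1 A.2).1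
  have h1 : star (act A) * act A = 1 := by
    have h0 : star (A : Matrix (Fin 3) (Fin 3) ℝ) * A = 1 :=
      (Matrix.mem_unitaryGroup_iff').1 hA
    rw [← map_star, ← map_mul, h0, map_one]
  have h2 : ⟪act A (q : E3), act A (q : E3)⟫_ℝ = ⟪(q : E3), (q : E3)⟫_ℝ := by
    rw [← ContinuousLinearMap.adjoint_inner_right, ← ContinuousLinearMap.star_eq_adjoint,
      ← mul_apply_eq_comp, h1, one_apply_eq_self]
  have h3 : ‖act A (q : E3)‖ ^ 2 = 1 := by
    rw [← real_inner_self_eq_norm_sq, h2, real_inner_self_eq_norm_sq]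
    simp
  have h4 : ‖act A (q : E3)‖ = 1 := by
    have := norm_nonneg (act A (q : E3))
    nlinarith
  simpa using h4

/-- The map of the sphere induced by a rotation. -/
noncomputable def rotMap (A : SO3) (q : S2) : S2 := ⟨act A (q : E3), act_mem A q⟩

theorem rotMap_mul (A B : SO3) (q : S2) : rotMap (A * B) q = rotMap A (rotMap B q) :=
  Subtype.ext (act_mul A B q)

theorem rotMap_one (q : S2) : rotMap 1 q = q := Subtype.ext (by simp [rotMap, act])

theorem contMDiff_rotMap (A : SO3) : ContMDiff (𝓡 2) (𝓡 2) ∞ (rotMap A) := by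
  have : Fact (Module.finrank ℝ E3 = 2 + 1) := ⟨finrank_euclideanSpace_fin⟩
  have h : ContMDiff (𝓡 2) 𝓘(ℝ, E3) ∞ (fun q : S2 => act A (q : E3)) :=
    (act (A : Matrix (Fin 3) (Fin 3) ℝ)).contDiff.contMDiff.comp (contMDiff_coe_sphere (n := 2))
  exact h.codRestrict_sphere (act_mem A)

/-- The rotation action `SO(3) → Diff(S²)`. -/
noncomputable def rot : SO3 →* DiffS2 where
  toFun A :=
    { toFun := rotMap A
      invFun := rotMap A⁻¹
      left_inv := fun q => by rw [← rotMap_mul, inv_mul_cancel, rotMap_one]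
      right_inv := fun q => by rw [← rotMap_mul, mul_inv_cancel, rotMap_one]
      contMDiff_toFun := contMDiff_rotMap A
      contMDiff_invFun := contMDiff_rotMap A⁻¹ }
  map_one' := Diffeomorph.ext rotMap_one
  map_mul' A B := Diffeomorph.ext (rotMap_mul A B)

/-- `biso`: the diffeomorphisms of the boundary sphere that are induced by a (smooth, orientation
preserving) isometry `Φ` of the flat ball of radius `R` that preserves the boundary. -/
def biso (R : ℝ) : Set DiffS2 :=
  {φ | ∃ Φ : E3 → E3, ContDiffOn ℝ ∞ Φ (ball R) ∧ BijOn Φ (ball R) (ball R) ∧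
    (∀ x ∈ ball R, ∀ u v : E3,
      ⟪fderivWithin ℝ Φ (ball R) x u, fderivWithin ℝ Φ (ball R) x v⟫_ℝ = ⟪u, v⟫_ℝ) ∧
    (∀ x ∈ ball R, 0 < (fderivWithin ℝ Φ (ball R) x).det) ∧
    ∀ q : S2, Φ (R • (q : E3)) = R • (φ q : E3)}

/-- The space of vacua `𝒱 = Diff(∂M) / biso`: a diffeomorphism `φ` acts by `h = φ^* δ`, so that
`φ` and `S ∘ φ` describe the same vacuum for an isometry `S`. -/
def Vacua (R : ℝ) : Type := Quot fun φ ψ : DiffS2 => ∃ S ∈ biso R, ψ = S * φ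

/-- The quotient `Diff(S²) / SO(3)` of `Diff(S²)` by the rotations acting by `φ ↦ A ∘ φ`. -/
def DiffModSO3 : Type := Quotient (QuotientGroup.rightRel rot.range)

/-- The tangent space of `Diff(S²)` at `φ`: smooth vector fields along `φ`. -/
def tangentDiff (φ : DiffS2) : Submodule ℝ (S2 → E3) where
  carrier := {V | ContMDiff (𝓡 2) 𝓘(ℝ, E3) ∞ V ∧ ∀ q : S2, ⟪V q, (φ q : E3)⟫_ℝ = 0}
  add_mem' {V W} hV hW :=
    ⟨hV.1.add hW.1, fun q => by
      have h1 := hV.2 q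
      have h2 := hW.2 q
      simp only [Pi.add_apply, inner_add_left, h1, h2, add_zero]⟩
  zero_mem' := ⟨contMDiff_const, fun q => by simp⟩
  smul_mem' c V hV :=
    ⟨(contMDiff_const : ContMDiff (𝓡 2) 𝓘(ℝ, ℝ) ∞ (fun _ : S2 => c)).smul hV.1, fun q => by
      have h1 := hV.2 q
      simp only [Pi.smul_apply, real_inner_smul_left, h1, mul_zero]⟩

/-- The tangent space at `φ` of the orbit `SO(3) ∘ φ`: the fields `q ↦ w × φ(q)`. -/
def vertical (φ : DiffS2) : Submodule ℝ (tangentDiff φ) where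
  carrier := {V | ∃ w : E3, ∀ q : S2, (V : S2 → E3) q = cross w (φ q : E3)}
  add_mem' := by
    rintro V W ⟨v, hv⟩ ⟨w, hw⟩
    refine ⟨v + w, fun q => ?_⟩
    simp [hv, hw, cross]
  zero_mem' := ⟨0, fun q => by simp [cross]⟩
  smul_mem' := by
    rintro c V ⟨v, hv⟩
    refine ⟨c • v, fun q => ?_⟩
    simp [hv, cross]

/-- The tangent space of `Diff(S²) / SO(3)` at the class of `φ`. -/
abbrev tangentVacua (φ : DiffS2) : Type := tangentDiff φ ⧸ vertical φ

/-- The class in `tangentVacua φ` of a vector field along `φ`. -/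
abbrev tangentClass (φ : DiffS2) (V : tangentDiff φ) : tangentVacua φ := (vertical φ).mkQ V

end RoundBall

/-! The momentum constraint says that the curl of σ is itself curl free. On the ball, which is
star-shaped, the Poincaré lemma gives curl σ = ∇g with g harmonic. The function A = -∫₀¹ g(sx) ds is
then harmonic and solves A + x·∇A = -g. Since curl (x × ∇A) = -∇(A + x·∇A) for harmonic A, the field
σ - x × ∇A is curl free. So σ = x × ∇A + ∇u with A harmonic and u arbitrary (`exists_potField`). The
two towers are the expansions of A and u in spherical harmonics: harmonicity forces the profile r^ℓ
for A (`coef_eq_of_harmonic`), and u keeps free profiles f(r).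

Functions on the spheres |x| = r are studied through their moments `coef` against polynomials. The
basic analytic input is that the rotation generators (x × ∇)_k integrate to zero over the sphere
(`integral_rotd_eq_zero`, `coef_rotd`). It yields the divergence theorem on the ball
(`integral_div_ball`), the orthogonality of different degrees, the mean value property and the rapid
decay of the moments of smooth functions (`exists_decay`). Completeness comes from the Fischer
decomposition and Stone-Weierstrass. For vector fields, `vector_harmonic_identity` reduces Cartesian
components to tangential test fields. Hence a continuous field on a sphere is determined by its
radial moments, its moments with x × ∇Z and its moments with the tangential gradients of Z
(`eq_zero_of_vector_moments`), and identities between fields become identities between numbers for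
each ℓ, m.

The expansion converges because the coefficients decay faster than every power of ℓ, while
normalised harmonics and their gradients grow at most like (ℓ+1)² (`exists_sup_bound`,
`exists_rotV_bound`). Conversely, a merely uniform limit cannot be differentiated term by term; the
constraint is recovered weakly, with a test field that vanishes to second order at the boundary
(`HasModeExpansion.momentumConstraint`).

On a solution, 𝔻 multiplies the x × ∇Z moments of the boundary value by (ℓ-1)/R and its gradient
moments by -2/R (`rotPair_opD`, `gradPair_opD`), because these moments behave like r^ℓ and like
f(r)/r with f'(R) = 0. So 𝔻 depends only on the boundary value. The divergence theorem turns the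
metric into R² ∮ σ·𝔻τ (`vacuaMetric_eq`), and the mode formula and the kernel follow. The first
tower contributes with a nonnegative sign and the second with a nonpositive one, so a null vector
outside the kernel needs both. Under the Hamiltonian constraint one needs in addition that a
boundary rotation is a rotation of the whole ball, which rests on a divergence identity weighted
with |x|² (`eq_zero_of_hamiltonian`).

Every tangent field extends to a solution: two series of solid harmonics, one multiplied by |x|²,
adjust the boundary value of u and make its radial derivative vanish there
(`exists_isSolution_of_tangentField`). Hence the radical of the metric is exactly the infinitesimal
rotations, and the metric descends to a nondegenerate form (`ker_tangentForm`). The isotropy group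
is found from metric rigidity: a bijection of the sphere that does not increase distances preserves
antipodes, hence inner products, hence is linear (`inner_eq_of_dist_le`, `biso_eq`). -/

namespace RoundBall

/-! ### Calculus on the closed ball -/

/-- Scalar functions that are smooth up to the boundary of the ball. -/
abbrev Smooth (R : ℝ) (u : E3 → ℝ) : Prop := ContDiffOn ℝ ∞ u (ball R)

theorem uniqueDiffOn_ball {R : ℝ} (hR : 0 < R) : UniqueDiffOn ℝ (ball R) :=
  uniqueDiffOn_convex (convex_closedBall _ _) (by
    rw [interior_closedBall _ hR.ne']; exact nonempty_ball.2 hR)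

variable {R : ℝ} {u v : E3 → ℝ} {x : E3}

theorem Smooth.differentiableWithinAt (hu : Smooth R u) (hx : x ∈ ball R) :
    DifferentiableWithinAt ℝ u (ball R) x :=
  hu.differentiableOn (by simp) x hx

theorem Smooth.fderivWithin (hR : 0 < R) (hu : Smooth R u) :
    ContDiffOn ℝ ∞ (fderivWithin ℝ u (ball R)) (ball R) :=
  ContDiffOn.fderivWithin hu (uniqueDiffOn_ball hR) (by simp)

theorem Smooth.pd (hR : 0 < R) (hu : Smooth R u) (i : Fin 3) : Smooth R (pd R i u) :=
  (hu.fderivWithin hR).clm_apply contDiffOn_const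

theorem Smooth.add' (hu : Smooth R u) (hv : Smooth R v) : Smooth R (fun x => u x + v x) := hu.add hv
theorem Smooth.sub' (hu : Smooth R u) (hv : Smooth R v) : Smooth R (fun x => u x - v x) := hu.sub hv
theorem Smooth.mul' (hu : Smooth R u) (hv : Smooth R v) : Smooth R (fun x => u x * v x) := hu.mul hv
theorem Smooth.neg' (hu : Smooth R u) : Smooth R (fun x => - u x) := hu.neg
theorem Smooth.const (c : ℝ) : Smooth R (fun _ => c) := contDiffOn_const
theorem Smooth.coord (i : Fin 3) : Smooth R (fun x => x i) := by
  have : ContDiff ℝ ∞ (fun x : E3 => x i) := by fun_prop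
  exact this.contDiffOn
theorem Smooth.sum' {ι : Type*} {s : Finset ι} {w : ι → E3 → ℝ} (h : ∀ i ∈ s, Smooth R (w i)) :
    Smooth R (fun x => ∑ i ∈ s, w i x) := ContDiffOn.sum h

theorem eq_sum_basisVec (v : E3) : v = ∑ i, v i • basisVec i := by
  ext j
  simp [basisVec, Fin.sum_univ_three]
  fin_cases j <;> simp

theorem basisVec_apply (i j : Fin 3) : basisVec i j = if j = i then 1 else 0 := by
  simp [basisVec]

theorem fderivWithin_eq_sum_pd (R : ℝ) (u : E3 → ℝ) (x v : E3) :
    fderivWithin ℝ u (ball R) x v = ∑ i, v i * pd R i u x := by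
  conv_lhs => rw [eq_sum_basisVec v]
  simp [pd]

theorem inner_eq_sum (v w : E3) : ⟪v, w⟫_ℝ = ∑ i, v i * w i := by
  simp [PiLp.inner_apply, mul_comm]

theorem norm_sq_eq_sum (v : E3) : ‖v‖ ^ 2 = ∑ i, v i ^ 2 := by
  rw [EuclideanSpace.real_norm_sq_eq]

theorem pd_congr {i : Fin 3} (h : EqOn u v (ball R)) (hx : x ∈ ball R) :
    pd R i u x = pd R i v x := by
  unfold pd; rw [fderivWithin_congr h (h hx)]

section rules
variable (hR : 0 < R) (hu : Smooth R u) (hv : Smooth R v) (hx : x ∈ ball R) (i : Fin 3)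
include hR hx

theorem pd_of_hasFDerivWithinAt {L : E3 →L[ℝ] ℝ} (h : HasFDerivWithinAt u L (ball R) x) :
    pd R i u x = L (basisVec i) := by
  unfold pd; rw [h.fderivWithin (uniqueDiffOn_ball hR x hx)]

theorem pd_of_hasFDerivAt {L : E3 →L[ℝ] ℝ} (h : HasFDerivAt u L x) :
    pd R i u x = L (basisVec i) := pd_of_hasFDerivWithinAt hR hx i h.hasFDerivWithinAt

theorem pd_const (c : ℝ) : pd R i (fun _ => c) x = 0 := by
  rw [pd_of_hasFDerivAt hR hx i (hasFDerivAt_const c x)]; simp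

theorem pd_coord (j : Fin 3) : pd R i (fun y => y j) x = if j = i then 1 else 0 := by
  refine (pd_of_hasFDerivAt (u := fun y => y j) hR hx i
    (EuclideanSpace.proj (𝕜 := ℝ) j).hasFDerivAt).trans ?_
  simp [basisVec_apply]

include hu in
theorem pd_neg : pd R i (fun y => - u y) x = - pd R i u x := by
  refine (pd_of_hasFDerivWithinAt (u := fun y => - u y) hR hx i
    (hu.differentiableWithinAt hx).hasFDerivWithinAt.neg).trans ?_
  simp [pd]

include hu in
theorem pd_const_mul (c : ℝ) : pd R i (fun y => c * u y) x = c * pd R i u x := by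
  rw [pd_of_hasFDerivWithinAt hR hx i
    ((hu.differentiableWithinAt hx).hasFDerivWithinAt.const_mul c)]
  simp [pd]

include hu hv

theorem pd_add : pd R i (fun y => u y + v y) x = pd R i u x + pd R i v x := by
  refine (pd_of_hasFDerivWithinAt (u := fun y => u y + v y) hR hx i
    ((hu.differentiableWithinAt hx).hasFDerivWithinAt.add
      (hv.differentiableWithinAt hx).hasFDerivWithinAt)).trans ?_
  simp [pd]

theorem pd_sub : pd R i (fun y => u y - v y) x = pd R i u x - pd R i v x := by
  refine (pd_of_hasFDerivWithinAt (u := fun y => u y - v y) hR hx i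
    ((hu.differentiableWithinAt hx).hasFDerivWithinAt.sub
      (hv.differentiableWithinAt hx).hasFDerivWithinAt)).trans ?_
  simp [pd]

theorem pd_mul : pd R i (fun y => u y * v y) x = u x * pd R i v x + v x * pd R i u x := by
  refine (pd_of_hasFDerivWithinAt (u := fun y => u y * v y) hR hx i
    ((hu.differentiableWithinAt hx).hasFDerivWithinAt.mul
      (hv.differentiableWithinAt hx).hasFDerivWithinAt)).trans ?_
  simp [pd]

end rules

theorem pd_sum (hR : 0 < R) {ι : Type*} {s : Finset ι} {w : ι → E3 → ℝ}
    (h : ∀ i ∈ s, Smooth R (w i)) (hx : x ∈ ball R) (i : Fin 3) :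
    pd R i (fun y => ∑ k ∈ s, w k y) x = ∑ k ∈ s, pd R i (w k) x := by
  rw [pd_of_hasFDerivWithinAt hR hx i (HasFDerivWithinAt.fun_sum
    fun k hk => ((h k hk).differentiableWithinAt hx).hasFDerivWithinAt)]
  simp [pd]

theorem pd_comm (hR : 0 < R) (hu : Smooth R u) (hx : x ∈ ball R) (i j : Fin 3) :
    pd R i (pd R j u) x = pd R j (pd R i u) x := by
  have key : ∀ i j, pd R i (pd R j u) x =
      fderivWithin ℝ (fderivWithin ℝ u (ball R)) (ball R) x (basisVec i) (basisVec j) := by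
    intro i j
    have h : DifferentiableWithinAt ℝ (fderivWithin ℝ u (ball R)) (ball R) x :=
      (hu.fderivWithin hR).differentiableOn (by simp) x hx
    have h2 := h.hasFDerivWithinAt.clm_apply (hasFDerivWithinAt_const (basisVec j) x (ball R))
    rw [show pd R j u = fun y => fderivWithin ℝ u (ball R) y (basisVec j) from rfl,
      pd_of_hasFDerivWithinAt hR hx i h2]
    simp
  rw [key, key]
  -- Symmetry of second derivatives within the ball holds even at boundary points, since they are
  -- limits of interior points.
  have hs := (hu x hx).isSymmSndFDerivWithinAt
    (by
      rw [minSmoothness_of_isRCLikeNormedField]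
      exact WithTop.coe_le_coe.2 (le_top : (2 : ℕ∞) ≤ ⊤)) (uniqueDiffOn_ball hR)
    (by rw [interior_closedBall _ hR.ne', closure_ball _ hR.ne']; exact hx) hx
  exact hs _ _

/-- A family of functions on the ball that is closed under partial derivatives is smooth. -/
theorem smooth_of_closed_under_pd (hR : 0 < R) (C : Set (E3 → ℝ))
    (hd : ∀ w ∈ C, DifferentiableOn ℝ w (ball R))
    (hC : ∀ w ∈ C, ∀ i, ∃ w' ∈ C, EqOn (RoundBall.pd R i w) w' (ball R))
    (hu : u ∈ C) : Smooth R u := by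
  -- The induction must treat all members of the family at once, because a derivative of `u` is
  -- another member.
  have key : ∀ n : ℕ, ∀ w ∈ C, ContDiffOn ℝ n w (ball R) := by
    intro n
    induction n with
    | zero => exact fun w hw => contDiffOn_zero.2 (hd w hw).continuousOn
    | succ n ih =>
      intro w hw
      rw [Nat.cast_add, Nat.cast_one,
        contDiffOn_succ_iff_fderivWithin (uniqueDiffOn_ball hR)]
      refine ⟨hd w hw, by simp, ?_⟩
      have : EqOn (_root_.fderivWithin ℝ w (ball R))
          (fun x => ∑ i, RoundBall.pd R i w x • (EuclideanSpace.proj (𝕜 := ℝ) i : E3 →L[ℝ] ℝ))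
          (ball R) := by
        intro x _
        ext v
        rw [fderivWithin_eq_sum_pd]
        simp [mul_comm]
      refine ContDiffOn.congr ?_ this
      refine ContDiffOn.sum fun i _ => ?_
      obtain ⟨w', hw', he⟩ := hC w hw i
      exact ((ih w' hw').congr he).smul contDiffOn_const
  exact contDiffOn_infty.2 fun n => key n u hu

theorem contDiffOn_iff_smooth {σ : E3 → E3} :
    ContDiffOn ℝ ∞ σ (ball R) ↔ ∀ i, Smooth R (fun x => σ x i) := contDiffOn_euclidean

theorem gradientWithin_apply (R : ℝ) (u : E3 → ℝ) (x : E3) (i : Fin 3) :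
    gradientWithin u (ball R) x i = pd R i u x := by
  have : ⟪gradientWithin u (ball R) x, basisVec i⟫_ℝ = pd R i u x := by
    simp [gradientWithin, pd]
  rw [← this, inner_eq_sum]
  simp [basisVec_apply]

/-! ### Parametric integrals -/

/-- By the mean value inequality on a convex set, the difference quotients are dominated by `bound`,
so dominated convergence also works at boundary points of `s`. The same lemma serves integrals over
the sphere, integrals along rays and, with counting measure, series. -/
theorem hasFDerivWithinAt_integral {E α : Type*} [NormedAddCommGroup E] [NormedSpace ℝ E]
    [MeasurableSpace α] {μ : Measure α} {s : Set E} (hs : Convex ℝ s) {φ : E → α → ℝ}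
    {φ' : E → α → E →L[ℝ] ℝ} {bound : α → ℝ} {x : E} (hx : x ∈ s)
    (hint : ∀ y ∈ s, Integrable (φ y) μ) (hm : AEStronglyMeasurable (φ' x) μ)
    (hd : ∀ a, ∀ y ∈ s, HasFDerivWithinAt (fun z => φ z a) (φ' y a) s y)
    (hb : ∀ a, ∀ y ∈ s, ‖φ' y a‖ ≤ bound a) (hbi : Integrable bound μ) :
    HasFDerivWithinAt (fun y => ∫ a, φ y a ∂μ) (∫ a, φ' x a ∂μ) s x := by
  have hi' : Integrable (φ' x) μ :=
    hbi.mono' hm (Eventually.of_forall fun a => hb a x hx)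
  rw [hasFDerivWithinAt_iff_tendsto]
  have hlim : Tendsto (fun y => ∫ a, ‖y - x‖⁻¹ * ‖φ y a - φ x a - φ' x a (y - x)‖ ∂μ)
      (𝓝[s] x) (𝓝 (∫ _, 0 ∂μ)) := by
    refine tendsto_integral_filter_of_dominated_convergence (fun a => 2 * bound a) ?_ ?_
      (hbi.const_mul 2) ?_
    · filter_upwards [self_mem_nhdsWithin] with y hy
      exact ((((hint y hy).sub (hint x hx)).sub (hi'.apply_continuousLinearMap _)).norm.const_mul
        _).aestronglyMeasurable
    · filter_upwards [self_mem_nhdsWithin] with y hy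
      refine Eventually.of_forall fun a => ?_
      have h1 : ‖φ y a - φ x a‖ ≤ bound a * ‖y - x‖ :=
        hs.norm_image_sub_le_of_norm_hasFDerivWithin_le (hd a) (hb a) hx hy
      have h2 : ‖φ' x a (y - x)‖ ≤ bound a * ‖y - x‖ :=
        ((φ' x a).le_opNorm _).trans (by gcongr; exact hb a x hx)
      have h3 : 0 ≤ bound a := (norm_nonneg _).trans (hb a x hx)
      rw [norm_mul, norm_inv, norm_norm, norm_norm]
      rcases eq_or_ne (‖y - x‖) 0 with h0 | h0
      · rw [h0]; simp; exact h3
      · have hpos : 0 < ‖y - x‖ := lt_of_le_of_ne (norm_nonneg _) h0.symm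
        rw [inv_mul_le_iff₀ hpos]
        calc _ ≤ ‖φ y a - φ x a‖ + ‖φ' x a (y - x)‖ := norm_sub_le _ _
          _ ≤ _ := by linarith
    · exact Eventually.of_forall fun a => hasFDerivWithinAt_iff_tendsto.1 (hd a x hx)
  rw [integral_zero] at hlim
  refine squeeze_zero' (Eventually.of_forall fun y => by positivity) ?_ hlim
  filter_upwards [self_mem_nhdsWithin] with y hy
  rw [integral_const_mul]
  gcongr
  rw [ContinuousLinearMap.integral_apply hi', ← integral_sub (hint y hy) (hint x hx),
    ← integral_sub (f := fun a => φ y a - φ x a) ((hint y hy).sub (hint x hx))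
      (hi'.apply_continuousLinearMap _)]
  exact norm_integral_le_integral_norm _

end RoundBall

namespace RoundBall

/-! ### Polar coordinates and integration by parts on the sphere -/

instance : Nontrivial E3 := ⟨⟨basisVec 0, 0, fun h => by
  have := congrArg (fun x : E3 => x 0) h
  simp [basisVec] at this⟩⟩

theorem norm_S2 (q : S2) : ‖(q : E3)‖ = 1 := by simp

theorem norm_smul_S2 {r : ℝ} (hr : 0 ≤ r) (q : S2) : ‖r • (q : E3)‖ = r := by
  rw [norm_smul, norm_S2, mul_one, Real.norm_of_nonneg hr]

theorem smul_mem_ball {R r : ℝ} (hr : r ∈ Icc (-R) R) (q : S2) : r • (q : E3) ∈ ball R := by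
  rw [mem_closedBall_zero_iff, norm_smul, norm_S2, mul_one, Real.norm_eq_abs]
  exact abs_le.2 hr

theorem sum_sq_S2 (q : S2) : (q : E3) 0 ^ 2 + (q : E3) 1 ^ 2 + (q : E3) 2 ^ 2 = 1 := by
  have := norm_sq_eq_sum (q : E3)
  rw [norm_S2, Fin.sum_univ_three] at this
  linarith

theorem integral_polar {G : E3 → ℝ} (hG : Integrable G) :
    ∫ x, G x = ∫ r in Ioi (0 : ℝ), r ^ 2 * ∫ q : S2, G (r • (q : E3)) ∂area := by
  have hmp := (volume : Measure E3).measurePreserving_homeomorphUnitSphereProd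
  have hsymm : MeasurePreserving (homeomorphUnitSphereProd E3).symm
      (area.prod (Measure.volumeIoiPow 2)) ((volume : Measure E3).comap (↑)) := by
    have := hmp.symm (homeomorphUnitSphereProd E3).toMeasurableEquiv
    simpa using this
  have h1 : ∫ x, G x = ∫ x : ({(0 : E3)}ᶜ : Set E3), G x ∂((volume : Measure E3).comap (↑)) := by
    rw [integral_subtype_comap (measurableSet_singleton _).compl G, restrict_compl_singleton]
  have hint : Integrable (fun x : ({(0 : E3)}ᶜ : Set E3) => G x)
      ((volume : Measure E3).comap (↑)) := by
    have := (integrableOn_iff_comap_subtypeVal (μ := (volume : Measure E3)) (f := G)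
      (measurableSet_singleton (0 : E3)).compl).1 hG.integrableOn
    exact this
  rw [h1, ← hsymm.integral_comp (Homeomorph.measurableEmbedding _) (fun x => G x)]
  have hint2 : Integrable (fun p : S2 × Ioi (0 : ℝ) => G ((homeomorphUnitSphereProd E3).symm p))
      (area.prod (Measure.volumeIoiPow 2)) :=
    (hsymm.integrable_comp_emb (Homeomorph.measurableEmbedding _)
      (g := fun x : ({(0 : E3)}ᶜ : Set E3) => G x)).2 hint
  rw [integral_prod_symm _ hint2]
  have hs : ∀ (q : S2) (r : Ioi (0 : ℝ)),
      ((homeomorphUnitSphereProd E3).symm (q, r) : E3) = (r : ℝ) • (q : E3) := fun _ _ => rfl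
  simp only [Measure.volumeIoiPow, ENNReal.ofReal, hs]
  rw [integral_withDensity_eq_integral_smul (by fun_prop),
    integral_subtype_comap measurableSet_Ioi
      (fun a : ℝ => Real.toNNReal (a ^ 2) • ∫ q : S2, G (a • (q : E3)) ∂area)]
  refine setIntegral_congr_fun measurableSet_Ioi fun r hr => ?_
  simp only [NNReal.smul_def]
  rw [Real.coe_toNNReal _ (by positivity), smul_eq_mul]

theorem integral_ball_polar {R : ℝ} (hR : 0 < R) {G : E3 → ℝ} (hG : ContinuousOn G (ball R)) :
    ∫ x in ball R, G x = ∫ r in (0 : ℝ)..R, r ^ 2 * ∫ q : S2, G (r • (q : E3)) ∂area := by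
  rw [← integral_indicator measurableSet_closedBall, integral_polar
    ((hG.integrableOn_compact (isCompact_closedBall _ _)).integrable_indicator
      measurableSet_closedBall), intervalIntegral.integral_of_le hR.le]
  rw [← integral_indicator measurableSet_Ioi, ← integral_indicator measurableSet_Ioc]
  congr 1
  ext r
  by_cases h0 : 0 < r
  · rw [indicator_of_mem (show r ∈ Ioi (0 : ℝ) from h0)]
    by_cases h1 : r ≤ R
    · rw [indicator_of_mem (show r ∈ Ioc 0 R from ⟨h0, h1⟩)]
      congr 2
      ext q
      rw [indicator_of_mem (smul_mem_ball ⟨by linarith, h1⟩ q)]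
    · rw [indicator_of_notMem (fun h => h1 h.2)]
      have : ∀ q : S2, (ball R).indicator G (r • (q : E3)) = 0 := fun q =>
        indicator_of_notMem (by
          rw [mem_closedBall_zero_iff, norm_smul_S2 h0.le]; exact h1) _
      simp [this]
  · rw [indicator_of_notMem (show r ∉ Ioi (0 : ℝ) from h0),
      indicator_of_notMem (fun h => h0 h.1)]

theorem cross_apply_zero (u v : E3) : cross u v 0 = u 1 * v 2 - u 2 * v 1 := by
  simp [cross, _root_.cross_apply]
theorem cross_apply_one (u v : E3) : cross u v 1 = u 2 * v 0 - u 0 * v 2 := by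
  simp [cross, _root_.cross_apply]
theorem cross_apply_two (u v : E3) : cross u v 2 = u 0 * v 1 - u 1 * v 0 := by
  simp [cross, _root_.cross_apply]

theorem cross_apply' (u v : E3) (k : Fin 3) :
    cross u v k = u (k + 1) * v (k + 2) - u (k + 2) * v (k + 1) := by
  fin_cases k <;> simp [cross, _root_.cross_apply]

theorem inner_cross_self (u v : E3) : ⟪u, cross v u⟫_ℝ = 0 := by
  rw [inner_eq_sum, Fin.sum_univ_three, cross_apply_zero, cross_apply_one, cross_apply_two]; ring

theorem cross_smul (c : ℝ) (u v : E3) : cross u (c • v) = c • cross u v := by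
  ext k; simp only [cross_apply', PiLp.smul_apply, smul_eq_mul]; ring

theorem smul_cross (c : ℝ) (u v : E3) : cross (c • u) v = c • cross u v := by
  ext k; simp only [cross_apply', PiLp.smul_apply, smul_eq_mul]; ring

/-- The generator `(x × ∇)_k` of the rotations about the `k`-th axis. -/
noncomputable def rotd (R : ℝ) (k : Fin 3) (u : E3 → ℝ) (x : E3) : ℝ :=
  x (k + 1) * pd R (k + 2) u x - x (k + 2) * pd R (k + 1) u x

theorem rotd_eq_fderivWithin (R : ℝ) (k : Fin 3) (u : E3 → ℝ) (x : E3) :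
    rotd R k u x = fderivWithin ℝ u (ball R) x (cross (basisVec k) x) := by
  rw [fderivWithin_eq_sum_pd, Fin.sum_univ_three]
  fin_cases k <;>
  simp [rotd, cross_apply_zero, cross_apply_one, cross_apply_two, basisVec_apply] <;> ring

theorem Smooth.rotd {R : ℝ} (hR : 0 < R) {u : E3 → ℝ} (hu : Smooth R u) (k : Fin 3) :
    Smooth R (rotd R k u) :=
  ((Smooth.coord _).mul' (hu.pd hR _)).sub' ((Smooth.coord _).mul' (hu.pd hR _))

theorem normal_smul {r : ℝ} (hr : 0 < r) (q : S2) : normal (r • (q : E3)) = q := by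
  rw [normal, norm_smul_S2 hr.le, smul_smul, inv_mul_cancel₀ hr.ne', one_smul]

theorem norm_normal {x : E3} (hx : x ≠ 0) : ‖normal x‖ = 1 := by
  rw [normal, norm_smul, norm_inv, norm_norm, inv_mul_cancel₀ (norm_ne_zero_iff.2 hx)]

theorem normal_mem_ball (x : E3) : normal x ∈ ball 1 := by
  rw [mem_closedBall_zero_iff]
  by_cases hx : x = 0
  · simp [normal, hx]
  · exact (norm_normal hx).le

theorem contDiffAt_normal {x : E3} (hx : x ≠ 0) : ContDiffAt ℝ ∞ normal x :=
  ((contDiffAt_norm ℝ hx).inv (norm_ne_zero_iff.2 hx)).smul contDiffAt_id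

theorem hasFDerivAt_norm {x : E3} (hx : x ≠ 0) :
    HasFDerivAt (fun y : E3 => ‖y‖) (‖x‖⁻¹ • innerSL ℝ x) x := by
  have h1 : HasFDerivAt (fun y : E3 => ‖y‖ ^ 2) (2 • innerSL ℝ x) x :=
    (hasStrictFDerivAt_norm_sq x).hasFDerivAt
  have h2 := h1.sqrt (by positivity)
  simp only [Real.sqrt_sq (norm_nonneg _)] at h2
  refine h2.congr_fderiv ?_
  have : ‖x‖ ≠ 0 := norm_ne_zero_iff.2 hx
  ext v
  simp
  field_simp

theorem fderiv_normal {x : E3} (hx : x ≠ 0) (v : E3) (hv : ⟪x, v⟫_ℝ = 0) :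
    fderiv ℝ normal x v = ‖x‖⁻¹ • v := by
  have hn : ‖x‖ ≠ 0 := norm_ne_zero_iff.2 hx
  have h := ((hasDerivAt_inv hn).comp_hasFDerivAt x (hasFDerivAt_norm hx)).smul (hasFDerivAt_id x)
  have h' : HasFDerivAt normal _ x := h
  rw [h'.fderiv]
  simp [hv]

/-- Extend `w` to be constant along rays and multiply by a radial cutoff. In space, x_i ∂_j F with i
≠ j has integral zero by parts; in polar coordinates the resulting integral of (x × ∇)_k F is a
positive radial factor times the integral over the sphere. -/
theorem integral_rotd_eq_zero {w : E3 → ℝ} (hw : Smooth 1 w) (k : Fin 3) :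
    ∫ q : S2, rotd 1 k w (q : E3) ∂area = 0 := by
  -- The cutoff vanishes for radii below 3/2 and above 5/2, hence avoids the origin, where x/|x| is
  -- singular, and makes the support compact.
  let χ : ContDiffBump (2 : ℝ) := ⟨1 / 4, 1 / 2, by norm_num, by norm_num⟩
  have hχ0 : ∀ t : ℝ, t ≤ 1 → χ t = 0 := fun t ht => χ.zero_of_le_dist (by
    rw [Real.dist_eq, abs_of_nonpos (by linarith)]; show (1 / 2 : ℝ) ≤ _; linarith)
  have hχ1 : ∀ t : ℝ, 3 ≤ t → χ t = 0 := fun t ht => χ.zero_of_le_dist (by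
    rw [Real.dist_eq, abs_of_nonneg (by linarith)]; show (1 / 2 : ℝ) ≤ _; linarith)
  let W : E3 → ℝ := fun x => w (normal x)
  let F : E3 → ℝ := fun x => χ ‖x‖ * W x
  have hW : ∀ x : E3, x ≠ 0 → ContDiffAt ℝ ∞ W x := fun x hx => by
    have h1 := (hw (normal x) (normal_mem_ball x)).comp (s := univ) (f := normal) x
      (contDiffAt_normal hx).contDiffWithinAt (fun y _ => normal_mem_ball y)
    exact contDiffWithinAt_univ.1 h1
  have hF : ContDiff ℝ ∞ F := by
    refine contDiff_iff_contDiffAt.2 fun x => ?_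
    by_cases hx : x = 0
    · have : F =ᶠ[𝓝 x] fun _ => 0 := by
        filter_upwards [ball_mem_nhds x one_pos] with y hy
        rw [hx, mem_ball_zero_iff] at hy
        simp [F, hχ0 _ hy.le]
      exact contDiffAt_const.congr_of_eventuallyEq this
    · exact (χ.contDiffAt.comp x (contDiffAt_norm ℝ hx)).mul (hW x hx)
  have hsupp : HasCompactSupport F :=
    HasCompactSupport.intro (isCompact_closedBall (0 : E3) 3) fun x hx => by
      rw [mem_closedBall_zero_iff, not_le] at hx
      simp [F, hχ1 _ hx.le]
  have hFd : ∀ v : E3, Continuous fun x => fderiv ℝ F x v := fun v =>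
    (hF.continuous_fderiv (by simp)).clm_apply continuous_const
  have hFs : ∀ v : E3, HasCompactSupport fun x => fderiv ℝ F x v := fun v =>
    (hsupp.fderiv ℝ).comp_left (g := fun L : E3 →L[ℝ] ℝ => L v) (by simp)
  have hibp : ∀ i j : Fin 3, i ≠ j → ∫ x : E3, x i * fderiv ℝ F x (basisVec j) = 0 := by
    intro i j hij
    have hd : ∀ x : E3, fderiv ℝ (fun y : E3 => y i) x (basisVec j) = 0 := fun x => by
      change fderiv ℝ (EuclideanSpace.proj (𝕜 := ℝ) i : E3 →L[ℝ] ℝ) x (basisVec j) = 0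
      rw [ContinuousLinearMap.fderiv]
      simp [basisVec_apply, hij]
    rw [integral_mul_fderiv_eq_neg_fderiv_mul_of_integrable]
    · simp [hd]
    · simp [hd]
    · exact (Continuous.mul (by fun_prop) (hFd _)).integrable_of_hasCompactSupport
        ((hFs _).mul_left)
    · exact (Continuous.mul (by fun_prop) hF.continuous).integrable_of_hasCompactSupport
        hsupp.mul_left
    · exact fun x _ => (EuclideanSpace.proj (𝕜 := ℝ) i : E3 →L[ℝ] ℝ).differentiableAt
    · exact fun x _ => hF.differentiable (by simp) x
  have hint : ∀ i j : Fin 3, Integrable fun x : E3 => x i * fderiv ℝ F x (basisVec j) :=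
    fun i j => (Continuous.mul (by fun_prop) (hFd _)).integrable_of_hasCompactSupport
        ((hFs _).mul_left)
  have hzero : ∫ x : E3, (x (k + 1) * fderiv ℝ F x (basisVec (k + 2))
      - x (k + 2) * fderiv ℝ F x (basisVec (k + 1))) = 0 := by
    rw [integral_sub (hint _ _) (hint _ _), hibp _ _ (by fin_cases k <;> simp),
      hibp _ _ (by fin_cases k <;> simp), sub_zero]
  -- The direction e_k × x is tangent to the spheres, so the radial cutoff is not differentiated,
  -- and the derivative of x/|x| is division by r.
  have hrot : ∀ r : ℝ, 0 < r → ∀ q : S2,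
      (r • (q : E3)) (k + 1) * fderiv ℝ F (r • (q : E3)) (basisVec (k + 2))
      - (r • (q : E3)) (k + 2) * fderiv ℝ F (r • (q : E3)) (basisVec (k + 1))
      = χ r * rotd 1 k w (q : E3) := by
    intro r hr q
    set x : E3 := r • (q : E3) with hxdef
    have hx : x ≠ 0 := by
      rw [← norm_ne_zero_iff, norm_smul_S2 hr.le]; exact hr.ne'
    have hv : x (k + 1) * fderiv ℝ F x (basisVec (k + 2))
      - x (k + 2) * fderiv ℝ F x (basisVec (k + 1)) = fderiv ℝ F x (cross (basisVec k) x) := by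
      conv_rhs => rw [eq_sum_basisVec (cross (basisVec k) x)]
      rw [map_sum, Fin.sum_univ_three]
      fin_cases k <;>
      simp [cross_apply_zero, cross_apply_one, cross_apply_two, basisVec_apply] <;> ring
    rw [hv]
    have hnx : normal x = q := normal_smul hr q
    have hWd : HasFDerivAt W ((fderivWithin ℝ w (ball 1) (normal x)).comp (fderiv ℝ normal x)) x :=
      (hw.differentiableWithinAt (normal_mem_ball x)).hasFDerivWithinAt.comp_hasFDerivAt x
        ((contDiffAt_normal hx).differentiableAt (by simp)).hasFDerivAt
        (Eventually.of_forall normal_mem_ball)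
    have hχd : HasFDerivAt (fun y : E3 => χ ‖y‖)
        (deriv χ ‖x‖ • (‖x‖⁻¹ • innerSL ℝ x)) x :=
      HasDerivAt.comp_hasFDerivAt (h₂ := χ) x
        ((χ.contDiff (n := 1)).differentiable (by simp) _).hasDerivAt (hasFDerivAt_norm hx)
    have hFx := hχd.mul hWd
    have hFx' : HasFDerivAt F _ x := hFx
    rw [hFx'.fderiv]
    have hin : ⟪x, cross (basisVec k) x⟫_ℝ = 0 := inner_cross_self _ _
    simp only [add_apply, smul_apply, ContinuousLinearMap.comp_apply,
      innerSL_apply_apply, hin, fderiv_normal hx _ hin, smul_eq_mul, mul_zero, add_zero]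
    rw [hnx, norm_smul_S2 hr.le, ← cross_smul, hxdef, smul_smul, inv_mul_cancel₀ hr.ne', one_smul,
      rotd_eq_fderivWithin]
  have hpolar := integral_polar ((hint (k + 1) (k + 2)).sub (hint (k + 2) (k + 1)))
  simp only [Pi.sub_apply] at hpolar
  rw [hzero, setIntegral_congr_fun measurableSet_Ioi (g := fun r => (r ^ 2 * χ r) *
    ∫ q : S2, rotd 1 k w (q : E3) ∂area) (fun r hr => by
      simp only [hrot r hr, integral_const_mul, mul_assoc])] at hpolar
  rw [integral_mul_const] at hpolar
  refine (mul_eq_zero.1 hpolar.symm).resolve_left (ne_of_gt ?_)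
  have hcont : Continuous fun r : ℝ => r ^ 2 * χ r := by
    have := χ.continuous; fun_prop
  have hcs : HasCompactSupport fun r : ℝ => r ^ 2 * χ r := χ.hasCompactSupport.mul_left
  rw [← integral_indicator measurableSet_Ioi]
  have heq : (Ioi (0 : ℝ)).indicator (fun r : ℝ => r ^ 2 * χ r) = fun r => r ^ 2 * χ r := by
    ext r
    by_cases hr : r ∈ Ioi (0 : ℝ)
    · rw [indicator_of_mem hr]
    · rw [indicator_of_notMem hr, hχ0 r (by rw [mem_Ioi] at hr; linarith), mul_zero]
  rw [heq]
  refine hcont.integral_pos_of_hasCompactSupport_nonneg_nonzero hcs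
    (fun r => mul_nonneg (by positivity) χ.nonneg) (x := 2) ?_
  have : χ 2 = 1 := χ.one_of_mem_closedBall (by simp [χ.rIn_pos.le])
  simp [this]

end RoundBall

namespace RoundBall

/-! ### Polynomial functions and spherical moments -/

/-- Real polynomials in three variables. -/
abbrev Poly : Type := MvPolynomial (Fin 3) ℝ

/-- The value of a polynomial at a point. -/
noncomputable def ev (P : Poly) (x : E3) : ℝ := MvPolynomial.eval (fun i => x i) P

@[simp] theorem ev_add (P Q : Poly) (x : E3) : ev (P + Q) x = ev P x + ev Q x := by simp [ev]
@[simp] theorem ev_sub (P Q : Poly) (x : E3) : ev (P - Q) x = ev P x - ev Q x := by simp [ev]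
@[simp] theorem ev_neg (P : Poly) (x : E3) : ev (-P) x = - ev P x := by simp [ev]
@[simp] theorem ev_mul (P Q : Poly) (x : E3) : ev (P * Q) x = ev P x * ev Q x := by simp [ev]
@[simp] theorem ev_X (i : Fin 3) (x : E3) : ev (MvPolynomial.X i) x = x i := by simp [ev]
@[simp] theorem ev_C (c : ℝ) (x : E3) : ev (MvPolynomial.C c) x = c := by simp [ev]
@[simp] theorem ev_zero (x : E3) : ev 0 x = 0 := by simp [ev]
@[simp] theorem ev_one (x : E3) : ev 1 x = 1 := by simp [ev]
@[simp] theorem ev_pow (P : Poly) (n : ℕ) (x : E3) : ev (P ^ n) x = ev P x ^ n := by simp [ev]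
@[simp] theorem ev_smul (c : ℝ) (P : Poly) (x : E3) : ev (c • P) x = c * ev P x := by
  simp [ev, MvPolynomial.smul_eval]
@[simp] theorem ev_sum {ι : Type*} (s : Finset ι) (P : ι → Poly) (x : E3) :
    ev (∑ i ∈ s, P i) x = ∑ i ∈ s, ev (P i) x := by simp [ev]

theorem angular_eq_ev (P : Poly) (x : E3) : angular P x = ev P (normal x) := rfl

theorem hasFDerivAt_ev (P : Poly) (x : E3) :
    HasFDerivAt (ev P) (∑ i, ev (MvPolynomial.pderiv i P) x •
      (EuclideanSpace.proj (𝕜 := ℝ) i : E3 →L[ℝ] ℝ)) x := by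
  induction P using MvPolynomial.induction_on with
  | C a =>
    have : ev (MvPolynomial.C a) = fun _ => a := funext fun x => by simp
    rw [this]
    simpa using hasFDerivAt_const a x
  | add p q hp hq =>
    have : ev (p + q) = fun x => ev p x + ev q x := funext fun x => by simp
    rw [this]
    refine (hp.add hq).congr_fderiv ?_
    simp [add_smul, Finset.sum_add_distrib]
  | mul_X p j hp =>
    have : ev (p * MvPolynomial.X j) = fun x => ev p x * x j := funext fun x => by simp
    rw [this]
    refine (hp.mul (EuclideanSpace.proj (𝕜 := ℝ) j : E3 →L[ℝ] ℝ).hasFDerivAt).congr_fderiv ?_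
    ext v
    simp only [Fin.sum_univ_three]
    fin_cases j <;> simp [MvPolynomial.pderiv_X] <;> ring

theorem contDiff_ev (P : Poly) : ContDiff ℝ ∞ (ev P) := by
  induction P using MvPolynomial.induction_on with
  | C a =>
    have : ev (MvPolynomial.C a) = fun _ => a := funext fun x => by simp
    rw [this]; exact contDiff_const
  | add p q hp hq =>
    have : ev (p + q) = fun x => ev p x + ev q x := funext fun x => by simp
    rw [this]; exact hp.add hq
  | mul_X p j hp =>
    have : ev (p * MvPolynomial.X j) = fun x => ev p x * x j := funext fun x => by simp
    rw [this]
    exact hp.mul (EuclideanSpace.proj (𝕜 := ℝ) j : E3 →L[ℝ] ℝ).contDiff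

theorem continuous_ev (P : Poly) : Continuous (ev P) := (contDiff_ev P).continuous

theorem smooth_ev (R : ℝ) (P : Poly) : Smooth R (ev P) := (contDiff_ev P).contDiffOn

theorem pd_ev {R : ℝ} (hR : 0 < R) (P : Poly) (i : Fin 3) {x : E3} (hx : x ∈ ball R) :
    pd R i (ev P) x = ev (MvPolynomial.pderiv i P) x := by
  rw [pd_of_hasFDerivAt hR hx i (hasFDerivAt_ev P x)]
  simp only [Fin.sum_univ_three]
  fin_cases i <;> simp [basisVec_apply]

/-- The generator of rotations about the `k`-th axis, acting on polynomials. -/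
noncomputable def rotP (k : Fin 3) (P : Poly) : Poly :=
  MvPolynomial.X (k + 1) * MvPolynomial.pderiv (k + 2) P
    - MvPolynomial.X (k + 2) * MvPolynomial.pderiv (k + 1) P

theorem rotd_ev {R : ℝ} (hR : 0 < R) (P : Poly) (k : Fin 3) {x : E3} (hx : x ∈ ball R) :
    rotd R k (ev P) x = ev (rotP k P) x := by
  simp [rotd, rotP, pd_ev hR _ _ hx]

theorem ev_smul_point {P : Poly} {l : ℕ} (hP : P.IsHomogeneous l) (r : ℝ) (x : E3) :
    ev P (r • x) = r ^ l * ev P x := by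
  simp only [ev, MvPolynomial.eval_eq', PiLp.smul_apply, smul_eq_mul, Finset.mul_sum]
  refine Finset.sum_congr rfl fun d hd => ?_
  have hd' : ∑ i, d i = l := by
    have := hP (MvPolynomial.mem_support_iff.1 hd)
    rw [← this, Finsupp.weight_apply, Finsupp.sum_fintype _ _ (by simp)]
    simp
  simp only [mul_pow, Finset.prod_mul_distrib, Finset.prod_pow_eq_pow_sum, hd']
  ring

instance : CompactSpace S2 := isCompact_iff_compactSpace.1 (isCompact_sphere _ _)

theorem integrable_of_continuous_S2 {g : S2 → ℝ} (hg : Continuous g) : Integrable g area :=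
  hg.integrable_of_hasCompactSupport (HasCompactSupport.of_compactSpace _)

theorem continuous_comp_smul {F : Type*} [TopologicalSpace F] {R : ℝ} {u : E3 → F}
    (hu : ContinuousOn u (ball R)) {r : ℝ}
    (hr : r ∈ Icc (-R) R) : Continuous fun q : S2 => u (r • (q : E3)) :=
  hu.comp_continuous (by fun_prop) fun q => smul_mem_ball hr q

theorem continuous_ev_S2 (P : Poly) : Continuous fun q : S2 => ev P (q : E3) :=
  (continuous_ev P).comp continuous_subtype_val

/-- The moment `∮ u(r q) P(q) dA(q)` of a function on the sphere of radius `r`. -/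
noncomputable def coef (u : E3 → ℝ) (P : Poly) (r : ℝ) : ℝ :=
  ∫ q : S2, u (r • (q : E3)) * ev P (q : E3) ∂area

/-! ### Linearity of the spherical moments in both arguments. -/

section coef
variable {R r : ℝ} {u v : E3 → ℝ} {P Q : Poly}

theorem integrable_coef (hu : ContinuousOn u (ball R)) (P : Poly) (hr : r ∈ Icc (-R) R) :
    Integrable (fun q : S2 => u (r • (q : E3)) * ev P (q : E3)) area :=
  integrable_of_continuous_S2 ((continuous_comp_smul hu hr).mul (continuous_ev_S2 P))

theorem coef_congr (h : EqOn u v (ball R)) (P : Poly) (hr : r ∈ Icc (-R) R) :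
    coef u P r = coef v P r := by
  unfold coef
  congr 1; ext q; rw [h (smul_mem_ball hr q)]

theorem coef_sub (hu : ContinuousOn u (ball R)) (hv : ContinuousOn v (ball R)) (P : Poly)
    (hr : r ∈ Icc (-R) R) : coef (fun x => u x - v x) P r = coef u P r - coef v P r := by
  unfold coef
  rw [← integral_sub (integrable_coef hu P hr) (integrable_coef hv P hr)]
  congr 1; ext q; ring

theorem coef_const_mul (c : ℝ) (u : E3 → ℝ) (P : Poly) (r : ℝ) :
    coef (fun x => c * u x) P r = c * coef u P r := by
  unfold coef
  rw [← integral_const_mul]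
  congr 1; ext q; ring

theorem coef_neg (u : E3 → ℝ) (P : Poly) (r : ℝ) :
    coef (fun x => - u x) P r = - coef u P r := by
  unfold coef
  rw [← integral_neg]
  congr 1; ext q; ring

theorem coef_sum {ι : Type*} {s : Finset ι} {w : ι → E3 → ℝ}
    (h : ∀ i ∈ s, ContinuousOn (w i) (ball R)) (P : Poly) (hr : r ∈ Icc (-R) R) :
    coef (fun x => ∑ i ∈ s, w i x) P r = ∑ i ∈ s, coef (w i) P r := by
  unfold coef
  rw [← integral_finsetSum _ fun i hi => integrable_coef (h i hi) P hr]
  congr 1; ext q; rw [Finset.sum_mul]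

theorem coef_smul_right (c : ℝ) (u : E3 → ℝ) (P : Poly) (r : ℝ) :
    coef u (c • P) r = c * coef u P r := by
  unfold coef
  rw [← integral_const_mul]
  congr 1; ext q; rw [ev_smul]; ring

theorem coef_neg_right (u : E3 → ℝ) (P : Poly) (r : ℝ) :
    coef u (-P) r = - coef u P r := by
  unfold coef
  rw [← integral_neg]
  congr 1; ext q; rw [ev_neg]; ring

theorem coef_sum_right {ι : Type*} {s : Finset ι} (hu : ContinuousOn u (ball R)) (P : ι → Poly)
    (hr : r ∈ Icc (-R) R) : coef u (∑ i ∈ s, P i) r = ∑ i ∈ s, coef u (P i) r := by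
  unfold coef
  rw [← integral_finsetSum _ fun i _ => integrable_coef hu (P i) hr]
  congr 1; ext q; rw [ev_sum, Finset.mul_sum]

end coef

/-! ### Rotational and radial derivatives of the spherical moments. -/

section smoothness
variable {R : ℝ} (hR : 0 < R) {u : E3 → ℝ} (hu : Smooth R u)
include hR hu

omit hR in
theorem hasFDerivWithinAt_comp_smul {r : ℝ} (hr : r ∈ Icc (-R) R) {x : E3} (hx : x ∈ ball 1) :
    HasFDerivWithinAt (fun y : E3 => u (r • y)) (r • fderivWithin ℝ u (ball R) (r • x)) (ball 1) x
    := by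
  have hm : MapsTo (fun y : E3 => r • y) (ball 1) (ball R) := fun y hy => by
    rw [mem_closedBall_zero_iff] at hy ⊢
    rw [norm_smul, Real.norm_eq_abs]
    have := abs_le.2 hr
    nlinarith [abs_nonneg r, norm_nonneg y]
  have h := HasFDerivWithinAt.comp (g := u) x
    (hu.differentiableWithinAt (hm hx)).hasFDerivWithinAt
    ((hasFDerivAt_id x).const_smul r).hasFDerivWithinAt hm
  refine h.congr_fderiv ?_
  ext v; simp

omit hR in
theorem smooth_comp_smul {r : ℝ} (hr : r ∈ Icc (-R) R) : Smooth 1 (fun y : E3 => u (r • y)) := by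
  refine hu.comp (contDiff_const_smul r).contDiffOn fun y hy => ?_
  rw [mem_closedBall_zero_iff] at hy ⊢
  rw [norm_smul, Real.norm_eq_abs]
  have := abs_le.2 hr
  nlinarith [abs_nonneg r, norm_nonneg y]

/-- The generator is a derivation, commutes with dilations and integrates to zero over the sphere,
so it is antisymmetric. -/
theorem coef_rotd {r : ℝ} (hr : r ∈ Icc (-R) R) (P : Poly) (k : Fin 3) :
    coef (rotd R k u) P r = - coef u (rotP k P) r := by
  have h := integral_rotd_eq_zero
    ((smooth_comp_smul hu hr).mul' (smooth_ev 1 P)) k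
  have hpt : ∀ q : S2, rotd 1 k (fun y => u (r • y) * ev P y) (q : E3) =
      rotd R k u (r • (q : E3)) * ev P (q : E3) + u (r • (q : E3)) * ev (rotP k P) q := by
    intro q
    have hq : (q : E3) ∈ ball 1 := sphere_subset_closedBall q.2
    have hpd : ∀ i, pd 1 i (fun y => u (r • y)) (q : E3) = r * pd R i u (r • (q : E3)) := by
      intro i
      rw [pd_of_hasFDerivWithinAt one_pos hq i (hasFDerivWithinAt_comp_smul hu hr hq)]
      simp [pd]
    rw [← rotd_ev one_pos P k hq]
    simp only [rotd, pd_mul one_pos (smooth_comp_smul hu hr) (smooth_ev 1 P) hq, hpd,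
      PiLp.smul_apply, smul_eq_mul]
    ring
  simp only [hpt] at h
  rw [integral_add (integrable_coef (hu.rotd hR k).continuousOn P hr)
    (integrable_coef hu.continuousOn _ hr)] at h
  unfold coef
  linarith

omit hR in
theorem hasDerivWithinAt_comp_ray {r : ℝ} (hr : r ∈ Icc (-R) R) (q : S2) :
    HasDerivWithinAt (fun t : ℝ => u (t • (q : E3)))
      (∑ i, pd R i u (r • (q : E3)) * (q : E3) i) (Icc (-R) R) r := by
  have h := (hu.differentiableWithinAt (smul_mem_ball hr q)).hasFDerivWithinAt
  have h2 := h.comp_hasDerivWithinAt (f := fun t : ℝ => t • (q : E3)) r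
    ((hasDerivAt_id r).smul_const (q : E3)).hasDerivWithinAt
    (fun t ht => smul_mem_ball ht q)
  refine h2.congr_deriv ?_
  rw [one_smul, fderivWithin_eq_sum_pd]
  simp [mul_comm]

omit hR in
theorem exists_bound : ∃ C, 0 ≤ C ∧ ∀ x ∈ ball R, |u x| ≤ C := by
  obtain ⟨C, hC⟩ := (isCompact_closedBall (0 : E3) R).exists_bound_of_continuousOn hu.continuousOn
  exact ⟨max C 0, le_max_right _ _, fun x hx => (hC x hx).trans (le_max_left _ _)⟩

/-- The polynomial is evaluated on the unit sphere, so only `u` depends on the radius. Negative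
radii are admitted on purpose: r = 0 becomes an interior point, and parity in r can be used later.
-/
theorem hasDerivWithinAt_coef {r : ℝ} (hr : r ∈ Icc (-R) R) (P : Poly) :
    HasDerivWithinAt (coef u P) (∑ i, coef (pd R i u) (MvPolynomial.X i * P) r)
      (Icc (-R) R) r := by
  have hb : ∃ C, ∀ q : S2, ∀ y ∈ Icc (-R) R,
      |(∑ i, pd R i u (y • (q : E3)) * (q : E3) i) * ev P (q : E3)| ≤ C := by
    have hc : ContinuousOn (fun p : ℝ × S2 =>
        (∑ i, pd R i u (p.1 • (p.2 : E3)) * (p.2 : E3) i) * ev P (p.2 : E3))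
        (Icc (-R) R ×ˢ univ) := by
      refine ContinuousOn.mul ?_ ((continuous_ev_S2 P).comp continuous_snd).continuousOn
      refine continuousOn_finsetSum _ fun i _ => ContinuousOn.mul ?_ (by fun_prop)
      exact (hu.pd hR i).continuousOn.comp (by fun_prop) fun p hp => smul_mem_ball hp.1 _
    obtain ⟨C, hC⟩ := (isCompact_Icc.prod isCompact_univ).exists_bound_of_continuousOn hc
    exact ⟨C, fun q y hy => hC (y, q) ⟨hy, mem_univ _⟩⟩
  obtain ⟨C, hC⟩ := hb
  have hcont : ∀ y ∈ Icc (-R) R, Continuous fun q : S2 =>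
      (∑ i, pd R i u (y • (q : E3)) * (q : E3) i) * ev P (q : E3) := fun y hy => by
    refine Continuous.mul ?_ (continuous_ev_S2 P)
    exact continuous_finsetSum _ fun i _ =>
      (continuous_comp_smul (hu.pd hR i).continuousOn hy).mul (by fun_prop)
  have key := hasFDerivWithinAt_integral (μ := area) (convex_Icc (-R) R)
    (φ := fun t (q : S2) => u (t • (q : E3)) * ev P (q : E3))
    (φ' := fun t q => ContinuousLinearMap.toSpanSingleton ℝ
      ((∑ i, pd R i u (t • (q : E3)) * (q : E3) i) * ev P (q : E3)))
    (bound := fun _ => C) hr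
    (fun y hy => integrable_coef hu.continuousOn P hy)
    (((ContinuousLinearMap.toSpanSingletonCLE (𝕜 := ℝ) (E := ℝ)).continuous.comp
      (hcont r hr)).aestronglyMeasurable)
    (fun q y hy => ((hasDerivWithinAt_comp_ray hu hy q).mul_const _).hasFDerivWithinAt)
    (fun q y hy => by
      rw [ContinuousLinearMap.norm_toSpanSingleton]
      exact hC q y hy)
    (integrable_const _)
  have h2 := key.hasDerivWithinAt
  refine h2.congr_deriv ?_
  rw [ContinuousLinearMap.integral_apply]
  · simp only [ContinuousLinearMap.toSpanSingleton_apply, one_smul]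
    unfold coef
    rw [← integral_finsetSum _ fun i _ => integrable_coef (hu.pd hR i).continuousOn _ hr]
    congr 1; ext q
    rw [Finset.sum_mul]
    refine Finset.sum_congr rfl fun i _ => ?_
    simp; ring
  · refine Integrable.mono' (g := fun _ => C) (integrable_const _)
      (((ContinuousLinearMap.toSpanSingletonCLE (𝕜 := ℝ) (E := ℝ)).continuous.comp
      (hcont r hr)).aestronglyMeasurable) (Eventually.of_forall fun q => ?_)
    rw [ContinuousLinearMap.norm_toSpanSingleton]
    exact hC q r hr

theorem contDiffOn_coef (P : Poly) : ContDiffOn ℝ ∞ (coef u P) (Icc (-R) R) := by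
  have key : ∀ n : ℕ, ∀ (v : E3 → ℝ), Smooth R v → ∀ P : Poly,
      ContDiffOn ℝ n (coef v P) (Icc (-R) R) := by
    intro n
    induction n with
    | zero =>
      intro v hv P
      refine contDiffOn_zero.2 fun r hr => ?_
      exact (hasDerivWithinAt_coef hR hv hr P).continuousWithinAt
    | succ n ih =>
      intro v hv P
      rw [Nat.cast_add, Nat.cast_one,
        contDiffOn_succ_iff_derivWithin (uniqueDiffOn_Icc (by linarith))]
      refine ⟨fun r hr => (hasDerivWithinAt_coef hR hv hr P).differentiableWithinAt, by simp, ?_⟩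
      refine (ContDiffOn.sum fun i (_ : i ∈ Finset.univ) =>
        ih _ (hv.pd hR i) (MvPolynomial.X i * P)).congr fun r hr => ?_
      exact (hasDerivWithinAt_coef hR hv hr P).derivWithin
        (uniqueDiffOn_Icc (by linarith) r hr)
  exact contDiffOn_infty.2 fun n => key n u hu P

/-- The tangential part of r ∂_i is a combination of two rotation generators with coordinate
coefficients. Moving them onto the coordinates produces x_i twice; the 2 is the mean curvature of
the unit sphere. -/
theorem mul_coef_pd {r : ℝ} (hr : r ∈ Icc (-R) R) (i : Fin 3) :
    r * coef (pd R i u) 1 r = r * ∑ j, coef (pd R j u) (MvPolynomial.X j * MvPolynomial.X i) r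
      + 2 * coef u (MvPolynomial.X i) r := by
  have h1 := coef_rotd hR hu hr (MvPolynomial.X (i + 1)) (i + 2)
  have h2 := coef_rotd hR hu hr (MvPolynomial.X (i + 2)) (i + 1)
  have e1 : rotP (i + 2) (MvPolynomial.X (i + 1)) = MvPolynomial.X i := by
    fin_cases i <;> simp [rotP, MvPolynomial.pderiv_X]
  have e2 : rotP (i + 1) (MvPolynomial.X (i + 2)) = - MvPolynomial.X i := by
    fin_cases i <;> simp [rotP, MvPolynomial.pderiv_X]
  rw [e1] at h1
  rw [e2, coef_neg_right, neg_neg] at h2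
  have hpt : r * coef (pd R i u) 1 r - r * ∑ j, coef (pd R j u)
      (MvPolynomial.X j * MvPolynomial.X i) r =
      coef (rotd R (i + 1) u) (MvPolynomial.X (i + 2)) r
        - coef (rotd R (i + 2) u) (MvPolynomial.X (i + 1)) r := by
    unfold coef
    rw [← integral_finsetSum _ fun j _ => integrable_coef (hu.pd hR j).continuousOn _ hr,
      ← integral_const_mul, ← integral_const_mul, ← integral_sub, ← integral_sub]
    · congr 1; ext q
      have hq := sum_sq_S2 q
      simp only [Fin.sum_univ_three, rotd, PiLp.smul_apply, smul_eq_mul, ev_mul, ev_X, ev_one]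
      fin_cases i <;> simp <;> linear_combination (-r) * (pd R _ u (r • (q : E3))) * hq
    · exact integrable_coef (hu.rotd hR _).continuousOn _ hr
    · exact integrable_coef (hu.rotd hR _).continuousOn _ hr
    · exact (integrable_coef (hu.pd hR i).continuousOn _ hr).const_mul _
    · exact (integrable_finsetSum _ fun j _ =>
        integrable_coef (hu.pd hR j).continuousOn _ hr).const_mul _
  linarith

end smoothness

/-! ### The divergence theorem on the ball. -/

section divergence
variable {R : ℝ} (hR : 0 < R) {V : Fin 3 → E3 → ℝ} (hV : ∀ i, Smooth R (V i))
include hR hV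

/-- This is the divergence theorem in differential form: sum `mul_coef_pd` over the components and
compare with the product rule for t² times the moments. Integration in r then gives the theorem on
the ball. -/
theorem hasDerivWithinAt_flux {r : ℝ} (hr : r ∈ Icc (-R) R) :
    HasDerivWithinAt (fun t => t ^ 2 * ∑ i, coef (V i) (MvPolynomial.X i) t)
      (r ^ 2 * coef (fun x => ∑ i, pd R i (V i) x) 1 r) (Icc (-R) R) r := by
  have h := ((hasDerivAt_pow 2 r).hasDerivWithinAt (s := Icc (-R) R)).mul
    (HasDerivWithinAt.fun_sum fun i (_ : i ∈ Finset.univ) =>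
      hasDerivWithinAt_coef hR (hV i) hr (MvPolynomial.X i))
  refine h.congr_deriv ?_
  rw [coef_sum (fun i _ => ((hV i).pd hR i).continuousOn) 1 hr]
  have h2 : r * ∑ i, coef (pd R i (V i)) 1 r = ∑ i,
    (r * ∑ j, coef (pd R j (V i)) (MvPolynomial.X j * MvPolynomial.X i) r
      + 2 * coef (V i) (MvPolynomial.X i) r) := by
    rw [Finset.mul_sum]
    exact Finset.sum_congr rfl fun i _ => mul_coef_pd hR (hV i) hr i
  rw [Finset.sum_add_distrib, ← Finset.mul_sum, ← Finset.mul_sum] at h2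
  simp only [Nat.cast_ofNat, Nat.add_one_sub_one, pow_one]
  linear_combination (-r) * h2

theorem integral_div_ball :
    ∫ x in ball R, ∑ i, pd R i (V i) x = R ^ 2 * ∑ i, coef (V i) (MvPolynomial.X i) R := by
  have hs : Smooth R (fun x => ∑ i, pd R i (V i) x) := Smooth.sum' fun i _ => (hV i).pd hR i
  rw [integral_ball_polar hR hs.continuousOn]
  have hsub : Icc 0 R ⊆ Icc (-R) R := Icc_subset_Icc_left (by linarith)
  have hd : ∀ r ∈ Ioo 0 R, HasDerivAt (fun t => t ^ 2 * ∑ i, coef (V i) (MvPolynomial.X i) t)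
      (r ^ 2 * ∫ q : S2, (fun x => ∑ i, pd R i (V i) x) (r • (q : E3)) ∂area) r := by
    intro r hr
    have h := hasDerivWithinAt_flux hR hV (hsub ⟨hr.1.le, hr.2.le⟩)
    have h2 := h.hasDerivAt (Icc_mem_nhds (by linarith [hr.1]) hr.2)
    simpa [coef] using h2
  have hc : ContinuousOn (fun r => r ^ 2 * ∫ q : S2,
      (fun x => ∑ i, pd R i (V i) x) (r • (q : E3)) ∂area) (Icc 0 R) := by
    have : ContinuousOn (fun r => coef (fun x => ∑ i, pd R i (V i) x) 1 r) (Icc 0 R) :=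
      (contDiffOn_coef hR hs 1).continuousOn.mono hsub
    simp only [coef, ev_one, mul_one] at this
    exact (continuousOn_pow 2).mul this
  rw [intervalIntegral.integral_eq_sub_of_hasDerivAt_of_le hR.le
    (fun r hr => (hasDerivWithinAt_flux hR hV (hsub hr)).continuousWithinAt.mono hsub)
    hd (hc.intervalIntegrable_of_Icc hR.le)]
  simp

/-- A field without divergence has no flux through the concentric spheres. -/
theorem flux_eq_zero (hdiv : ∀ x ∈ ball R, ∑ i, pd R i (V i) x = 0) {r : ℝ} (hr : r ∈ Ioc 0 R) :
    ∑ i, coef (V i) (MvPolynomial.X i) r = 0 := by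
  have hsub : Icc 0 R ⊆ Icc (-R) R := Icc_subset_Icc_left (by linarith)
  have h0 : ∀ t ∈ Icc (-R) R, coef (fun x => ∑ i, pd R i (V i) x) 1 t = 0 := fun t ht => by
    simp [coef, hdiv _ (smul_mem_ball ht _)]
  have hc := constant_of_has_deriv_right_zero (a := 0) (b := R)
    (f := fun t => t ^ 2 * ∑ i, coef (V i) (MvPolynomial.X i) t)
    (fun t ht => (hasDerivWithinAt_flux hR hV (hsub ht)).continuousWithinAt.mono hsub)
    (fun t ht => by
      have h := hasDerivWithinAt_flux hR hV (hsub ⟨ht.1, ht.2.le⟩)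
      rw [h0 t (hsub ⟨ht.1, ht.2.le⟩), mul_zero] at h
      exact (h.hasDerivAt (Icc_mem_nhds (by linarith [ht.1]) ht.2)).hasDerivWithinAt) r
      ⟨hr.1.le, hr.2⟩
  exact (mul_eq_zero.1 (hc.trans (by simp))).resolve_left (pow_ne_zero _ hr.1.ne')

end divergence

end RoundBall

namespace RoundBall
open MvPolynomial (X C pderiv)

/-! ### Solid harmonics -/

theorem pderiv_comm' (i j : Fin 3) (P : Poly) :
    pderiv i (pderiv j P) = pderiv j (pderiv i P) := by
  ext m
  simp only [MvPolynomial.coeff_pderiv, Finsupp.add_apply, Finsupp.single_apply]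
  rw [add_right_comm]
  by_cases h : i = j
  · subst h; rfl
  · simp [h, Ne.symm h]; ring

/-- The Laplacian of polynomials. -/
noncomputable def lapP : Poly →ₗ[ℝ] Poly :=
  ∑ i : Fin 3, (pderiv i).toLinearMap ∘ₗ (pderiv i).toLinearMap

theorem lapP_apply (P : Poly) : lapP P = ∑ i, pderiv i (pderiv i P) := by
  simp [lapP]

/-- The Euler operator `x · ∇` on polynomials. -/
noncomputable def eulerP (P : Poly) : Poly := ∑ i, X i * pderiv i P

/-- The polynomial `|x|²`. -/
noncomputable def rsq : Poly := X 0 ^ 2 + X 1 ^ 2 + X 2 ^ 2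

theorem eulerP_of_isHomogeneous {P : Poly} {l : ℕ} (h : P.IsHomogeneous l) :
    eulerP P = C (l : ℝ) * P := by
  rw [eulerP, h.sum_X_mul_pderiv, nsmul_eq_mul]; simp

theorem isHomogeneous_rsq : rsq.IsHomogeneous 2 :=
  (((MvPolynomial.isHomogeneous_X ℝ 0).pow 2).add ((MvPolynomial.isHomogeneous_X ℝ 1).pow 2)).add
    ((MvPolynomial.isHomogeneous_X ℝ 2).pow 2)

theorem ev_rsq (x : E3) : ev rsq x = ‖x‖ ^ 2 := by
  simp [rsq, norm_sq_eq_sum, Fin.sum_univ_three]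

theorem lapP_rsq_mul (Q : Poly) : lapP (rsq * Q) = rsq * lapP Q + 4 * eulerP Q + 6 * Q := by
  simp only [lapP_apply, eulerP, rsq, Fin.sum_univ_three, MvPolynomial.pderiv_mul, map_add,
    MvPolynomial.pderiv_pow, MvPolynomial.pderiv_X, Derivation.map_natCast]
  simp
  ring

theorem isSolidHarmonic_iff {l : ℕ} {P : Poly} :
    IsSolidHarmonic l P ↔ P.IsHomogeneous l ∧ lapP P = 0 := by
  rw [IsSolidHarmonic, lapP_apply]

theorem IsSolidHarmonic.pderiv {l : ℕ} {P : Poly} (h : IsSolidHarmonic l P) (i : Fin 3) :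
    IsSolidHarmonic (l - 1) (pderiv i P) := by
  refine ⟨h.1.pderiv, ?_⟩
  have := congrArg (MvPolynomial.pderiv i) h.2
  rw [map_sum, map_zero] at this
  rw [← this]
  refine Finset.sum_congr rfl fun j _ => ?_
  rw [pderiv_comm' i j, pderiv_comm' i j]

/-- With the Euler operator E one has ∑ L_k² = |x|² Δ - E² - E, and E acts as l on degree l. -/
theorem IsSolidHarmonic.rotP_rotP {l : ℕ} {P : Poly} (h : IsSolidHarmonic l P) :
    ∑ k, rotP k (rotP k P) = C (-((l : ℝ) * (l + 1))) * P := by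
  have h1 := eulerP_of_isHomogeneous h.1
  have h2 : eulerP (eulerP P) = C (l : ℝ) * (C (l : ℝ) * P) := by
    rw [eulerP_of_isHomogeneous (l := l), h1]
    rw [h1]
    simpa using (MvPolynomial.isHomogeneous_C (Fin 3) (l : ℝ)).mul h.1
  have h3 := h.2
  have key : ∑ k, rotP k (rotP k P) =
      rsq * (∑ i, MvPolynomial.pderiv i (MvPolynomial.pderiv i P)) - eulerP (eulerP P)
        - eulerP P := by
    simp only [eulerP, rotP, rsq, Fin.sum_univ_three, map_sub, MvPolynomial.pderiv_mul, map_add,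
      MvPolynomial.pderiv_X, pderiv_comm' 1 0, pderiv_comm' 2 0, pderiv_comm' 2 1]
    simp [pderiv_comm' 1 0, pderiv_comm' 2 0, pderiv_comm' 2 1]
    ring
  rw [key, h3, h2, h1]
  simp only [map_neg, map_mul, map_add, map_one]
  ring

theorem isHomogeneous_pderiv_zero {P : Poly} (h : P.IsHomogeneous 0) (i : Fin 3) :
    pderiv i P = 0 := by
  rw [MvPolynomial.totalDegree_eq_zero_iff_eq_C.1 (Nat.le_zero.1 h.totalDegree_le), MvPolynomial.pderiv_C]

theorem lapP_of_lt_two {P : Poly} {l : ℕ} (h : P.IsHomogeneous l) (hl : l < 2) : lapP P = 0 := by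
  rw [lapP_apply]
  refine Finset.sum_eq_zero fun i _ => isHomogeneous_pderiv_zero ?_ i
  have : l - 1 = 0 := by omega
  exact this ▸ h.pderiv

/-- Homogeneous polynomials of degree `n` that are combinations of `|x|^{2j}` times solid
harmonics. -/
noncomputable def fischer (n : ℕ) : Submodule ℝ Poly :=
  Submodule.span ℝ {Q | ∃ j k H, 2 * j + k = n ∧ IsSolidHarmonic k H ∧ Q = rsq ^ j * H}

theorem fischer_isHomogeneous {n : ℕ} {Q : Poly} (h : Q ∈ fischer n) : Q.IsHomogeneous n := by
  have : fischer n ≤ MvPolynomial.homogeneousSubmodule (Fin 3) ℝ n := by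
    refine Submodule.span_le.2 ?_
    rintro _ ⟨j, k, H, rfl, hH, rfl⟩
    exact (isHomogeneous_rsq.pow j).mul hH.1
  exact this h

theorem lapP_rsq_pow_mul {k : ℕ} {H : Poly} (h : IsSolidHarmonic k H) (j : ℕ) :
    lapP (rsq ^ (j + 1) * H) = C ((2 * (j + 1)) * (2 * (j + 1) + 2 * k + 1) : ℝ) *
      (rsq ^ j * H) := by
  induction j with
  | zero =>
    rw [zero_add, pow_one, lapP_rsq_mul, (isSolidHarmonic_iff.1 h).2,
      eulerP_of_isHomogeneous h.1]
    simp only [C.map_mul, C.map_add, C.map_one, CharP.cast_eq_zero, C.map_zero]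
    simp only [map_ofNat]
    ring
  | succ j ih =>
    have e : rsq ^ (j + 1 + 1) * H = rsq * (rsq ^ (j + 1) * H) := by ring
    rw [e, lapP_rsq_mul, ih, eulerP_of_isHomogeneous ((isHomogeneous_rsq.pow (j + 1)).mul h.1)]
    push_cast
    simp only [C.map_mul, C.map_add, C.map_one]
    simp only [map_ofNat]
    ring

/-- Each generator |x|^{2j} H is an eigenvector of S ↦ Δ(|x|² S) with a nonzero eigenvalue, by
`lapP_rsq_pow_mul`, so this map is onto. -/
theorem exists_lapP_rsq_mul {n : ℕ} {Q : Poly} (h : Q ∈ fischer n) :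
    ∃ S ∈ fischer n, lapP (rsq * S) = Q := by
  refine Submodule.span_induction ?_ ?_ ?_ ?_ h
  · rintro _ ⟨j, k, H, hn, hH, rfl⟩
    have hc : ((2 * (j + 1)) * (2 * (j + 1) + 2 * k + 1) : ℝ) ≠ 0 := by positivity
    refine ⟨((2 * (j + 1)) * (2 * (j + 1) + 2 * k + 1) : ℝ)⁻¹ • (rsq ^ j * H),
      Submodule.smul_mem _ _ (Submodule.subset_span ⟨j, k, H, hn, hH, rfl⟩), ?_⟩
    rw [mul_smul_comm, map_smul, ← mul_assoc, ← pow_succ', lapP_rsq_pow_mul hH,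
      MvPolynomial.C_mul', smul_smul, inv_mul_cancel₀ hc, one_smul]
  · exact ⟨0, zero_mem _, by simp⟩
  · rintro x y _ _ ⟨S, hS, rfl⟩ ⟨T, hT, rfl⟩
    exact ⟨S + T, add_mem hS hT, by rw [mul_add, map_add]⟩
  · rintro a x _ ⟨S, hS, rfl⟩
    exact ⟨a • S, Submodule.smul_mem _ _ hS, by rw [mul_smul_comm, map_smul]⟩

theorem rsq_mul_mem_fischer {n : ℕ} {Q : Poly} (h : Q ∈ fischer n) :
    rsq * Q ∈ fischer (n + 2) := by
  refine Submodule.span_induction ?_ ?_ ?_ ?_ h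
  · rintro _ ⟨j, k, H, hn, hH, rfl⟩
    exact Submodule.subset_span ⟨j + 1, k, H, by omega, hH, by ring⟩
  · simp
  · rintro x y _ _ hx hy
    rw [mul_add]; exact add_mem hx hy
  · rintro a x _ hx
    rw [mul_smul_comm]; exact Submodule.smul_mem _ _ hx

/-- The Fischer decomposition. -/
theorem mem_fischer {n : ℕ} {Q : Poly} (h : Q.IsHomogeneous n) : Q ∈ fischer n := by
  induction n using Nat.strong_induction_on generalizing Q with
  | _ n ih =>
    rcases lt_or_ge n 2 with hn | hn
    · exact Submodule.subset_span ⟨0, n, Q, by omega,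
        isSolidHarmonic_iff.2 ⟨h, lapP_of_lt_two h hn⟩, by simp⟩
    · obtain ⟨m, rfl⟩ : ∃ m, n = m + 2 := ⟨n - 2, by omega⟩
      have hl : (lapP Q).IsHomogeneous m := by
        rw [lapP_apply]
        exact MvPolynomial.IsHomogeneous.sum _ _ _ fun i _ => (h.pderiv (i := i)).pderiv (i := i)
      -- ΔQ has degree lower by two, so by induction it equals Δ(|x|² S) for some S; what remains of
      -- Q is harmonic.
      obtain ⟨S, hS, hSQ⟩ := exists_lapP_rsq_mul (ih m (by omega) hl)
      have hR := rsq_mul_mem_fischer hS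
      have hD : IsSolidHarmonic (m + 2) (Q - rsq * S) :=
        isSolidHarmonic_iff.2 ⟨h.sub (fischer_isHomogeneous hR), by rw [map_sub, hSQ, sub_self]⟩
      have : Q = (Q - rsq * S) + rsq * S := by ring
      rw [this]
      exact add_mem (Submodule.subset_span ⟨0, m + 2, _, by omega, hD, by simp⟩) hR

/-! ### Dimensions of the spaces of homogeneous polynomials and of solid harmonics. -/

/-- The space of homogeneous polynomials of degree `n`. -/
abbrev homPoly (n : ℕ) : Submodule ℝ Poly := MvPolynomial.homogeneousSubmodule (Fin 3) ℝ n

/-- The space of solid harmonics of degree `l`. -/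
noncomputable def harm (l : ℕ) : Submodule ℝ Poly := homPoly l ⊓ LinearMap.ker lapP

theorem mem_harm {l : ℕ} {P : Poly} : P ∈ harm l ↔ IsSolidHarmonic l P := by
  rw [isSolidHarmonic_iff]; rfl

instance (n : ℕ) : FiniteDimensional ℝ (homPoly n) :=
  Module.Finite.iff_fg.2 (MvPolynomial.homogeneousSubmodule_fg _ _ n)

instance (l : ℕ) : FiniteDimensional ℝ (harm l) :=
  Submodule.finiteDimensional_of_le (inf_le_left : harm l ≤ homPoly l)

theorem finrank_homPoly (n : ℕ) : Module.finrank ℝ (homPoly n) = (n + 2).choose 2 := by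
  let D := (Finset.univ : Finset (Fin 3)).finsuppAntidiag n
  have hD : ∀ d : Fin 3 →₀ ℕ, d ∈ D ↔ d.degree = n := fun d => by
    simp [D, Finset.mem_finsuppAntidiag, Finsupp.degree_eq_sum]
  let L : homPoly n →ₗ[ℝ] (D → ℝ) :=
    LinearMap.pi fun d => (MvPolynomial.lcoeff ℝ (d : Fin 3 →₀ ℕ)).comp (homPoly n).subtype
  have hL : ∀ P d, L P d = MvPolynomial.coeff (d : Fin 3 →₀ ℕ) (P : Poly) := fun P d => rfl
  have hb : Function.Bijective L := by
    constructor
    · rw [← LinearMap.ker_eq_bot, LinearMap.ker_eq_bot']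
      intro P hP
      ext d
      by_cases hd : d.degree = n
      · have := congrFun hP ⟨d, (hD d).2 hd⟩
        rw [hL] at this
        simpa using this
      · have := P.2.coeff_eq_zero hd
        simpa using this
    · intro c
      refine ⟨⟨∑ d : D, MvPolynomial.monomial (d : Fin 3 →₀ ℕ) (c d), ?_⟩, ?_⟩
      · exact Submodule.sum_mem _ fun d _ =>
          MvPolynomial.isHomogeneous_monomial _ ((hD _).1 d.2)
      · ext d
        rw [hL]
        simp only [MvPolynomial.coeff_sum, MvPolynomial.coeff_monomial]
        rw [Finset.sum_eq_single d]
        · simp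
        · intro b _ hb
          rw [if_neg (fun h => hb (Subtype.ext h))]
        · simp
  rw [(LinearEquiv.ofBijective L hb).finrank_eq, Module.finrank_fintype_fun_eq_card,
    Fintype.card_coe, Finset.card_finsuppAntidiag_nat_eq_choose, Finset.card_univ, Fintype.card_fin]
  rw [show 3 + n - 1 = n + 2 by omega, ← Nat.choose_symm_of_eq_add (show n + 2 = n + 2 from rfl)]

/-- The Laplacian maps degree m + 2 onto degree m, so the dimension of its kernel is a difference of
two binomial coefficients. Below degree two every polynomial is harmonic. -/
theorem finrank_harm (l : ℕ) : Module.finrank ℝ (harm l) = 2 * l + 1 := by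
  rcases lt_or_ge l 2 with hl | hl
  · have : harm l = homPoly l := inf_eq_left.2 fun P hP => lapP_of_lt_two hP hl
    rw [this, finrank_homPoly]
    interval_cases l <;> rfl
  · obtain ⟨m, rfl⟩ : ∃ m, l = m + 2 := ⟨l - 2, by omega⟩
    have hm : ∀ P ∈ homPoly (m + 2), lapP P ∈ homPoly m := fun P hP => by
      rw [lapP_apply]
      exact MvPolynomial.IsHomogeneous.sum _ _ _ fun i _ =>
        (MvPolynomial.IsHomogeneous.pderiv (i := i) hP).pderiv (i := i)
    let L : homPoly (m + 2) →ₗ[ℝ] homPoly m := lapP.restrict hm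
    have hsurj : Function.Surjective L := by
      rintro ⟨Q, hQ⟩
      obtain ⟨S, hS, hSQ⟩ := exists_lapP_rsq_mul (mem_fischer hQ)
      exact ⟨⟨rsq * S, fischer_isHomogeneous (rsq_mul_mem_fischer hS)⟩, Subtype.ext hSQ⟩
    have hrn := L.finrank_range_add_finrank_ker
    rw [LinearMap.range_eq_top.2 hsurj, finrank_top, finrank_homPoly, finrank_homPoly] at hrn
    have hker : Module.finrank ℝ (LinearMap.ker L) = Module.finrank ℝ (harm (m + 2)) := by
      have e : (LinearMap.ker L).map (homPoly (m + 2)).subtype = harm (m + 2) := by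
        ext P
        simp only [Submodule.mem_map, LinearMap.mem_ker, Submodule.coe_subtype, harm,
          Submodule.mem_inf]
        constructor
        · rintro ⟨⟨Q, hQ⟩, hQ0, rfl⟩
          exact ⟨hQ, congrArg Subtype.val hQ0⟩
        · rintro ⟨h1, h2⟩
          exact ⟨⟨P, h1⟩, Subtype.ext h2, rfl⟩
      rw [← e]
      exact (Submodule.equivMapOfInjective _ Subtype.val_injective _).finrank_eq
    rw [hker] at hrn
    have c1 : (m + 2 + 2).choose 2 = (m + 2).choose 2 + (2 * (m + 2) + 1) := by
      rw [Nat.choose_succ_succ (m + 3) 1, Nat.choose_succ_succ (m + 2) 1]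
      simp; ring
    omega

end RoundBall

namespace RoundBall
open MvPolynomial (X C pderiv)

/-! ### The inner product of polynomials on the sphere -/

/-- The `L²` inner product of polynomials on the unit sphere. -/
noncomputable def sip (P Q : Poly) : ℝ := ∫ q : S2, ev P (q : E3) * ev Q (q : E3) ∂area

theorem coef_ev_one (P Q : Poly) : coef (ev P) Q 1 = sip P Q := by simp [coef, sip]

theorem coef_ev {P : Poly} {l : ℕ} (hP : P.IsHomogeneous l) (Q : Poly) (r : ℝ) :
    coef (ev P) Q r = r ^ l * sip P Q := by
  unfold coef sip
  rw [← integral_const_mul]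
  congr 1; ext q; rw [ev_smul_point hP]; ring

theorem integrable_sip (P Q : Poly) :
    Integrable (fun q : S2 => ev P (q : E3) * ev Q (q : E3)) area :=
  integrable_of_continuous_S2 ((continuous_ev_S2 P).mul (continuous_ev_S2 Q))

theorem sip_comm (P Q : Poly) : sip P Q = sip Q P := by
  unfold sip; congr 1; ext q; ring

theorem sip_add_left (P P' Q : Poly) : sip (P + P') Q = sip P Q + sip P' Q := by
  unfold sip
  rw [← integral_add (integrable_sip _ _) (integrable_sip _ _)]
  congr 1; ext q; rw [ev_add]; ring

theorem sip_smul_left (c : ℝ) (P Q : Poly) : sip (c • P) Q = c * sip P Q := by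
  unfold sip
  rw [← integral_const_mul]
  congr 1; ext q; rw [ev_smul]; ring

theorem sip_self_nonneg (P : Poly) : 0 ≤ sip P P :=
  integral_nonneg fun _ => mul_self_nonneg _

theorem sip_rotP (k : Fin 3) (P Q : Poly) : sip (rotP k P) Q = - sip P (rotP k Q) := by
  have h1 : (1 : ℝ) ∈ Icc (-1 : ℝ) 1 := by simp
  rw [← coef_ev_one, ← coef_ev_one, ← coef_rotd one_pos (smooth_ev 1 P) h1 Q k]
  exact coef_congr (fun x hx => (rotd_ev one_pos P k hx).symm) Q h1

theorem sum_sip_rotP {l : ℕ} {Q : Poly} (hQ : IsSolidHarmonic l Q) (P : Poly) :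
    ∑ k, sip (rotP k P) (rotP k Q) = ((l : ℝ) * (l + 1)) * sip P Q := by
  have h : ∀ k, sip (rotP k P) (rotP k Q) = - sip (rotP k (rotP k Q)) P := fun k => by
    rw [sip_rotP, sip_comm]
  simp only [h, Finset.sum_neg_distrib]
  have h2 : ∑ k, sip (rotP k (rotP k Q)) P = sip (∑ k, rotP k (rotP k Q)) P := by
    simp only [Fin.sum_univ_three, sip_add_left]
  rw [h2, hQ.rotP_rotP, MvPolynomial.C_mul', sip_smul_left, sip_comm Q P]
  ring

/-- The operator -∑ L_k² is symmetric, and its eigenvalues l(l+1) are distinct for distinct degrees.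
-/
theorem sip_eq_zero_of_ne {l l' : ℕ} (hne : l ≠ l') {P Q : Poly} (hP : IsSolidHarmonic l P)
    (hQ : IsSolidHarmonic l' Q) : sip P Q = 0 := by
  have h1 := sum_sip_rotP hQ P
  have h2 := sum_sip_rotP hP Q
  have h3 : ∑ k, sip (rotP k P) (rotP k Q) = ∑ k, sip (rotP k Q) (rotP k P) :=
    Finset.sum_congr rfl fun k _ => sip_comm _ _
  rw [h1, h2, sip_comm Q P] at h3
  have h4 : ((l' : ℝ) * (l' + 1) - l * (l + 1)) * sip P Q = 0 := by linarith
  refine (mul_eq_zero.1 h4).resolve_left fun h => hne ?_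
  have h5 : ((l' : ℝ) - l) * (l' + l + 1) = 0 := by linarith
  have h6 := (mul_eq_zero.1 h5).resolve_right (by positivity)
  exact_mod_cast (sub_eq_zero.1 h6).symm

theorem eq_zero_of_integral_sq {g : S2 → ℝ} (hg : Continuous g)
    (h : ∫ q, g q * g q ∂area = 0) : g = 0 := by
  ext q
  by_contra hq
  have h1 := Continuous.integral_pos_of_hasCompactSupport_nonneg_nonzero
    (μ := area) (f := fun q => g q * g q) (hg.mul hg) (HasCompactSupport.of_compactSpace _)
    (fun q => mul_self_nonneg _) (x := q) (mul_self_ne_zero.2 hq)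
  exact h1.ne' h

theorem eq_zero_of_sip_self {l : ℕ} {P : Poly} (hP : P.IsHomogeneous l) (h : sip P P = 0) :
    P = 0 := by
  have h1 := eq_zero_of_integral_sq (continuous_ev_S2 P) h
  refine MvPolynomial.funext fun v => ?_
  rw [map_zero]
  let x : E3 := WithLp.toLp 2 v
  change ev P x = 0
  by_cases hx : x = 0
  · rcases Nat.eq_zero_or_pos l with hl | hl
    · subst hl
      have hq : ‖basisVec 0‖ = 1 := by simp [basisVec]
      have h2 := ev_smul_point hP 0 (basisVec 0)
      rw [pow_zero, one_mul, zero_smul] at h2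
      rw [hx, h2]
      exact congrFun h1 ⟨basisVec 0, by simpa using hq⟩
    · have h2 := ev_smul_point hP 0 x
      rw [zero_pow hl.ne', zero_mul, zero_smul] at h2
      rw [hx, h2]
  · have hn := norm_normal hx
    have h2 := ev_smul_point hP ‖x‖ (normal x)
    rw [normal, smul_smul, mul_inv_cancel₀ (norm_ne_zero_iff.2 hx), one_smul] at h2
    rw [h2]
    have h3 := congrFun h1 ⟨normal x, by simpa using hn⟩
    simp only [Pi.zero_apply] at h3
    rw [show ev P (‖x‖⁻¹ • x) = 0 from h3, mul_zero]

theorem normal_S2 (q : S2) : normal (q : E3) = q := by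
  have := normal_smul one_pos q
  rwa [one_smul] at this

theorem angular_S2 (P : Poly) (q : S2) : angular P (q : E3) = ev P (q : E3) := by
  rw [angular_eq_ev, normal_S2]

theorem exists_orthonormal_harm (l : ℕ) : ∃ Y : Fin (2 * l + 1) → Poly,
    (∀ m, IsSolidHarmonic l (Y m)) ∧ (∀ m m', sip (Y m) (Y m') = if m = m' then 1 else 0) ∧
    ∀ P, IsSolidHarmonic l P → P ∈ Submodule.span ℝ (range Y) := by
  let core : InnerProductSpace.Core ℝ (harm l) :=
    { inner := fun P Q => sip P Q
      conj_inner_symm := fun P Q => by simp [sip_comm]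
      re_inner_nonneg := fun P => by simpa using sip_self_nonneg _
      add_left := fun P P' Q => sip_add_left _ _ _
      smul_left := fun P Q c => by simpa using sip_smul_left _ _ _
      definite := fun P hP => Subtype.ext (eq_zero_of_sip_self (mem_harm.1 P.2).1 hP) }
  let _ : NormedAddCommGroup (harm l) := core.toNormedAddCommGroup
  let _ : InnerProductSpace ℝ (harm l) := InnerProductSpace.ofCore core.toCore
  let b := (stdOrthonormalBasis ℝ (harm l)).reindex (finCongr (finrank_harm l))
  refine ⟨fun m => (b m : Poly), fun m => mem_harm.1 (b m).2, fun m m' => ?_, fun P hP => ?_⟩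
  · exact (orthonormal_iff_ite.1 b.orthonormal) m m'
  · have h1 : (⟨P, mem_harm.2 hP⟩ : harm l) ∈ Submodule.span ℝ (range b) := by
      rw [← b.coe_toBasis, b.toBasis.span_eq]; trivial
    have h2 := Submodule.mem_map_of_mem (f := (harm l).subtype) h1
    rw [Submodule.map_span, ← range_comp] at h2
    exact h2

theorem exists_isHarmonicBasis : ∃ Y : (ℓ : ℕ) → Fin (2 * ℓ + 1) → Poly, IsHarmonicBasis Y := by
  choose Y h1 h2 h3 using exists_orthonormal_harm
  refine ⟨Y, h1, fun l m m' => ?_, h3⟩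
  simp only [angular_S2]
  exact h2 l m m'

theorem IsHarmonicBasis.sip_eq {Y : (ℓ : ℕ) → Fin (2 * ℓ + 1) → Poly} (hY : IsHarmonicBasis Y)
    (p p' : ModeIdx) : sip (Y p.1 p.2) (Y p'.1 p'.2) = if p = p' then 1 else 0 := by
  obtain ⟨l, m⟩ := p
  obtain ⟨l', m'⟩ := p'
  by_cases h : l = l'
  · subst h
    have := hY.orthonormal l m m'
    simp only [angular_S2] at this
    simp [sip, this]
  · rw [if_neg (fun h' => h (congrArg Sigma.fst h'))]
    exact sip_eq_zero_of_ne h (hY.harmonic _ _) (hY.harmonic _ _)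

/-! ### Completeness -/

/-- A linear condition on polynomials that holds for solid harmonics, and depends only on the
values on the sphere, holds for all polynomials. -/
theorem poly_induction {p : Poly → Prop} (h0 : p 0) (hadd : ∀ P Q, p P → p Q → p (P + Q))
    (hsmul : ∀ (c : ℝ) P, p P → p (c • P)) (hrsq : ∀ P, p P → p (rsq * P))
    (hharm : ∀ l P, IsSolidHarmonic l P → p P) (P : Poly) : p P := by
  have hf : ∀ n, ∀ Q ∈ fischer n, p Q := by
    intro n Q hQ
    refine Submodule.span_induction ?_ h0 (fun x y _ _ => hadd x y) (fun a x _ => hsmul a x) hQ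
    rintro _ ⟨j, k, H, -, hH, rfl⟩
    induction j with
    | zero => simpa using hharm k H hH
    | succ j ih =>
      rw [pow_succ', mul_assoc]; exact hrsq _ ih
  rw [← MvPolynomial.sum_homogeneousComponent P]
  exact Finset.sum_induction _ p hadd h0 fun n _ =>
    hf n _ (mem_fischer (MvPolynomial.homogeneousComponent_isHomogeneous n P))

theorem ev_rsq_S2 (q : S2) : ev rsq (q : E3) = 1 := by rw [ev_rsq, norm_S2]; norm_num

theorem integral_mul_ev_eq_zero {g : S2 → ℝ} (hg : Continuous g)
    (h : ∀ l P, IsSolidHarmonic l P → ∫ q, g q * ev P (q : E3) ∂area = 0) (P : Poly) :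
    ∫ q, g q * ev P (q : E3) ∂area = 0 := by
  have hi : ∀ P, Integrable (fun q => g q * ev P (q : E3)) area := fun P =>
    integrable_of_continuous_S2 (hg.mul (continuous_ev_S2 P))
  refine poly_induction (p := fun P => ∫ q, g q * ev P (q : E3) ∂area = 0) (by simp)
    (fun P Q hP hQ => ?_) (fun c P hP => ?_) (fun P hP => ?_) h P
  · simp only [ev_add, mul_add]
    rw [integral_add (hi P) (hi Q), hP, hQ, add_zero]
  · simp only [ev_smul, mul_left_comm _ c]
    rw [integral_const_mul, hP, mul_zero]
  · simpa only [ev_mul, ev_rsq_S2, one_mul] using hP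

/-- By the Fischer decomposition g is orthogonal to all polynomials. These are dense in C(S²) by
Stone-Weierstrass, so g is orthogonal to itself. -/
theorem eq_zero_of_moments {g : S2 → ℝ} (hg : Continuous g)
    (h : ∀ l P, IsSolidHarmonic l P → ∫ q, g q * ev P (q : E3) ∂area = 0) : g = 0 := by
  have hP := integral_mul_ev_eq_zero hg h
  let Φ : Poly →ₐ[ℝ] C(S2, ℝ) := MvPolynomial.aeval fun i =>
    ⟨fun q => (q : E3) i, by fun_prop⟩
  have hΦ : ∀ P q, Φ P q = ev P (q : E3) := by
    intro P q
    let e : C(S2, ℝ) →ₐ[ℝ] ℝ :=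
      { toFun := fun f => f q
        map_one' := rfl
        map_mul' := fun _ _ => rfl
        map_zero' := rfl
        map_add' := fun _ _ => rfl
        commutes' := fun _ => rfl }
    change e (Φ P) = ev P (q : E3)
    rw [← AlgHom.comp_apply, MvPolynomial.comp_aeval]
    rfl
  have hsep : Φ.range.SeparatesPoints := by
    intro q q' hne
    by_contra hcon
    push Not at hcon
    refine hne (Subtype.ext ?_)
    ext i
    have := hcon (fun q => Φ (X i) q) ⟨Φ (X i), ⟨X i, rfl⟩, rfl⟩
    simpa [hΦ] using this
  have htop := ContinuousMap.subalgebra_topologicalClosure_eq_top_of_separatesPoints _ hsep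
  let G : C(S2, ℝ) := ⟨g, hg⟩
  have hcont : Continuous fun f : C(S2, ℝ) => ∫ q, g q * f q ∂area := by
    have hi : ∀ f : C(S2, ℝ), Integrable (fun q => g q * f q) area := fun f =>
      integrable_of_continuous_S2 (hg.mul f.continuous)
    let L : C(S2, ℝ) →ₗ[ℝ] ℝ :=
      { toFun := fun f => ∫ q, g q * f q ∂area
        map_add' := fun f f' => by
          rw [← integral_add (hi f) (hi f')]
          simp only [ContinuousMap.add_apply, mul_add]
        map_smul' := fun c f => by
          simp only [ContinuousMap.smul_apply, smul_eq_mul, mul_left_comm _ c,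
            integral_const_mul, RingHom.id_apply] }
    refine AddMonoidHomClass.continuous_of_bound L (∫ q, |g q| ∂area) fun f => ?_
    rw [← integral_mul_const]
    refine norm_integral_le_of_norm_le
      ((integrable_of_continuous_S2 hg.abs).mul_const _) (Eventually.of_forall fun q => ?_)
    rw [norm_mul, Real.norm_eq_abs]
    exact mul_le_mul_of_nonneg_left (f.norm_coe_le_norm q) (abs_nonneg _)
  have hclosed : IsClosed {f : C(S2, ℝ) | ∫ q, g q * f q ∂area = 0} :=
    isClosed_eq hcont continuous_const
  have hsub : (Φ.range : Set C(S2, ℝ)) ⊆ {f : C(S2, ℝ) | ∫ q, g q * f q ∂area = 0} := by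
    rintro _ ⟨P, rfl⟩
    change ∫ q, g q * Φ P q ∂area = 0
    simp only [hΦ]
    exact hP P
  have hmem : G ∈ Φ.range.topologicalClosure := by rw [htop]; trivial
  have : G ∈ closure (Φ.range : Set C(S2, ℝ)) := hmem
  have h2 : G ∈ {f : C(S2, ℝ) | ∫ q, g q * f q ∂area = 0} :=
    closure_minimal hsub hclosed this
  exact eq_zero_of_integral_sq hg h2

/-! ### Completeness for vector fields on the sphere. -/

/-- The tangent field `x × ∇P` of a polynomial. -/
noncomputable def rotV (P : Poly) (x : E3) : E3 := WithLp.toLp 2 fun k => ev (rotP k P) x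

@[simp] theorem rotV_apply (P : Poly) (x : E3) (k : Fin 3) : rotV P x k = ev (rotP k P) x := rfl

theorem rotP_add (k : Fin 3) (P Q : Poly) : rotP k (P + Q) = rotP k P + rotP k Q := by
  simp [rotP]; ring
theorem rotP_smul (k : Fin 3) (c : ℝ) (P : Poly) : rotP k (c • P) = c • rotP k P := by
  simp [rotP, smul_sub]
theorem rotP_mul (k : Fin 3) (P Q : Poly) : rotP k (P * Q) = P * rotP k Q + rotP k P * Q := by
  simp only [rotP, MvPolynomial.pderiv_mul]; ring
theorem rotP_rsq (k : Fin 3) : rotP k rsq = 0 := by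
  fin_cases k <;> simp [rotP, rsq, MvPolynomial.pderiv_X] <;> ring

theorem rotV_add (P Q : Poly) (x : E3) : rotV (P + Q) x = rotV P x + rotV Q x := by
  ext k; simp [rotP_add]
theorem rotV_smul (c : ℝ) (P : Poly) (x : E3) : rotV (c • P) x = c • rotV P x := by
  ext k; simp [rotP_smul]
theorem rotV_zero (x : E3) : rotV 0 x = 0 := by
  ext k; simp [rotP]
theorem rotV_rsq_mul (P : Poly) (q : S2) : rotV (rsq * P) q = rotV P q := by
  ext k; simp [rotP_mul, rotP_rsq, ev_rsq_S2]

theorem continuous_rotV (P : Poly) : Continuous (rotV P) :=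
  (PiLp.continuous_toLp 2 _).comp (continuous_pi fun k => continuous_ev (rotP k P))

theorem inner_rotV_self (P : Poly) (x : E3) : ⟪rotV P x, x⟫_ℝ = 0 := by
  rw [inner_eq_sum, Fin.sum_univ_three]
  simp [rotP]; ring

theorem integral_inner_rotV_eq_zero {W : S2 → E3} (hW : Continuous W)
    (h : ∀ l P, IsSolidHarmonic l P → ∫ q, ⟪W q, rotV P (q : E3)⟫_ℝ ∂area = 0) (P : Poly) :
    ∫ q, ⟪W q, rotV P (q : E3)⟫_ℝ ∂area = 0 := by
  have hi : ∀ P, Integrable (fun q : S2 => ⟪W q, rotV P (q : E3)⟫_ℝ) area := fun P =>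
    integrable_of_continuous_S2 (hW.inner ((continuous_rotV P).comp continuous_subtype_val))
  refine poly_induction (p := fun P => ∫ q, ⟪W q, rotV P (q : E3)⟫_ℝ ∂area = 0)
    (by simp [rotV_zero]) (fun P Q hP hQ => ?_) (fun c P hP => ?_) (fun P hP => ?_) h P
  · simp only [rotV_add, inner_add_right]
    rw [integral_add (hi P) (hi Q), hP, hQ, add_zero]
  · simp only [rotV_smul, inner_smul_right]
    rw [integral_const_mul, hP, mul_zero]
  · simpa only [rotV_rsq_mul] using hP

theorem continuous_cross {α : Type*} [TopologicalSpace α] {u v : α → E3} (hu : Continuous u)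
    (hv : Continuous v) : Continuous fun a => cross (u a) (v a) := by
  refine (PiLp.continuous_toLp 2 _).comp (continuous_pi fun k => ?_)
  have : ∀ a, crossProduct (u a).ofLp (v a).ofLp k =
      u a (k + 1) * v a (k + 2) - u a (k + 2) * v a (k + 1) := fun a => cross_apply' (u a) (v a) k
  simp only [this]
  fun_prop

/-- In vector form: k(k+1) H e_i = k ∇(x_i H) - x × ∇(L_i H) + x × (x × ∇ ∂_i H), by homogeneity and
harmonicity. It writes a constant direction times a harmonic through fields whose pairing with a
tangent field is a tangential moment. -/
theorem vector_harmonic_identity {k : ℕ} {H : Poly} (hH : IsSolidHarmonic k H) (i j : Fin 3) :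
    C ((k : ℝ) * (k + 1)) * (if j = i then H else 0) =
      C (k : ℝ) * pderiv j (X i * H) - rotP j (rotP i H)
        + (X (j + 1) * rotP (j + 2) (pderiv i H) - X (j + 2) * rotP (j + 1) (pderiv i H)) := by
  have h1 := eulerP_of_isHomogeneous hH.1
  have h2 : ∀ j, pderiv j (eulerP H) = C (k : ℝ) * pderiv j H := fun j => by
    rw [h1, MvPolynomial.pderiv_C_mul]
  have h3 := hH.2
  have e0 := h2 0
  have e1 := h2 1
  have e2 := h2 2
  simp only [eulerP, rotP, Fin.sum_univ_three, map_sub, MvPolynomial.pderiv_mul, map_add,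
    MvPolynomial.pderiv_X, pderiv_comm' 1 0, pderiv_comm' 2 0, pderiv_comm' 2 1, map_mul,
    map_one] at *
  fin_cases i <;> fin_cases j <;>
    simp [pderiv_comm' 1 0, pderiv_comm' 2 0, pderiv_comm' 2 1] at h1 e0 e1 e2 h3 ⊢
  · linear_combination (-(k : Poly)) * h1 - X 1 * e1 - X 2 * e2 + (X 1 ^ 2 + X 2 ^ 2) * h3
  · linear_combination X 0 * e1 - X 0 * X 1 * h3
  · linear_combination X 0 * e2 - X 0 * X 2 * h3
  · linear_combination X 1 * e0 - X 1 * X 0 * h3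
  · linear_combination (-(k : Poly)) * h1 - X 0 * e0 - X 2 * e2 + (X 0 ^ 2 + X 2 ^ 2) * h3
  · linear_combination X 1 * e2 - X 1 * X 2 * h3
  · linear_combination X 2 * e0 - X 2 * X 0 * h3
  · linear_combination X 2 * e1 - X 2 * X 1 * h3
  · linear_combination (-(k : Poly)) * h1 - X 0 * e0 - X 1 * e1 + (X 0 ^ 2 + X 1 ^ 2) * h3

/-- Tangent and normal moments determine a continuous vector field on the sphere. -/
theorem eq_zero_of_vector_moments {V : S2 → E3} (hV : Continuous V)
    (ha : ∀ l P, IsSolidHarmonic l P → ∫ q, ⟪V q, (q : E3)⟫_ℝ * ev P (q : E3) ∂area = 0)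
    (hb : ∀ l P, IsSolidHarmonic l P → ∫ q, ⟪V q, rotV P (q : E3)⟫_ℝ ∂area = 0)
    (hc : ∀ l P, IsSolidHarmonic l P →
      ∫ q, ⟪cross (q : E3) (V q), rotV P (q : E3)⟫_ℝ ∂area = 0) : V = 0 := by
  have hn : ∀ q, ⟪V q, (q : E3)⟫_ℝ = 0 := fun q =>
    congrFun (eq_zero_of_moments (hV.inner continuous_subtype_val) ha) q
  have hW : Continuous fun q : S2 => cross (q : E3) (V q) :=
    continuous_cross continuous_subtype_val hV
  have hb' := integral_inner_rotV_eq_zero hV hb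
  have hc' := integral_inner_rotV_eq_zero hW hc
  -- Here V is already known to be tangent, so (q × V)·(q × ∇P) is simply V·∇P.
  have hdot : ∀ (q : S2) (P : Poly), ⟪cross (q : E3) (V q), rotV P (q : E3)⟫_ℝ =
      ∑ j, V q j * ev (pderiv j P) (q : E3) := by
    intro q P
    have h1 := hn q
    have h2 := sum_sq_S2 q
    rw [inner_eq_sum, Fin.sum_univ_three] at h1 ⊢
    simp only [Fin.sum_univ_three, rotV_apply, rotP, ev_sub, ev_mul, ev_X, cross_apply_zero,
      cross_apply_one, cross_apply_two]
    simp only [Fin.isValue, zero_add, Fin.reduceAdd]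
    linear_combination (V q 0 * ev (pderiv 0 P) (q : E3) + V q 1 * ev (pderiv 1 P) (q : E3)
      + V q 2 * ev (pderiv 2 P) (q : E3)) * h2 - ((q : E3) 0 * ev (pderiv 0 P) (q : E3)
      + (q : E3) 1 * ev (pderiv 1 P) (q : E3) + (q : E3) 2 * ev (pderiv 2 P) (q : E3)) * h1
  have hcomp : ∀ i, (fun q => V q i) = 0 := by
    intro i
    refine eq_zero_of_moments (by fun_prop) fun k H hH => ?_
    -- In degree zero the factor k(k+1) vanishes, but then H is constant and H e_i = ∇(x_i H)
    -- directly.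
    rcases Nat.eq_zero_or_pos k with hk | hk
    · subst hk
      have h0 := hc' (X i * H)
      rw [← h0]
      congr 1; ext q
      rw [hdot]
      simp only [MvPolynomial.pderiv_mul, isHomogeneous_pderiv_zero hH.1, mul_zero, add_zero,
        MvPolynomial.pderiv_X, Fin.sum_univ_three]
      fin_cases i <;> simp
    · have hpt : ∀ q : S2, V q i * ev H (q : E3) = ((k : ℝ) * (k + 1))⁻¹ *
          (k * ⟪cross (q : E3) (V q), rotV (X i * H) (q : E3)⟫_ℝ
            - ⟪V q, rotV (rotP i H) (q : E3)⟫_ℝ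
            - ⟪cross (q : E3) (V q), rotV (pderiv i H) (q : E3)⟫_ℝ) := by
        intro q
        rw [eq_inv_mul_iff_mul_eq₀ (by positivity), hdot q (X i * H)]
        have hid : ∀ j, _ := fun j => congrArg (fun P => V q j * ev P (q : E3))
          (vector_harmonic_identity hH i j)
        have hs := Finset.sum_congr (rfl : (Finset.univ : Finset (Fin 3)) = Finset.univ)
          fun j _ => hid j
        have hl : ∑ j, V q j * ev (C ((k : ℝ) * (k + 1)) * (if j = i then H else 0)) (q : E3) =
            (k : ℝ) * (k + 1) * (V q i * ev H (q : E3)) := by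
          rw [Finset.sum_eq_single i]
          · rw [if_pos rfl, ev_mul, ev_C]; ring
          · intro j _ hj; simp [hj]
          · simp
        rw [hl] at hs
        rw [hs, inner_eq_sum, inner_eq_sum]
        simp only [Fin.sum_univ_three, rotV_apply, cross_apply_zero,
          cross_apply_one, cross_apply_two, ev_add, ev_sub, ev_mul, ev_C, ev_X]
        simp only [Fin.isValue, zero_add, Fin.reduceAdd]
        ring
      have i1 := integrable_of_continuous_S2
        (hW.inner ((continuous_rotV (X i * H)).comp continuous_subtype_val))
      have i2 := integrable_of_continuous_S2
        (hV.inner ((continuous_rotV (rotP i H)).comp continuous_subtype_val))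
      have i3 := integrable_of_continuous_S2
        (hW.inner ((continuous_rotV (pderiv i H)).comp continuous_subtype_val))
      simp only [Function.comp_apply] at i1 i2 i3
      simp only [hpt]
      rw [integral_const_mul, integral_sub
          (f := fun q : S2 => (k : ℝ) * ⟪cross (q : E3) (V q), rotV (X i * H) (q : E3)⟫_ℝ
            - ⟪V q, rotV (rotP i H) (q : E3)⟫_ℝ) ((i1.const_mul _).sub i2) i3,
        integral_sub (i1.const_mul _) i2, integral_const_mul, hb', hc', hc']
      simp
  ext q i
  exact congrFun (hcomp i) q

end RoundBall

namespace RoundBall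
open MvPolynomial (X C pderiv)

/-! ### Pointwise bounds for spherical harmonics -/

/-- The area of the unit sphere. -/
noncomputable def sphereArea : ℝ := area.real univ

theorem sphereArea_pos : 0 < sphereArea := by
  have : NeZero area := ⟨Measure.toSphere_ne_zero _⟩
  exact measureReal_univ_pos

theorem sq_integral_le {f : S2 → ℝ} (hf : Continuous f) :
    (∫ q, f q ∂area) ^ 2 ≤ sphereArea * ∫ q, f q ^ 2 ∂area := by
  have hc := sphereArea_pos
  set m := (∫ q, f q ∂area) / sphereArea with hm
  have h0 : 0 ≤ ∫ q, (f q - m) ^ 2 ∂area := integral_nonneg fun _ => sq_nonneg _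
  have h1 : ∫ q, (f q - m) ^ 2 ∂area =
      ∫ q, f q ^ 2 ∂area - 2 * m * ∫ q, f q ∂area + m ^ 2 * sphereArea := by
    have e : (fun q => (f q - m) ^ 2) = fun q => (f q ^ 2 - 2 * m * f q) + m ^ 2 := by
      ext q; ring
    have i1 := integrable_of_continuous_S2 (hf.pow 2)
    have i2 := (integrable_of_continuous_S2 hf).const_mul (2 * m)
    rw [e, integral_add (f := fun q => f q ^ 2 - 2 * m * f q) (i1.sub i2) (integrable_const _),
      integral_sub (f := fun q => f q ^ 2) i1 i2, integral_const_mul, integral_const, smul_eq_mul]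
    simp only [sphereArea]; ring
  rw [h1] at h0
  have h2 : ∫ q, f q ∂area = m * sphereArea := by rw [hm]; field_simp
  rw [h2] at h0 ⊢
  nlinarith

/-- The derivative of the spherical integral around y is the flux of the gradient, which vanishes
for a harmonic polynomial. Hence the integral keeps its value at radius zero. -/
theorem coef_mean_value {P : Poly} (hP : lapP P = 0) (y : E3) {δ : ℝ} (hδ : 0 < δ) {r : ℝ}
    (hr : r ∈ Icc 0 δ) : coef (fun x => ev P (y + x)) 1 r = sphereArea * ev P y := by
  have hs : ∀ Q : Poly, Smooth δ (fun x => ev Q (y + x)) := fun Q =>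
    ((contDiff_ev Q).comp (contDiff_const.add contDiff_id)).contDiffOn
  have hpd : ∀ (Q : Poly) (i : Fin 3), EqOn (pd δ i (fun x => ev Q (y + x)))
      (fun x => ev (pderiv i Q) (y + x)) (ball δ) := fun Q i x hx => by
    have h := (hasFDerivAt_ev Q (y + x)).comp x ((hasFDerivAt_id x).const_add y)
    rw [pd_of_hasFDerivAt (u := fun x => ev Q (y + x)) hδ hx i h]
    simp only [Fin.sum_univ_three]
    fin_cases i <;> simp [basisVec_apply]
  have hsub : Icc 0 δ ⊆ Icc (-δ) δ := Icc_subset_Icc_left (by linarith)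
  have hd : ∀ t ∈ Icc 0 δ, HasDerivWithinAt (coef (fun x => ev P (y + x)) 1) 0 (Icc (-δ) δ) t := by
    intro t ht
    refine (hasDerivWithinAt_coef hδ (hs P) (hsub ht) 1).congr_deriv ?_
    simp only [mul_one]
    have e : ∀ i, coef (pd δ i fun x => ev P (y + x)) (X i) t =
        coef (fun x => ev (pderiv i P) (y + x)) (X i) t := fun i =>
      coef_congr (hpd P i) _ (hsub ht)
    simp only [e]
    -- At radius zero the flux lemma does not apply; there the gradient is a constant vector, whose
    -- flux through the unit sphere vanishes.
    rcases eq_or_lt_of_le ht.1 with h0 | h0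
    · have hz := fun i : Fin 3 => flux_eq_zero (R := 1) one_pos
        (V := fun j _ => ev (pderiv i P) y * if j = i then 1 else 0)
        (fun j => contDiffOn_const) (r := 1)
        (fun x hx => Finset.sum_eq_zero fun j _ => pd_const one_pos hx _ _) (by simp)
      refine Finset.sum_eq_zero fun i _ => ?_
      rw [← hz i, Finset.sum_eq_single i]
      · simp [coef, ← h0]
      · intro j _ hj; simp [coef, hj]
      · simp
    · refine flux_eq_zero hδ (V := fun i x => ev (pderiv i P) (y + x)) (fun i => hs _)
        (fun x hx => ?_) ⟨h0, ht.2⟩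
      have : ∀ i, pd δ i (fun x => ev (pderiv i P) (y + x)) x =
        ev (pderiv i (pderiv i P)) (y + x) := fun i => hpd _ i hx
      simp only [this]
      rw [← ev_sum, ← lapP_apply, hP, ev_zero]
  have hc := constant_of_has_deriv_right_zero (a := 0) (b := δ)
    (f := coef (fun x => ev P (y + x)) 1)
    (fun t ht => (hd t ht).continuousWithinAt.mono hsub)
    (fun t ht => ((hd t ⟨ht.1, ht.2.le⟩).hasDerivAt
      (Icc_mem_nhds (by linarith [ht.1]) ht.2)).hasDerivWithinAt) r hr
  rw [hc]
  simp [coef, sphereArea]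

theorem integral_ball_ev_sq {P : Poly} {l : ℕ} (hP : P.IsHomogeneous l) {ρ : ℝ} (hρ : 0 < ρ) :
    ∫ x in ball ρ, ev P x ^ 2 = ρ ^ (2 * l + 3) / (2 * l + 3) * sip P P := by
  rw [integral_ball_polar (G := fun x => ev P x ^ 2) hρ ((continuous_ev P).pow 2).continuousOn]
  have : ∀ r : ℝ, r ^ 2 * ∫ q : S2, ev P (r • (q : E3)) ^ 2 ∂area =
      r ^ (2 * l + 2) * sip P P := by
    intro r
    simp only [ev_smul_point hP, mul_pow]
    rw [integral_const_mul, sip]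
    simp only [← sq]
    ring
  simp only [this]
  rw [intervalIntegral.integral_mul_const, integral_pow]
  push_cast
  rw [zero_pow (by omega), show ((2 : ℝ) * l + 2 + 1) = 2 * l + 3 by ring, sub_zero]

/-- Apply the mean value property and Cauchy-Schwarz on the ball of radius δ = 1/(l+1) around q, and
enlarge it to radius 1 + δ around the origin. The choice of δ keeps (1+δ)^(2l+3) ≤ e³. The volume of
the small ball costs (l+1)³ and the radial integral over the large one gains 1/(2l+3), so the square
of the value is bounded with (l+1)². -/
theorem exists_sup_bound : ∃ K : ℝ, 0 ≤ K ∧ ∀ (l : ℕ) (P : Poly), IsSolidHarmonic l P →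
    ∀ q : S2, |ev P (q : E3)| ≤ K * (l + 1) * √(sip P P) := by
  have hc := sphereArea_pos
  refine ⟨√(3 * Real.exp 3 / sphereArea), Real.sqrt_nonneg _, fun l P hP q => ?_⟩
  have hl : (0 : ℝ) < l + 1 := by positivity
  set δ : ℝ := (l + 1 : ℝ)⁻¹ with hδdef
  have hδ : 0 < δ := by positivity
  set y : E3 := (q : E3) with hy
  have hcont : Continuous fun x => ev P (y + x) := (continuous_ev P).comp (by fun_prop)
  have h1 : ∀ r ∈ Icc 0 δ, sphereArea * ev P y ^ 2 ≤ ∫ q : S2, ev P (y + r • (q : E3)) ^ 2 ∂area := by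
    intro r hr
    have h := sq_integral_le (f := fun q : S2 => ev P (y + r • (q : E3)))
      (hcont.comp (by fun_prop))
    have hm := coef_mean_value (isSolidHarmonic_iff.1 hP).2 y hδ hr
    simp only [coef, ev_one, mul_one] at hm
    rw [hm, mul_pow, sq sphereArea, mul_assoc] at h
    exact le_of_mul_le_mul_left h hc
  have h2 : δ ^ 3 / 3 * (sphereArea * ev P y ^ 2) ≤ ∫ x in ball δ, ev P (y + x) ^ 2 := by
    rw [integral_ball_polar (G := fun x => ev P (y + x) ^ 2) hδ (hcont.pow 2).continuousOn]
    have : δ ^ 3 / 3 * (sphereArea * ev P y ^ 2) =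
        ∫ r in (0 : ℝ)..δ, r ^ 2 * (sphereArea * ev P y ^ 2) := by
      rw [intervalIntegral.integral_mul_const, integral_pow]; norm_num
    rw [this]
    refine intervalIntegral.integral_mono_on hδ.le (by
      apply Continuous.intervalIntegrable; fun_prop) ?_ fun r hr =>
        mul_le_mul_of_nonneg_left (h1 r hr) (sq_nonneg r)
    have hs : Smooth δ (fun x => ev P (y + x) ^ 2) :=
      (((contDiff_ev P).comp (contDiff_const.add contDiff_id)).pow 2).contDiffOn
    have := (contDiffOn_coef hδ hs 1).continuousOn.mono
      (Icc_subset_Icc_left (show -δ ≤ 0 by linarith))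
    have h3 : ContinuousOn (fun r => coef (fun x => ev P (y + x) ^ 2) 1 r) (Icc 0 δ) := this
    simp only [coef, ev_one, mul_one] at h3
    exact ((continuousOn_pow 2).mul h3).intervalIntegrable_of_Icc hδ.le
  have h3 : ∫ x in ball δ, ev P (y + x) ^ 2 ≤ ∫ x in ball (1 + δ), ev P x ^ 2 := by
    have e : ∫ x in ball δ, ev P (y + x) ^ 2 = ∫ x in (fun x => y + x) '' ball δ, ev P x ^ 2 :=
      ((measurePreserving_add_left volume y).setIntegral_image_emb
        (Homeomorph.addLeft y).measurableEmbedding (fun x => ev P x ^ 2) _).symm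
    rw [e]
    refine setIntegral_mono_set ?_ (Eventually.of_forall fun x => sq_nonneg _) ?_
    · exact ((continuous_ev P).pow 2).continuousOn.integrableOn_compact (isCompact_closedBall _ _)
    · refine LE.le.eventuallyLE ?_
      rintro _ ⟨x, hx, rfl⟩
      rw [mem_closedBall_zero_iff] at hx ⊢
      exact (norm_add_le _ _).trans (add_le_add (norm_S2 q).le hx)
  rw [integral_ball_ev_sq hP.1 (by positivity)] at h3
  have h4 : (1 + δ) ^ (2 * l + 3) ≤ Real.exp 3 := by
    calc (1 + δ) ^ (2 * l + 3) ≤ (Real.exp δ) ^ (2 * l + 3) := by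
          gcongr; rw [add_comm]; exact Real.add_one_le_exp δ
      _ = Real.exp ((2 * l + 3 : ℕ) * δ) := (Real.exp_nat_mul _ _).symm
      _ ≤ Real.exp 3 := by
          apply Real.exp_le_exp.2
          rw [hδdef, ← div_eq_mul_inv, div_le_iff₀ hl]
          push_cast; linarith [(Nat.cast_nonneg l : (0 : ℝ) ≤ l)]
  have hsip := sip_self_nonneg P
  have h5 : ev P y ^ 2 ≤ 3 * Real.exp 3 / sphereArea * (l + 1) ^ 2 * sip P P := by
    have h6 : δ ^ 3 / 3 * (sphereArea * ev P y ^ 2) ≤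
        Real.exp 3 / (2 * l + 3) * sip P P :=
      h2.trans (h3.trans (by gcongr))
    have h7 : Real.exp 3 / (2 * l + 3) * sip P P ≤ Real.exp 3 / (l + 1) * sip P P := by
      have hl0 : (0 : ℝ) ≤ l := Nat.cast_nonneg l
      refine mul_le_mul_of_nonneg_right ?_ hsip
      exact div_le_div_of_nonneg_left (Real.exp_pos 3).le hl (by linarith)
    have h8 := h6.trans h7
    have e1 : δ ^ 3 / 3 * (sphereArea * ev P y ^ 2) =
      (sphereArea / (3 * (l + 1) ^ 3)) * ev P y ^ 2 := by
      rw [hδdef]; field_simp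
    rw [e1] at h8
    have h9 := mul_le_mul_of_nonneg_left h8
      (show 0 ≤ 3 * ((l : ℝ) + 1) ^ 3 / sphereArea by positivity)
    have e2 : 3 * ((l : ℝ) + 1) ^ 3 / sphereArea * ((sphereArea / (3 * (l + 1) ^ 3)) * ev P y ^ 2)
      = ev P y ^ 2 := by field_simp
    rw [e2] at h9
    refine h9.trans (le_of_eq ?_)
    field_simp
  have h10 := Real.abs_le_sqrt h5
  rw [Real.sqrt_mul (by positivity), Real.sqrt_mul (by positivity), Real.sqrt_sq hl.le] at h10
  exact h10

/-- The divergence of P∇P is |∇P|², and its flux through the sphere of radius t is t^(2l+1) l ‖P‖².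
Differentiate at t = 1. -/
theorem sum_sip_pderiv {P : Poly} {l : ℕ} (hP : IsSolidHarmonic l P) :
    ∑ i, sip (pderiv i P) (pderiv i P) = (l * (2 * l + 1)) * sip P P := by
  rcases Nat.eq_zero_or_pos l with hl | hl
  · subst hl
    simp [isHomogeneous_pderiv_zero hP.1, sip]
  have hV : ∀ i : Fin 3, Smooth 1 (fun x => ev P x * ev (pderiv i P) x) := fun i =>
    (smooth_ev 1 _).mul' (smooth_ev 1 _)
  have h1 : (1 : ℝ) ∈ Icc (-1 : ℝ) 1 := by simp
  have hd := hasDerivWithinAt_flux one_pos hV h1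
  have hflux : ∀ t : ℝ, t ^ 2 * ∑ i, coef (fun x => ev P x * ev (pderiv i P) x) (X i) t =
      t ^ (2 * l + 1) * (l * sip P P) := by
    intro t
    have e : ∀ i, coef (fun x => ev P x * ev (pderiv i P) x) (X i) t =
        t ^ (2 * l - 1) * ∫ q : S2, ev P (q : E3) * ev (X i * pderiv i P) (q : E3) ∂area := by
      intro i
      unfold coef
      rw [← integral_const_mul]
      congr 1; ext q
      beta_reduce
      rw [ev_smul_point hP.1, ev_smul_point hP.1.pderiv, ev_mul, ev_X,
        show 2 * l - 1 = l + (l - 1) by omega, pow_add]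
      ring
    simp only [e]
    rw [← Finset.mul_sum, ← mul_assoc, ← pow_add, show 2 + (2 * l - 1) = 2 * l + 1 by omega,
      ← integral_finsetSum _ fun i _ => integrable_sip _ _]
    congr 1
    rw [sip, ← integral_const_mul]
    congr 1; ext q
    rw [← Finset.mul_sum, ← ev_sum, ← eulerP, eulerP_of_isHomogeneous hP.1, ev_mul, ev_C]
    ring
  have hd' := hd.congr (f₁ := fun t => t ^ (2 * l + 1) * (l * sip P P))
    (fun t _ => (hflux t).symm) (hflux 1).symm
  have hd2 : HasDerivWithinAt (fun t : ℝ => t ^ (2 * l + 1) * (l * sip P P))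
      (((2 * l + 1 : ℕ) : ℝ) * 1 ^ (2 * l + 1 - 1) * (l * sip P P)) (Icc (-1) 1) 1 :=
    ((hasDerivAt_pow (2 * l + 1) (1 : ℝ)).mul_const _).hasDerivWithinAt
  have heq := (uniqueDiffOn_Icc (show (-1 : ℝ) < 1 by norm_num) 1 h1).eq_deriv _ hd' hd2
  have hdiv : ∀ x ∈ ball 1, ∑ i, pd 1 i (fun x => ev P x * ev (pderiv i P) x) x =
      ∑ i, ev (pderiv i P) x * ev (pderiv i P) x := by
    intro x hx
    have : ∀ i, pd 1 i (fun x => ev P x * ev (pderiv i P) x) x =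
        ev P x * ev (pderiv i (pderiv i P)) x + ev (pderiv i P) x * ev (pderiv i P) x := fun i => by
      rw [pd_mul one_pos (smooth_ev 1 _) (smooth_ev 1 _) hx, pd_ev one_pos _ _ hx,
        pd_ev one_pos _ _ hx]
    simp only [this, Finset.sum_add_distrib]
    rw [← Finset.mul_sum, ← ev_sum, hP.2]; simp
  rw [coef_congr hdiv 1 h1, one_pow, one_mul] at heq
  have e3 : coef (fun x => ∑ i, ev (pderiv i P) x * ev (pderiv i P) x) 1 1 =
      ∑ i, sip (pderiv i P) (pderiv i P) := by
    unfold coef sip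
    rw [← integral_finsetSum _ fun i _ => integrable_sip _ _]
    simp
  rw [e3] at heq
  rw [heq]; push_cast; ring

theorem sip_pderiv_le {P : Poly} {l : ℕ} (hP : IsSolidHarmonic l P) (i : Fin 3) :
    √(sip (pderiv i P) (pderiv i P)) ≤ 2 * (l + 1) * √(sip P P) := by
  have h := sum_sip_pderiv hP
  have h1 : sip (pderiv i P) (pderiv i P) ≤ ∑ i, sip (pderiv i P) (pderiv i P) :=
    Finset.single_le_sum (f := fun i => sip (pderiv i P) (pderiv i P))
      (fun i _ => sip_self_nonneg _) (Finset.mem_univ i)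
  have h2 : sip (pderiv i P) (pderiv i P) ≤ (2 * (l + 1)) ^ 2 * sip P P := by
    rw [h] at h1
    refine h1.trans (mul_le_mul_of_nonneg_right ?_ (sip_self_nonneg P))
    have : (0 : ℝ) ≤ l := Nat.cast_nonneg l
    nlinarith
  calc _ ≤ √((2 * (l + 1)) ^ 2 * sip P P) := Real.sqrt_le_sqrt h2
    _ = _ := by rw [Real.sqrt_mul (by positivity), Real.sqrt_sq (by positivity)]

theorem integral_abs_ev_le (P : Poly) :
    ∫ q : S2, |ev P (q : E3)| ∂area ≤ √sphereArea * √(sip P P) := by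
  have h := sq_integral_le (continuous_ev_S2 P).abs
  simp only [sq_abs] at h
  rw [← Real.sqrt_mul sphereArea_pos.le]
  refine (le_abs_self _).trans (Real.abs_le_sqrt ?_)
  simpa only [sip, ← sq] using h

theorem abs_apply_S2_le (q : S2) (i : Fin 3) : |(q : E3) i| ≤ 1 :=
  (PiLp.norm_apply_le (q : E3) i).trans_eq (norm_S2 q)

theorem abs_coef_le {R r B : ℝ} {u : E3 → ℝ} (hr : r ∈ Icc (-R) R)
    (hB : ∀ x ∈ ball R, |u x| ≤ B) (P : Poly) :
    |coef u P r| ≤ B * (√sphereArea * √(sip P P)) := by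
  let e0 : S2 := ⟨basisVec 0, by simp [basisVec]⟩
  have hB0 : 0 ≤ B := (abs_nonneg _).trans (hB _ (smul_mem_ball hr e0))
  calc |coef u P r| ≤ ∫ q : S2, B * |ev P (q : E3)| ∂area := by
        rw [← Real.norm_eq_abs, coef]
        refine norm_integral_le_of_norm_le ((integrable_of_continuous_S2
          (continuous_ev_S2 P).abs).const_mul B) (Eventually.of_forall fun q => ?_)
        rw [norm_mul, Real.norm_eq_abs, Real.norm_eq_abs]
        exact mul_le_mul_of_nonneg_right (hB _ (smul_mem_ball hr q)) (abs_nonneg _)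
    _ = B * ∫ q : S2, |ev P (q : E3)| ∂area := integral_const_mul _ _
    _ ≤ _ := mul_le_mul_of_nonneg_left (integral_abs_ev_le P) hB0

/-! ### Rapid decay of the moments of a smooth function -/

/-- The spherical Laplacian `∑ L_k L_k`. -/
noncomputable def sphLap (R : ℝ) (u : E3 → ℝ) (x : E3) : ℝ := ∑ k, rotd R k (rotd R k u) x

section decay
variable {R : ℝ} (hR : 0 < R) {u : E3 → ℝ} (hu : Smooth R u)
include hR hu

theorem Smooth.sphLap : Smooth R (sphLap R u) := Smooth.sum' fun k _ => (hu.rotd hR k).rotd hR k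

theorem coef_sphLap {l : ℕ} {P : Poly} (hP : IsSolidHarmonic l P) {r : ℝ}
    (hr : r ∈ Icc (-R) R) :
    coef (RoundBall.sphLap R u) P r = -((l : ℝ) * (l + 1)) * coef u P r := by
  unfold RoundBall.sphLap
  rw [coef_sum (fun k _ => ((hu.rotd hR k).rotd hR k).continuousOn) P hr]
  have h : ∀ k, coef (RoundBall.rotd R k (RoundBall.rotd R k u)) P r =
      coef u (rotP k (rotP k P)) r :=
    fun k => by rw [coef_rotd hR (hu.rotd hR k) hr, coef_rotd hR hu hr, neg_neg]
  simp only [h]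
  rw [← coef_sum_right hu.continuousOn _ hr, hP.rotP_rotP, MvPolynomial.C_mul', coef_smul_right]

theorem Smooth.sphLap_iterate (n : ℕ) : Smooth R ((RoundBall.sphLap R)^[n] u) := by
  induction n with
  | zero => exact hu
  | succ n ih => rw [Function.iterate_succ_apply']; exact ih.sphLap hR

theorem coef_sphLap_iterate (n : ℕ) {l : ℕ} {P : Poly} (hP : IsSolidHarmonic l P) {r : ℝ}
    (hr : r ∈ Icc (-R) R) :
    coef ((RoundBall.sphLap R)^[n] u) P r = (-((l : ℝ) * (l + 1))) ^ n * coef u P r := by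
  induction n with
  | zero => simp
  | succ n ih =>
    rw [Function.iterate_succ_apply', coef_sphLap hR (hu.sphLap_iterate hR n) hP hr, ih]; ring

/-- Applying the spherical Laplacian n times multiplies the moment by (-l(l+1))^n, while the result
is bounded by the supremum of a fixed smooth function. The crude bound l(l+1) ≥ (l+1)/2 suffices
since n is arbitrary; it fails for l = 0, which therefore enters only with n = 0. -/
theorem exists_decay_of_pos (n : ℕ) : ∃ A, 0 ≤ A ∧ ∀ (l : ℕ) (P : Poly), 1 ≤ l ∨ n = 0 →
    IsSolidHarmonic l P → sip P P = 1 → ∀ r ∈ Icc (-R) R, |coef u P r| ≤ A / (l + 1) ^ n ∧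
      |∑ i, coef (RoundBall.pd R i u) (X i * P) r| ≤ A / (l + 1) ^ n := by
  set w := (RoundBall.sphLap R)^[n] u with hwdef
  have hw : Smooth R w := hu.sphLap_iterate hR n
  obtain ⟨B, hB0, hB⟩ := exists_bound hw
  choose D hD0 hD using fun i => exists_bound (hw.pd hR i)
  refine ⟨2 ^ n * ((B + ∑ i, D i) * √sphereArea), by
    have := Finset.sum_nonneg fun i (_ : i ∈ Finset.univ) => hD0 i
    positivity, fun l P hl hP hP1 r hr => ?_⟩
  have hDs : 0 ≤ ∑ i, D i := Finset.sum_nonneg fun i _ => hD0 i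
  have hpow : (((l : ℝ) + 1) / 2) ^ n ≤ ((l : ℝ) * (l + 1)) ^ n := by
    rcases hl with hl | rfl
    · have : (1 : ℝ) ≤ l := by exact_mod_cast hl
      refine pow_le_pow_left₀ (by positivity) ?_ n
      nlinarith
    · simp
  have hdiv : ∀ x y : ℝ, (-((l : ℝ) * (l + 1))) ^ n * x = y → |y| ≤ (B + ∑ i, D i) * √sphereArea →
      |x| ≤ 2 ^ n * ((B + ∑ i, D i) * √sphereArea) / (l + 1) ^ n := by
    intro x y hxy hy
    rw [← hxy, abs_mul, abs_pow, abs_neg, abs_of_nonneg (by positivity)] at hy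
    have h1 : (((l : ℝ) + 1) / 2) ^ n * |x| ≤ (B + ∑ i, D i) * √sphereArea :=
      (mul_le_mul_of_nonneg_right hpow (abs_nonneg _)).trans hy
    rw [le_div_iff₀ (by positivity)]
    rw [div_pow, div_mul_eq_mul_div, div_le_iff₀ (by positivity)] at h1
    linarith
  have hE := fun t (ht : t ∈ Icc (-R) R) => coef_sphLap_iterate hR hu n hP ht
  refine ⟨hdiv _ _ (hE r hr).symm ?_, hdiv _ _ (?_ : _ = ∑ i, coef (RoundBall.pd R i w) (X i * P) r) ?_⟩
  · refine (abs_coef_le hr hB P).trans ?_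
    rw [hP1, Real.sqrt_one, mul_one]
    gcongr
    linarith
  · have d1 := hasDerivWithinAt_coef hR hw hr P
    have d2 := (hasDerivWithinAt_coef hR hu hr P).const_mul ((-((l : ℝ) * (l + 1))) ^ n)
    have d3 := d1.congr (fun t ht => (hE t ht).symm) (hE r hr).symm
    exact (uniqueDiffOn_Icc (show -R < R by linarith) r hr).eq_deriv _ d2 d3
  · have hb : ∀ i, |coef (RoundBall.pd R i w) (X i * P) r| ≤ D i * √sphereArea := by
      intro i
      refine (abs_coef_le hr (hD i) _).trans ?_
      have : sip (X i * P) (X i * P) ≤ 1 := by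
        rw [← hP1]
        refine integral_mono (integrable_sip _ _) (integrable_sip _ _) fun q => ?_
        have hqi : (q : E3) i ^ 2 ≤ 1 := (sq_le_one_iff_abs_le_one _).2 (abs_apply_S2_le q i)
        simp only [ev_mul, ev_X]
        nlinarith [mul_self_nonneg (ev P (q : E3))]
      have h1 : √(sip (X i * P) (X i * P)) ≤ 1 := by
        rw [Real.sqrt_le_left (by norm_num)]; simpa using this
      have := Real.sqrt_nonneg sphereArea
      have h2 := hD0 i
      calc D i * (√sphereArea * √(sip (X i * P) (X i * P))) ≤ D i * (√sphereArea * 1) := by gcongr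
        _ = _ := by ring
    calc _ ≤ ∑ i, |coef (RoundBall.pd R i w) (X i * P) r| := Finset.abs_sum_le_sum_abs _ _
      _ ≤ ∑ i, D i * √sphereArea := Finset.sum_le_sum fun i _ => hb i
      _ = (∑ i, D i) * √sphereArea := (Finset.sum_mul _ _ _).symm
      _ ≤ _ := by gcongr; linarith

omit hR hu in
theorem coef_zero_of_pos {l : ℕ} (hl : 1 ≤ l) {P : Poly} (hP : IsSolidHarmonic l P) :
    coef u P 0 = 0 := by
  have h1 : IsSolidHarmonic 0 (1 : Poly) :=
    ⟨MvPolynomial.isHomogeneous_one _ _, by simp⟩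
  have h2 := sip_eq_zero_of_ne (show 0 ≠ l by omega) h1 hP
  have : coef u P 0 = u 0 * sip 1 P := by
    unfold coef sip
    rw [← integral_const_mul]
    congr 1; ext q; simp
  rw [this, h2, mul_zero]

/-- Rapid decay of the spherical harmonic coefficients of a function that is smooth up to the
boundary of the ball, together with their radial derivatives. -/
theorem exists_decay (n : ℕ) : ∃ A, 0 ≤ A ∧ ∀ (l : ℕ) (P : Poly), IsSolidHarmonic l P →
    sip P P = 1 → ∀ r ∈ Icc 0 R, |coef u P r| ≤ A / (l + 1) ^ n ∧
      |∑ i, coef (RoundBall.pd R i u) (X i * P) r| ≤ A / (l + 1) ^ n ∧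
      (1 ≤ l → |coef u P r| ≤ A / (l + 1) ^ n * r) := by
  obtain ⟨A, hA0, hA⟩ := exists_decay_of_pos hR hu n
  -- Degree zero is covered by the exponent 0, because (l+1)^n = 1 there.
  obtain ⟨B, hB0, hB⟩ := exists_decay_of_pos hR hu 0
  have hsub : Icc 0 R ⊆ Icc (-R) R := Icc_subset_Icc_left (by linarith)
  refine ⟨A + B, by positivity, fun l P hP hP1 r hr => ?_⟩
  have hpos : (0 : ℝ) < (l + 1) ^ n := by positivity
  rcases Nat.eq_zero_or_pos l with hl | hl
  · subst hl
    have h := hB 0 P (Or.inr rfl) hP hP1 r (hsub hr)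
    simp only [pow_zero, div_one, CharP.cast_eq_zero, zero_add, one_pow] at h ⊢
    exact ⟨by linarith [h.1], by linarith [h.2], fun h => absurd h (by norm_num)⟩
  · have hle : A / ((l : ℝ) + 1) ^ n ≤ (A + B) / (l + 1) ^ n := by gcongr; linarith
    refine ⟨((hA l P (Or.inl hl) hP hP1 r (hsub hr)).1).trans hle,
      ((hA l P (Or.inl hl) hP hP1 r (hsub hr)).2).trans hle, fun _ => ?_⟩
    -- For l ≥ 1 the moment vanishes at the centre, so the bound on the radial derivative yields a
    -- factor r. It will control f(r)/r in the tangential part of a gradient mode.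
    have h := (convex_Icc (-R) R).norm_image_sub_le_of_norm_hasDerivWithin_le
      (f := coef u P) (fun t ht => hasDerivWithinAt_coef hR hu ht P)
      (fun t ht => (hA l P (Or.inl hl) hP hP1 t ht).2) (hsub ⟨le_refl 0, hR.le⟩) (hsub hr)
    rw [coef_zero_of_pos hl hP, sub_zero, sub_zero, Real.norm_eq_abs, Real.norm_eq_abs,
      abs_of_nonneg hr.1] at h
    exact h.trans (mul_le_mul_of_nonneg_right hle hr.1)

end decay

end RoundBall

namespace RoundBall
open MvPolynomial (X C pderiv)

/-! ### Integrals along rays -/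

theorem ray_mem_ball {R : ℝ} {x : E3} (hx : x ∈ ball R) {s : ℝ} (hs : s ∈ Icc (0 : ℝ) 1) :
    s • x ∈ ball R := by
  rw [mem_closedBall_zero_iff] at hx ⊢
  rw [norm_smul, Real.norm_of_nonneg hs.1]
  nlinarith [hs.2, norm_nonneg x, hs.1]

/-- `∫₀¹ s^k u(s x) ds`. -/
noncomputable def rayInt (k : ℕ) (u : E3 → ℝ) (x : E3) : ℝ :=
  ∫ s : unitInterval, (s : ℝ) ^ k * u ((s : ℝ) • x)

theorem rayInt_eq_intervalIntegral (k : ℕ) (u : E3 → ℝ) (x : E3) :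
    rayInt k u x = ∫ s in (0 : ℝ)..1, s ^ k * u (s • x) := by
  rw [rayInt, intervalIntegral.integral_of_le zero_le_one, ← integral_Icc_eq_integral_Ioc]
  exact integral_subtype_comap measurableSet_Icc fun s : ℝ => s ^ k * u (s • x)

section ray
variable {R : ℝ} (hR : 0 < R) {u : E3 → ℝ}

theorem continuous_ray {F : Type*} [TopologicalSpace F] {u : E3 → F}
    (hu : ContinuousOn u (ball R)) {x : E3} (hx : x ∈ ball R) :
    Continuous fun s : unitInterval => u ((s : ℝ) • x) :=
  hu.comp_continuous (by fun_prop) fun s => ray_mem_ball hx s.2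

theorem integrable_unitInterval {f : unitInterval → ℝ} (hf : Continuous f) : Integrable f :=
  hf.integrable_of_hasCompactSupport (HasCompactSupport.of_compactSpace _)

theorem integrable_ray (hu : ContinuousOn u (ball R)) (k : ℕ) {x : E3} (hx : x ∈ ball R) :
    Integrable fun s : unitInterval => (s : ℝ) ^ k * u ((s : ℝ) • x) :=
  integrable_unitInterval (Continuous.mul (by fun_prop) (continuous_ray hu hx))

include hR

theorem hasFDerivWithinAt_rayInt (hu : Smooth R u) (k : ℕ) {x : E3} (hx : x ∈ ball R) :
    HasFDerivWithinAt (rayInt k u)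
      (∫ s : unitInterval, (s : ℝ) ^ (k + 1) • fderivWithin ℝ u (ball R) ((s : ℝ) • x))
      (ball R) x := by
  obtain ⟨B, hB⟩ := (isCompact_closedBall (0 : E3) R).exists_bound_of_continuousOn
    (hu.fderivWithin hR).continuousOn
  refine hasFDerivWithinAt_integral (μ := (volume : Measure unitInterval)) (convex_closedBall _ _)
    (φ := fun (y : E3) (s : unitInterval) => (s : ℝ) ^ k * u ((s : ℝ) • y))
    (φ' := fun y s => (s : ℝ) ^ (k + 1) • fderivWithin ℝ u (ball R) ((s : ℝ) • y))
    (bound := fun _ => B) hx (fun y hy => integrable_ray hu.continuousOn k hy) ?_ ?_ ?_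
    (integrable_const _)
  · exact (Continuous.smul (f := fun s : unitInterval => (s : ℝ) ^ (k + 1)) (by fun_prop)
      (continuous_ray (hu.fderivWithin hR).continuousOn hx)).aestronglyMeasurable
  · intro s y hy
    have hm : MapsTo (fun y : E3 => (s : ℝ) • y) (ball R) (ball R) := fun z hz =>
      ray_mem_ball hz s.2
    have h := ((hu.differentiableWithinAt (hm hy)).hasFDerivWithinAt.comp (g := u) y
      ((hasFDerivAt_id y).const_smul (s : ℝ)).hasFDerivWithinAt hm).const_mul ((s : ℝ) ^ k)
    refine h.congr_fderiv ?_
    ext v; simp; ring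
  · intro s y hy
    rw [norm_smul, norm_pow, Real.norm_of_nonneg s.2.1]
    have h1 : (s : ℝ) ^ (k + 1) ≤ 1 := pow_le_one₀ s.2.1 s.2.2
    have h2 := hB _ (ray_mem_ball hy s.2)
    calc _ ≤ 1 * B := mul_le_mul h1 h2 (norm_nonneg _) zero_le_one
      _ = B := one_mul B

theorem pd_rayInt (hu : Smooth R u) (k : ℕ) {x : E3} (hx : x ∈ ball R) (i : Fin 3) :
    pd R i (rayInt k u) x = rayInt (k + 1) (pd R i u) x := by
  have hi : Integrable (fun s : unitInterval =>
      (s : ℝ) ^ (k + 1) • fderivWithin ℝ u (ball R) ((s : ℝ) • x)) :=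
    (Continuous.smul (f := fun s : unitInterval => (s : ℝ) ^ (k + 1)) (by fun_prop) (continuous_ray
      (hu.fderivWithin hR).continuousOn hx)).integrable_of_hasCompactSupport
      (HasCompactSupport.of_compactSpace _)
  rw [pd_of_hasFDerivWithinAt hR hx i (hasFDerivWithinAt_rayInt hR hu k hx),
    ContinuousLinearMap.integral_apply hi]
  rfl

theorem Smooth.rayInt (hu : Smooth R u) (k : ℕ) : Smooth R (rayInt k u) := by
  refine smooth_of_closed_under_pd hR {w | ∃ k v, Smooth R v ∧ w = RoundBall.rayInt k v} ?_ ?_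
    ⟨k, u, hu, rfl⟩
  · rintro _ ⟨k, v, hv, rfl⟩ x hx
    exact (hasFDerivWithinAt_rayInt hR hv k hx).differentiableWithinAt
  · rintro _ ⟨k, v, hv, rfl⟩ i
    exact ⟨_, ⟨k + 1, _, hv.pd hR i, rfl⟩, fun x hx => pd_rayInt hR hv k hx i⟩

omit hR in
theorem hasDerivWithinAt_ray (hu : Smooth R u) {x : E3} (hx : x ∈ ball R) {s : ℝ}
    (hs : s ∈ Icc (0 : ℝ) 1) :
    HasDerivWithinAt (fun s : ℝ => u (s • x)) (∑ j, x j * pd R j u (s • x)) (Icc 0 1) s := by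
  have h := (hu.differentiableWithinAt (ray_mem_ball hx hs)).hasFDerivWithinAt
  have h2 := h.comp_hasDerivWithinAt (f := fun t : ℝ => t • x) s
    ((hasDerivAt_id s).smul_const x).hasDerivWithinAt (fun t ht => ray_mem_ball hx ht)
  refine h2.congr_deriv ?_
  rw [one_smul, fderivWithin_eq_sum_pd]

theorem continuousOn_ray_deriv (hu : Smooth R u) {x : E3} (hx : x ∈ ball R) :
    ContinuousOn (fun s : ℝ => ∑ j, x j * pd R j u (s • x)) (Icc 0 1) :=
  continuousOn_finsetSum _ fun j _ => ContinuousOn.mul continuousOn_const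
    ((hu.pd hR j).continuousOn.comp (by fun_prop) fun s hs => ray_mem_ball hx hs)

theorem sum_mul_rayInt_zero (hu : Smooth R u) {x : E3} (hx : x ∈ ball R) :
    ∑ j, x j * rayInt 0 (pd R j u) x = u x - u 0 := by
  have h := intervalIntegral.integral_eq_sub_of_hasDerivAt_of_le zero_le_one
    (f := fun s : ℝ => u (s • x)) (f' := fun s => ∑ j, x j * pd R j u (s • x))
    (fun s hs => (hasDerivWithinAt_ray hu hx hs).continuousWithinAt)
    (fun s hs => (hasDerivWithinAt_ray hu hx ⟨hs.1.le, hs.2.le⟩).hasDerivAt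
      (Icc_mem_nhds hs.1 hs.2))
    ((continuousOn_ray_deriv hR hu hx).intervalIntegrable_of_Icc zero_le_one)
  rw [one_smul, zero_smul] at h
  rw [← h, intervalIntegral.integral_finsetSum]
  · refine Finset.sum_congr rfl fun j _ => ?_
    rw [intervalIntegral.integral_const_mul, rayInt_eq_intervalIntegral]
    simp
  · intro j _
    refine ContinuousOn.intervalIntegrable_of_Icc zero_le_one (ContinuousOn.mul continuousOn_const ?_)
    exact (hu.pd hR j).continuousOn.comp (by fun_prop) fun s hs => ray_mem_ball hx hs

/-- This is the fundamental theorem of calculus for s ↦ s u(sx). It says that 1 + x·∇ inverts u ↦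
∫₀¹ u(sx) ds, which is used both in the Poincaré lemma and to solve for the potential A. -/
theorem rayInt_add_sum_mul_rayInt (hu : Smooth R u) {x : E3} (hx : x ∈ ball R) :
    rayInt 0 u x + ∑ j, x j * rayInt 1 (pd R j u) x = u x := by
  have hc1 : ContinuousOn (fun s : ℝ => u (s • x)) (Icc 0 1) :=
    hu.continuousOn.comp (by fun_prop) fun s hs => ray_mem_ball hx hs
  have hc2 : ∀ j, ContinuousOn (fun s : ℝ => pd R j u (s • x)) (Icc 0 1) := fun j =>
    (hu.pd hR j).continuousOn.comp (by fun_prop) fun s hs => ray_mem_ball hx hs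
  have h := intervalIntegral.integral_eq_sub_of_hasDerivAt_of_le zero_le_one
    (f := fun s : ℝ => s * u (s • x))
    (f' := fun s => 1 * u (s • x) + s * ∑ j, x j * pd R j u (s • x))
    (continuousOn_id.mul hc1)
    (fun s hs => (hasDerivAt_id s).mul ((hasDerivWithinAt_ray hu hx
      ⟨hs.1.le, hs.2.le⟩).hasDerivAt (Icc_mem_nhds hs.1 hs.2)))
    (((continuousOn_const.mul hc1).add (continuousOn_id.mul
      (continuousOn_ray_deriv hR hu hx))).intervalIntegrable_of_Icc zero_le_one)
  simp only [one_smul, one_mul, zero_mul, sub_zero, Finset.mul_sum] at h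
  rw [← h, intervalIntegral.integral_add (hc1.intervalIntegrable_of_Icc zero_le_one),
    intervalIntegral.integral_finsetSum]
  · congr 1
    · rw [rayInt_eq_intervalIntegral]; simp
    · refine Finset.sum_congr rfl fun j _ => ?_
      rw [rayInt_eq_intervalIntegral, ← intervalIntegral.integral_const_mul]
      congr 1; ext s; ring
  · exact fun j _ => (continuousOn_id.mul (continuousOn_const.mul
      (hc2 j))).intervalIntegrable_of_Icc zero_le_one
  · exact (continuousOn_finsetSum _ fun j _ => continuousOn_id.mul (continuousOn_const.mul
      (hc2 j))).intervalIntegrable_of_Icc zero_le_one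

end ray

/-! ### The projections of a smooth function to spherical harmonics are smooth -/

open scoped Pointwise in
theorem measurePreserving_neg_S2 : MeasurePreserving (fun q : S2 => -q) area area := by
  refine ⟨by fun_prop, ?_⟩
  ext s hs
  have hm : Measurable fun q : S2 => -q := by fun_prop
  rw [Measure.map_apply hm hs, Measure.toSphere_apply' _ (hm hs), Measure.toSphere_apply' _ hs,
    ← Measure.measure_neg _ (Ioo (0 : ℝ) 1 • ((↑) '' s : Set E3))]
  congr 2
  ext x
  simp only [Set.mem_neg, Set.mem_smul, mem_image, mem_preimage]
  constructor
  · rintro ⟨t, ht, _, ⟨q, hq, rfl⟩, rfl⟩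
    exact ⟨t, ht, _, ⟨-q, hq, rfl⟩, by simp⟩
  · rintro ⟨t, ht, _, ⟨q, hq, rfl⟩, h⟩
    refine ⟨t, ht, _, ⟨-q, by simpa using hq, rfl⟩, ?_⟩
    rw [← neg_neg x, ← h]; simp

theorem coef_neg_arg {P : Poly} {l : ℕ} (hP : P.IsHomogeneous l) (u : E3 → ℝ) (r : ℝ) :
    coef u P (-r) = (-1) ^ l * coef u P r := by
  have h := measurePreserving_neg_S2.integral_comp
    (Homeomorph.neg S2).measurableEmbedding
    (fun q : S2 => u (r • (q : E3)) * ev P (q : E3))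
  unfold coef
  rw [← h, ← integral_const_mul]
  congr 1; ext q
  have e : ev P (-(q : E3)) = (-1) ^ l * ev P (q : E3) := by
    rw [← neg_one_smul ℝ (q : E3), ev_smul_point hP]
  have e2 : ((-1 : ℝ) ^ l) * (-1) ^ l = 1 := by rw [← mul_pow]; simp
  rw [show ((-q : S2) : E3) = -(q : E3) from rfl, e, smul_neg, neg_smul]
  linear_combination (-(u (-(r • (q : E3))) * ev P (q : E3))) * e2

/-- The projection of `x_i P` to the solid harmonics of degree one higher. -/
noncomputable def raiseP (l : ℕ) (i : Fin 3) (P : Poly) : Poly :=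
  X i * P - (2 * (l : ℝ) + 1)⁻¹ • (rsq * pderiv i P)

/-- The coefficient comes from Δ(x_i P) = 2 ∂_i P and Δ(|x|² ∂_i P) = 2(2l+1) ∂_i P. -/
theorem IsSolidHarmonic.raiseP {l : ℕ} (hl : 1 ≤ l) {P : Poly} (hP : IsSolidHarmonic l P)
    (i : Fin 3) : IsSolidHarmonic (l + 1) (raiseP l i P) := by
  rw [isSolidHarmonic_iff]
  constructor
  · refine MvPolynomial.IsHomogeneous.sub ?_ ?_
    · rw [add_comm]; exact (MvPolynomial.isHomogeneous_X ℝ i).mul hP.1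
    · have := isHomogeneous_rsq.mul (hP.1.pderiv (i := i))
      rw [show 2 + (l - 1) = l + 1 by omega] at this
      exact (homPoly (l + 1)).smul_mem _ this
  · have h1 : lapP (X i * P) = 2 * MvPolynomial.pderiv i P := by
      have h3 := hP.2
      rw [lapP_apply]
      simp only [Fin.sum_univ_three, MvPolynomial.pderiv_mul, map_add, MvPolynomial.pderiv_X] at h3 ⊢
      fin_cases i <;> simp <;> linear_combination X _ * h3
    have h2 : lapP (MvPolynomial.pderiv i P) = 0 := (isSolidHarmonic_iff.1 (hP.pderiv i)).2
    have h4 : ((l - 1 : ℕ) : ℝ) = l - 1 := by push_cast [hl]; ring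
    have h5 : lapP (rsq * MvPolynomial.pderiv i P) =
        (2 * (2 * (l : ℝ) + 1)) • MvPolynomial.pderiv i P := by
      rw [lapP_rsq_mul, h2, eulerP_of_isHomogeneous hP.1.pderiv, h4, MvPolynomial.smul_eq_C_mul]
      simp only [map_mul, map_add, map_sub, map_one, map_ofNat]
      ring
    have hne : (2 * (l : ℝ) + 1) ≠ 0 := by positivity
    rw [RoundBall.raiseP, map_sub, map_smul, h1, h5, smul_smul,
      show (2 * (l : ℝ) + 1)⁻¹ * (2 * (2 * (l : ℝ) + 1)) = 2 by field_simp,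
      MvPolynomial.smul_eq_C_mul, show (C (2 : ℝ) : Poly) = 2 from map_ofNat C 2, sub_self]

/-! ### Powers of r dividing the moments, and smooth even functions of |x|. -/

section factor
variable {R : ℝ} (hR : 0 < R) {u : E3 → ℝ}
include hR

omit hR in
theorem sum_rotd_mul_rotP {l : ℕ} {P : Poly} (hP : P.IsHomogeneous l) (r : ℝ) (q : S2) :
    ∑ k, rotd R k u (r • (q : E3)) * ev (rotP k P) (q : E3) =
      r * ∑ i, pd R i u (r • (q : E3)) *
        (ev (pderiv i P) (q : E3) - l * ((q : E3) i * ev P (q : E3))) := by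
  have h := congrArg (fun P => ev P (q : E3)) (eulerP_of_isHomogeneous hP)
  have hq := sum_sq_S2 q
  simp only [eulerP, Fin.sum_univ_three, ev_add, ev_mul, ev_X, ev_C] at h
  simp only [Fin.sum_univ_three, rotd, rotP, ev_sub, ev_mul, ev_X, PiLp.smul_apply, smul_eq_mul]
  simp only [Fin.isValue, zero_add, Fin.reduceAdd]
  generalize pd R 0 u (r • (q : E3)) = a0
  generalize pd R 1 u (r • (q : E3)) = a1
  generalize pd R 2 u (r • (q : E3)) = a2
  generalize ev (pderiv 0 P) (q : E3) = b0 at *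
  generalize ev (pderiv 1 P) (q : E3) = b1 at *
  generalize ev (pderiv 2 P) (q : E3) = b2 at *
  linear_combination (r * (a0 * b0 + a1 * b1 + a2 * b2)) * hq
    - (r * ((q : E3) 0 * a0 + (q : E3) 1 * a1 + (q : E3) 2 * a2)) * h

/-- The moment times l(l+1) is the integral of (x × ∇u)·(q × ∇P) with x = rq, which exhibits one
factor r. What multiplies ∂_i u is ∂_i P - l x_i P, and on the sphere this splits into harmonics of
degrees l - 1 and l + 1, so the step can be repeated. -/
theorem coef_eq_mul_sum (hu : Smooth R u) {l : ℕ} (hl : 1 ≤ l) {P : Poly}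
    (hP : IsSolidHarmonic l P) {r : ℝ} (hr : r ∈ Icc (-R) R) :
    coef u P r = r * (((l : ℝ) * (l + 1))⁻¹ * ∑ i,
      ((1 - l / (2 * l + 1)) * coef (pd R i u) (pderiv i P) r
        - l * coef (pd R i u) (raiseP l i P) r)) := by
  have h1 : ((l : ℝ) * (l + 1)) * coef u P r = ∑ k, coef (rotd R k u) (rotP k P) r := by
    have h : ∀ k, coef (rotd R k u) (rotP k P) r = - coef u (rotP k (rotP k P)) r :=
      fun k => coef_rotd hR hu hr _ _
    simp only [h, Finset.sum_neg_distrib]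
    rw [← coef_sum_right hu.continuousOn _ hr, hP.rotP_rotP, MvPolynomial.C_mul', coef_smul_right]
    ring
  have h2 : ∑ k, coef (rotd R k u) (rotP k P) r = r * ∑ i,
      ((1 - l / (2 * l + 1)) * coef (pd R i u) (pderiv i P) r
        - l * coef (pd R i u) (raiseP l i P) r) := by
    have hi : ∀ i Q, Integrable (fun q : S2 => pd R i u (r • (q : E3)) * ev Q (q : E3)) area :=
      fun i Q => integrable_coef (hu.pd hR i).continuousOn Q hr
    unfold coef
    rw [← integral_finsetSum _ fun k _ => integrable_coef (hu.rotd hR k).continuousOn _ hr]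
    simp only [← integral_const_mul]
    have e : ∀ i, (∫ q : S2, (1 - (l : ℝ) / (2 * l + 1)) *
        (pd R i u (r • (q : E3)) * ev (pderiv i P) (q : E3)) ∂area
        - ∫ q : S2, (l : ℝ) * (pd R i u (r • (q : E3)) * ev (raiseP l i P) (q : E3)) ∂area) =
        ∫ q : S2, ((1 - (l : ℝ) / (2 * l + 1)) *
        (pd R i u (r • (q : E3)) * ev (pderiv i P) (q : E3))
        - (l : ℝ) * (pd R i u (r • (q : E3)) * ev (raiseP l i P) (q : E3))) ∂area := fun i =>
      (integral_sub ((hi i _).const_mul _) ((hi i _).const_mul _)).symm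
    simp only [e]
    rw [← integral_finsetSum (f := fun i (q : S2) => (1 - (l : ℝ) / (2 * l + 1)) *
        (pd R i u (r • (q : E3)) * ev (pderiv i P) (q : E3))
        - (l : ℝ) * (pd R i u (r • (q : E3)) * ev (raiseP l i P) (q : E3))) _
        fun i _ => ((hi i _).const_mul _).sub ((hi i _).const_mul _),
      ← integral_const_mul]
    congr 1; ext q
    rw [sum_rotd_mul_rotP hP.1]
    congr 1
    refine Finset.sum_congr rfl fun i _ => ?_
    simp only [raiseP, ev_sub, ev_smul, ev_mul, ev_X, ev_rsq_S2]
    have hne : (2 * (l : ℝ) + 1) ≠ 0 := by positivity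
    field_simp
    ring
  have hpos : (0 : ℝ) < l * (l + 1) := by
    have : (1 : ℝ) ≤ l := by exact_mod_cast hl
    nlinarith
  rw [h2] at h1
  rw [mul_left_comm, ← h1, inv_mul_cancel_left₀ hpos.ne']

/-- Each use of `coef_eq_mul_sum` extracts one factor r and changes the degree by one at most, so
the degrees remain large enough for the remaining factors. -/
theorem exists_coef_eq_pow_mul (k : ℕ) : ∀ (u : E3 → ℝ), Smooth R u → ∀ (l : ℕ) (P : Poly),
    k ≤ l → IsSolidHarmonic l P → ∃ g : ℝ → ℝ, ContDiffOn ℝ ∞ g (Icc (-R) R) ∧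
      ∀ t ∈ Icc (-R) R, coef u P t = t ^ k * g t := by
  induction k with
  | zero => exact fun u hu l P _ _ => ⟨coef u P, contDiffOn_coef hR hu P, fun t _ => by simp⟩
  | succ k ih =>
    intro u hu l P hk hP
    have hl : 1 ≤ l := by omega
    choose g hg hg' using fun i => ih (pd R i u) (hu.pd hR i) (l - 1) (pderiv i P) (by omega)
      (hP.pderiv i)
    choose h hh hh' using fun i => ih (pd R i u) (hu.pd hR i) (l + 1) (raiseP l i P) (by omega)
      (hP.raiseP hl i)
    refine ⟨fun t => ((l : ℝ) * (l + 1))⁻¹ * ∑ i,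
      ((1 - (l : ℝ) / (2 * l + 1)) * g i t - l * h i t), ?_, fun t ht => ?_⟩
    · exact contDiffOn_const.mul (ContDiffOn.sum fun i _ =>
        (contDiffOn_const.mul (hg i)).sub (contDiffOn_const.mul (hh i)))
    · rw [coef_eq_mul_sum hR hu hl hP ht]
      simp only [hg' _ t ht, hh' _ t ht, Fin.sum_univ_three]
      ring

/-- For even g one has g'(t) = t h(t) with h again smooth and even, and the gradient of g(|x|) is
h(|x|) x. Induct on the order of differentiability. -/
theorem smooth_even_norm (g : ℝ → ℝ) (hg : ContDiffOn ℝ ∞ g (Icc (-R) R))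
    (heven : ∀ t ∈ Icc (-R) R, g (-t) = g t) : Smooth R fun x => g ‖x‖ := by
  have huniq := uniqueDiffOn_Icc (show -R < R by linarith)
  have hneg : ∀ t ∈ Icc (-R) R, -t ∈ Icc (-R) R := fun t ht => ⟨by linarith [ht.2], by linarith [ht.1]⟩
  have hnorm : ∀ x ∈ ball R, ‖x‖ ∈ Icc (-R) R := fun x hx => by
    rw [mem_closedBall_zero_iff] at hx
    exact ⟨by linarith [norm_nonneg x], hx⟩
  have h0mem : (0 : ℝ) ∈ Icc (-R) R := ⟨by linarith, hR.le⟩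
  have step : ∀ g : ℝ → ℝ, ContDiffOn ℝ ∞ g (Icc (-R) R) → (∀ t ∈ Icc (-R) R, g (-t) = g t) →
      ∃ h : ℝ → ℝ, ContDiffOn ℝ ∞ h (Icc (-R) R) ∧ (∀ t ∈ Icc (-R) R, h (-t) = h t) ∧
        ∀ t ∈ Icc (-R) R, HasDerivWithinAt g (t * h t) (Icc (-R) R) t := by
    intro g hg heven
    have hd : ∀ t ∈ Icc (-R) R, HasDerivWithinAt g (derivWithin g (Icc (-R) R) t) (Icc (-R) R) t :=
      fun t ht => (hg.differentiableOn (by simp) t ht).hasDerivWithinAt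
    have hodd : ∀ t ∈ Icc (-R) R, derivWithin g (Icc (-R) R) (-t) =
        -derivWithin g (Icc (-R) R) t := by
      intro t ht
      have h1 := (hd (-t) (hneg t ht)).comp t ((hasDerivAt_neg t).hasDerivWithinAt) hneg
      have h2 := h1.congr (f₁ := g) (fun s hs => (heven s hs).symm) (heven t ht).symm
      have := (huniq t ht).eq_deriv _ h2 (hd t ht)
      linarith
    -- Hadamard's quotient g'(t)/t is taken from the ray integral on the ball, by viewing g' as a
    -- function of the first coordinate.
    let u : E3 → ℝ := fun x => derivWithin g (Icc (-R) R) (x 0)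
    have hco : ∀ x ∈ ball R, x 0 ∈ Icc (-R) R := fun x hx => by
      rw [mem_closedBall_zero_iff] at hx
      exact abs_le.1 ((PiLp.norm_apply_le x 0).trans hx)
    have hu : Smooth R u :=
      (hg.derivWithin huniq (m := ∞) (by simp)).comp (Smooth.coord 0) hco
    have hmem : ∀ t ∈ Icc (-R) R, t • basisVec 0 ∈ ball R := fun t ht => by
      rw [mem_closedBall_zero_iff, norm_smul, Real.norm_eq_abs]
      simpa [basisVec] using abs_le.2 ht
    let h : ℝ → ℝ := fun t => rayInt 0 (pd R 0 u) (t • basisVec 0)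
    have hmul : ∀ t ∈ Icc (-R) R, t * h t = derivWithin g (Icc (-R) R) t := by
      intro t ht
      have h1 := sum_mul_rayInt_zero hR hu (hmem t ht)
      have h2 := hodd 0 h0mem
      rw [neg_zero] at h2
      simp only [Fin.sum_univ_three, u, PiLp.smul_apply, basisVec_apply, smul_eq_mul,
        PiLp.zero_apply] at h1
      simp at h1
      linarith
    refine ⟨h, ?_, fun t ht => ?_, fun t ht => ?_⟩
    · exact ((hu.pd hR 0).rayInt hR 0).comp
        (contDiff_id.smul contDiff_const).contDiffOn hmem
    · rcases eq_or_ne t 0 with rfl | ht0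
      · rw [neg_zero]
      · have h1 := hmul (-t) (hneg t ht)
        rw [hodd t ht, ← hmul t ht] at h1
        have : t * h (-t) = t * h t := by linarith
        exact mul_left_cancel₀ ht0 this
    · rw [hmul t ht]; exact hd t ht
  have key : ∀ n : ℕ, ∀ g : ℝ → ℝ, ContDiffOn ℝ ∞ g (Icc (-R) R) →
      (∀ t ∈ Icc (-R) R, g (-t) = g t) → ContDiffOn ℝ n (fun x : E3 => g ‖x‖) (ball R) := by
    intro n
    induction n with
    | zero =>
      intro g hg _
      refine contDiffOn_zero.2 ?_
      exact hg.continuousOn.comp continuous_norm.continuousOn hnorm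
    | succ n ih =>
      intro g hg heven
      obtain ⟨h, hh, hheven, hgd⟩ := step g hg heven
      have hfd : ∀ x ∈ ball R, HasFDerivWithinAt (fun x : E3 => g ‖x‖) (h ‖x‖ • innerSL ℝ x)
          (ball R) x := by
        intro x hx
        rcases eq_or_ne x 0 with rfl | hx0
        · have h1 := hgd 0 h0mem
          rw [zero_mul, hasDerivWithinAt_iff_hasFDerivWithinAt, hasFDerivWithinAt_iff_tendsto] at h1
          rw [hasFDerivWithinAt_iff_tendsto]
          have h2 : Tendsto (fun x : E3 => ‖x‖) (𝓝[ball R] 0) (𝓝[Icc (-R) R] 0) := by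
            refine tendsto_nhdsWithin_iff.2 ⟨?_, ?_⟩
            · have := (continuous_norm (E := E3)).tendsto 0
              rw [norm_zero] at this
              exact this.mono_left nhdsWithin_le_nhds
            · filter_upwards [self_mem_nhdsWithin] with x hx using hnorm x hx
          refine (h1.comp h2).congr fun x => ?_
          simp
        · have h1 := (hgd ‖x‖ (hnorm x hx)).comp_hasFDerivWithinAt x
            (hasFDerivAt_norm hx0).hasFDerivWithinAt (s := ball R) hnorm
          refine h1.congr_fderiv ?_
          have : ‖x‖ ≠ 0 := norm_ne_zero_iff.2 hx0
          rw [smul_smul]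
          congr 1
          field_simp
      rw [Nat.cast_add, Nat.cast_one, contDiffOn_succ_iff_fderivWithin (uniqueDiffOn_ball hR)]
      refine ⟨fun x hx => (hfd x hx).differentiableWithinAt, by simp, ?_⟩
      refine ContDiffOn.congr ?_ fun x hx => (hfd x hx).fderivWithin (uniqueDiffOn_ball hR x hx)
      exact (ih h hh hheven).smul (innerSL ℝ : E3 →L[ℝ] E3 →L[ℝ] ℝ).contDiff.contDiffOn
  exact contDiffOn_infty.2 fun n => key n g hg heven

end factor

theorem norm_smul_normal (x : E3) : ‖x‖ • normal x = x := by
  rcases eq_or_ne x 0 with rfl | hx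
  · simp
  · rw [normal, smul_smul, mul_inv_cancel₀ (norm_ne_zero_iff.2 hx), one_smul]

theorem ev_eq_norm_pow_mul {P : Poly} {l : ℕ} (hP : P.IsHomogeneous l) (x : E3) :
    ev P x = ‖x‖ ^ l * ev P (normal x) := by
  rw [← ev_smul_point hP, norm_smul_normal]

/-- The moment is r^l g(r) with g smooth, and g is even because the moment has the parity of l. The
factor r^l turns P(x/|x|) back into the polynomial P, so the origin is harmless. -/
theorem smooth_scalarMode_coef {R : ℝ} (hR : 0 < R) {u : E3 → ℝ} (hu : Smooth R u) {l : ℕ}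
    {P : Poly} (hP : IsSolidHarmonic l P) : Smooth R (scalarMode P (coef u P)) := by
  obtain ⟨g, hg, hg'⟩ := exists_coef_eq_pow_mul hR l u hu l P le_rfl hP
  have heven : ∀ t ∈ Icc (-R) R, g (-t) = g t := by
    intro t ht
    rcases eq_or_ne t 0 with rfl | ht0
    · rw [neg_zero]
    · have h1 := coef_neg_arg hP.1 u t
      rw [hg' t ht, hg' (-t) ⟨by linarith [ht.2], by linarith [ht.1]⟩, neg_pow, mul_assoc] at h1
      have h2 := mul_left_cancel₀ (pow_ne_zero l (by norm_num : (-1 : ℝ) ≠ 0)) h1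
      exact mul_left_cancel₀ (pow_ne_zero l ht0) h2
  refine ((smooth_even_norm hR g hg heven).mul' (smooth_ev R P)).congr fun x hx => ?_
  have hx' : ‖x‖ ∈ Icc (-R) R := by
    rw [mem_closedBall_zero_iff] at hx
    exact ⟨by linarith [norm_nonneg x], hx⟩
  rw [scalarMode, angular_eq_ev, hg' _ hx', ev_eq_norm_pow_mul hP.1 x]
  ring

end RoundBall

namespace RoundBall
open MvPolynomial (X C pderiv)

/-! ### Curl, potentials and the momentum constraint -/

section potentials
variable {R : ℝ} (hR : 0 < R)
include hR

theorem Smooth.dcomp {σ : E3 → E3} (hσ : ContDiffOn ℝ ∞ σ (ball R)) (i j : Fin 3) :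
    Smooth R (dcomp R σ i j) := (contDiffOn_iff_smooth.1 hσ j).pd hR i

omit hR in
theorem curl_apply (σ : E3 → E3) (x : E3) (k : Fin 3) :
    curl R σ x k = dcomp R σ (k + 1) (k + 2) x - dcomp R σ (k + 2) (k + 1) x := by
  fin_cases k <;> simp [curl]

theorem contDiffOn_curl {σ : E3 → E3} (hσ : ContDiffOn ℝ ∞ σ (ball R)) :
    ContDiffOn ℝ ∞ (curl R σ) (ball R) := by
  refine contDiffOn_iff_smooth.2 fun k => ?_
  simp only [curl_apply]
  exact (Smooth.dcomp hR hσ _ _).sub' (Smooth.dcomp hR hσ _ _)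

/-- The components of `curl (curl σ)`, up to sign. -/
noncomputable def curlCurl (R : ℝ) (σ : E3 → E3) (j : Fin 3) (x : E3) : ℝ :=
  ∑ i, pd R i (fun y => dcomp R σ i j y - dcomp R σ j i y) x

theorem Smooth.curlCurl {σ : E3 → E3} (hσ : ContDiffOn ℝ ∞ σ (ball R)) (j : Fin 3) :
    Smooth R (curlCurl R σ j) :=
  Smooth.sum' fun _ _ => ((Smooth.dcomp hR hσ _ _).sub' (Smooth.dcomp hR hσ _ _)).pd hR _

theorem momentumConstraint_iff {σ : E3 → E3} (hσ : ContDiffOn ℝ ∞ σ (ball R)) :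
    MomentumConstraint R σ ↔ ∀ x ∈ ball R, ∀ j, curlCurl R σ j x = 0 := by
  refine forall₂_congr fun x hx => forall_congr' fun j => ?_
  have h : ∀ i, pd R i (fun y => (1 / 2) * (dcomp R σ i j y - dcomp R σ j i y)) x =
      (1 / 2) * pd R i (fun y => dcomp R σ i j y - dcomp R σ j i y) x := fun i =>
    pd_const_mul hR ((Smooth.dcomp hR hσ _ _).sub' (Smooth.dcomp hR hσ _ _)) hx i _
  simp only [h, ← Finset.mul_sum, curlCurl]
  simp

theorem curlCurl_eq {σ : E3 → E3} (hσ : ContDiffOn ℝ ∞ σ (ball R)) {x : E3} (hx : x ∈ ball R)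
    (j : Fin 3) : curlCurl R σ j x = - curl R (curl R σ) x j := by
  have h : ∀ i k, dcomp R (curl R σ) i k x =
      pd R i (dcomp R σ (k + 1) (k + 2)) x - pd R i (dcomp R σ (k + 2) (k + 1)) x := fun i k => by
    have e : (fun y => curl R σ y k) =
      fun y => dcomp R σ (k + 1) (k + 2) y - dcomp R σ (k + 2) (k + 1) y := by
      funext y; exact curl_apply σ y k
    unfold dcomp at e ⊢
    rw [e]
    exact pd_sub hR (Smooth.dcomp hR hσ _ _) (Smooth.dcomp hR hσ _ _) hx i
  have h2 : ∀ i, pd R i (fun y => dcomp R σ i j y - dcomp R σ j i y) x =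
      pd R i (dcomp R σ i j) x - pd R i (dcomp R σ j i) x := fun i =>
    pd_sub hR (Smooth.dcomp hR hσ _ _) (Smooth.dcomp hR hσ _ _) hx i
  rw [curl_apply, h, h, curlCurl]
  simp only [h2, Fin.sum_univ_three]
  fin_cases j <;> simp <;> ring

theorem momentumConstraint_iff_curl {σ : E3 → E3} (hσ : ContDiffOn ℝ ∞ σ (ball R)) :
    MomentumConstraint R σ ↔ ∀ x ∈ ball R, curl R (curl R σ) x = 0 := by
  rw [momentumConstraint_iff hR hσ]
  refine forall₂_congr fun x hx => ?_
  simp only [curlCurl_eq hR hσ hx, neg_eq_zero]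
  exact ⟨fun h => by ext j; exact h j, fun h j => by rw [h]; rfl⟩

/-- Poincaré lemma: the potential is ∫₀¹ x·v(sx) ds. -/
theorem exists_potential {v : Fin 3 → E3 → ℝ} (hv : ∀ j, Smooth R (v j))
    (h : ∀ x ∈ ball R, ∀ i j, pd R i (v j) x = pd R j (v i) x) :
    ∃ g, Smooth R g ∧ ∀ x ∈ ball R, ∀ i, pd R i g x = v i x := by
  have hs : ∀ j, Smooth R fun x => x j * rayInt 0 (v j) x := fun j =>
    (Smooth.coord j).mul' ((hv j).rayInt hR 0)
  refine ⟨fun x => ∑ j, x j * rayInt 0 (v j) x, Smooth.sum' fun j _ => hs j, fun x hx i => ?_⟩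
  rw [pd_sum hR (fun j _ => hs j) hx i, ← rayInt_add_sum_mul_rayInt hR (hv i) hx]
  have e : ∀ j, pd R i (fun x => x j * rayInt 0 (v j) x) x =
      x j * rayInt 1 (pd R j (v i)) x + rayInt 0 (v j) x * (if j = i then 1 else 0) := by
    intro j
    rw [pd_mul hR (Smooth.coord j) ((hv j).rayInt hR 0) hx i, pd_coord hR hx, pd_rayInt hR (hv j) 0 hx]
    congr 2
    unfold rayInt
    congr 1; ext s
    rw [h _ (ray_mem_ball hx s.2) i j]
  simp only [e, Finset.sum_add_distrib, mul_ite, mul_one, mul_zero, Finset.sum_ite_eq',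
    Finset.mem_univ, if_true]
  ring

/-- The field `x × ∇A + ∇u`. -/
noncomputable def potField (R : ℝ) (A u : E3 → ℝ) (x : E3) : E3 :=
  WithLp.toLp 2 fun k => rotd R k A x + pd R k u x

omit hR in
theorem potField_apply (A u : E3 → ℝ) (x : E3) (k : Fin 3) :
    potField R A u x k = rotd R k A x + pd R k u x := rfl

theorem contDiffOn_potField {A u : E3 → ℝ} (hA : Smooth R A) (hu : Smooth R u) :
    ContDiffOn ℝ ∞ (potField R A u) (ball R) :=
  contDiffOn_iff_smooth.2 fun k => (hA.rotd hR k).add' (hu.pd hR k)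

theorem dcomp_potField {A u : E3 → ℝ} (hA : Smooth R A) (hu : Smooth R u) {x : E3}
    (hx : x ∈ ball R) (i k : Fin 3) :
    dcomp R (potField R A u) i k x = pd R i (rotd R k A) x + pd R i (pd R k u) x :=
  pd_add hR (hA.rotd hR k) (hu.pd hR k) hx i

theorem pd_rotd {A : E3 → ℝ} (hA : Smooth R A) {x : E3} (hx : x ∈ ball R) (i k : Fin 3) :
    pd R i (rotd R k A) x = x (k + 1) * pd R i (pd R (k + 2) A) x
      + pd R (k + 2) A x * (if k + 1 = i then 1 else 0)
      - (x (k + 2) * pd R i (pd R (k + 1) A) x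
      + pd R (k + 1) A x * (if k + 2 = i then 1 else 0)) := by
  unfold rotd
  rw [pd_sub hR ((Smooth.coord _).mul' (hA.pd hR _)) ((Smooth.coord _).mul' (hA.pd hR _)) hx,
    pd_mul hR (Smooth.coord _) (hA.pd hR _) hx, pd_mul hR (Smooth.coord _) (hA.pd hR _) hx,
    pd_coord hR hx, pd_coord hR hx]

/-- The vector identity is curl (x × ∇A) = x ΔA - ∇(A + x·∇A). -/
theorem curl_potField {A u : E3 → ℝ} (hA : Smooth R A) (hu : Smooth R u)
    (hΔ : ∀ x ∈ ball R, ∑ i, pd R i (pd R i A) x = 0) {x : E3} (hx : x ∈ ball R) (k : Fin 3) :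
    curl R (potField R A u) x k = - pd R k (fun y => A y + ∑ j, y j * pd R j A y) x := by
  have hs : ∀ j, Smooth R fun y => y j * pd R j A y := fun j => (Smooth.coord j).mul' (hA.pd hR j)
  rw [curl_apply, dcomp_potField hR hA hu hx, dcomp_potField hR hA hu hx,
    pd_comm hR hu hx (k + 1), pd_rotd hR hA hx, pd_rotd hR hA hx,
    pd_add hR hA (Smooth.sum' fun j _ => hs j) hx, pd_sum hR (fun j _ => hs j) hx]
  have e : ∀ j, pd R k (fun y => y j * pd R j A y) x =
      x j * pd R k (pd R j A) x + pd R j A x * (if j = k then 1 else 0) := fun j => by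
    rw [pd_mul hR (Smooth.coord j) (hA.pd hR j) hx, pd_coord hR hx]
  have h := hΔ x hx
  have c1 := pd_comm hR hA hx 0 1
  have c2 := pd_comm hR hA hx 0 2
  have c3 := pd_comm hR hA hx 1 2
  simp only [e, Fin.sum_univ_three] at h ⊢
  fin_cases k
  · simp [c1, c2]; linear_combination x 0 * h
  · simp [c1, c3]; linear_combination x 1 * h
  · simp [c2, c3]; linear_combination x 2 * h

theorem momentum_potField {A u : E3 → ℝ} (hA : Smooth R A) (hu : Smooth R u)
    (hΔ : ∀ x ∈ ball R, ∑ i, pd R i (pd R i A) x = 0) :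
    MomentumConstraint R (potField R A u) := by
  rw [momentumConstraint_iff_curl hR (contDiffOn_potField hR hA hu)]
  intro x hx
  ext k
  have hs : Smooth R fun y => A y + ∑ j, y j * pd R j A y :=
    hA.add' (Smooth.sum' fun j _ => (Smooth.coord j).mul' (hA.pd hR j))
  have e : ∀ i k, dcomp R (curl R (potField R A u)) i k x =
      - pd R i (pd R k fun y => A y + ∑ j, y j * pd R j A y) x := fun i k => by
    rw [← pd_neg hR (hs.pd hR k) hx]
    exact pd_congr (fun y hy => curl_potField hR hA hu hΔ hy k) hx
  rw [curl_apply, e, e, pd_comm hR hs hx]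
  simp

theorem exists_potField {σ : E3 → E3} (hσ : ContDiffOn ℝ ∞ σ (ball R))
    (h : MomentumConstraint R σ) : ∃ A u, Smooth R A ∧ Smooth R u ∧
      (∀ x ∈ ball R, ∑ i, pd R i (pd R i A) x = 0) ∧ EqOn σ (potField R A u) (ball R) := by
  have hω := contDiffOn_iff_smooth.1 (contDiffOn_curl hR hσ)
  rw [momentumConstraint_iff_curl hR hσ] at h
  obtain ⟨g, hg, hgω⟩ := exists_potential hR hω (fun x hx i j => by
    have e : ∀ k, dcomp R (curl R σ) (k + 1) (k + 2) x = dcomp R (curl R σ) (k + 2) (k + 1) x := by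
      intro k
      have := congrArg (fun v : E3 => v k) (h x hx)
      simp only [curl_apply, PiLp.zero_apply] at this
      linarith
    have e0 := e 0
    have e1 := e 1
    have e2 := e 2
    unfold dcomp at e0 e1 e2
    fin_cases i <;> fin_cases j <;> simp at e0 e1 e2 ⊢ <;> linarith)
  have hgΔ : ∀ x ∈ ball R, ∑ i, pd R i (pd R i g) x = 0 := by
    intro x hx
    have e : ∀ i, pd R i (pd R i g) x =
        pd R i (dcomp R σ (i + 1) (i + 2)) x - pd R i (dcomp R σ (i + 2) (i + 1)) x := fun i => by
      rw [← pd_sub hR (Smooth.dcomp hR hσ _ _) (Smooth.dcomp hR hσ _ _) hx]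
      refine pd_congr (fun y hy => ?_) hx
      rw [hgω y hy]; exact curl_apply σ y i
    have c : ∀ i j k, pd R i (dcomp R σ j k) x = pd R j (dcomp R σ i k) x := fun i j k =>
      pd_comm hR (contDiffOn_iff_smooth.1 hσ k) hx i j
    simp only [e, Fin.sum_univ_three]
    have c1 := c 0 1 2
    have c2 := c 0 2 1
    have c3 := c 1 2 0
    simp
    linarith
  -- This choice solves A + x·∇A = -g, so that x × ∇A has the same curl as σ. It inherits
  -- harmonicity from g because the Laplacian passes under the ray integral.
  set A : E3 → ℝ := fun x => - rayInt 0 g x with hAdef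
  have hA : Smooth R A := (hg.rayInt hR 0).neg'
  have hA1 : ∀ x ∈ ball R, ∀ i, pd R i A x = - rayInt 1 (pd R i g) x := fun x hx i => by
    rw [hAdef, pd_neg hR (hg.rayInt hR 0) hx, pd_rayInt hR hg 0 hx]
  have hAΔ : ∀ x ∈ ball R, ∑ i, pd R i (pd R i A) x = 0 := by
    intro x hx
    have e : ∀ i, pd R i (pd R i A) x = - rayInt 2 (pd R i (pd R i g)) x := fun i => by
      rw [pd_congr (fun y hy => hA1 y hy i) hx, pd_neg hR ((hg.pd hR i).rayInt hR 1) hx,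
        pd_rayInt hR (hg.pd hR i) 1 hx]
    simp only [e, Finset.sum_neg_distrib, neg_eq_zero]
    unfold rayInt
    rw [← integral_finsetSum _ fun i _ =>
      integrable_ray ((hg.pd hR i).pd hR i).continuousOn 2 hx]
    simp only [← Finset.mul_sum]
    rw [← integral_zero unitInterval ℝ]
    congr 1; ext s
    rw [hgΔ _ (ray_mem_ball hx s.2), mul_zero]
  have hAg : EqOn (fun y => A y + ∑ j, y j * pd R j A y) (fun y => - g y) (ball R) := by
    intro x hx
    simp only [hA1 x hx, mul_neg, Finset.sum_neg_distrib]
    rw [← rayInt_add_sum_mul_rayInt hR hg hx, hAdef]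
    ring
  have h0 : Smooth R fun _ => 0 := Smooth.const 0
  have hcurl : ∀ x ∈ ball R, ∀ k, curl R (potField R A fun _ => 0) x k = curl R σ x k := by
    intro x hx k
    rw [curl_potField hR hA h0 hAΔ hx, pd_congr hAg hx, pd_neg hR hg hx, neg_neg, hgω x hx]
  obtain ⟨u, hu, hu'⟩ := exists_potential hR
    (v := fun j x => σ x j - potField R A (fun _ => 0) x j)
    (fun j => (contDiffOn_iff_smooth.1 hσ j).sub'
      (contDiffOn_iff_smooth.1 (contDiffOn_potField hR hA h0) j))
    (fun x hx i j => by
      have e : ∀ i j, pd R i (fun x => σ x j - potField R A (fun _ => 0) x j) x =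
          dcomp R σ i j x - dcomp R (potField R A fun _ => 0) i j x := fun i j =>
        pd_sub hR (contDiffOn_iff_smooth.1 hσ j)
          (contDiffOn_iff_smooth.1 (contDiffOn_potField hR hA h0) j) hx i
      have c0 := hcurl x hx 0
      have c1 := hcurl x hx 1
      have c2 := hcurl x hx 2
      rw [curl_apply, curl_apply] at c0 c1 c2
      rw [e, e]
      fin_cases i <;> fin_cases j <;> simp at c0 c1 c2 ⊢ <;> linarith)
  refine ⟨A, u, hA, hu, hAΔ, fun x hx => ?_⟩
  ext k
  rw [potField_apply, hu' x hx, potField_apply, pd_const hR hx]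
  ring

/-- The projections of a harmonic function to spherical harmonics are multiples of `r^l`. -/
theorem coef_eq_of_harmonic {A : E3 → ℝ} (hA : Smooth R A)
    (hΔ : ∀ x ∈ ball R, ∑ i, pd R i (pd R i A) x = 0) {l : ℕ} {P : Poly}
    (hP : IsSolidHarmonic l P) : ∃ a : ℝ, ∀ r ∈ Icc 0 R, coef A P r = a * r ^ l := by
  obtain ⟨g, hg, hg'⟩ := exists_coef_eq_pow_mul hR l A hA l P le_rfl hP
  -- Green's identity: A∇P - P∇A is divergence free, so its flux vanishes, which is the Euler
  -- equation r c' = l c for the moment c.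
  have hflux : ∀ r ∈ Ioc 0 R, (l : ℝ) * coef A P r =
      r * ∑ i, coef (pd R i A) (X i * P) r := by
    intro r hr
    have hrI : r ∈ Icc (-R) R := ⟨by linarith [hr.1], hr.2⟩
    have hV : ∀ i, Smooth R fun x => A x * ev (pderiv i P) x - ev P x * pd R i A x := fun i =>
      (hA.mul' (smooth_ev R _)).sub' ((smooth_ev R _).mul' (hA.pd hR i))
    have h := flux_eq_zero hR hV (fun x hx => by
      have e : ∀ i, pd R i (fun x => A x * ev (pderiv i P) x - ev P x * pd R i A x) x =
          A x * ev (pderiv i (pderiv i P)) x - ev P x * pd R i (pd R i A) x := fun i => by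
        rw [pd_sub hR (hA.mul' (smooth_ev R _)) ((smooth_ev R _).mul' (hA.pd hR i)) hx,
          pd_mul hR hA (smooth_ev R _) hx, pd_mul hR (smooth_ev R _) (hA.pd hR i) hx,
          pd_ev hR _ _ hx, pd_ev hR _ _ hx]
        ring
      have h2 := congrArg (fun Q => ev Q x) hP.2
      have h3 := hΔ x hx
      simp only [Fin.sum_univ_three, ev_add] at h2 h3
      simp only [e, Fin.sum_univ_three]
      have h4 : ev (0 : Poly) x = 0 := by simp [ev]
      linear_combination A x * (h2.trans h4) - ev P x * h3) hr
    have e : ∀ i, coef (fun x => A x * ev (pderiv i P) x - ev P x * pd R i A x) (X i) r =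
        r ^ (l - 1) * coef A (X i * pderiv i P) r - r ^ l * coef (pd R i A) (X i * P) r := by
      intro i
      unfold coef
      rw [← integral_const_mul, ← integral_const_mul, ← integral_sub
        ((integrable_coef hA.continuousOn _ hrI).const_mul _)
        ((integrable_coef (hA.pd hR i).continuousOn _ hrI).const_mul _)]
      congr 1; ext q
      simp only [ev_smul_point hP.1, ev_smul_point (hP.pderiv i).1, ev_mul, ev_X]
      ring
    simp only [e, Finset.sum_sub_distrib, ← Finset.mul_sum] at h
    rw [← coef_sum_right hA.continuousOn _ hrI] at h
    have h5 : ∑ i, X i * pderiv i P = (l : ℝ) • P := by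
      rw [MvPolynomial.smul_eq_C_mul]; exact eulerP_of_isHomogeneous hP.1
    rw [h5, coef_smul_right] at h
    rcases Nat.eq_zero_or_pos l with rfl | hl
    · simp at h ⊢
      rw [h]; simp
    · obtain ⟨m, rfl⟩ : ∃ m, l = m + 1 := ⟨l - 1, by omega⟩
      rw [Nat.add_sub_cancel, pow_succ, mul_assoc, ← mul_sub] at h
      rcases mul_eq_zero.1 h with h | h
      · exact absurd h (pow_ne_zero _ hr.1.ne')
      · linarith
  refine ⟨g R, fun r hr => ?_⟩
  have hrI : r ∈ Icc (-R) R := ⟨by linarith [hr.1], hr.2⟩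
  rw [hg' r hrI, mul_comm]
  congr 1
  rcases hr.2.eq_or_lt with rfl | hlt
  · rfl
  have hsub : Icc r R ⊆ Icc (-R) R := Icc_subset_Icc hrI.1 le_rfl
  -- Writing the moment as r^l g, the Euler equation becomes r^(l+1) g' = 0, so g is constant. Using
  -- the smooth quotient g, rather than dividing by r^l, includes r = 0.
  obtain ⟨c, hc, hslope⟩ := exists_hasDerivAt_eq_slope g (derivWithin g (Icc (-R) R)) hlt
    (hg.continuousOn.mono hsub) (fun t ht => ((hg.differentiableOn (by simp) t
      (hsub (Ioo_subset_Icc_self ht))).hasDerivWithinAt).hasDerivAt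
      (Icc_mem_nhds (by linarith [ht.1, hr.1]) ht.2))
  have hc0 : 0 < c := hr.1.trans_lt hc.1
  have hcI : c ∈ Icc (-R) R := hsub (Ioo_subset_Icc_self hc)
  have hcn : Icc (-R) R ∈ 𝓝 c := Icc_mem_nhds (by linarith) hc.2
  have hd1 := (hasDerivWithinAt_coef hR hA hcI P).hasDerivAt hcn
  have hgd := ((hg.differentiableOn (by simp) c hcI).hasDerivWithinAt).hasDerivAt hcn
  have hev : coef A P =ᶠ[𝓝 c] (fun x => x ^ l) * g := by
    filter_upwards [hcn] with t ht using hg' t ht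
  have hd2 := ((hasDerivAt_pow l c).mul hgd).congr_of_eventuallyEq hev
  have h6 := hd1.unique hd2
  have h7 := hflux c ⟨hc0, hc.2.le⟩
  rw [h6, hg' c hcI] at h7
  have h8 : c ^ (l + 1) * derivWithin g (Icc (-R) R) c = 0 := by
    rcases Nat.eq_zero_or_pos l with rfl | hl
    · simp at h7 ⊢
      rcases h7 with h7 | h7
      · exact Or.inl h7
      · exact Or.inr h7
    · obtain ⟨m, rfl⟩ : ∃ m, l = m + 1 := ⟨l - 1, by omega⟩
      simp only [Nat.add_sub_cancel] at h7
      linear_combination -h7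
  have h9 := (mul_eq_zero.1 h8).resolve_left (pow_ne_zero _ hc0.ne')
  rw [h9] at hslope
  have : R - r ≠ 0 := by linarith
  field_simp at hslope
  linarith

end potentials

end RoundBall

namespace RoundBall
open MvPolynomial (X C pderiv)

/-! ### Pairings of vector fields on the sphere with vector spherical harmonics -/

/-- The radial moment. -/
noncomputable def radPair (V : S2 → E3) (Z : Poly) : ℝ :=
  ∫ q : S2, ⟪V q, (q : E3)⟫_ℝ * ev Z (q : E3) ∂area

/-- The moment with `x × ∇Z`. -/
noncomputable def rotPair (V : S2 → E3) (Z : Poly) : ℝ :=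
  ∫ q : S2, ⟪V q, rotV Z (q : E3)⟫_ℝ ∂area

/-- The moment with the tangential gradient of `Z`. -/
noncomputable def gradPair (V : S2 → E3) (Z : Poly) : ℝ :=
  ∫ q : S2, ⟪cross (q : E3) (V q), rotV Z (q : E3)⟫_ℝ ∂area

/-- The test field of the radial moment. -/
noncomputable def radW (Z : Poly) (q : S2) : E3 := ev Z (q : E3) • (q : E3)

/-- The test field of the gradient moment. -/
noncomputable def gradW (Z : Poly) (q : S2) : E3 := cross (rotV Z (q : E3)) (q : E3)

theorem radPair_eq (V : S2 → E3) (Z : Poly) : radPair V Z = ∫ q : S2, ⟪V q, radW Z q⟫_ℝ ∂area := by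
  unfold radPair radW
  congr 1; ext q
  rw [inner_smul_right]; ring

theorem inner_cross_left (u v w : E3) : ⟪cross u v, w⟫_ℝ = ⟪v, cross w u⟫_ℝ := by
  simp only [inner_eq_sum, Fin.sum_univ_three, cross_apply_zero, cross_apply_one, cross_apply_two]
  ring

theorem gradPair_eq (V : S2 → E3) (Z : Poly) :
    gradPair V Z = ∫ q : S2, ⟪V q, gradW Z q⟫_ℝ ∂area := by
  unfold gradPair gradW
  simp only [inner_cross_left]

theorem continuous_radW (Z : Poly) : Continuous (radW Z) :=
  (continuous_ev_S2 Z).smul continuous_subtype_val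

theorem continuous_rotV_S2 (Z : Poly) : Continuous fun q : S2 => rotV Z (q : E3) :=
  (continuous_rotV Z).comp continuous_subtype_val

theorem continuous_gradW (Z : Poly) : Continuous (gradW Z) :=
  continuous_cross (continuous_rotV_S2 Z) continuous_subtype_val

theorem integrable_inner_S2 {V W : S2 → E3} (hV : Continuous V) (hW : Continuous W) :
    Integrable (fun q => ⟪V q, W q⟫_ℝ) area :=
  integrable_of_continuous_S2 (hV.inner hW)

theorem cross_add_left (u v w : E3) : cross (u + v) w = cross u w + cross v w := by
  ext k; simp only [cross_apply', PiLp.add_apply]; ring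

theorem radW_add (P Q : Poly) (q : S2) : radW (P + Q) q = radW P q + radW Q q := by
  simp [radW, add_smul]

theorem radW_smul (c : ℝ) (P : Poly) (q : S2) : radW (c • P) q = c • radW P q := by
  simp [radW, mul_smul]

theorem gradW_add (P Q : Poly) (q : S2) : gradW (P + Q) q = gradW P q + gradW Q q := by
  simp [gradW, rotV_add, cross_add_left]

theorem gradW_smul (c : ℝ) (P : Poly) (q : S2) : gradW (c • P) q = c • gradW P q := by
  simp [gradW, rotV_smul, smul_cross]

theorem moment_span {Y : (ℓ : ℕ) → Fin (2 * ℓ + 1) → Poly} (hY : IsHarmonicBasis Y)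
    {V : S2 → E3} (hV : Continuous V) {w : Poly → S2 → E3} (hw : ∀ P, Continuous (w P))
    (hadd : ∀ P Q q, w (P + Q) q = w P q + w Q q) (hsmul : ∀ (c : ℝ) P q, w (c • P) q = c • w P q)
    (h : ∀ l m, ∫ q : S2, ⟪V q, w (Y l m) q⟫_ℝ ∂area = 0) (l : ℕ) (P : Poly)
    (hP : IsSolidHarmonic l P) : ∫ q : S2, ⟪V q, w P q⟫_ℝ ∂area = 0 := by
  refine Submodule.span_induction (p := fun P _ => ∫ q : S2, ⟪V q, w P q⟫_ℝ ∂area = 0)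
    ?_ ?_ ?_ ?_ (hY.spans l P hP)
  · rintro _ ⟨m, rfl⟩; exact h l m
  · have : ∀ q, w 0 q = 0 := fun q => by simpa using hsmul 0 0 q
    simp [this]
  · intro P Q _ _ h1 h2
    simp only [hadd, inner_add_right]
    rw [integral_add (integrable_inner_S2 hV (hw P)) (integrable_inner_S2 hV (hw Q)), h1, h2,
      add_zero]
  · intro c P _ h1
    simp only [hsmul, inner_smul_right]
    rw [integral_const_mul, h1, mul_zero]

theorem eq_zero_of_basis_moments {Y : (ℓ : ℕ) → Fin (2 * ℓ + 1) → Poly} (hY : IsHarmonicBasis Y)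
    {V : S2 → E3} (hV : Continuous V) (ha : ∀ l m, radPair V (Y l m) = 0)
    (hb : ∀ l m, rotPair V (Y l m) = 0) (hc : ∀ l m, gradPair V (Y l m) = 0) : V = 0 := by
  refine eq_zero_of_vector_moments hV (fun l P hP => ?_) (fun l P hP => ?_) (fun l P hP => ?_)
  · have := moment_span hY hV continuous_radW radW_add radW_smul
      (fun l m => by rw [← radPair_eq]; exact ha l m) l P hP
    rwa [← radPair_eq] at this
  · exact moment_span hY hV (w := fun P q => rotV P (q : E3)) continuous_rotV_S2
      (fun P Q q => rotV_add P Q q) (fun c P q => rotV_smul c P q) hb l P hP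
  · have := moment_span hY hV continuous_gradW gradW_add gradW_smul
      (fun l m => by rw [← gradPair_eq]; exact hc l m) l P hP
    rwa [← gradPair_eq] at this

theorem sum_rotP_pderiv (Z : Poly) : ∑ j, rotP j (pderiv j Z) = 0 := by
  simp only [Fin.sum_univ_three, rotP, Fin.isValue, zero_add, Fin.reduceAdd]
  rw [pderiv_comm' 1 0, pderiv_comm' 2 0, pderiv_comm' 2 1]
  ring

section potential_pairings
variable {R r : ℝ} (hR : 0 < R) {A u : E3 → ℝ} (hA : Smooth R A) (hu : Smooth R u)
  (hr : r ∈ Ioc 0 R)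
include hR hA hu hr

omit hA in
theorem radPair_potField (Z : Poly) :
    radPair (fun q => potField R A u (r • (q : E3))) Z = ∑ i, coef (pd R i u) (X i * Z) r := by
  have hrI : r ∈ Icc (-R) R := ⟨by linarith [hr.1], hr.2⟩
  unfold radPair coef
  rw [← integral_finsetSum _ fun i _ => integrable_coef (hu.pd hR i).continuousOn _ hrI]
  congr 1; ext q
  simp only [inner_eq_sum, Fin.sum_univ_three, potField_apply, rotd, ev_mul, ev_X,
    PiLp.smul_apply, smul_eq_mul, Fin.isValue, zero_add, Fin.reduceAdd]
  ring

/-- The pairing of the two rotational fields is moved by parts onto Z and gives the eigenvalue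
l(l+1). The gradient part becomes a moment against (x × ∇)·∇Z, which is zero. -/
theorem rotPair_potField {l : ℕ} {Z : Poly} (hZ : IsSolidHarmonic l Z) :
    rotPair (fun q => potField R A u (r • (q : E3))) Z = (l * (l + 1)) * coef A Z r := by
  have hrI : r ∈ Icc (-R) R := ⟨by linarith [hr.1], hr.2⟩
  have h : ∀ q : S2, ⟪potField R A u (r • (q : E3)), rotV Z (q : E3)⟫_ℝ =
      (∑ k, rotd R k A (r • (q : E3)) * ev (rotP k Z) (q : E3)) -
        r⁻¹ * ∑ k, rotd R k u (r • (q : E3)) * ev (pderiv k Z) (q : E3) := by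
    intro q
    have hr0 := hr.1.ne'
    simp only [inner_eq_sum, Fin.sum_univ_three, potField_apply, rotV_apply, rotd, rotP, ev_sub,
      ev_mul, ev_X, PiLp.smul_apply, smul_eq_mul, Fin.isValue, zero_add, Fin.reduceAdd]
    field_simp
    ring
  have i1 : ∀ k, Integrable (fun q : S2 => rotd R k A (r • (q : E3)) * ev (rotP k Z) (q : E3))
    area := fun k => integrable_coef (hA.rotd hR k).continuousOn _ hrI
  have i2 : ∀ k, Integrable (fun q : S2 => rotd R k u (r • (q : E3)) * ev (pderiv k Z) (q : E3))
    area := fun k => integrable_coef (hu.rotd hR k).continuousOn _ hrI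
  unfold rotPair
  simp only [h]
  rw [integral_sub (integrable_finsetSum _ fun k _ => i1 k)
    ((integrable_finsetSum _ fun k _ => i2 k).const_mul _), integral_const_mul,
    integral_finsetSum _ fun k _ => i1 k, integral_finsetSum _ fun k _ => i2 k]
  have e1 : ∀ k, ∫ q : S2, rotd R k A (r • (q : E3)) * ev (rotP k Z) (q : E3) ∂area =
    - coef A (rotP k (rotP k Z)) r := fun k => coef_rotd hR hA hrI _ _
  have e2 : ∀ k, ∫ q : S2, rotd R k u (r • (q : E3)) * ev (pderiv k Z) (q : E3) ∂area =
    - coef u (rotP k (pderiv k Z)) r := fun k => coef_rotd hR hu hrI _ _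
  simp only [e1, e2, Finset.sum_neg_distrib]
  rw [← coef_sum_right hA.continuousOn _ hrI, ← coef_sum_right hu.continuousOn _ hrI,
    hZ.rotP_rotP, sum_rotP_pderiv, MvPolynomial.C_mul', coef_smul_right]
  have : coef u 0 r = 0 := by simp [coef, ev]
  rw [this]; ring

/-- The cross product with q turns tangent vectors by a right angle, which exchanges the roles of A
and u in `rotPair_potField`. -/
theorem gradPair_potField {l : ℕ} {Z : Poly} (hZ : IsSolidHarmonic l Z) :
    gradPair (fun q => potField R A u (r • (q : E3))) Z = (l * (l + 1)) / r * coef u Z r := by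
  have hrI : r ∈ Icc (-R) R := ⟨by linarith [hr.1], hr.2⟩
  have h : ∀ q : S2, ⟪cross (q : E3) (potField R A u (r • (q : E3))), rotV Z (q : E3)⟫_ℝ =
      (∑ k, rotd R k A (r • (q : E3)) * ev (pderiv k Z) (q : E3)) +
        r⁻¹ * ∑ k, rotd R k u (r • (q : E3)) * ev (rotP k Z) (q : E3) := by
    intro q
    have hr0 := hr.1.ne'
    have hq := sum_sq_S2 q
    simp only [inner_eq_sum, Fin.sum_univ_three, potField_apply, rotV_apply, rotd, rotP, ev_sub,
      cross_apply_zero, cross_apply_one, cross_apply_two,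
      ev_mul, ev_X, PiLp.smul_apply, smul_eq_mul, Fin.isValue, zero_add, Fin.reduceAdd]
    generalize pd R 0 u (r • (q : E3)) = a0
    generalize pd R 1 u (r • (q : E3)) = a1
    generalize pd R 2 u (r • (q : E3)) = a2
    generalize pd R 0 A (r • (q : E3)) = c0
    generalize pd R 1 A (r • (q : E3)) = c1
    generalize pd R 2 A (r • (q : E3)) = c2
    generalize ev (pderiv 0 Z) (q : E3) = b0
    generalize ev (pderiv 1 Z) (q : E3) = b1
    generalize ev (pderiv 2 Z) (q : E3) = b2
    generalize (q : E3) 0 = x0 at *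
    generalize (q : E3) 1 = x1 at *
    generalize (q : E3) 2 = x2 at *
    field_simp
    linear_combination (r * ((x1 * c2 - x2 * c1) * b0 + (x2 * c0 - x0 * c2) * b1
      + (x0 * c1 - x1 * c0) * b2)) * hq
  have i1 : ∀ k, Integrable (fun q : S2 => rotd R k u (r • (q : E3)) * ev (rotP k Z) (q : E3))
    area := fun k => integrable_coef (hu.rotd hR k).continuousOn _ hrI
  have i2 : ∀ k, Integrable (fun q : S2 => rotd R k A (r • (q : E3)) * ev (pderiv k Z) (q : E3))
    area := fun k => integrable_coef (hA.rotd hR k).continuousOn _ hrI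
  unfold gradPair
  simp only [h]
  rw [integral_add (integrable_finsetSum _ fun k _ => i2 k)
    ((integrable_finsetSum _ fun k _ => i1 k).const_mul _), integral_const_mul,
    integral_finsetSum _ fun k _ => i1 k, integral_finsetSum _ fun k _ => i2 k]
  have e1 : ∀ k, ∫ q : S2, rotd R k u (r • (q : E3)) * ev (rotP k Z) (q : E3) ∂area =
    - coef u (rotP k (rotP k Z)) r := fun k => coef_rotd hR hu hrI _ _
  have e2 : ∀ k, ∫ q : S2, rotd R k A (r • (q : E3)) * ev (pderiv k Z) (q : E3) ∂area =
    - coef A (rotP k (pderiv k Z)) r := fun k => coef_rotd hR hA hrI _ _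
  simp only [e1, e2, Finset.sum_neg_distrib]
  rw [← coef_sum_right hA.continuousOn _ hrI, ← coef_sum_right hu.continuousOn _ hrI,
    hZ.rotP_rotP, sum_rotP_pderiv, MvPolynomial.C_mul', coef_smul_right]
  have : coef A 0 r = 0 := by simp [coef, ev]
  rw [this]; ring

end potential_pairings

/-! ### The modes -/

/-- Only tangential derivatives enter x × ∇, so the extension of P that is constant along rays may
be replaced by the polynomial itself at x/|x|. -/
theorem coexactHarmonic_eq {P : Poly} {x : E3} (hx : x ≠ 0) :
    coexactHarmonic P x = rotV P (normal x) := by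
  have hd : DifferentiableAt ℝ (angular P) x :=
    ((contDiff_ev P).contDiffAt.comp x (contDiffAt_normal hx)).differentiableAt (by simp)
  have hf : ∀ v, ⟪x, v⟫_ℝ = 0 →
      fderiv ℝ (angular P) x v = ∑ i, ev (pderiv i P) (normal x) * (‖x‖⁻¹ * v i) := by
    intro v hv
    have h := ((hasFDerivAt_ev P (normal x)).comp x
      ((contDiffAt_normal hx).differentiableAt (by simp)).hasFDerivAt).fderiv
    rw [show angular P = ev P ∘ normal from rfl, h]
    simp only [ContinuousLinearMap.comp_apply, fderiv_normal hx v hv]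
    simp
    rw [Finset.mul_sum]
    exact Finset.sum_congr rfl fun i _ => by ring
  have hg : ∀ v, fderiv ℝ (angular P) x v = ∑ i, gradient (angular P) x i * v i := by
    intro v
    rw [← inner_eq_sum, gradient, InnerProductSpace.toDual_symm_apply]
  ext k
  have h1 := hf (cross (basisVec k) x) (inner_cross_self _ _)
  rw [hg] at h1
  rw [coexactHarmonic, cross_apply', rotV_apply, rotP]
  simp only [Fin.sum_univ_three, cross_apply_zero, cross_apply_one, cross_apply_two,
    basisVec_apply] at h1
  simp only [ev_sub, ev_mul, ev_X, normal, PiLp.smul_apply, smul_eq_mul] at h1 ⊢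
  fin_cases k
  · simp at h1 ⊢; linear_combination h1
  · simp at h1 ⊢; linear_combination h1
  · simp at h1 ⊢; linear_combination h1

theorem modeField_eq_potField {R : ℝ} (hR : 0 < R) {l : ℕ} {P : Poly} (hP : IsSolidHarmonic l P)
    (a : ℝ) (f : ℝ → ℝ) {x : E3} (hx : x ∈ ball R) :
    modeField R l P a f x = potField R (fun y => a * ev P y) (scalarMode P f) x := by
  ext k
  rw [modeField, potField_apply, PiLp.add_apply, gradientWithin_apply]
  congr 1
  have h1 : rotd R k (fun y => a * ev P y) x = a * ev (rotP k P) x := by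
    rw [← rotd_ev hR P k hx]
    unfold rotd
    rw [pd_const_mul hR (smooth_ev R P) hx, pd_const_mul hR (smooth_ev R P) hx]
    ring
  rw [h1, PiLp.smul_apply, smul_eq_mul, mul_assoc]
  congr 1
  -- At the origin `angular P` need not be differentiable, but the cross product with x = 0 kills
  -- whatever value its gradient has.
  rcases eq_or_ne x 0 with rfl | hx0
  · have e : coexactHarmonic P 0 = 0 := by
      ext k; simp [coexactHarmonic, cross_apply']
    rw [e, rotP]
    simp
  · rw [coexactHarmonic_eq hx0, rotV_apply]
    conv_rhs => rw [← norm_smul_normal x]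
    have hh : (rotP k P).IsHomogeneous l := by
      rcases Nat.eq_zero_or_pos l with rfl | hl
      · rw [rotP, isHomogeneous_pderiv_zero hP.1, isHomogeneous_pderiv_zero hP.1]
        simpa using MvPolynomial.isHomogeneous_zero (Fin 3) ℝ 0
      · have e : 1 + (l - 1) = l := by omega
        refine MvPolynomial.IsHomogeneous.sub ?_ ?_
        · rw [← e]; exact (MvPolynomial.isHomogeneous_X ℝ _).mul hP.1.pderiv
        · rw [← e]; exact (MvPolynomial.isHomogeneous_X ℝ _).mul hP.1.pderiv
    rw [ev_smul_point hh]

section modes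
variable {R r : ℝ} (hR : 0 < R) (hr : r ∈ Ioc 0 R) {P : Poly} {f : ℝ → ℝ}

theorem scalarMode_smul {t : ℝ} (ht : 0 < t) (P : Poly) (f : ℝ → ℝ) (q : S2) :
    scalarMode P f (t • (q : E3)) = f t * ev P (q : E3) := by
  rw [scalarMode, norm_smul_S2 ht.le, angular_eq_ev, normal_smul ht]

theorem coef_scalarMode {t : ℝ} (ht : 0 < t) (P : Poly) (f : ℝ → ℝ) (Q : Poly) :
    coef (scalarMode P f) Q t = f t * sip P Q := by
  unfold coef sip
  rw [← integral_const_mul]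
  congr 1; ext q
  rw [scalarMode_smul ht]; ring

include hR hr

/-- Both sides are the radial derivative of f(r) times the inner product of P and Q. The derivative
of f is expressed as a moment, since only f(r) P(x/|x|), and not f, is assumed smooth. -/
theorem coef_pd_scalarMode (hf : Smooth R (scalarMode P f)) (hP : sip P P = 1) (Q : Poly) :
    ∑ i, coef (pd R i (scalarMode P f)) (X i * Q) r =
      (∑ i, coef (pd R i (scalarMode P f)) (X i * P) r) * sip P Q := by
  have hrI : r ∈ Icc (-R) R := ⟨by linarith [hr.1], hr.2⟩
  have hsub : Ioc 0 R ⊆ Icc (-R) R := fun t ht => ⟨by linarith [ht.1], ht.2⟩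
  have h1 := (hasDerivWithinAt_coef hR hf hrI Q).mono hsub
  have h2 := ((hasDerivWithinAt_coef hR hf hrI P).mono hsub).mul_const (sip P Q)
  have h3 := h2.congr (f₁ := coef (scalarMode P f) Q) (fun t ht => by
    rw [coef_scalarMode ht.1, coef_scalarMode ht.1, hP, mul_one]) (by
    rw [coef_scalarMode hr.1, coef_scalarMode hr.1, hP, mul_one])
  exact ((uniqueDiffOn_Ioc 0 R) r hr).eq_deriv _ h1 h3

/-- The rotational and the radial derivatives are identified separately through their moments, and
recombined by ∇ = q (q·∇) - q × (q × ∇). -/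
theorem pd_scalarMode (hf : Smooth R (scalarMode P f)) (hP : sip P P = 1) (q : S2) (i : Fin 3) :
    pd R i (scalarMode P f) (r • (q : E3)) =
      (∑ j, coef (pd R j (scalarMode P f)) (X j * P) r) * ev P (q : E3) * (q : E3) i
        - f r / r * cross (q : E3) (rotV P (q : E3)) i := by
  have hrI : r ∈ Icc (-R) R := ⟨by linarith [hr.1], hr.2⟩
  set U := scalarMode P f
  set D := ∑ j, coef (pd R j U) (X j * P) r with hD
  have hrot : ∀ (k : Fin 3) (q : S2), rotd R k U (r • (q : E3)) = f r * ev (rotP k P) (q : E3) := by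
    intro k
    have hc1 : Continuous fun q : S2 => rotd R k U (r • (q : E3)) :=
      continuous_comp_smul (hf.rotd hR k).continuousOn hrI
    have h := eq_zero_of_moments
      (g := fun q : S2 => rotd R k U (r • (q : E3)) - f r * ev (rotP k P) (q : E3))
      (hc1.sub (continuous_const.mul (continuous_ev_S2 _))) (fun l Q hQ => ?_)
    · intro q
      have := congrFun h q
      simp only [Pi.zero_apply] at this
      linarith
    · simp only [sub_mul, mul_assoc]
      rw [integral_sub (integrable_coef (hf.rotd hR k).continuousOn _ hrI)
        ((integrable_sip _ _).const_mul _), integral_const_mul]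
      change coef (rotd R k U) Q r - f r * sip (rotP k P) Q = 0
      rw [coef_rotd hR hf hrI, sip_rotP, coef_scalarMode hr.1]
      ring
  have hrad : ∀ q : S2, ∑ j, pd R j U (r • (q : E3)) * (q : E3) j = D * ev P (q : E3) := by
    have hc1 : ∀ j, Continuous fun q : S2 => pd R j U (r • (q : E3)) * (q : E3) j := fun j =>
      (continuous_comp_smul (hf.pd hR j).continuousOn hrI).mul (by fun_prop)
    have h := eq_zero_of_moments
      (g := fun q : S2 => ∑ j, pd R j U (r • (q : E3)) * (q : E3) j - D * ev P (q : E3))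
      ((continuous_finsetSum _ fun j _ => hc1 j).sub
        (continuous_const.mul (continuous_ev_S2 _))) (fun l Q hQ => ?_)
    · intro q
      have := congrFun h q
      simp only [Pi.zero_apply] at this
      linarith
    · have i1 : ∀ j, Integrable (fun q : S2 =>
          pd R j U (r • (q : E3)) * ev (X j * Q) (q : E3)) area := fun j =>
        integrable_coef (hf.pd hR j).continuousOn _ hrI
      have e : ∀ q : S2, (∑ j, pd R j U (r • (q : E3)) * (q : E3) j - D * ev P (q : E3)) *
          ev Q (q : E3) = ∑ j, pd R j U (r • (q : E3)) * ev (X j * Q) (q : E3)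
            - D * (ev P (q : E3) * ev Q (q : E3)) := fun q => by
        simp only [ev_mul, ev_X, sub_mul, Finset.sum_mul, mul_assoc]
      simp only [e]
      rw [integral_sub (integrable_finsetSum _ fun j _ => i1 j)
        ((integrable_sip _ _).const_mul _), integral_const_mul, integral_finsetSum _ fun j _ => i1 j]
      change ∑ j, coef (pd R j U) (X j * Q) r - D * sip P Q = 0
      rw [hD, coef_pd_scalarMode hR hr hf hP, sub_self]
  have h0 := hrot 0 q
  have h1 := hrot 1 q
  have h2 := hrot 2 q
  have h3 := hrad q
  have hq := sum_sq_S2 q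
  have hr0 := hr.1.ne'
  simp only [rotd, Fin.sum_univ_three, PiLp.smul_apply, smul_eq_mul, Fin.isValue, zero_add,
    Fin.reduceAdd] at h0 h1 h2 h3
  obtain rfl | rfl | rfl : i = 0 ∨ i = 1 ∨ i = 2 := by fin_cases i <;> simp
  · rw [cross_apply_zero, rotV_apply, rotV_apply]
    field_simp
    linear_combination -(r * pd R 0 U (r • (q : E3))) * hq + (r * (q : E3) 0) * h3
      + (q : E3) 2 * h1 - (q : E3) 1 * h2
  · rw [cross_apply_one, rotV_apply, rotV_apply]
    field_simp
    linear_combination -(r * pd R 1 U (r • (q : E3))) * hq + (r * (q : E3) 1) * h3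
      + (q : E3) 0 * h2 - (q : E3) 2 * h0
  · rw [cross_apply_two, rotV_apply, rotV_apply]
    field_simp
    linear_combination -(r * pd R 2 U (r • (q : E3))) * hq + (r * (q : E3) 2) * h3
      + (q : E3) 1 * h0 - (q : E3) 0 * h1

theorem modeField_smul {l : ℕ} (a : ℝ) (hf : Smooth R (scalarMode P f)) (hP : sip P P = 1)
    (q : S2) : modeField R l P a f (r • (q : E3)) = (a * r ^ l) • rotV P (q : E3)
      + (∑ j, coef (pd R j (scalarMode P f)) (X j * P) r) • radW P q + (f r / r) • gradW P q := by
  ext i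
  have hx0 : r • (q : E3) ≠ 0 := by
    rw [← norm_ne_zero_iff, norm_smul_S2 hr.1.le]; exact hr.1.ne'
  rw [modeField, coexactHarmonic_eq hx0, normal_smul hr.1, norm_smul_S2 hr.1.le]
  simp only [PiLp.add_apply, PiLp.smul_apply, gradientWithin_apply, smul_eq_mul]
  rw [pd_scalarMode hR hr hf hP, radW, gradW]
  simp only [PiLp.smul_apply, smul_eq_mul, cross_apply']
  ring

end modes

end RoundBall

namespace RoundBall
open MvPolynomial (X C pderiv)

/-! ### Consequences of a mode expansion -/

theorem hasSum_integral_inner {ι α : Type*} [MeasurableSpace α] {μ : Measure α}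
    [IsFiniteMeasure μ] {F : ι → E3 → E3} {σ : E3 → E3} {K : Set E3}
    (h : TendstoUniformlyOn (fun (s : Finset ι) x => ∑ p ∈ s, F p x) σ atTop K)
    {g : α → E3} (hg : ∀ᵐ a ∂μ, g a ∈ K) {w : α → E3} {B : ℝ} (hw : ∀ᵐ a ∂μ, ‖w a‖ ≤ B)
    (hi : ∀ p, Integrable (fun a => ⟪F p (g a), w a⟫_ℝ) μ)
    (hσ : Integrable (fun a => ⟪σ (g a), w a⟫_ℝ) μ) :
    HasSum (fun p => ∫ a, ⟪F p (g a), w a⟫_ℝ ∂μ) (∫ a, ⟪σ (g a), w a⟫_ℝ ∂μ) := by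
  rw [HasSum, SummationFilter.unconditional_filter, Metric.tendsto_nhds]
  intro ε hε
  have hpos : 0 < (|B| + 1) * (μ.real univ + 1) := by positivity
  filter_upwards [Metric.tendstoUniformlyOn_iff.1 h _ (div_pos hε hpos)] with s hs
  rw [dist_eq_norm, ← integral_finsetSum _ fun p _ => hi p,
    ← integral_sub (integrable_finsetSum _ fun p _ => hi p) hσ]
  have hb : ∀ᵐ a ∂μ, ‖∑ p ∈ s, ⟪F p (g a), w a⟫_ℝ - ⟪σ (g a), w a⟫_ℝ‖ ≤
      ε / ((|B| + 1) * (μ.real univ + 1)) * |B| := by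
    filter_upwards [hg, hw] with a ha hwa
    rw [← sum_inner, ← inner_sub_left]
    refine (norm_inner_le_norm _ _).trans ?_
    have h1 := (hs _ ha).le
    rw [dist_comm, dist_eq_norm] at h1
    exact mul_le_mul h1 (hwa.trans (le_abs_self B)) (norm_nonneg _) (by positivity)
  refine (norm_integral_le_of_norm_le_const hb).trans_lt ?_
  have hm : 0 ≤ μ.real univ := measureReal_nonneg
  have hB := abs_nonneg B
  rw [div_mul_eq_mul_div, div_mul_eq_mul_div, div_lt_iff₀ hpos, mul_assoc]
  refine mul_lt_mul_of_pos_left ?_ hε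
  nlinarith

variable {R : ℝ} {Y : (ℓ : ℕ) → Fin (2 * ℓ + 1) → Poly} {σ : E3 → E3}
  {a : (ℓ : ℕ) → Fin (2 * ℓ + 1) → ℝ} {f : (ℓ : ℕ) → Fin (2 * ℓ + 1) → ℝ → ℝ}

/-- The mode with index `p` of an expansion. -/
noncomputable abbrev modeAt (R : ℝ) (Y : (ℓ : ℕ) → Fin (2 * ℓ + 1) → Poly)
    (a : (ℓ : ℕ) → Fin (2 * ℓ + 1) → ℝ) (f : (ℓ : ℕ) → Fin (2 * ℓ + 1) → ℝ → ℝ) (p : ModeIdx)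
    (x : E3) : E3 :=
  modeField R p.1 (Y p.1 p.2) (a p.1 p.2) (f p.1 p.2) x

theorem contDiffOn_modeField (hR : 0 < R) {l : ℕ} {P : Poly} (hP : IsSolidHarmonic l P) (a : ℝ)
    {f : ℝ → ℝ} (hf : Smooth R (scalarMode P f)) :
    ContDiffOn ℝ ∞ (modeField R l P a f) (ball R) :=
  (contDiffOn_potField hR ((Smooth.const a).mul' (smooth_ev R P)) hf).congr fun _ hx =>
    modeField_eq_potField hR hP a f hx

/-! ### Moments of a field that has a mode expansion. -/

section expansion
variable (hR : 0 < R) (hY : IsHarmonicBasis Y) (h : HasModeExpansion R Y σ a f)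
include hR hY h

theorem HasModeExpansion.continuousOn_mode (p : ModeIdx) :
    ContinuousOn (modeAt R Y a f p) (ball R) :=
  (contDiffOn_modeField hR (hY.harmonic _ _) _ (h.smooth _ _)).continuousOn

theorem HasModeExpansion.continuousOn : ContinuousOn σ (ball R) :=
  h.tendsto.continuousOn (Frequently.of_forall fun s =>
    continuousOn_finsetSum s fun p _ => h.continuousOn_mode hR hY p)

theorem HasModeExpansion.hasSum_moment {r : ℝ} (hr : r ∈ Icc (-R) R) {w : S2 → E3}
    (hw : Continuous w) :
    HasSum (fun p => ∫ q : S2, ⟪modeAt R Y a f p (r • (q : E3)), w q⟫_ℝ ∂area)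
      (∫ q : S2, ⟪σ (r • (q : E3)), w q⟫_ℝ ∂area) := by
  obtain ⟨B, hB⟩ := isCompact_univ.exists_bound_of_continuousOn (f := w) hw.continuousOn
  exact hasSum_integral_inner h.tendsto (g := fun q : S2 => r • (q : E3))
    (ae_of_all _ fun q => smul_mem_ball hr q) (ae_of_all _ fun q => hB q (mem_univ q))
    (fun p => integrable_inner_S2 (continuous_comp_smul (h.continuousOn_mode hR hY p) hr) hw)
    (integrable_inner_S2 (continuous_comp_smul (h.continuousOn hR hY) hr) hw)

variable {r : ℝ} (hr : r ∈ Ioc 0 R)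
include hr

/-- Moments are continuous under uniform convergence, and orthonormality leaves a single mode of the
series. The same holds for the other two kinds of moments. -/
theorem HasModeExpansion.radPair_eq (l : ℕ) (m : Fin (2 * l + 1)) :
    radPair (fun q => σ (r • (q : E3))) (Y l m) =
      ∑ i, coef (pd R i (scalarMode (Y l m) (f l m))) (X i * Y l m) r := by
  have hrI : r ∈ Icc (-R) R := ⟨by linarith [hr.1], hr.2⟩
  have hs := h.hasSum_moment hR hY hrI (continuous_radW (Y l m))
  rw [← RoundBall.radPair_eq] at hs
  have e : ∀ p : ModeIdx, ∫ q : S2, ⟪modeAt R Y a f p (r • (q : E3)), radW (Y l m) q⟫_ℝ ∂area =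
      (∑ i, coef (pd R i (scalarMode (Y p.1 p.2) (f p.1 p.2))) (X i * Y p.1 p.2) r)
        * if p = ⟨l, m⟩ then 1 else 0 := by
    intro p
    rw [← RoundBall.radPair_eq (fun q : S2 => modeAt R Y a f p (r • (q : E3)))]
    simp only [modeAt, modeField_eq_potField hR (hY.harmonic _ _) _ _ (smul_mem_ball hrI _)]
    rw [radPair_potField hR (h.smooth _ _) hr, coef_pd_scalarMode hR hr (h.smooth _ _)
      (by simpa using hY.sip_eq p p), hY.sip_eq p ⟨l, m⟩]
  simp only [e] at hs
  have := (hasSum_single (f := fun p : ModeIdx => (∑ i, coef (pd R i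
    (scalarMode (Y p.1 p.2) (f p.1 p.2))) (X i * Y p.1 p.2) r) * if p = ⟨l, m⟩ then (1 : ℝ) else 0)
    (⟨l, m⟩ : ModeIdx) (fun p hp => by rw [if_neg hp, mul_zero])).unique hs
  rw [← this]; simp

theorem HasModeExpansion.rotPair_eq (l : ℕ) (m : Fin (2 * l + 1)) :
    rotPair (fun q => σ (r • (q : E3))) (Y l m) = (l * (l + 1)) * (a l m * r ^ l) := by
  have hrI : r ∈ Icc (-R) R := ⟨by linarith [hr.1], hr.2⟩
  have hs := h.hasSum_moment hR hY hrI (continuous_rotV_S2 (Y l m))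
  change HasSum _ (rotPair _ _) at hs
  have e : ∀ p : ModeIdx, ∫ q : S2, ⟪modeAt R Y a f p (r • (q : E3)), rotV (Y l m) q⟫_ℝ ∂area =
      (l * (l + 1)) * (a p.1 p.2 * (r ^ p.1 * if p = ⟨l, m⟩ then 1 else 0)) := by
    intro p
    change rotPair (fun q : S2 => modeAt R Y a f p (r • (q : E3))) (Y l m) = _
    simp only [modeAt, modeField_eq_potField hR (hY.harmonic _ _) _ _ (smul_mem_ball hrI _)]
    rw [rotPair_potField hR ((Smooth.const _).mul' (smooth_ev R _)) (h.smooth _ _) hr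
      (hY.harmonic l m), coef_const_mul, coef_ev (hY.harmonic _ _).1, hY.sip_eq p ⟨l, m⟩]
  simp only [e] at hs
  have := (hasSum_single (f := fun p : ModeIdx => (l * (l + 1) : ℝ) *
      (a p.1 p.2 * (r ^ p.1 * if p = ⟨l, m⟩ then 1 else 0)))
    (⟨l, m⟩ : ModeIdx) (fun p hp => by rw [if_neg hp]; simp)).unique hs
  rw [← this]; simp

theorem HasModeExpansion.gradPair_eq (l : ℕ) (m : Fin (2 * l + 1)) :
    gradPair (fun q => σ (r • (q : E3))) (Y l m) = (l * (l + 1)) / r * f l m r := by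
  have hrI : r ∈ Icc (-R) R := ⟨by linarith [hr.1], hr.2⟩
  have hs := h.hasSum_moment hR hY hrI (continuous_gradW (Y l m))
  rw [← RoundBall.gradPair_eq] at hs
  have e : ∀ p : ModeIdx, ∫ q : S2, ⟪modeAt R Y a f p (r • (q : E3)), gradW (Y l m) q⟫_ℝ ∂area =
      (l * (l + 1)) / r * (f p.1 p.2 r * if p = ⟨l, m⟩ then 1 else 0) := by
    intro p
    rw [← RoundBall.gradPair_eq (fun q : S2 => modeAt R Y a f p (r • (q : E3)))]
    simp only [modeAt, modeField_eq_potField hR (hY.harmonic _ _) _ _ (smul_mem_ball hrI _)]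
    rw [gradPair_potField hR ((Smooth.const _).mul' (smooth_ev R _)) (h.smooth _ _) hr
      (hY.harmonic l m), coef_scalarMode hr.1, hY.sip_eq p ⟨l, m⟩]
  simp only [e] at hs
  have := (hasSum_single (f := fun p : ModeIdx => (l * (l + 1) : ℝ) / r *
      (f p.1 p.2 r * if p = ⟨l, m⟩ then 1 else 0))
    (⟨l, m⟩ : ModeIdx) (fun p hp => by rw [if_neg hp]; simp)).unique hs
  rw [← this]; simp

omit h hr in
-- On (0, R] the profile f coincides with a moment of the smooth function f(r)Y, so its one-sided
-- derivative at R exists. At r = 0 the two may differ, which does not affect the derivative at R.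
theorem sum_coef_pd_scalarMode_eq_derivWithin (l : ℕ) (m : Fin (2 * l + 1))
    (hf : Smooth R (scalarMode (Y l m) (f l m))) :
    ∑ i, coef (pd R i (scalarMode (Y l m) (f l m))) (X i * Y l m) R =
      derivWithin (f l m) (Icc 0 R) R := by
  have hRI : R ∈ Icc (-R) R := ⟨by linarith, le_rfl⟩
  have hP : sip (Y l m) (Y l m) = 1 := by simpa using hY.sip_eq ⟨l, m⟩ ⟨l, m⟩
  have h1 := (hasDerivWithinAt_coef hR hf hRI (Y l m)).mono
    (show Ioc 0 R ⊆ Icc (-R) R from fun t ht => ⟨by linarith [ht.1], ht.2⟩)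
  have h2 := h1.congr (f₁ := f l m) (fun t ht => by rw [coef_scalarMode ht.1, hP, mul_one])
    (by rw [coef_scalarMode hR, hP, mul_one])
  have h3 : HasDerivWithinAt (f l m) (∑ i, coef (pd R i (scalarMode (Y l m) (f l m)))
      (X i * Y l m) R) (Icc 0 R) R := by
    refine h2.mono_of_mem_nhdsWithin ?_
    have : Icc 0 R ∩ Ioi 0 ∈ 𝓝[Icc 0 R] R :=
      inter_mem self_mem_nhdsWithin (mem_nhdsWithin_of_mem_nhds (Ioi_mem_nhds hR))
    exact mem_of_superset this fun t ht => ⟨ht.2, ht.1.2⟩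
  exact (h3.derivWithin (uniqueDiffOn_Icc hR R ⟨hR.le, le_rfl⟩)).symm

omit hr in
theorem HasModeExpansion.boundaryPreserving_iff : BoundaryPreserving R σ ↔
    ∀ l m, derivWithin (f l m) (Icc 0 R) R = 0 := by
  have hRI : R ∈ Icc (-R) R := ⟨by linarith, le_rfl⟩
  have hrad : ∀ l m, radPair (fun q => σ (R • (q : E3))) (Y l m) =
      derivWithin (f l m) (Icc 0 R) R := fun l m => by
    rw [h.radPair_eq hR hY ⟨hR, le_rfl⟩,
      sum_coef_pd_scalarMode_eq_derivWithin hR hY l m (h.smooth l m)]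
  constructor
  · intro hb l m
    rw [← hrad, radPair]
    simp only [hb _, zero_mul, integral_zero]
  · intro hd
    have hc : Continuous fun q : S2 => σ (R • (q : E3)) :=
      continuous_comp_smul (h.continuousOn hR hY) hRI
    have hz := eq_zero_of_moments (g := fun q : S2 => ⟪σ (R • (q : E3)), (q : E3)⟫_ℝ)
      (hc.inner continuous_subtype_val) (fun l P hP => by
        have := moment_span hY hc continuous_radW radW_add radW_smul
          (fun l m => by
            rw [← RoundBall.radPair_eq (fun q : S2 => σ (R • (q : E3)))]
            rw [hrad, hd]) l P hP
        rwa [← RoundBall.radPair_eq (fun q : S2 => σ (R • (q : E3)))] at this)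
    exact fun q => congrFun hz q

end expansion

/-! ### Existence of the mode expansion -/

theorem summable_modeIdx : Summable fun p : ModeIdx => ((p.1 : ℝ) + 1)⁻¹ ^ 4 := by
  rw [summable_sigma_of_nonneg fun p => by positivity]
  refine ⟨fun l => Summable.of_finite, ?_⟩
  simp only [tsum_fintype, Finset.sum_const, Finset.card_univ, Fintype.card_fin, nsmul_eq_mul]
  have h2 : Summable fun l : ℕ => 2 * (((l + 1 : ℕ) : ℝ) ^ 2)⁻¹ :=
    ((summable_nat_add_iff 1).2 (Real.summable_nat_pow_inv.2 one_lt_two)).mul_left 2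
  refine Summable.of_nonneg_of_le (fun l => by positivity) (fun l => ?_) h2
  push_cast
  have hl : (0 : ℝ) ≤ l := Nat.cast_nonneg l
  have e : 2 * (((l : ℝ) + 1) ^ 2)⁻¹ = (2 * ((l : ℝ) + 1) ^ 2) * ((l : ℝ) + 1)⁻¹ ^ 4 := by
    field_simp
  rw [e]
  refine mul_le_mul_of_nonneg_right ?_ (by positivity)
  nlinarith

theorem norm_le_sum_abs (v : E3) : ‖v‖ ≤ ∑ i, |v i| := by
  conv_lhs => rw [eq_sum_basisVec v]
  refine (norm_sum_le _ _).trans (Finset.sum_le_sum fun i _ => ?_)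
  rw [norm_smul]; simp [basisVec]

theorem norm_cross_le (u v : E3) : ‖cross u v‖ ≤ ‖u‖ * ‖v‖ := by
  refine abs_le_of_sq_le_sq' ?_ (by positivity) |>.2
  rw [mul_pow, norm_sq_eq_sum, norm_sq_eq_sum, norm_sq_eq_sum]
  simp only [Fin.sum_univ_three, cross_apply_zero, cross_apply_one, cross_apply_two]
  nlinarith [sq_nonneg (u 0 * v 0 + u 1 * v 1 + u 2 * v 2)]

/-- Partial derivatives of a solid harmonic are solid harmonics of one degree less, so
`exists_sup_bound` applies to them; one factor l + 1 comes from it and another from the norm of the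
derivative. -/
theorem exists_rotV_bound : ∃ K : ℝ, 0 ≤ K ∧ ∀ (l : ℕ) (P : Poly), IsSolidHarmonic l P →
    sip P P = 1 → ∀ q : S2, |ev P (q : E3)| ≤ K * ((l : ℝ) + 1) ^ 2 ∧
      ‖rotV P (q : E3)‖ ≤ K * ((l : ℝ) + 1) ^ 2 := by
  obtain ⟨K, hK, hb⟩ := exists_sup_bound
  refine ⟨12 * K, by positivity, fun l P hP h1 q => ?_⟩
  have hl : (0 : ℝ) ≤ l := Nat.cast_nonneg l
  have hd : ∀ i, |ev (pderiv i P) (q : E3)| ≤ 2 * K * ((l : ℝ) + 1) ^ 2 := by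
    intro i
    have h2 := hb (l - 1) _ (hP.pderiv i) q
    have h3 := sip_pderiv_le hP i
    rw [h1, Real.sqrt_one, mul_one] at h3
    have h4 : ((l - 1 : ℕ) : ℝ) ≤ l := by exact_mod_cast Nat.sub_le l 1
    calc _ ≤ K * (((l - 1 : ℕ) : ℝ) + 1) * √(sip (pderiv i P) (pderiv i P)) := h2
      _ ≤ K * ((l : ℝ) + 1) * (2 * (l + 1)) := by gcongr
      _ = _ := by ring
  have hr : ∀ k, |rotV P (q : E3) k| ≤ 4 * K * ((l : ℝ) + 1) ^ 2 := by
    intro k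
    rw [rotV_apply, rotP]
    simp only [ev_sub, ev_mul, ev_X]
    refine (abs_sub _ _).trans ?_
    rw [abs_mul, abs_mul]
    have := mul_le_mul (abs_apply_S2_le q (k + 1)) (hd (k + 2)) (abs_nonneg _) zero_le_one
    have := mul_le_mul (abs_apply_S2_le q (k + 2)) (hd (k + 1)) (abs_nonneg _) zero_le_one
    linarith
  constructor
  · have h2 := hb l P hP q
    rw [h1, Real.sqrt_one, mul_one] at h2
    refine h2.trans ?_
    have : K * ((l : ℝ) + 1) ≤ K * ((l : ℝ) + 1) ^ 2 := by
      refine mul_le_mul_of_nonneg_left ?_ hK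
      nlinarith
    nlinarith [mul_nonneg hK (sq_nonneg ((l : ℝ) + 1))]
  · refine (norm_le_sum_abs _).trans ((Finset.sum_le_sum fun k _ => hr k).trans ?_)
    simp only [Finset.sum_const, Finset.card_univ, Fintype.card_fin, nsmul_eq_mul]
    apply le_of_eq; push_cast; ring

theorem rotV_of_degree_zero {P : Poly} (hP : P.IsHomogeneous 0) (x : E3) : rotV P x = 0 := by
  ext k
  rw [rotV_apply, rotP, isHomogeneous_pderiv_zero hP, isHomogeneous_pderiv_zero hP]
  simp [ev]

theorem ball_subset_closure (hR : 0 < R) : ball R ⊆ closure (ball R \ {0}) := by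
  have h1 : (0 : E3) ∈ closure (ball R \ {0}) := by
    have hc : Tendsto (fun t : ℝ => t • basisVec 0) (𝓝[>] 0) (𝓝 ((0 : ℝ) • basisVec 0)) :=
      ((continuous_id.smul continuous_const).tendsto 0).mono_left nhdsWithin_le_nhds
    rw [zero_smul] at hc
    refine mem_closure_of_tendsto hc ?_
    filter_upwards [Ioc_mem_nhdsGT hR] with t ht
    have hn : ‖t • basisVec 0‖ = t := by
      rw [norm_smul, Real.norm_of_nonneg ht.1.le]; simp [basisVec]
    refine ⟨by rw [mem_closedBall_zero_iff, hn]; exact ht.2, ?_⟩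
    rw [mem_singleton_iff, ← norm_eq_zero, hn]; exact ht.1.ne'
  intro x hx
  rcases eq_or_ne x 0 with rfl | hx0
  · exact h1
  · exact subset_closure ⟨hx, hx0⟩

theorem exists_polar {x : E3} (hx : x ∈ ball R) (hx0 : x ≠ 0) :
    ∃ r ∈ Ioc 0 R, ∃ q : S2, x = r • (q : E3) :=
  ⟨‖x‖, ⟨norm_pos_iff.2 hx0, mem_closedBall_zero_iff.1 hx⟩,
    ⟨normal x, by rw [mem_sphere_zero_iff_norm, norm_normal hx0]⟩, (norm_smul_normal x).symm⟩

/-- The polar formula for a mode holds only off the origin; continuity carries the bound over. -/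
theorem norm_le_of_norm_le_polar (hR : 0 < R) {V : E3 → E3} (hV : ContinuousOn V (ball R)) {M : ℝ}
    (h : ∀ r ∈ Ioc 0 R, ∀ q : S2, ‖V (r • (q : E3))‖ ≤ M) : ∀ x ∈ ball R, ‖V x‖ ≤ M := by
  intro x hx
  have hx' := ball_subset_closure hR hx
  have hne : (𝓝[ball R \ {0}] x).NeBot := mem_closure_iff_nhdsWithin_neBot.1 hx'
  have ht : Tendsto (fun y => ‖V y‖) (𝓝[ball R \ {0}] x) (𝓝 ‖V x‖) :=
    ((hV x hx).mono sdiff_subset).norm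
  refine le_of_tendsto ht ?_
  filter_upwards [self_mem_nhdsWithin] with y hy
  obtain ⟨r, hr, q, rfl⟩ := exists_polar hy.1 hy.2
  exact h r hr q

theorem exists_hasModeExpansion (hR : 0 < R) (hY : IsHarmonicBasis Y)
    (hσ : ContDiffOn ℝ ∞ σ (ball R)) (hm : MomentumConstraint R σ) :
    ∃ a f, HasModeExpansion R Y σ a f := by
  obtain ⟨A, u, hA, hu, hΔ, hpot⟩ := exists_potField hR hσ hm
  choose a ha using fun l m => coef_eq_of_harmonic hR hA hΔ (hY.harmonic l m)
  let f : (l : ℕ) → Fin (2 * l + 1) → ℝ → ℝ := fun l m => coef u (Y l m)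
  have hf : ∀ l m, Smooth R (scalarMode (Y l m) (f l m)) := fun l m =>
    smooth_scalarMode_coef hR hu (hY.harmonic l m)
  have hsip : ∀ l m, sip (Y l m) (Y l m) = 1 := fun l m => by simpa using hY.sip_eq ⟨l, m⟩ ⟨l, m⟩
  obtain ⟨K, hK, hKb⟩ := exists_rotV_bound
  -- The exponent 6 pays for the growth (l+1)² of the harmonics and leaves the fourth power that
  -- `summable_modeIdx` needs.
  obtain ⟨A1, hA1, hAb⟩ := exists_decay hR hA 6
  obtain ⟨A2, hA2, hub⟩ := exists_decay hR hu 6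
  have hbound : ∀ p : ModeIdx, ∀ x ∈ ball R,
      ‖modeAt R Y a f p x‖ ≤ (A1 * K + 2 * A2 * K) * ((p.1 : ℝ) + 1)⁻¹ ^ 4 := by
    rintro ⟨l, m⟩
    refine norm_le_of_norm_le_polar hR
      (contDiffOn_modeField hR (hY.harmonic l m) _ (hf l m)).continuousOn fun r hr q => ?_
    have hP := hY.harmonic l m
    have hr0 : r ∈ Icc 0 R := ⟨hr.1.le, hr.2⟩
    have hl : (0 : ℝ) < (l : ℝ) + 1 := by positivity
    obtain ⟨hb1, hb2⟩ := hKb l _ hP (hsip l m) q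
    have h1 : |a l m * r ^ l| ≤ A1 / (l + 1) ^ 6 := by
      rw [← ha l m r hr0]; exact (hAb l _ hP (hsip l m) r hr0).1
    have h2 : |∑ j, coef (pd R j (scalarMode (Y l m) (f l m))) (X j * Y l m) r| ≤
        A2 / (l + 1) ^ 6 := by
      have hrI : r ∈ Icc (-R) R := ⟨by linarith [hr.1], hr.2⟩
      have hsub : Ioc 0 R ⊆ Icc (-R) R := fun t ht => ⟨by linarith [ht.1], ht.2⟩
      have d1 := (hasDerivWithinAt_coef hR (hf l m) hrI (Y l m)).mono hsub
      have d2 := (hasDerivWithinAt_coef hR hu hrI (Y l m)).mono hsub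
      have d3 := d2.congr (f₁ := coef (scalarMode (Y l m) (f l m)) (Y l m))
        (fun t ht => by rw [coef_scalarMode ht.1, hsip, mul_one])
        (by rw [coef_scalarMode hr.1, hsip, mul_one])
      rw [(uniqueDiffOn_Ioc 0 R r hr).eq_deriv _ d1 d3]
      exact (hub l _ hP (hsip l m) r hr0).2.1
    have hgW : ‖gradW (Y l m) q‖ ≤ ‖rotV (Y l m) (q : E3)‖ := by
      refine (norm_cross_le _ _).trans ?_
      rw [norm_S2, mul_one]
    have h3 : ‖(f l m r / r) • gradW (Y l m) q‖ ≤ A2 / (l + 1) ^ 6 * (K * ((l : ℝ) + 1) ^ 2) := by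
      rw [norm_smul]
      -- In degree zero f(r)/r may be unbounded near the origin, but the tangential gradient it
      -- multiplies is zero.
      rcases Nat.eq_zero_or_pos l with rfl | hl1
      · have : gradW (Y 0 m) q = 0 := by
          unfold gradW
          rw [rotV_of_degree_zero hP.1]
          ext k; simp [cross_apply']
        rw [this, norm_zero, mul_zero]
        positivity
      · refine mul_le_mul ?_ (hgW.trans hb2) (norm_nonneg _) (by positivity)
        rw [Real.norm_eq_abs, abs_div, abs_of_pos hr.1, div_le_iff₀ hr.1]
        exact (hub l _ hP (hsip l m) r hr0).2.2 hl1
    rw [modeField_smul hR hr _ (hf l m) (hsip l m)]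
    have t1 : ‖(a l m * r ^ l) • rotV (Y l m) (q : E3)‖ ≤
        A1 / (l + 1) ^ 6 * (K * ((l : ℝ) + 1) ^ 2) := by
      rw [norm_smul]
      exact mul_le_mul h1 hb2 (norm_nonneg _) (by positivity)
    have t2 : ‖(∑ j, coef (pd R j (scalarMode (Y l m) (f l m))) (X j * Y l m) r) •
        radW (Y l m) q‖ ≤ A2 / (l + 1) ^ 6 * (K * ((l : ℝ) + 1) ^ 2) := by
      rw [norm_smul, radW, norm_smul, norm_S2, mul_one]
      exact mul_le_mul h2 hb1 (norm_nonneg _) (by positivity)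
    refine ((norm_add_le _ _).trans (add_le_add (norm_add_le _ _) le_rfl)).trans
      ((add_le_add (add_le_add t1 t2) h3).trans (le_of_eq ?_))
    field_simp
    ring
  have htend := tendstoUniformlyOn_tsum (summable_modeIdx.mul_left (A1 * K + 2 * A2 * K)) hbound
  have hexp : HasModeExpansion R Y (fun x => ∑' p, modeAt R Y a f p x) a f := ⟨hf, htend⟩
  refine ⟨a, f, hf, htend.congr_right ?_⟩
  have hcT := hexp.continuousOn hR hY
  -- The sum of the series and σ are both continuous, so it suffices to compare their three kinds of
  -- moments on each sphere of positive radius.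
  refine EqOn.of_subset_closure (s := ball R \ {0}) ?_ hcT hσ.continuousOn sdiff_subset
    (ball_subset_closure hR)
  intro x hx
  obtain ⟨r, hr, q, rfl⟩ := exists_polar hx.1 hx.2
  have hrI : r ∈ Icc (-R) R := ⟨by linarith [hr.1], hr.2⟩
  have hr0 : r ∈ Icc 0 R := ⟨hr.1.le, hr.2⟩
  have c1 := continuous_comp_smul hcT hrI
  have c2 := continuous_comp_smul hσ.continuousOn hrI
  have hσpot : (fun q : S2 => σ (r • (q : E3))) = fun q : S2 => potField R A u (r • (q : E3)) := by
    funext q; exact hpot (smul_mem_ball hrI q)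
  have hz := eq_zero_of_basis_moments hY
    (V := fun q : S2 => (∑' p, modeAt R Y a f p (r • (q : E3))) - σ (r • (q : E3))) (c1.sub c2)
    (fun l m => by
      rw [radPair_eq]
      simp only [inner_sub_left]
      rw [integral_sub (integrable_inner_S2 c1 (continuous_radW _))
        (integrable_inner_S2 c2 (continuous_radW _)), ← radPair_eq, ← radPair_eq,
        hexp.radPair_eq hR hY hr, hσpot, radPair_potField hR hu hr, sub_eq_zero]
      have hsub : Ioc 0 R ⊆ Icc (-R) R := fun t ht => ⟨by linarith [ht.1], ht.2⟩
      have d1 := (hasDerivWithinAt_coef hR (hf l m) hrI (Y l m)).mono hsub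
      have d2 := (hasDerivWithinAt_coef hR hu hrI (Y l m)).mono hsub
      have d3 := d2.congr (f₁ := coef (scalarMode (Y l m) (f l m)) (Y l m))
        (fun t ht => by rw [coef_scalarMode ht.1, hsip, mul_one])
        (by rw [coef_scalarMode hr.1, hsip, mul_one])
      exact (uniqueDiffOn_Ioc 0 R r hr).eq_deriv _ d1 d3)
    (fun l m => by
      unfold rotPair
      simp only [inner_sub_left]
      rw [integral_sub (integrable_inner_S2 c1 (continuous_rotV_S2 _))
        (integrable_inner_S2 c2 (continuous_rotV_S2 _)), sub_eq_zero]
      change rotPair _ _ = rotPair (fun q : S2 => σ (r • (q : E3))) _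
      rw [hexp.rotPair_eq hR hY hr, hσpot, rotPair_potField hR hA hu hr (hY.harmonic l m),
        ha l m r hr0])
    (fun l m => by
      rw [gradPair_eq]
      simp only [inner_sub_left]
      rw [integral_sub (integrable_inner_S2 c1 (continuous_gradW _))
        (integrable_inner_S2 c2 (continuous_gradW _)), ← gradPair_eq, ← gradPair_eq,
        hexp.gradPair_eq hR hY hr, hσpot, gradPair_potField hR hA hu hr (hY.harmonic l m),
        sub_self])
  have := congrFun hz q
  simp only [Pi.zero_apply] at this
  exact sub_eq_zero.1 this

end RoundBall

namespace RoundBall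
open MvPolynomial (X C pderiv)

/-! ### Superpositions of modes satisfy the momentum constraint -/

section converse
variable {R : ℝ} (hR : 0 < R)

theorem integrable_ball {g : E3 → ℝ} (hg : ContinuousOn g (ball R)) :
    Integrable g (volume.restrict (ball R)) :=
  hg.integrableOn_compact (isCompact_closedBall _ _)

instance : IsFiniteMeasure (volume.restrict (ball R)) :=
  ⟨by rw [Measure.restrict_apply_univ]; exact measure_closedBall_lt_top⟩

include hR

theorem eq_zero_of_integral_ball {g : E3 → ℝ} (hg : ContinuousOn g (ball R))
    (h0 : ∀ x ∈ ball R, 0 ≤ g x) (h : ∫ x in ball R, g x = 0) : ∀ x ∈ ball R, g x = 0 := by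
  have h1 := (setIntegral_eq_zero_iff_of_nonneg_ae
    ((ae_restrict_iff' measurableSet_closedBall).2 (ae_of_all _ h0)) (integrable_ball hg)).1 h
  refine Measure.eqOn_of_ae_eq (μ := volume) h1 hg continuousOn_const ?_
  rw [interior_closedBall _ hR.ne', closure_ball _ hR.ne']

/-- Green's formula for the formally self-adjoint operator curl curl; the boundary terms contain W
or its first derivatives and drop out. -/
theorem integral_curlCurl_mul {V W : E3 → E3} (hV : ContDiffOn ℝ ∞ V (ball R))
    (hW : ContDiffOn ℝ ∞ W (ball R)) (hW0 : ∀ q : S2, W (R • (q : E3)) = 0)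
    (hW1 : ∀ i j, ∀ q : S2, dcomp R W i j (R • (q : E3)) = 0) :
    ∫ x in ball R, ∑ j, V x j * curlCurl R W j x = ∫ x in ball R, ∑ j, curlCurl R V j x * W x j := by
  have sV := contDiffOn_iff_smooth.1 hV
  have sW := contDiffOn_iff_smooth.1 hW
  have dV : ∀ i j, Smooth R fun x => dcomp R V i j x - dcomp R V j i x := fun i j =>
    (Smooth.dcomp hR hV i j).sub' (Smooth.dcomp hR hV j i)
  have dW : ∀ i j, Smooth R fun x => dcomp R W i j x - dcomp R W j i x := fun i j =>
    (Smooth.dcomp hR hW i j).sub' (Smooth.dcomp hR hW j i)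
  have s1 : ∀ i j, Smooth R fun x => V x j * (dcomp R W i j x - dcomp R W j i x) := fun i j =>
    (sV j).mul' (dW i j)
  have s2 : ∀ i j, Smooth R fun x => W x j * (dcomp R V i j x - dcomp R V j i x) := fun i j =>
    (sW j).mul' (dV i j)
  have h := integral_div_ball hR (V := fun i x => ∑ j,
      (V x j * (dcomp R W i j x - dcomp R W j i x) - W x j * (dcomp R V i j x - dcomp R V j i x)))
    fun i => Smooth.sum' fun j _ => (s1 i j).sub' (s2 i j)
  have hf : ∀ i, coef (fun x => ∑ j, (V x j * (dcomp R W i j x - dcomp R W j i x) -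
      W x j * (dcomp R V i j x - dcomp R V j i x))) (X i) R = 0 := fun i => by
    simp [coef, hW0, hW1]
  simp only [hf, Finset.sum_const_zero, mul_zero] at h
  rw [← sub_eq_zero, ← integral_sub
    (integrable_ball (Smooth.sum' fun j _ => (sV j).mul' (Smooth.curlCurl hR hW j)).continuousOn)
    (integrable_ball (Smooth.sum' fun j _ => (Smooth.curlCurl hR hV j).mul' (sW j)).continuousOn),
    ← h]
  refine setIntegral_congr_fun measurableSet_closedBall fun x hx => ?_
  have e : ∀ i, pd R i (fun x => ∑ j, (V x j * (dcomp R W i j x - dcomp R W j i x)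
        - W x j * (dcomp R V i j x - dcomp R V j i x))) x =
      ∑ j, (V x j * pd R i (fun x => dcomp R W i j x - dcomp R W j i x) x
        + (dcomp R W i j x - dcomp R W j i x) * dcomp R V i j x
        - (W x j * pd R i (fun x => dcomp R V i j x - dcomp R V j i x) x
          + (dcomp R V i j x - dcomp R V j i x) * dcomp R W i j x)) := fun i => by
    rw [pd_sum hR (fun j _ => (s1 i j).sub' (s2 i j)) hx]
    refine Finset.sum_congr rfl fun j _ => ?_
    rw [pd_sub hR (s1 i j) (s2 i j) hx, pd_mul hR (sV j) (dW i j) hx, pd_mul hR (sW j) (dV i j) hx]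
    rfl
  simp only [e]
  simp only [curlCurl, Fin.sum_univ_three]
  ring

/-- Uniform convergence says nothing about derivatives, so all of them are moved to a test field.
The modes satisfy the constraint and pair to zero with curl curl W, hence so does σ; choosing W as a
weight times curl curl σ gives the strong equation. -/
theorem HasModeExpansion.momentumConstraint {Y : (ℓ : ℕ) → Fin (2 * ℓ + 1) → Poly} {σ : E3 → E3}
    {a : (ℓ : ℕ) → Fin (2 * ℓ + 1) → ℝ} {f : (ℓ : ℕ) → Fin (2 * ℓ + 1) → ℝ → ℝ}
    (hY : IsHarmonicBasis Y) (hσ : ContDiffOn ℝ ∞ σ (ball R))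
    (h : HasModeExpansion R Y σ a f) : MomentumConstraint R σ := by
  have hRI : R ∈ Icc (-R) R := ⟨by linarith, le_rfl⟩
  have hmode : ∀ p : ModeIdx, ContDiffOn ℝ ∞ (modeAt R Y a f p) (ball R) := fun p =>
    contDiffOn_modeField hR (hY.harmonic _ _) _ (h.smooth _ _)
  have hmodeE : ∀ p : ModeIdx, ∀ x ∈ ball R, ∀ j, curlCurl R (modeAt R Y a f p) j x = 0 := by
    intro p
    rw [← momentumConstraint_iff hR (hmode p)]
    have hA : Smooth R fun y => a p.1 p.2 * ev (Y p.1 p.2) y :=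
      (Smooth.const _).mul' (smooth_ev R _)
    have hm := momentum_potField hR hA (h.smooth p.1 p.2) (fun x hx => by
      have e : ∀ i, pd R i (pd R i fun y => a p.1 p.2 * ev (Y p.1 p.2) y) x =
          a p.1 p.2 * ev (pderiv i (pderiv i (Y p.1 p.2))) x := fun i => by
        rw [pd_congr (v := fun y => a p.1 p.2 * ev (pderiv i (Y p.1 p.2)) y) (fun y hy => by
          rw [pd_const_mul hR (smooth_ev R _) hy, pd_ev hR _ _ hy]) hx,
          pd_const_mul hR (smooth_ev R _) hx, pd_ev hR _ _ hx]
      have h2 := congrArg (fun Q => ev Q x) (hY.harmonic p.1 p.2).2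
      simp only [e, ← Finset.mul_sum, Fin.sum_univ_three, ev_add] at h2 ⊢
      rw [h2]; simp [ev])
    have heq : EqOn (modeAt R Y a f p) (potField R (fun y => a p.1 p.2 * ev (Y p.1 p.2) y)
        (scalarMode (Y p.1 p.2) (f p.1 p.2))) (ball R) := fun x hx =>
      modeField_eq_potField hR (hY.harmonic _ _) _ _ hx
    intro x hx j
    rw [← hm x hx j]
    refine Finset.sum_congr rfl fun i _ => pd_congr (fun y hy => ?_) hx
    have ed : ∀ i j, dcomp R (modeAt R Y a f p) i j y = dcomp R (potField R
        (fun y => a p.1 p.2 * ev (Y p.1 p.2) y) (scalarMode (Y p.1 p.2) (f p.1 p.2))) i j y :=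
      fun i j => pd_congr (fun z hz => by rw [heq hz]) hy
    rw [ed, ed]
  rw [momentumConstraint_iff hR hσ]
  -- The weight vanishes on the boundary, so W = χ² curl curl σ vanishes there together with its
  -- first derivatives, while χ is positive in the interior.
  set χ : E3 → ℝ := fun x => R ^ 2 - ∑ k, x k * x k with hχ
  have sχ : Smooth R χ := (Smooth.const _).sub'
    (Smooth.sum' fun k _ => (Smooth.coord k).mul' (Smooth.coord k))
  have sE := Smooth.curlCurl hR hσ
  let W : E3 → E3 := fun x => WithLp.toLp 2 fun j => χ x * (χ x * curlCurl R σ j x)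
  have sW : ∀ j, Smooth R fun x => χ x * (χ x * curlCurl R σ j x) := fun j =>
    sχ.mul' (sχ.mul' (sE j))
  have hW : ContDiffOn ℝ ∞ W (ball R) := contDiffOn_iff_smooth.2 sW
  have hχ0 : ∀ q : S2, χ (R • (q : E3)) = 0 := by
    intro q
    have := sum_sq_S2 q
    simp only [hχ, Fin.sum_univ_three, PiLp.smul_apply, smul_eq_mul]
    linear_combination -R ^ 2 * this
  have hW0 : ∀ q : S2, W (R • (q : E3)) = 0 := fun q => by
    ext j; simp [W, hχ0]
  have hW1 : ∀ i j, ∀ q : S2, dcomp R W i j (R • (q : E3)) = 0 := by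
    intro i j q
    have hx := smul_mem_ball hRI q
    change pd R i (fun x => χ x * (χ x * curlCurl R σ j x)) _ = 0
    rw [pd_mul hR sχ (sχ.mul' (sE j)) hx, hχ0]
    ring
  let w : E3 → E3 := fun x => WithLp.toLp 2 fun j => curlCurl R W j x
  have hw : ContinuousOn w (ball R) :=
    (contDiffOn_iff_smooth.2 fun j => Smooth.curlCurl hR hW j).continuousOn
  obtain ⟨B, hB⟩ := (isCompact_closedBall (0 : E3) R).exists_bound_of_continuousOn hw
  have hs := hasSum_integral_inner (μ := volume.restrict (ball R)) h.tendsto (g := fun x => x)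
    ((ae_restrict_iff' measurableSet_closedBall).2 (ae_of_all _ fun x hx => hx))
    ((ae_restrict_iff' measurableSet_closedBall).2 (ae_of_all _ hB))
    (fun p => integrable_ball ((h.continuousOn_mode hR hY p).inner hw))
    (integrable_ball (hσ.continuousOn.inner hw))
  have hin : ∀ V : E3 → E3, ContDiffOn ℝ ∞ V (ball R) →
      ∫ x in ball R, ⟪V x, w x⟫_ℝ = ∫ x in ball R, ∑ j, curlCurl R V j x * W x j := by
    intro V hV
    simp only [inner_eq_sum]
    exact integral_curlCurl_mul hR hV hW hW0 hW1
  have hzero : ∀ p : ModeIdx, ∫ x in ball R, ⟪modeAt R Y a f p x, w x⟫_ℝ = 0 := by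
    intro p
    rw [hin _ (hmode p), ← integral_zero E3 ℝ (μ := volume.restrict (ball R))]
    refine setIntegral_congr_fun measurableSet_closedBall fun x hx => ?_
    simp [hmodeE p x hx]
  have hint : ∫ x in ball R, ⟪σ x, w x⟫_ℝ = 0 := by
    have hs' : HasSum (fun p : ModeIdx => ∫ x in ball R, ⟪modeAt R Y a f p x, w x⟫_ℝ)
      (∫ x in ball R, ⟪σ x, w x⟫_ℝ) := hs
    simp only [hzero] at hs'
    exact hs'.unique hasSum_zero
  rw [hin σ hσ] at hint
  have hz := eq_zero_of_integral_ball hR (g := fun x => ∑ j, curlCurl R σ j x * W x j)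
    (Smooth.sum' fun j _ => (sE j).mul' (sW j)).continuousOn
    (fun x _ => Finset.sum_nonneg fun j _ => by
      change 0 ≤ curlCurl R σ j x * (χ x * (χ x * curlCurl R σ j x))
      nlinarith [sq_nonneg (χ x * curlCurl R σ j x)]) hint
  have hopen : ∀ j, EqOn (curlCurl R σ j) 0 (Metric.ball 0 R) := by
    intro j x hx
    have hxb : x ∈ ball R := ball_subset_closedBall hx
    have hn : 0 < χ x := by
      have h1 := norm_sq_eq_sum x
      have h2 : ‖x‖ < R := mem_ball_zero_iff.1 hx
      simp only [hχ]
      have h3 : ∑ k, x k * x k = ‖x‖ ^ 2 := by rw [h1]; simp only [sq]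
      rw [h3]
      nlinarith [norm_nonneg x]
    have h1 := (Finset.sum_eq_zero_iff_of_nonneg (fun j _ => by
      change 0 ≤ curlCurl R σ j x * (χ x * (χ x * curlCurl R σ j x))
      nlinarith [sq_nonneg (χ x * curlCurl R σ j x)])).1 (hz x hxb) j (Finset.mem_univ j)
    have h2 : (χ x * curlCurl R σ j x) ^ 2 = 0 := by
      rw [← h1]; change _ = curlCurl R σ j x * (χ x * (χ x * curlCurl R σ j x)); ring
    exact (mul_eq_zero.1 (pow_eq_zero_iff two_ne_zero |>.1 h2)).resolve_left hn.ne'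
  intro x hx j
  exact EqOn.of_subset_closure (hopen j) (sE j).continuousOn continuousOn_const
    ball_subset_closedBall (by rw [closure_ball _ hR.ne']) hx

end converse

end RoundBall

namespace RoundBall
open MvPolynomial (X C pderiv)

/-! ### The boundary operator -/

/-- The normal derivative of a vector field at the boundary point `R • q`. -/
noncomputable def radD (R : ℝ) (τ : E3 → E3) (q : S2) : E3 :=
  WithLp.toLp 2 fun j => ∑ i, dcomp R τ i j (R • (q : E3)) * (q : E3) i

theorem radD_apply (R : ℝ) (τ : E3 → E3) (q : S2) (j : Fin 3) :
    radD R τ q j = ∑ i, dcomp R τ i j (R • (q : E3)) * (q : E3) i := rfl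

section opD
variable {R : ℝ} (hR : 0 < R) {τ : E3 → E3}
include hR

theorem continuous_radD (hτ : ContDiffOn ℝ ∞ τ (ball R)) : Continuous (radD R τ) := by
  have hRI : R ∈ Icc (-R) R := ⟨by linarith, le_rfl⟩
  refine (PiLp.continuous_toLp 2 _).comp (continuous_pi fun j => continuous_finsetSum _ fun i _ => ?_)
  exact (continuous_comp_smul (Smooth.dcomp hR hτ i j).continuousOn hRI).mul (by fun_prop)

theorem hasDerivWithinAt_ray_field (hτ : ContDiffOn ℝ ∞ τ (ball R)) (q : S2) :
    HasDerivWithinAt (fun t : ℝ => τ (t • (q : E3))) (radD R τ q) (Ioc 0 R) R := by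
  have hRI : R ∈ Icc (-R) R := ⟨by linarith, le_rfl⟩
  rw [hasDerivWithinAt_iff_hasFDerivWithinAt, hasFDerivWithinAt_euclidean]
  intro j
  have h := ((hasDerivWithinAt_comp_ray (contDiffOn_iff_smooth.1 hτ j) hRI q).mono
    (show Ioc 0 R ⊆ Icc (-R) R from fun t ht => ⟨by linarith [ht.1], ht.2⟩)).hasFDerivWithinAt
  refine h.congr_fderiv ?_
  ext
  simp [radD_apply, dcomp]

/-- Along a ray the normal is constant, so the normal derivative commutes with the tangential
projection; the extrinsic curvature of the sphere is R⁻¹ on tangent vectors. -/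
theorem opD_eq (hτ : ContDiffOn ℝ ∞ τ (ball R)) (hb : BoundaryPreserving R τ) (q : S2) :
    opD R τ q = radD R τ q - ⟪radD R τ q, (q : E3)⟫_ℝ • (q : E3) - R⁻¹ • τ (R • (q : E3)) := by
  have hRI : R ∈ Icc (-R) R := ⟨by linarith, le_rfl⟩
  have hx0 : R • (q : E3) ≠ 0 := by
    rw [← norm_ne_zero_iff, norm_smul_S2 hR.le]; exact hR.ne'
  have hxb := smul_mem_ball hRI q
  have hK : extrinsicCurvature (R • (q : E3)) (τ (R • (q : E3))) = R⁻¹ • τ (R • (q : E3)) := by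
    rw [extrinsicCurvature, fderiv_normal hx0, norm_smul_S2 hR.le]
    rw [inner_smul_left, real_inner_comm, hb q, mul_zero]
  have hd : DifferentiableWithinAt ℝ (fun y => tangential y (τ y)) (ball R) (R • (q : E3)) := by
    have h1 : DifferentiableWithinAt ℝ τ (ball R) (R • (q : E3)) :=
      hτ.differentiableOn (by simp) _ hxb
    have h2 : DifferentiableWithinAt ℝ normal (ball R) (R • (q : E3)) :=
      ((contDiffAt_normal hx0).differentiableAt (by simp)).differentiableWithinAt
    exact h1.sub ((h1.inner ℝ h2).smul h2)
  have h1 := hd.hasFDerivWithinAt.comp_hasDerivWithinAt (f := fun t : ℝ => t • (q : E3))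
    (s := Ioc 0 R) R ((hasDerivAt_id R).smul_const (q : E3)).hasDerivWithinAt
    (fun t ht => smul_mem_ball ⟨by linarith [ht.1], ht.2⟩ q)
  rw [one_smul] at h1
  have h2 := hasDerivWithinAt_ray_field hR hτ q
  have h3 := h2.sub ((h2.inner ℝ (hasDerivWithinAt_const R (Ioc 0 R) (q : E3))).smul_const (q : E3))
  have h4 := h3.congr (f₁ := (fun y => tangential y (τ y)) ∘ fun t : ℝ => t • (q : E3))
    (fun t ht => by simp only [Function.comp, tangential, normal_smul ht.1]; rfl)
    (by simp only [Function.comp, tangential, normal_smul hR]; rfl)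
  have h5 := (uniqueDiffOn_Ioc 0 R R ⟨hR, le_rfl⟩).eq_deriv _ h1 h4
  rw [opD, hK, normalDeriv, normal_smul hR, h5, tangential, normal_smul hR]
  congr 1
  simp only [inner_zero_right, zero_add, inner_sub_left, inner_smul_left,
    real_inner_self_eq_norm_sq, norm_S2]
  simp

theorem continuous_opD (hτ : ContDiffOn ℝ ∞ τ (ball R)) (hb : BoundaryPreserving R τ) :
    Continuous (opD R τ) := by
  have hRI : R ∈ Icc (-R) R := ⟨by linarith, le_rfl⟩
  have h1 := continuous_radD hR hτ
  have h2 : Continuous fun q : S2 => ⟪radD R τ q, (q : E3)⟫_ℝ := h1.inner continuous_subtype_val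
  have h3 : Continuous fun q : S2 => R⁻¹ • τ (R • (q : E3)) :=
    Continuous.const_smul (continuous_comp_smul hτ.continuousOn hRI) R⁻¹
  exact ((h1.sub (h2.smul continuous_subtype_val)).sub h3).congr fun q => (opD_eq hR hτ hb q).symm

theorem inner_opD (hτ : ContDiffOn ℝ ∞ τ (ball R)) (hb : BoundaryPreserving R τ) (q : S2) :
    ⟪opD R τ q, (q : E3)⟫_ℝ = 0 := by
  rw [opD_eq hR hτ hb, inner_sub_left, inner_sub_left, inner_smul_left, inner_smul_left, hb q,
    real_inner_self_eq_norm_sq, norm_S2]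
  simp

theorem radPair_opD (hτ : ContDiffOn ℝ ∞ τ (ball R)) (hb : BoundaryPreserving R τ) (Z : Poly) :
    radPair (opD R τ) Z = 0 := by
  simp only [radPair, inner_opD hR hτ hb, zero_mul, integral_zero]

/-- Against a fixed tangent test field the projection in 𝔻 is invisible, so the moment of 𝔻τ is the
radial derivative of the moment of τ minus R⁻¹ times that moment. -/
theorem moment_opD (hτ : ContDiffOn ℝ ∞ τ (ball R)) (hb : BoundaryPreserving R τ)
    {w : S2 → E3} {W : Fin 3 → Poly} (hW : ∀ q j, w q j = ev (W j) (q : E3))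
    (hw : ∀ q : S2, ⟪(q : E3), w q⟫_ℝ = 0) {D : ℝ}
    (hD : HasDerivWithinAt (fun r : ℝ => ∫ q : S2, ⟪τ (r • (q : E3)), w q⟫_ℝ ∂area) D
      (Ioc 0 R) R) :
    ∫ q : S2, ⟪opD R τ q, w q⟫_ℝ ∂area = D - R⁻¹ * ∫ q : S2, ⟪τ (R • (q : E3)), w q⟫_ℝ ∂area := by
  have hRI : R ∈ Icc (-R) R := ⟨by linarith, le_rfl⟩
  have hsub : Ioc 0 R ⊆ Icc (-R) R := fun t ht => ⟨by linarith [ht.1], ht.2⟩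
  have hs := contDiffOn_iff_smooth.1 hτ
  have hwc : Continuous w := by
    have : w = fun q : S2 => WithLp.toLp 2 fun j => ev (W j) (q : E3) := by
      funext q; ext j; exact hW q j
    rw [this]
    exact (PiLp.continuous_toLp 2 _).comp (continuous_pi fun j => continuous_ev_S2 _)
  have e : ∀ t ∈ Icc (-R) R, ∫ q : S2, ⟪τ (t • (q : E3)), w q⟫_ℝ ∂area =
      ∑ j, coef (fun x => τ x j) (W j) t := fun t ht => by
    simp only [inner_eq_sum, hW]
    exact integral_finsetSum _ fun j _ => integrable_coef (hs j).continuousOn _ ht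
  have hd : HasDerivWithinAt (fun t => ∑ j, coef (fun x => τ x j) (W j) t)
      (∑ j, ∑ i, coef (pd R i fun x => τ x j) (X i * W j) R) (Ioc 0 R) R :=
    HasDerivWithinAt.fun_sum fun j _ => (hasDerivWithinAt_coef hR (hs j) hRI (W j)).mono hsub
  have hd2 := hd.congr (fun t ht => e t (hsub ht)) (e R hRI)
  have h1 : D = ∑ j, ∑ i, coef (pd R i fun x => τ x j) (X i * W j) R :=
    (uniqueDiffOn_Ioc 0 R R ⟨hR, le_rfl⟩).eq_deriv _ hD hd2
  have h2 : ∫ q : S2, ⟪radD R τ q, w q⟫_ℝ ∂area = D := by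
    rw [h1]
    unfold coef
    have i1 : ∀ j i, Integrable (fun q : S2 => pd R i (fun x => τ x j) (R • (q : E3)) *
        ev (X i * W j) (q : E3)) area := fun j i =>
      integrable_coef ((hs j).pd hR i).continuousOn _ hRI
    have e2 : ∀ j, ∑ i, ∫ q : S2, pd R i (fun x => τ x j) (R • (q : E3)) *
        ev (X i * W j) (q : E3) ∂area = ∫ q : S2, ∑ i, pd R i (fun x => τ x j) (R • (q : E3)) *
        ev (X i * W j) (q : E3) ∂area := fun j => (integral_finsetSum _ fun i _ => i1 j i).symm
    simp only [e2]
    rw [← integral_finsetSum _ fun j _ => integrable_finsetSum _ fun i _ => i1 j i]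
    congr 1; ext q
    simp only [inner_eq_sum, hW, radD_apply, ev_mul, ev_X, dcomp, Finset.sum_mul, mul_assoc]
  have c1 := continuous_radD hR hτ
  have c2 := continuous_comp_smul hτ.continuousOn hRI
  have e3 : ∀ q : S2, ⟪opD R τ q, w q⟫_ℝ =
      ⟪radD R τ q, w q⟫_ℝ - R⁻¹ * ⟪τ (R • (q : E3)), w q⟫_ℝ := fun q => by
    rw [opD_eq hR hτ hb, inner_sub_left, inner_sub_left, inner_smul_left, inner_smul_left, hw q]
    simp
  simp only [e3]
  rw [integral_sub (integrable_inner_S2 c1 hwc) ((integrable_inner_S2 c2 hwc).const_mul _),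
    integral_const_mul, h2]

variable (h : IsSolution R τ)
include h

/-- This moment of a solution is a multiple of r^l, whose logarithmic derivative l/R loses 1/R to
the extrinsic curvature. -/
theorem rotPair_opD {l : ℕ} {Z : Poly} (hZ : IsSolidHarmonic l Z) :
    rotPair (opD R τ) Z = (l - 1) / R * rotPair (fun q => τ (R • (q : E3))) Z := by
  obtain ⟨A, u, hA, hu, hΔ, hpot⟩ := exists_potField hR h.smooth h.momentum
  obtain ⟨a, ha⟩ := coef_eq_of_harmonic hR hA hΔ hZ
  have e : ∀ t ∈ Ioc 0 R, ∫ q : S2, ⟪τ (t • (q : E3)), rotV Z (q : E3)⟫_ℝ ∂area =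
      (l * (l + 1)) * (a * t ^ l) := fun t ht => by
    rw [← ha t ⟨ht.1.le, ht.2⟩, ← rotPair_potField hR hA hu ht hZ, rotPair]
    congr 1; ext q
    rw [hpot (smul_mem_ball ⟨by linarith [ht.1], ht.2⟩ q)]
  have hRR : R ∈ Ioc 0 R := ⟨hR, le_rfl⟩
  have hd := (((hasDerivAt_pow l R).const_mul a).const_mul
    ((l : ℝ) * (l + 1))).hasDerivWithinAt (s := Ioc 0 R)
  have := moment_opD hR h.smooth h.boundary (w := fun q : S2 => rotV Z (q : E3))
    (W := fun j => rotP j Z) (fun q j => rfl)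
    (fun q => by rw [real_inner_comm]; exact inner_rotV_self _ _) (hd.congr e (e R hRR))
  rw [rotPair, this, rotPair, e R hRR]
  rcases Nat.eq_zero_or_pos l with rfl | hl
  · simp
  · obtain ⟨m, rfl⟩ : ∃ m, l = m + 1 := ⟨l - 1, by omega⟩
    rw [Nat.add_sub_cancel]
    field_simp
    push_cast
    ring

/-- The moment is a multiple of c(r)/r, where c' (R) = 0 because σ is boundary preserving. The
factor 1/r contributes -1/R and the extrinsic curvature another -1/R. -/
theorem gradPair_opD {l : ℕ} {Z : Poly} (hZ : IsSolidHarmonic l Z) :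
    gradPair (opD R τ) Z = -2 / R * gradPair (fun q => τ (R • (q : E3))) Z := by
  obtain ⟨A, u, hA, hu, hΔ, hpot⟩ := exists_potField hR h.smooth h.momentum
  have hRR : R ∈ Ioc 0 R := ⟨hR, le_rfl⟩
  have hRI : R ∈ Icc (-R) R := ⟨by linarith, le_rfl⟩
  have e : ∀ t ∈ Ioc 0 R, ∫ q : S2, ⟪τ (t • (q : E3)), gradW Z q⟫_ℝ ∂area =
      (l * (l + 1)) * (t⁻¹ * coef u Z t) := fun t ht => by
    have := gradPair_potField hR hA hu ht hZ
    rw [gradPair_eq] at this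
    rw [← mul_assoc, ← div_eq_mul_inv, ← this]
    congr 1; ext q
    rw [hpot (smul_mem_ball ⟨by linarith [ht.1], ht.2⟩ q)]
  have hφ : ∑ i, coef (pd R i u) (X i * Z) R = 0 := by
    rw [← radPair_potField hR hu (A := A) hRR, radPair]
    have : ∀ q : S2, ⟪potField R A u (R • (q : E3)), (q : E3)⟫_ℝ = 0 := fun q => by
      rw [← hpot (smul_mem_ball hRI q)]; exact h.boundary q
    simp [this]
  have hd1 := (hasDerivWithinAt_coef hR hu hRI Z).mono
    (show Ioc 0 R ⊆ Icc (-R) R from fun t ht => ⟨by linarith [ht.1], ht.2⟩)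
  rw [hφ] at hd1
  have hd := (((hasDerivAt_inv hR.ne').hasDerivWithinAt (s := Ioc 0 R)).mul hd1).const_mul
    ((l : ℝ) * (l + 1))
  have := moment_opD hR h.smooth h.boundary (w := gradW Z)
    (W := fun j => rotP (j + 1) Z * X (j + 2) - rotP (j + 2) Z * X (j + 1))
    (fun q j => by
      rw [gradW, cross_apply', rotV_apply, rotV_apply]
      simp only [ev_sub, ev_mul, ev_X])
    (fun q => by rw [gradW, inner_cross_self]) (hd.congr e (e R hRR))
  rw [gradPair_eq, this, gradPair_eq, e R hRR]
  field_simp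
  ring

end opD

/-! ### Well-definedness of 𝔻, and the metric as a boundary integral. -/

section opD_consequences
variable {R : ℝ} (hR : 0 < R) {σ τ : E3 → E3}
include hR

/-- A solution is not determined by its boundary value, but all moments of 𝔻σ are: they are zero or
fixed multiples of moments of the boundary value. -/
theorem opD_eq_of_boundary_eq (hσ : IsSolution R σ) (hτ : IsSolution R τ)
    (h : ∀ q : S2, σ (R • (q : E3)) = τ (R • (q : E3))) : opD R σ = opD R τ := by
  have c1 := continuous_opD hR hσ.smooth hσ.boundary
  have c2 := continuous_opD hR hτ.smooth hτ.boundary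
  have hf : (fun q : S2 => σ (R • (q : E3))) = fun q : S2 => τ (R • (q : E3)) := funext h
  have hz := eq_zero_of_vector_moments (V := fun q => opD R σ q - opD R τ q) (c1.sub c2)
    (fun l P hP => by
      simp only [inner_sub_left, inner_opD hR hσ.smooth hσ.boundary,
        inner_opD hR hτ.smooth hτ.boundary, sub_zero, zero_mul, integral_zero])
    (fun l P hP => by
      simp only [inner_sub_left]
      rw [integral_sub (integrable_inner_S2 c1 (continuous_rotV_S2 _))
        (integrable_inner_S2 c2 (continuous_rotV_S2 _)), sub_eq_zero]
      change rotPair _ _ = rotPair _ _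
      rw [rotPair_opD hR hσ hP, rotPair_opD hR hτ hP, hf])
    (fun l P hP => by
      change gradPair _ P = 0
      rw [gradPair_eq]
      simp only [inner_sub_left]
      rw [integral_sub (integrable_inner_S2 c1 (continuous_gradW _))
        (integrable_inner_S2 c2 (continuous_gradW _)), sub_eq_zero, ← gradPair_eq, ← gradPair_eq,
        gradPair_opD hR hσ hP, gradPair_opD hR hτ hP, hf])
  funext q
  exact sub_eq_zero.1 (congrFun hz q)

/-- Rotational derivatives of `w` have vanishing moments on the boundary by parts, and they span all
tangential derivatives. -/
theorem sum_mul_pd_eq_zero {w : E3 → ℝ} (hw : Smooth R w) (h : ∀ q : S2, w (R • (q : E3)) = 0)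
    (q : S2) {v : E3} (hv : ⟪v, (q : E3)⟫_ℝ = 0) : ∑ i, v i * pd R i w (R • (q : E3)) = 0 := by
  have hRI : R ∈ Icc (-R) R := ⟨by linarith, le_rfl⟩
  have hrot : ∀ k, rotd R k w (R • (q : E3)) = 0 := by
    intro k
    have hz := eq_zero_of_moments (g := fun q : S2 => rotd R k w (R • (q : E3)))
      (continuous_comp_smul (hw.rotd hR k).continuousOn hRI) (fun l P hP => by
        change coef (rotd R k w) P R = 0
        rw [coef_rotd hR hw hRI]
        simp [coef, h])
    exact congrFun hz q
  have h0 := hrot 0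
  have h1 := hrot 1
  have h2 := hrot 2
  have hq := sum_sq_S2 q
  have hR0 := hR.ne'
  simp only [inner_eq_sum, rotd, Fin.sum_univ_three, PiLp.smul_apply, smul_eq_mul, Fin.isValue,
    zero_add, Fin.reduceAdd] at h0 h1 h2 hv ⊢
  set p0 := pd R 0 w (R • (q : E3))
  set p1 := pd R 1 w (R • (q : E3))
  set p2 := pd R 2 w (R • (q : E3))
  have k0 : (q : E3) 1 * p2 - (q : E3) 2 * p1 = 0 := mul_left_cancel₀ hR0 (by linear_combination h0)
  have k1 : (q : E3) 2 * p0 - (q : E3) 0 * p2 = 0 := mul_left_cancel₀ hR0 (by linear_combination h1)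
  have k2 : (q : E3) 0 * p1 - (q : E3) 1 * p0 = 0 := mul_left_cancel₀ hR0 (by linear_combination h2)
  linear_combination -(v 0 * p0 + v 1 * p1 + v 2 * p2) * hq
    + ((q : E3) 0 * p0 + (q : E3) 1 * p1 + (q : E3) 2 * p2) * hv
    + (v 0 * (q : E3) 2 - v 2 * (q : E3) 0) * k1 + (v 1 * (q : E3) 0 - v 0 * (q : E3) 1) * k2
    + (v 2 * (q : E3) 1 - v 1 * (q : E3) 2) * k0

/-- The integrand is the divergence of σ_j δh_ij(τ) - 2 σ_i div τ, because the terms with second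
derivatives of τ form the momentum constraint. On the boundary the last term has no normal
component. -/
theorem vacuaMetric_eq (hσ : ContDiffOn ℝ ∞ σ (ball R)) (hσb : BoundaryPreserving R σ)
    (hτ : IsSolution R τ) :
    vacuaMetric R σ τ = R ^ 2 * ∫ q : S2, ⟪σ (R • (q : E3)), opD R τ q⟫_ℝ ∂area := by
  have hRI : R ∈ Icc (-R) R := ⟨by linarith, le_rfl⟩
  have sσ := contDiffOn_iff_smooth.1 hσ
  have sτ := contDiffOn_iff_smooth.1 hτ.smooth
  have dτ := Smooth.dcomp hR hτ.smooth
  have sdiv : Smooth R fun x => ∑ k, dcomp R τ k k x := Smooth.sum' fun k _ => dτ k k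
  have s1 : ∀ i j, Smooth R fun x => σ x j * (dcomp R τ i j x + dcomp R τ j i x) := fun i j =>
    (sσ j).mul' ((dτ i j).add' (dτ j i))
  have s2 : ∀ i, Smooth R fun x => 2 * (σ x i * ∑ k, dcomp R τ k k x) := fun i =>
    (Smooth.const 2).mul' ((sσ i).mul' sdiv)
  have s3 : ∀ i, Smooth R fun x => ∑ j, σ x j * (dcomp R τ i j x + dcomp R τ j i x) := fun i =>
    Smooth.sum' fun j _ => s1 i j
  have h := integral_div_ball hR (V := fun i x =>
    ∑ j, σ x j * (dcomp R τ i j x + dcomp R τ j i x) - 2 * (σ x i * ∑ k, dcomp R τ k k x))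
    fun i => (s3 i).sub' (s2 i)
  have hint : vacuaMetric R σ τ = ∫ x in ball R, ∑ i, pd R i (fun x =>
      ∑ j, σ x j * (dcomp R τ i j x + dcomp R τ j i x) - 2 * (σ x i * ∑ k, dcomp R τ k k x)) x := by
    rw [vacuaMetric, ← integral_const_mul]
    refine setIntegral_congr_fun measurableSet_closedBall fun x hx => ?_
    have e : ∀ i, pd R i (fun x => ∑ j, σ x j * (dcomp R τ i j x + dcomp R τ j i x)
        - 2 * (σ x i * ∑ k, dcomp R τ k k x)) x =
        ∑ j, (σ x j * (pd R i (dcomp R τ i j) x + pd R i (dcomp R τ j i) x)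
          + (dcomp R τ i j x + dcomp R τ j i x) * dcomp R σ i j x)
        - 2 * (σ x i * ∑ k, pd R i (dcomp R τ k k) x
          + (∑ k, dcomp R τ k k x) * dcomp R σ i i x) := fun i => by
      rw [pd_sub hR (s3 i) (s2 i) hx, pd_sum hR (fun j _ => s1 i j) hx,
        pd_const_mul hR ((sσ i).mul' sdiv) hx, pd_mul hR (sσ i) sdiv hx,
        pd_sum hR (fun k _ => dτ k k) hx]
      congr 1
      refine Finset.sum_congr rfl fun j _ => ?_
      rw [pd_mul hR (sσ j) ((dτ i j).add' (dτ j i)) hx, pd_add hR (dτ i j) (dτ j i) hx]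
      rfl
    have hE := (momentumConstraint_iff hR hτ.smooth).1 hτ.momentum x hx
    have e2 : ∀ i j, pd R i (fun y => dcomp R τ i j y - dcomp R τ j i y) x =
        pd R i (dcomp R τ i j) x - pd R i (dcomp R τ j i) x := fun i j =>
      pd_sub hR (dτ i j) (dτ j i) hx i
    have c : ∀ i j k, pd R i (dcomp R τ j k) x = pd R j (dcomp R τ i k) x := fun i j k =>
      pd_comm hR (sτ k) hx i j
    have hE0 := hE 0
    have hE1 := hE 1
    have hE2 := hE 2
    simp only [curlCurl, e2, Fin.sum_univ_three] at hE0 hE1 hE2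
    simp only [e]
    simp only [deltaH, Fin.sum_univ_three]
    linear_combination -(σ x 0 * hE0) - σ x 1 * hE1 - σ x 2 * hE2
      + 2 * σ x 0 * (c 0 1 1 + c 0 2 2) + 2 * σ x 1 * (c 1 0 0 + c 1 2 2)
      + 2 * σ x 2 * (c 2 0 0 + c 2 1 1)
  rw [hint, h]
  congr 1
  unfold coef
  rw [← integral_finsetSum _ fun i _ => integrable_coef ((s3 i).sub' (s2 i)).continuousOn _ hRI]
  congr 1; ext q
  have hb := hσb q
  have hxb := smul_mem_ball hRI q
  have hw : Smooth R fun x => ∑ j, x j * τ x j :=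
    Smooth.sum' fun j _ => (Smooth.coord j).mul' (sτ j)
  -- The function x·τ vanishes on the boundary, hence so does its derivative along the tangent
  -- vector σ. This replaces n_i σ_j ∂_j τ_i by -σ·τ/R, the extrinsic curvature term of 𝔻.
  have ht := sum_mul_pd_eq_zero hR hw (fun q => by
    have := hτ.boundary q
    rw [inner_eq_sum] at this
    simp only [Fin.sum_univ_three, PiLp.smul_apply, smul_eq_mul] at this ⊢
    linear_combination R * this) q hb
  have e : ∀ i, pd R i (fun x => ∑ j, x j * τ x j) (R • (q : E3)) =
      ∑ j, ((R * (q : E3) j) * dcomp R τ i j (R • (q : E3))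
        + τ (R • (q : E3)) j * if j = i then 1 else 0) := fun i => by
    rw [pd_sum hR (fun j _ => (Smooth.coord j).mul' (sτ j)) hxb]
    refine Finset.sum_congr rfl fun j _ => ?_
    rw [pd_mul hR (Smooth.coord j) (sτ j) hxb, pd_coord hR hxb]
    rfl
  have hE : ⟪σ (R • (q : E3)), opD R τ q⟫_ℝ = ⟪σ (R • (q : E3)), radD R τ q⟫_ℝ
      - R⁻¹ * ⟪σ (R • (q : E3)), τ (R • (q : E3))⟫_ℝ := by
    rw [opD_eq hR hτ.smooth hτ.boundary, inner_sub_right, inner_sub_right, inner_smul_right,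
      inner_smul_right, hb]
    ring
  rw [hE]
  simp only [e] at ht
  simp only [inner_eq_sum, radD_apply, Fin.sum_univ_three, ev_X] at ht hb ⊢
  simp at ht
  have hR0 := hR.ne'
  generalize τ (R • (q : E3)) = T at *
  generalize σ (R • (q : E3)) = S at *
  field_simp
  linear_combination ht - 2 * R * (dcomp R τ 0 0 (R • (q : E3)) + dcomp R τ 1 1 (R • (q : E3))
    + dcomp R τ 2 2 (R • (q : E3))) * hb

omit hR in
-- On the diagonal, the function integrated in the metric is -4 times the left side of the
-- Hamiltonian constraint.
theorem vacuaMetric_eq_zero_of_hamiltonian (h : HamiltonianConstraint R σ) :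
    vacuaMetric R σ σ = 0 := by
  rw [vacuaMetric, mul_eq_zero]
  right
  rw [← integral_zero E3 ℝ (μ := volume.restrict (ball R))]
  refine setIntegral_congr_fun measurableSet_closedBall fun x hx => ?_
  have := h x hx
  simp only [deltaH, Fin.sum_univ_three] at this ⊢
  linear_combination -4 * this

end opD_consequences

end RoundBall

namespace RoundBall
open MvPolynomial (X C pderiv)

/-! ### The metric in terms of the modes, and the kernel of the boundary operator -/

section metric
variable {R : ℝ} {Y : (ℓ : ℕ) → Fin (2 * ℓ + 1) → Poly} {σ τ : E3 → E3}
  {a b : (ℓ : ℕ) → Fin (2 * ℓ + 1) → ℝ} {f g : (ℓ : ℕ) → Fin (2 * ℓ + 1) → ℝ → ℝ}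
  (hR : 0 < R) (hY : IsHarmonicBasis Y)
include hR hY

theorem modeAt_boundary (hσ : BoundaryPreserving R σ) (h : HasModeExpansion R Y σ a f)
    (p : ModeIdx) (q : S2) : modeAt R Y a f p (R • (q : E3)) =
      (a p.1 p.2 * R ^ p.1) • rotV (Y p.1 p.2) (q : E3)
        + (f p.1 p.2 R / R) • gradW (Y p.1 p.2) q := by
  have hd := (h.boundaryPreserving_iff hR hY).1 hσ p.1 p.2
  rw [← sum_coef_pd_scalarMode_eq_derivWithin hR hY p.1 p.2 (h.smooth _ _)] at hd
  have := modeField_smul hR ⟨hR, le_rfl⟩ (l := p.1) (a p.1 p.2) (h.smooth p.1 p.2)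
    (by simpa using hY.sip_eq p p) q
  rw [hd, zero_smul, add_zero] at this
  exact this

theorem rotPair_opD_mode (hσ : IsSolution R σ) (h : HasModeExpansion R Y σ a f) (l : ℕ)
    (m : Fin (2 * l + 1)) : rotPair (opD R σ) (Y l m) =
      (l - 1) / R * ((l * (l + 1)) * (a l m * R ^ l)) := by
  rw [rotPair_opD hR hσ (hY.harmonic l m), h.rotPair_eq hR hY ⟨hR, le_rfl⟩]

theorem gradPair_opD_mode (hσ : IsSolution R σ) (h : HasModeExpansion R Y σ a f) (l : ℕ)
    (m : Fin (2 * l + 1)) : gradPair (opD R σ) (Y l m) =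
      -2 / R * ((l * (l + 1)) / R * f l m R) := by
  rw [gradPair_opD hR hσ (hY.harmonic l m), h.gradPair_eq hR hY ⟨hR, le_rfl⟩]

theorem hasSum_vacuaMetric (hσ : IsSolution R σ) (hτ : IsSolution R τ)
    (h : HasModeExpansion R Y σ a f) (h' : HasModeExpansion R Y τ b g) :
    HasSum (fun p : ModeIdx => R ^ 3 * (((p.1 : ℝ) * ((p.1 : ℝ) + 1)) *
        (((p.1 : ℝ) - 1) * ((R ^ ((p.1 : ℤ) - 1) * a p.1 p.2) * (R ^ ((p.1 : ℤ) - 1) * b p.1 p.2))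
          - 2 * ((f p.1 p.2 R / R ^ 2) * (g p.1 p.2 R / R ^ 2))))) (vacuaMetric R σ τ) := by
  have hRI : R ∈ Icc (-R) R := ⟨by linarith, le_rfl⟩
  have hc := continuous_opD hR hτ.smooth hτ.boundary
  rw [vacuaMetric_eq hR hσ.smooth hσ.boundary hτ]
  refine ((h.hasSum_moment hR hY hRI hc).mul_left (R ^ 2)).congr_fun fun p => ?_
  have hw1 := continuous_rotV_S2 (Y p.1 p.2)
  have hw2 := continuous_gradW (Y p.1 p.2)
  have e : ∫ q : S2, ⟪modeAt R Y a f p (R • (q : E3)), opD R τ q⟫_ℝ ∂area =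
      (a p.1 p.2 * R ^ p.1) * rotPair (opD R τ) (Y p.1 p.2)
        + (f p.1 p.2 R / R) * gradPair (opD R τ) (Y p.1 p.2) := by
    rw [gradPair_eq, rotPair, ← integral_const_mul, ← integral_const_mul,
      ← integral_add ((integrable_inner_S2 hc hw1).const_mul _)
        ((integrable_inner_S2 hc hw2).const_mul _)]
    congr 1; ext q
    rw [modeAt_boundary hR hY hσ.boundary h, inner_add_left, inner_smul_left, inner_smul_left,
      real_inner_comm, real_inner_comm _ (gradW _ _)]
    simp
  rw [e, rotPair_opD_mode hR hY hτ h', gradPair_opD_mode hR hY hτ h']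
  obtain ⟨l, m⟩ := p
  -- The exponent is an integer because l - 1 is negative for l = 0, where the factor l removes the
  -- term.
  have hz : R ^ ((l : ℤ) - 1) = R ^ l / R := by
    rw [zpow_sub₀ hR.ne', zpow_natCast, zpow_one]
  simp only [hz]
  have hR0 := hR.ne'
  field_simp
  ring

theorem opD_eq_zero_iff (hσ : IsSolution R σ) (h : HasModeExpansion R Y σ a f) :
    (∀ q, opD R σ q = 0) ↔ (∀ ℓ m, 1 < ℓ → a ℓ m = 0) ∧ (∀ ℓ m, 1 ≤ ℓ → f ℓ m R = 0) := by
  constructor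
  · intro h0
    refine ⟨fun l m hl => ?_, fun l m hl => ?_⟩
    · have h1 := rotPair_opD_mode hR hY hσ h l m
      simp only [rotPair, h0, inner_zero_left, integral_zero] at h1
      have hl' : (1 : ℝ) < l := by exact_mod_cast hl
      have hp : 0 < ((l : ℝ) - 1) / R * ((l * (l + 1)) * R ^ l) := by
        have : (0 : ℝ) < l - 1 := by linarith
        positivity
      have h2 : (((l : ℝ) - 1) / R * ((l * (l + 1)) * R ^ l)) * a l m = 0 := by
        rw [h1]; ring
      exact (mul_eq_zero.1 h2).resolve_left hp.ne'
    · have h1 := gradPair_opD_mode hR hY hσ h l m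
      rw [gradPair_eq] at h1
      simp only [h0, inner_zero_left, integral_zero] at h1
      have hl' : (1 : ℝ) ≤ l := by exact_mod_cast hl
      have hp : 0 < 2 / R * ((l * (l + 1)) / R) := by positivity
      have h2 : (2 / R * (((l : ℝ) * (l + 1)) / R)) * f l m R = 0 := by
        linear_combination h1
      exact (mul_eq_zero.1 h2).resolve_left hp.ne'
  · rintro ⟨ha, hf⟩
    have hz := eq_zero_of_basis_moments hY (continuous_opD hR hσ.smooth hσ.boundary)
      (fun l m => radPair_opD hR hσ.smooth hσ.boundary _)
      (fun l m => by
        rw [rotPair_opD_mode hR hY hσ h]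
        rcases Nat.lt_or_ge 1 l with hl | hl
        · rw [ha l m hl]; ring
        · interval_cases l <;> simp)
      (fun l m => by
        rw [gradPair_opD_mode hR hY hσ h]
        rcases Nat.eq_zero_or_pos l with rfl | hl
        · simp
        · rw [hf l m hl]; ring)
    exact fun q => congrFun hz q

theorem boundary_eq_sum (hσ : BoundaryPreserving R σ) (h : HasModeExpansion R Y σ a f)
    (ha : ∀ ℓ m, 1 < ℓ → a ℓ m = 0) (hf : ∀ ℓ m, 1 ≤ ℓ → f ℓ m R = 0) (q : S2) :
    σ (R • (q : E3)) = ∑ m, (a 1 m * R) • rotV (Y 1 m) (q : E3) := by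
  have hRI : R ∈ Icc (-R) R := ⟨by linarith, le_rfl⟩
  have hs : HasSum (fun p : ModeIdx => modeAt R Y a f p (R • (q : E3))) (σ (R • (q : E3))) := by
    rw [HasSum, SummationFilter.unconditional_filter]
    exact h.tendsto.tendsto_at (smul_mem_ball hRI q)
  have hs2 := hasSum_sum_of_ne_finset_zero (L := SummationFilter.unconditional ModeIdx)
    (f := fun p : ModeIdx => modeAt R Y a f p (R • (q : E3)))
    (s := Finset.univ.map (Function.Embedding.sigmaMk (β := fun l : ℕ => Fin (2 * l + 1)) 1))
    (by
      rintro ⟨l, m⟩ hp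
      rw [modeAt_boundary hR hY hσ h]
      have hl1 : l ≠ 1 := by
        rintro rfl
        exact hp (Finset.mem_map.2 ⟨m, Finset.mem_univ m, rfl⟩)
      rcases Nat.eq_zero_or_pos l with rfl | hl
      · have h0 := rotV_of_degree_zero (hY.harmonic 0 m).1 (q : E3)
        simp only [gradW, h0, smul_zero, zero_add]
        have : cross 0 (q : E3) = 0 := by ext k; simp [cross_apply']
        rw [this, smul_zero]
      · simp only [ha l m (by omega), hf l m hl]
        simp)
  rw [hs.unique hs2, Finset.sum_map]
  refine Finset.sum_congr rfl fun m _ => ?_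
  rw [modeAt_boundary hR hY hσ h]
  change (a 1 m * R ^ 1) • rotV (Y 1 m) (q : E3) + (f 1 m R / R) • gradW (Y 1 m) q = _
  rw [hf 1 m le_rfl]
  simp

omit hR hY in
theorem rotV_of_degree_one {P : Poly} (hP : P.IsHomogeneous 1) :
    ∃ c : E3, ∀ x, rotV P x = cross c x := by
  refine ⟨WithLp.toLp 2 fun i => - ev (pderiv i P) 0, fun x => ?_⟩
  have hc : ∀ i, ev (pderiv i P) x = ev (pderiv i P) 0 := fun i => by
    have := ev_smul_point (hP.pderiv (i := i)) 0 x
    simpa using this.symm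
  ext k
  rw [rotV_apply, cross_apply', rotP]
  simp only [ev_sub, ev_mul, ev_X, hc]
  ring

omit hR hY in
theorem cross_sum_left {ι : Type*} (s : Finset ι) (c : ι → E3) (x : E3) :
    cross (∑ i ∈ s, c i) x = ∑ i ∈ s, cross (c i) x := by
  classical
  induction s using Finset.induction_on with
  | empty => ext k; simp [cross_apply']
  | insert i s hi ih => rw [Finset.sum_insert hi, Finset.sum_insert hi, cross_add_left, ih]

omit hR in
theorem exists_cross_eq_sum (c : Fin (2 * 1 + 1) → ℝ) : ∃ w : E3, ∀ q : S2,
    ∑ m, (c m * R) • rotV (Y 1 m) (q : E3) = cross w (R • (q : E3)) := by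
  choose d hd using fun m => rotV_of_degree_one (hY.harmonic 1 m).1
  refine ⟨∑ m, c m • d m, fun q => ?_⟩
  rw [cross_smul, cross_sum_left, Finset.smul_sum]
  refine Finset.sum_congr rfl fun m _ => ?_
  rw [hd, smul_cross, smul_smul, mul_comm]

/-- If one tower is absent, all terms of the vanishing sum have one sign and each is zero. Then only
the modes a_{1m} survive on the boundary, and these are rotations. -/
theorem bothTowers_of_null (hσ : IsSolution R σ) (h : HasModeExpansion R Y σ a f)
    (h0 : vacuaMetric R σ σ = 0)
    (hrot : ¬ ∃ w : E3, ∀ q : S2, σ (R • (q : E3)) = cross w (R • (q : E3))) :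
    BothTowers R a f := by
  have hs := hasSum_vacuaMetric hR hY hσ hσ h h
  rw [h0] at hs
  have hker : ¬ ((∀ ℓ m, 1 < ℓ → a ℓ m = 0) ∧ (∀ ℓ m, 1 ≤ ℓ → f ℓ m R = 0)) := by
    rintro ⟨ha, hf⟩
    obtain ⟨w, hw⟩ := exists_cross_eq_sum (R := R) hY (fun m => a 1 m)
    exact hrot ⟨w, fun q => by rw [boundary_eq_sum hR hY hσ.boundary h ha hf, hw]⟩
  have hR3 : 0 < R ^ 3 := by positivity
  constructor
  · by_contra hcon
    push Not at hcon
    refine hker ⟨fun l m hl => hcon l m hl, fun l m hl => ?_⟩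
    have hterm : ∀ p : ModeIdx, R ^ 3 * (((p.1 : ℝ) * ((p.1 : ℝ) + 1)) *
        (((p.1 : ℝ) - 1) * ((R ^ ((p.1 : ℤ) - 1) * a p.1 p.2) * (R ^ ((p.1 : ℤ) - 1) * a p.1 p.2))
          - 2 * ((f p.1 p.2 R / R ^ 2) * (f p.1 p.2 R / R ^ 2)))) =
        -(R ^ 3 * (((p.1 : ℝ) * ((p.1 : ℝ) + 1)) * (2 * (f p.1 p.2 R / R ^ 2) ^ 2))) := by
      rintro ⟨l, m⟩
      rcases Nat.lt_or_ge l 2 with hl | hl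
      · interval_cases l
        · simp
        · simp only [Nat.cast_one]; ring
      · simp only [hcon l m hl]; ring
    simp only [hterm] at hs
    have hs' : HasSum (fun p : ModeIdx => R ^ 3 * (((p.1 : ℝ) * ((p.1 : ℝ) + 1)) *
        (2 * (f p.1 p.2 R / R ^ 2) ^ 2))) 0 := by simpa only [neg_neg, neg_zero] using hs.neg
    have h1 := (hasSum_zero_iff_of_nonneg (fun p : ModeIdx => by
      change 0 ≤ R ^ 3 * (((p.1 : ℝ) * ((p.1 : ℝ) + 1)) * (2 * (f p.1 p.2 R / R ^ 2) ^ 2))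
      positivity)).1 hs'
    have h2 := congrFun h1 ⟨l, m⟩
    have hl' : (1 : ℝ) ≤ l := by exact_mod_cast hl
    have hp : 0 < R ^ 3 * (((l : ℝ) * (l + 1)) * 2) := by positivity
    have h3 : (R ^ 3 * (((l : ℝ) * (l + 1)) * 2)) * (f l m R / R ^ 2) ^ 2 = 0 := by
      have h2' : R ^ 3 * (((l : ℝ) * (l + 1)) * (2 * (f l m R / R ^ 2) ^ 2)) = 0 := h2
      linear_combination h2'
    have h4 := (mul_eq_zero.1 h3).resolve_left hp.ne'
    have h5 := (div_eq_zero_iff.1 ((pow_eq_zero_iff two_ne_zero).1 h4))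
    exact h5.resolve_right (by positivity)
  · by_contra hcon
    push Not at hcon
    refine hker ⟨fun l m hl => ?_, fun l m hl => hcon l m hl⟩
    have hterm : ∀ p : ModeIdx, R ^ 3 * (((p.1 : ℝ) * ((p.1 : ℝ) + 1)) *
        (((p.1 : ℝ) - 1) * ((R ^ ((p.1 : ℤ) - 1) * a p.1 p.2) * (R ^ ((p.1 : ℤ) - 1) * a p.1 p.2))
          - 2 * ((f p.1 p.2 R / R ^ 2) * (f p.1 p.2 R / R ^ 2)))) =
        R ^ 3 * (((p.1 : ℝ) * ((p.1 : ℝ) + 1)) *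
        (((p.1 : ℝ) - 1) * (R ^ ((p.1 : ℤ) - 1) * a p.1 p.2) ^ 2)) := by
      rintro ⟨l, m⟩
      rcases Nat.eq_zero_or_pos l with rfl | hl
      · simp
      · simp only [hcon l m hl]; ring
    simp only [hterm] at hs
    have h1 := (hasSum_zero_iff_of_nonneg (fun p : ModeIdx => by
      obtain ⟨l, m⟩ := p
      rcases Nat.eq_zero_or_pos l with rfl | hl
      · simp
      · have hl' : (1 : ℝ) ≤ l := by exact_mod_cast hl
        have : (0 : ℝ) ≤ (l : ℝ) - 1 := by linarith
        change 0 ≤ R ^ 3 * (((l : ℝ) * ((l : ℝ) + 1)) *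
          (((l : ℝ) - 1) * (R ^ ((l : ℤ) - 1) * a l m) ^ 2))
        positivity)).1 hs
    have h2 := congrFun h1 ⟨l, m⟩
    have hl' : (1 : ℝ) < l := by exact_mod_cast hl
    have hp : 0 < R ^ 3 * (((l : ℝ) * (l + 1)) * (l - 1)) := by
      have : (0 : ℝ) < (l : ℝ) - 1 := by linarith
      positivity
    have h3 : (R ^ 3 * (((l : ℝ) * (l + 1)) * (l - 1))) * (R ^ ((l : ℤ) - 1) * a l m) ^ 2 = 0 := by
      have h2' : R ^ 3 * (((l : ℝ) * (l + 1)) * ((l - 1) * (R ^ ((l : ℤ) - 1) * a l m) ^ 2)) = 0 := h2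
      linear_combination h2'
    have h4 := (mul_eq_zero.1 h3).resolve_left hp.ne'
    exact (mul_eq_zero.1 ((pow_eq_zero_iff two_ne_zero).1 h4)).resolve_left
      (zpow_ne_zero _ hR.ne')

end metric

/-! ### Linearity, and infinitesimal rotations -/

section linear
variable {R : ℝ} (hR : 0 < R) {σ τ : E3 → E3}
include hR

theorem dcomp_add_smul (hσ : ContDiffOn ℝ ∞ σ (ball R)) (hτ : ContDiffOn ℝ ∞ τ (ball R)) (c : ℝ)
    {x : E3} (hx : x ∈ ball R) (i j : Fin 3) :
    dcomp R (fun x => σ x + c • τ x) i j x = dcomp R σ i j x + c * dcomp R τ i j x := by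
  have sσ := contDiffOn_iff_smooth.1 hσ j
  have sτ := contDiffOn_iff_smooth.1 hτ j
  unfold dcomp
  rw [← pd_const_mul hR sτ hx, ← pd_add hR sσ ((Smooth.const c).mul' sτ) hx]
  rfl

theorem IsSolution.add_smul (hσ : IsSolution R σ) (hτ : IsSolution R τ) (c : ℝ) :
    IsSolution R fun x => σ x + c • τ x := by
  have hs : ContDiffOn ℝ ∞ (fun x => σ x + c • τ x) (ball R) :=
    hσ.smooth.add (contDiffOn_const (c := c) |>.smul hτ.smooth)
  refine ⟨hs, ?_, fun q => ?_⟩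
  · have h1 := (momentumConstraint_iff hR hσ.smooth).1 hσ.momentum
    have h2 := (momentumConstraint_iff hR hτ.smooth).1 hτ.momentum
    rw [momentumConstraint_iff hR hs]
    intro x hx j
    have e : curlCurl R (fun x => σ x + c • τ x) j x = curlCurl R σ j x + c * curlCurl R τ j x := by
      unfold curlCurl
      rw [Finset.mul_sum, ← Finset.sum_add_distrib]
      refine Finset.sum_congr rfl fun i _ => ?_
      have s1 := (Smooth.dcomp hR hσ.smooth i j).sub' (Smooth.dcomp hR hσ.smooth j i)
      have s2 := (Smooth.dcomp hR hτ.smooth i j).sub' (Smooth.dcomp hR hτ.smooth j i)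
      rw [← pd_const_mul hR s2 hx, ← pd_add hR s1 ((Smooth.const c).mul' s2) hx]
      refine pd_congr (fun y hy => ?_) hx
      simp only [dcomp_add_smul hR hσ.smooth hτ.smooth c hy]
      ring
    rw [e, h1 x hx j, h2 x hx j]; ring
  · rw [inner_add_left, inner_smul_left, hσ.boundary q, hτ.boundary q]; simp

omit hR in
theorem contDiff_cross (w : E3) : ContDiff ℝ ∞ (cross w) := by
  refine contDiff_euclidean.2 fun k => ?_
  simp only [cross_apply']
  fun_prop

theorem dcomp_cross (w : E3) {x : E3} (hx : x ∈ ball R) (i j : Fin 3) :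
    dcomp R (cross w) i j x = w (j + 1) * (if j + 2 = i then 1 else 0)
      - w (j + 2) * (if j + 1 = i then 1 else 0) := by
  unfold dcomp
  simp only [cross_apply']
  rw [pd_sub hR ((Smooth.const _).mul' (Smooth.coord _)) ((Smooth.const _).mul' (Smooth.coord _)) hx,
    pd_const_mul hR (Smooth.coord _) hx, pd_const_mul hR (Smooth.coord _) hx, pd_coord hR hx,
    pd_coord hR hx]

theorem isSolution_cross (w : E3) : IsSolution R (cross w) := by
  refine ⟨(contDiff_cross w).contDiffOn, ?_, fun q => ?_⟩
  · rw [momentumConstraint_iff hR (contDiff_cross w).contDiffOn]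
    intro x hx j
    refine Finset.sum_eq_zero fun i _ => ?_
    rw [pd_congr (v := fun _ => (w (j + 1) * (if j + 2 = i then 1 else 0)
      - w (j + 2) * (if j + 1 = i then 1 else 0)) - (w (i + 1) * (if i + 2 = j then 1 else 0)
      - w (i + 2) * (if i + 1 = j then 1 else 0))) (fun y hy => by
        simp only [dcomp_cross hR w hy]) hx, pd_const hR hx]
  · rw [cross_smul, inner_smul_left, real_inner_comm, inner_cross_self, mul_zero]

theorem opD_cross (w : E3) (q : S2) : opD R (cross w) q = 0 := by
  have hRI : R ∈ Icc (-R) R := ⟨by linarith, le_rfl⟩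
  have h := isSolution_cross hR w
  have hrad : radD R (cross w) q = cross w (q : E3) := by
    ext j
    simp only [radD_apply, dcomp_cross hR w (smul_mem_ball hRI q), cross_apply', Fin.sum_univ_three]
    fin_cases j <;> simp <;> ring
  rw [opD_eq hR h.smooth h.boundary, hrad, cross_smul, smul_smul, inv_mul_cancel₀ hR.ne', one_smul,
    real_inner_comm, inner_cross_self]
  simp

omit hR in
theorem isTangentField_cross (w : E3) : IsTangentField fun q : S2 => cross w (R • (q : E3)) := by
  refine ⟨?_, fun q => ?_⟩
  · have : Fact (Module.finrank ℝ E3 = 2 + 1) := ⟨finrank_euclideanSpace_fin⟩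
    have h : ContDiff ℝ ∞ fun x : E3 => cross w (R • x) :=
      (contDiff_cross w).comp (contDiff_id.const_smul R)
    exact h.contMDiff.comp (contMDiff_coe_sphere (n := 2))
  · change ⟪cross w (R • (q : E3)), (q : E3)⟫_ℝ = 0
    rw [cross_smul, inner_smul_left, real_inner_comm, inner_cross_self, mul_zero]

theorem kerD_eq_rotations :
    kerD R = {ζ | ∃ w : E3, ∀ q : S2, ζ q = cross w (R • (q : E3))} := by
  ext ζ
  constructor
  · rintro ⟨-, σ, hσ, hb, h0⟩
    obtain ⟨Y, hY⟩ := exists_isHarmonicBasis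
    obtain ⟨a, f, h⟩ := exists_hasModeExpansion hR hY hσ.smooth hσ.momentum
    obtain ⟨ha, hf⟩ := (opD_eq_zero_iff hR hY hσ h).1 h0
    obtain ⟨w, hw⟩ := exists_cross_eq_sum (R := R) hY (fun m => a 1 m)
    exact ⟨w, fun q => by rw [← hb q, boundary_eq_sum hR hY hσ.boundary h ha hf, hw]⟩
  · rintro ⟨w, hw⟩
    rw [show ζ = fun q : S2 => cross w (R • (q : E3)) from funext hw]
    exact ⟨isTangentField_cross w, cross w, isSolution_cross hR w, fun q => rfl, opD_cross hR w⟩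

theorem kerD_eq_modes {Y : (ℓ : ℕ) → Fin (2 * ℓ + 1) → Poly} (hY : IsHarmonicBasis Y) :
    kerD R = {ζ | ∃ c : Fin (2 * 1 + 1) → ℝ, ∀ q : S2,
      ζ q = ∑ m, (c m * R) • coexactHarmonic (Y 1 m) (R • (q : E3))} := by
  have hco : ∀ (m) (q : S2), coexactHarmonic (Y 1 m) (R • (q : E3)) = rotV (Y 1 m) (q : E3) := by
    intro m q
    have hx0 : R • (q : E3) ≠ 0 := by
      rw [← norm_ne_zero_iff, norm_smul_S2 hR.le]; exact hR.ne'
    rw [coexactHarmonic_eq hx0, normal_smul hR]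
  simp only [hco]
  ext ζ
  constructor
  · rintro ⟨-, σ, hσ, hb, h0⟩
    obtain ⟨a, f, h⟩ := exists_hasModeExpansion hR hY hσ.smooth hσ.momentum
    obtain ⟨ha, hf⟩ := (opD_eq_zero_iff hR hY hσ h).1 h0
    exact ⟨a 1, fun q => by rw [← hb q, boundary_eq_sum hR hY hσ.boundary h ha hf]⟩
  · rintro ⟨c, hc⟩
    rw [kerD_eq_rotations hR]
    obtain ⟨w, hw⟩ := exists_cross_eq_sum (R := R) hY c
    exact ⟨w, fun q => by rw [hc, hw]⟩

/-- A solution of both constraints that vanishes at the boundary is zero. -/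
theorem eq_zero_of_hamiltonian {v : E3 → E3} (hv : ContDiffOn ℝ ∞ v (ball R))
    (hm : MomentumConstraint R v) (hH : HamiltonianConstraint R v)
    (hb : ∀ q : S2, v (R • (q : E3)) = 0) : ∀ x ∈ ball R, v x = 0 := by
  have sv := contDiffOn_iff_smooth.1 hv
  have dv := Smooth.dcomp hR hv
  rw [momentumConstraint_iff hR hv] at hm
  have dd : ∀ i j, Smooth R fun x => dcomp R v i j x - dcomp R v j i x := fun i j =>
    (dv i j).sub' (dv j i)
  -- The field v_j(∂_i v_j - ∂_j v_i) has divergence |curl v|² by the momentum constraint, and no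
  -- flux since v vanishes on the boundary.
  have hcurl : ∀ x ∈ ball R, ∀ i j, dcomp R v i j x = dcomp R v j i x := by
    have s1 : ∀ i j, Smooth R fun x => v x j * (dcomp R v i j x - dcomp R v j i x) := fun i j =>
      (sv j).mul' (dd i j)
    have h := integral_div_ball hR (V := fun i x => ∑ j, v x j * (dcomp R v i j x - dcomp R v j i x))
      fun i => Smooth.sum' fun j _ => s1 i j
    have hf : ∀ i, coef (fun x => ∑ j, v x j * (dcomp R v i j x - dcomp R v j i x)) (X i) R = 0 :=
      fun i => by simp [coef, hb]
    simp only [hf, Finset.sum_const_zero, mul_zero] at h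
    have e : ∀ x ∈ ball R, ∑ i, pd R i (fun x => ∑ j, v x j * (dcomp R v i j x - dcomp R v j i x)) x
        = (dcomp R v 0 1 x - dcomp R v 1 0 x) ^ 2 + (dcomp R v 0 2 x - dcomp R v 2 0 x) ^ 2
          + (dcomp R v 1 2 x - dcomp R v 2 1 x) ^ 2 := by
      intro x hx
      have e1 : ∀ i, pd R i (fun x => ∑ j, v x j * (dcomp R v i j x - dcomp R v j i x)) x =
          ∑ j, (v x j * pd R i (fun x => dcomp R v i j x - dcomp R v j i x) x
            + (dcomp R v i j x - dcomp R v j i x) * dcomp R v i j x) := fun i => by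
        rw [pd_sum hR (fun j _ => s1 i j) hx]
        refine Finset.sum_congr rfl fun j _ => ?_
        rw [pd_mul hR (sv j) (dd i j) hx]
        rfl
      have h0 := hm x hx 0
      have h1 := hm x hx 1
      have h2 := hm x hx 2
      simp only [e1]
      simp only [curlCurl, Fin.sum_univ_three] at h0 h1 h2 ⊢
      linear_combination v x 0 * h0 + v x 1 * h1 + v x 2 * h2
    rw [setIntegral_congr_fun measurableSet_closedBall e] at h
    have hz := eq_zero_of_integral_ball hR
      (((((dd 0 1).continuousOn).pow 2).add (((dd 0 2).continuousOn).pow 2)).add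
        (((dd 1 2).continuousOn).pow 2)) (fun x _ => by simp only [Pi.add_apply, Pi.pow_apply]; positivity) h
    intro x hx
    have h1 := hz x hx
    simp only [Pi.add_apply, Pi.pow_apply] at h1
    have p1 := sq_nonneg (dcomp R v 0 1 x - dcomp R v 1 0 x)
    have p2 := sq_nonneg (dcomp R v 0 2 x - dcomp R v 2 0 x)
    have p3 := sq_nonneg (dcomp R v 1 2 x - dcomp R v 2 1 x)
    have q1 := (pow_eq_zero_iff two_ne_zero).1
      (show (dcomp R v 0 1 x - dcomp R v 1 0 x) ^ 2 = 0 by linarith)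
    have q2 := (pow_eq_zero_iff two_ne_zero).1
      (show (dcomp R v 0 2 x - dcomp R v 2 0 x) ^ 2 = 0 by linarith)
    have q3 := (pow_eq_zero_iff two_ne_zero).1
      (show (dcomp R v 1 2 x - dcomp R v 2 1 x) ^ 2 = 0 by linarith)
    intro i j
    fin_cases i <;> fin_cases j <;> simp <;> linarith
  have sn : Smooth R fun x => ∑ j, v x j * v x j := Smooth.sum' fun j _ => (sv j).mul' (sv j)
  have sxv : Smooth R fun x => ∑ j, x j * v x j :=
    Smooth.sum' fun j _ => (Smooth.coord j).mul' (sv j)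
  have sφ : Smooth R fun x => ∑ j, x j * x j :=
    Smooth.sum' fun j _ => (Smooth.coord j).mul' (Smooth.coord j)
  have sdiv : Smooth R fun x => ∑ k, dcomp R v k k x := Smooth.sum' fun k _ => dv k k
  have sg : ∀ i, Smooth R fun x => ∑ j, v x j * dcomp R v j i x := fun i =>
    Smooth.sum' fun j _ => (sv j).mul' (dv j i)
  have sG : ∀ i, Smooth R fun x => v x i * (∑ k, dcomp R v k k x) - ∑ j, v x j * dcomp R v j i x :=
    fun i => ((sv i).mul' sdiv).sub' (sg i)
  have sF1 : ∀ i, Smooth R fun x => (∑ j, x j * x j) *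
      (v x i * (∑ k, dcomp R v k k x) - ∑ j, v x j * dcomp R v j i x) := fun i => sφ.mul' (sG i)
  have sF2 : ∀ i, Smooth R fun x => 2 * ((∑ j, x j * v x j) * v x i - x i * ∑ j, v x j * v x j) :=
    fun i => (Smooth.const 2).mul' ((sxv.mul' (sv i)).sub' ((Smooth.coord i).mul' sn))
  -- For curl-free v the Hamiltonian constraint says that G = v div v - (v·∇)v is divergence free.
  -- Then |x|² G has divergence 2x·G, and the correction -2((x·v) v - x|v|²) is chosen so that the
  -- total divergence is 4|v|². There is no flux through the boundary, so v vanishes.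
  have h := integral_div_ball hR (V := fun i x => (∑ j, x j * x j) *
      (v x i * (∑ k, dcomp R v k k x) - ∑ j, v x j * dcomp R v j i x)
      - 2 * ((∑ j, x j * v x j) * v x i - x i * ∑ j, v x j * v x j))
    fun i => (sF1 i).sub' (sF2 i)
  have hf : ∀ i, coef (fun x => (∑ j, x j * x j) *
      (v x i * (∑ k, dcomp R v k k x) - ∑ j, v x j * dcomp R v j i x)
      - 2 * ((∑ j, x j * v x j) * v x i - x i * ∑ j, v x j * v x j)) (X i) R = 0 :=
    fun i => by simp [coef, hb]
  simp only [hf, Finset.sum_const_zero, mul_zero] at h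
  have e : ∀ x ∈ ball R, ∑ i, pd R i (fun x => (∑ j, x j * x j) *
      (v x i * (∑ k, dcomp R v k k x) - ∑ j, v x j * dcomp R v j i x)
      - 2 * ((∑ j, x j * v x j) * v x i - x i * ∑ j, v x j * v x j)) x =
      4 * ∑ j, v x j * v x j := by
    intro x hx
    have eφ : ∀ i, pd R i (fun x => ∑ j, x j * x j) x = 2 * x i := fun i => by
      rw [pd_sum hR (fun j _ => (Smooth.coord j).mul' (Smooth.coord j)) hx]
      have : ∀ j, pd R i (fun x => x j * x j) x = 2 * x j * if j = i then 1 else 0 := fun j => by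
        rw [pd_mul hR (Smooth.coord j) (Smooth.coord j) hx, pd_coord hR hx]; ring
      simp [this]
    have en : ∀ i, pd R i (fun x => ∑ j, v x j * v x j) x =
        ∑ j, (v x j * dcomp R v i j x + v x j * dcomp R v i j x) := fun i => by
      rw [pd_sum hR (fun j _ => (sv j).mul' (sv j)) hx]
      refine Finset.sum_congr rfl fun j _ => ?_
      rw [pd_mul hR (sv j) (sv j) hx]; rfl
    have exv : ∀ i, pd R i (fun x => ∑ j, x j * v x j) x =
        ∑ j, (x j * dcomp R v i j x + v x j * if j = i then 1 else 0) := fun i => by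
      rw [pd_sum hR (fun j _ => (Smooth.coord j).mul' (sv j)) hx]
      refine Finset.sum_congr rfl fun j _ => ?_
      rw [pd_mul hR (Smooth.coord j) (sv j) hx, pd_coord hR hx]; rfl
    have eG : ∀ i, pd R i (fun x => v x i * (∑ k, dcomp R v k k x)
          - ∑ j, v x j * dcomp R v j i x) x =
        v x i * ∑ k, pd R i (dcomp R v k k) x + (∑ k, dcomp R v k k x) * dcomp R v i i x
        - ∑ j, (v x j * pd R i (dcomp R v j i) x + dcomp R v j i x * dcomp R v i j x) := fun i => by
      rw [pd_sub hR ((sv i).mul' sdiv) (sg i) hx, pd_mul hR (sv i) sdiv hx,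
        pd_sum hR (fun k _ => dv k k) hx, pd_sum hR (fun j _ => (sv j).mul' (dv j i)) hx]
      congr 1
      refine Finset.sum_congr rfl fun j _ => ?_
      rw [pd_mul hR (sv j) (dv j i) hx]; rfl
    have e1 : ∀ i, pd R i (fun x => (∑ j, x j * x j) *
        (v x i * (∑ k, dcomp R v k k x) - ∑ j, v x j * dcomp R v j i x)
        - 2 * ((∑ j, x j * v x j) * v x i - x i * ∑ j, v x j * v x j)) x =
        (∑ j, x j * x j) * (v x i * ∑ k, pd R i (dcomp R v k k) x
          + (∑ k, dcomp R v k k x) * dcomp R v i i x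
          - ∑ j, (v x j * pd R i (dcomp R v j i) x + dcomp R v j i x * dcomp R v i j x))
        + (v x i * (∑ k, dcomp R v k k x) - ∑ j, v x j * dcomp R v j i x) * (2 * x i)
        - 2 * (((∑ j, x j * v x j) * dcomp R v i i x
          + v x i * ∑ j, (x j * dcomp R v i j x + v x j * if j = i then 1 else 0))
          - (x i * ∑ j, (v x j * dcomp R v i j x + v x j * dcomp R v i j x)
          + ∑ j, v x j * v x j)) := fun i => by
      rw [pd_sub hR (sF1 i) (sF2 i) hx, pd_mul hR sφ (sG i) hx,
        pd_const_mul hR ((sxv.mul' (sv i)).sub' ((Smooth.coord i).mul' sn)) hx,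
        pd_sub hR (sxv.mul' (sv i)) ((Smooth.coord i).mul' sn) hx, pd_mul hR sxv (sv i) hx,
        pd_mul hR (Smooth.coord i) sn hx, pd_coord hR hx, eφ, en, exv, eG]
      rw [if_pos rfl, mul_one]
      rfl
    have hHx := hH x hx
    have c : ∀ i j k, pd R i (dcomp R v j k) x = pd R j (dcomp R v i k) x := fun i j k =>
      pd_comm hR (sv k) hx i j
    have k01 := hcurl x hx 0 1
    have k02 := hcurl x hx 0 2
    have k12 := hcurl x hx 1 2
    simp only [e1]
    simp only [Fin.sum_univ_three] at hHx ⊢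
    rw [c 1 0 1, c 2 0 2, c 2 1 2, c 1 0 0, c 2 0 0, c 2 1 1]
    rw [k01, k02, k12] at hHx ⊢
    simp
    linear_combination (x 0 * x 0 + x 1 * x 1 + x 2 * x 2) * hHx
  rw [setIntegral_congr_fun measurableSet_closedBall e] at h
  have hz := eq_zero_of_integral_ball hR ((Smooth.const 4).mul' sn).continuousOn
    (fun x _ => by
      have : 0 ≤ ∑ j, v x j * v x j := Finset.sum_nonneg fun j _ => mul_self_nonneg _
      linarith) h
  intro x hx
  have h1 : ‖v x‖ ^ 2 = 0 := by
    rw [norm_sq_eq_sum]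
    have := hz x hx
    simp only [sq]
    linarith
  exact norm_eq_zero.1 ((pow_eq_zero_iff two_ne_zero).1 h1)

/-- The Hamiltonian constraint involves only the symmetrised gradient, and that of w × x is zero. So
σ - w × x solves both constraints and vanishes on the boundary. -/
theorem eq_cross_of_hamiltonian (hσ : IsSolution R σ) (hH : HamiltonianConstraint R σ) {w : E3}
    (hw : ∀ q : S2, σ (R • (q : E3)) = cross w (R • (q : E3))) :
    ∀ x ∈ ball R, σ x = cross w x := by
  have hc := isSolution_cross hR w
  have hs := hσ.add_smul hR hc (-1)
  have hH' : HamiltonianConstraint R fun x => σ x + (-1 : ℝ) • cross w x := by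
    intro x hx
    have h1 := hH x hx
    simp only [dcomp_add_smul hR hσ.smooth hc.smooth _ hx, dcomp_cross hR w hx,
      Fin.sum_univ_three] at h1 ⊢
    simp
    linear_combination h1
  intro x hx
  have := eq_zero_of_hamiltonian hR hs.smooth hs.momentum hH' (fun q => by
    rw [hw]; simp) x hx
  rw [neg_one_smul, ← sub_eq_add_neg] at this
  exact sub_eq_zero.1 this

end linear

end RoundBall

namespace RoundBall
open MvPolynomial (X C pderiv)

/-! ### Series of solid harmonics -/

/-- A series is an integral for counting measure, so differentiation under the integral applies,
including at the boundary of the ball. -/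
theorem hasFDerivWithinAt_tsum {ι : Type*} [Countable ι] {s : Set E3} (hs : Convex ℝ s)
    {φ : ι → E3 → ℝ} {φ' : ι → E3 → E3 →L[ℝ] ℝ} {bound : ι → ℝ} {x : E3} (hx : x ∈ s)
    (hsum : ∀ y ∈ s, Summable fun p => φ p y)
    (hd : ∀ p, ∀ y ∈ s, HasFDerivWithinAt (φ p) (φ' p y) s y)
    (hb : ∀ p, ∀ y ∈ s, ‖φ' p y‖ ≤ bound p) (hbs : Summable bound) :
    HasFDerivWithinAt (fun y => ∑' p, φ p y) (∑' p, φ' p x) s x := by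
  let _ : MeasurableSpace ι := ⊤
  have hc1 : ∀ {g : ι → ℝ}, Summable g → ∫ p, g p ∂Measure.count = ∑' p, g p := by
    intro g hg
    rw [integral_countable (integrable_count_iff.2 hg.norm)]
    simp
  have hsum' : Summable fun p => ‖φ' p x‖ :=
    Summable.of_nonneg_of_le (fun p => norm_nonneg _) (fun p => hb p x hx) hbs
  have hc2 : ∫ p, φ' p x ∂Measure.count = ∑' p, φ' p x := by
    rw [integral_countable (integrable_count_iff.2 hsum')]
    simp
  have h := hasFDerivWithinAt_integral (μ := (Measure.count : Measure ι)) hs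
    (φ := fun y p => φ p y) (φ' := fun y p => φ' p y) (bound := bound) hx
    (fun y hy => integrable_count_iff.2 (hsum y hy).norm)
    (StronglyMeasurable.of_discrete).aestronglyMeasurable hd hb (integrable_count_iff.2 hbs.norm)
  rw [hc2] at h
  exact h.congr (fun y hy => (hc1 (hsum y hy)).symm) (hc1 (hsum x hx)).symm

/-- A family of solid harmonics of degree `l - k`, indexed by the modes, that decays rapidly on
the ball of radius `R`. -/
structure RapidFamily (R : ℝ) (k : ℕ) (P : ModeIdx → Poly) : Prop where
  harmonic : ∀ p, IsSolidHarmonic (p.1 - k) (P p)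
  decay : ∀ n : ℕ, ∃ A, 0 ≤ A ∧ ∀ p, R ^ (p.1 - k) * √(sip (P p) (P p)) ≤ A / ((p.1 : ℝ) + 1) ^ n

/-- The sum of a family of polynomials. -/
noncomputable def series (P : ModeIdx → Poly) (x : E3) : ℝ := ∑' p, ev (P p) x

section series
variable {R : ℝ} (hR : 0 < R) {k : ℕ} {P : ModeIdx → Poly}

include hR

/-- A derivative costs a factor 2(l+1)/R in norm, which rapid decay absorbs. -/
theorem RapidFamily.pderiv (h : RapidFamily R k P) (i : Fin 3) :
    RapidFamily R (k + 1) fun p => pderiv i (P p) := by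
  refine ⟨fun p => by rw [Nat.sub_add_eq]; exact (h.harmonic p).pderiv i, fun n => ?_⟩
  obtain ⟨A, hA, hb⟩ := h.decay (n + 1)
  refine ⟨2 * A / R, by positivity, fun p => ?_⟩
  have hl : (0 : ℝ) < (p.1 : ℝ) + 1 := by positivity
  -- When the truncated degree is zero the polynomial is constant and its derivative vanishes, so
  -- the truncated subtraction does no harm.
  rcases Nat.eq_zero_or_pos (p.1 - k) with h0 | hpos
  · have h1 := h.harmonic p
    rw [h0] at h1
    rw [isHomogeneous_pderiv_zero h1.1]
    simp only [sip, ev]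
    simp
    positivity
  · have hd := sip_pderiv_le (h.harmonic p) i
    have e : R ^ (p.1 - k) = R ^ (p.1 - (k + 1)) * R := by
      rw [← pow_succ]; congr 1; omega
    have hle : ((p.1 - k : ℕ) : ℝ) + 1 ≤ (p.1 : ℝ) + 1 := by
      have : ((p.1 - k : ℕ) : ℝ) ≤ p.1 := by exact_mod_cast Nat.sub_le _ _
      linarith
    have h2 := hb p
    rw [e, pow_succ, le_div_iff₀ (by positivity)] at h2
    have hs := Real.sqrt_nonneg (sip (P p) (P p))
    calc R ^ (p.1 - (k + 1)) * √(sip (MvPolynomial.pderiv i (P p)) (MvPolynomial.pderiv i (P p)))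
        ≤ R ^ (p.1 - (k + 1)) * (2 * ((p.1 : ℝ) + 1) * √(sip (P p) (P p))) := by
          refine mul_le_mul_of_nonneg_left (hd.trans ?_) (by positivity)
          gcongr
      _ = 2 / R / ((p.1 : ℝ) + 1) ^ n * (R ^ (p.1 - (k + 1)) * R * √(sip (P p) (P p)) *
            (((p.1 : ℝ) + 1) ^ n * ((p.1 : ℝ) + 1))) := by field_simp
      _ ≤ 2 / R / ((p.1 : ℝ) + 1) ^ n * A := by
          refine mul_le_mul_of_nonneg_left h2 (by positivity)
      _ = _ := by field_simp

theorem RapidFamily.exists_bound (h : RapidFamily R k P) : ∃ M : ModeIdx → ℝ, Summable M ∧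
    (∀ p, 0 ≤ M p) ∧ ∀ p, ∀ x ∈ ball R, |ev (P p) x| ≤ M p := by
  obtain ⟨K, hK, hb⟩ := exists_sup_bound
  obtain ⟨A, hA, hd⟩ := h.decay 5
  refine ⟨fun p => K * A * ((p.1 : ℝ) + 1)⁻¹ ^ 4, summable_modeIdx.mul_left _,
    fun p => by positivity, fun p x hx => ?_⟩
  have hl : (0 : ℝ) < (p.1 : ℝ) + 1 := by positivity
  have hle : ((p.1 - k : ℕ) : ℝ) + 1 ≤ (p.1 : ℝ) + 1 := by
    have : ((p.1 - k : ℕ) : ℝ) ≤ p.1 := by exact_mod_cast Nat.sub_le _ _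
    linarith
  have hs := Real.sqrt_nonneg (sip (P p) (P p))
  have hp := h.harmonic p
  obtain ⟨q, hq⟩ : ∃ q : S2, x = ‖x‖ • (q : E3) := by
    rcases eq_or_ne x 0 with rfl | hx0
    · exact ⟨⟨basisVec 0, by simp [basisVec]⟩, by simp⟩
    · exact ⟨⟨normal x, by rw [mem_sphere_zero_iff_norm, norm_normal hx0]⟩,
        (norm_smul_normal x).symm⟩
  have hx' : ‖x‖ ≤ R := mem_closedBall_zero_iff.1 hx
  rw [hq, ev_smul_point hp.1, abs_mul, abs_of_nonneg (by positivity)]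
  have h2 := hd p
  rw [le_div_iff₀ (by positivity)] at h2
  calc ‖x‖ ^ (p.1 - k) * |ev (P p) (q : E3)|
      ≤ R ^ (p.1 - k) * (K * ((p.1 : ℝ) + 1) * √(sip (P p) (P p))) := by
        refine mul_le_mul (pow_le_pow_left₀ (norm_nonneg _) hx' _) ((hb _ _ hp q).trans ?_)
          (abs_nonneg _) (by positivity)
        gcongr
    _ = K * ((p.1 : ℝ) + 1)⁻¹ ^ 4 * (R ^ (p.1 - k) * √(sip (P p) (P p)) *
          ((p.1 : ℝ) + 1) ^ 5) := by field_simp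
    _ ≤ K * ((p.1 : ℝ) + 1)⁻¹ ^ 4 * A := mul_le_mul_of_nonneg_left h2 (by positivity)
    _ = _ := by ring

theorem RapidFamily.summable (h : RapidFamily R k P) {x : E3} (hx : x ∈ ball R) :
    Summable fun p => ev (P p) x := by
  obtain ⟨M, hM, -, hb⟩ := h.exists_bound hR
  exact Summable.of_norm_bounded hM fun p => hb p x hx

theorem RapidFamily.hasFDerivWithinAt (h : RapidFamily R k P) {x : E3} (hx : x ∈ ball R) :
    ∃ L : E3 →L[ℝ] ℝ, HasFDerivWithinAt (series P) L (ball R) x ∧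
      ∀ i, L (basisVec i) = series (fun p => MvPolynomial.pderiv i (P p)) x := by
  choose M hM hM0 hMb using fun i => (h.pderiv hR i).exists_bound hR
  have hb : ∀ (p : ModeIdx), ∀ y ∈ ball R, ‖∑ i, ev (MvPolynomial.pderiv i (P p)) y •
      (EuclideanSpace.proj (𝕜 := ℝ) i : E3 →L[ℝ] ℝ)‖ ≤ ∑ i, M i p := by
    intro p y hy
    refine (norm_sum_le _ _).trans (Finset.sum_le_sum fun i _ => ?_)
    rw [norm_smul]
    have : ‖(EuclideanSpace.proj (𝕜 := ℝ) i : E3 →L[ℝ] ℝ)‖ ≤ 1 :=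
      ContinuousLinearMap.opNorm_le_bound _ zero_le_one fun v => by
        rw [one_mul]; exact PiLp.norm_apply_le v i
    calc _ ≤ M i p * 1 := mul_le_mul (hMb i p y hy) this (norm_nonneg _) (hM0 i p)
      _ = _ := mul_one _
  have hbs : Summable fun p => ∑ i, M i p := summable_sum fun i _ => hM i
  refine ⟨_, hasFDerivWithinAt_tsum (convex_closedBall _ _) hx (fun y hy => h.summable hR hy)
    (fun p y _ => (hasFDerivAt_ev (P p) y).hasFDerivWithinAt) hb hbs, fun i => ?_⟩
  have hsum' := Summable.of_norm_bounded hbs fun p => hb p x hx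
  refine ((ContinuousLinearMap.apply ℝ ℝ (basisVec i)).map_tsum hsum').trans
    (tsum_congr fun p => ?_)
  simp [basisVec_apply]

theorem RapidFamily.pd_series (h : RapidFamily R k P) {x : E3} (hx : x ∈ ball R) (i : Fin 3) :
    pd R i (series P) x = series (fun p => MvPolynomial.pderiv i (P p)) x := by
  obtain ⟨L, hL, hLi⟩ := h.hasFDerivWithinAt hR hx
  rw [pd_of_hasFDerivWithinAt hR hx i hL, hLi]

theorem RapidFamily.smooth (h : RapidFamily R k P) : Smooth R (series P) := by
  refine smooth_of_closed_under_pd hR {w | ∃ k P, RapidFamily R k P ∧ w = series P} ?_ ?_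
    ⟨k, P, h, rfl⟩
  · rintro _ ⟨k, P, h, rfl⟩ x hx
    obtain ⟨L, hL, -⟩ := h.hasFDerivWithinAt hR hx
    exact hL.differentiableWithinAt
  · rintro _ ⟨k, P, h, rfl⟩ i
    exact ⟨_, ⟨k + 1, _, h.pderiv hR i, rfl⟩, fun x hx => h.pd_series hR hx i⟩

theorem RapidFamily.laplace_series (h : RapidFamily R k P) {x : E3} (hx : x ∈ ball R) :
    ∑ i, pd R i (pd R i (series P)) x = 0 := by
  have e : ∀ i, pd R i (pd R i (series P)) x =
      series (fun p => MvPolynomial.pderiv i (MvPolynomial.pderiv i (P p))) x := fun i => by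
    rw [pd_congr (fun y hy => h.pd_series hR hy i) hx, (h.pderiv hR i).pd_series hR hx]
  simp only [e, series]
  rw [← Summable.tsum_finsetSum fun i _ => ((h.pderiv hR i).pderiv hR i).summable hR hx]
  refine (tsum_congr fun p => ?_).trans tsum_zero
  have h2 := congrArg (fun Q => ev Q x) (h.harmonic p).2
  simp only [Fin.sum_univ_three, ev_add] at h2 ⊢
  rw [h2]; simp [ev]

theorem RapidFamily.hasSum_coef (h : RapidFamily R k P) (Q : Poly) {r : ℝ}
    (hr : r ∈ Icc (-R) R) : HasSum (fun p => coef (ev (P p)) Q r) (coef (series P) Q r) := by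
  obtain ⟨M, hM, hM0, hb⟩ := h.exists_bound hR
  obtain ⟨B, hB⟩ := isCompact_univ.exists_bound_of_continuousOn (continuous_ev_S2 Q).continuousOn
  have hi : ∀ p, Integrable (fun q : S2 => ev (P p) (r • (q : E3)) * ev Q (q : E3)) area := fun p =>
    integrable_coef (smooth_ev R (P p)).continuousOn Q hr
  have := hasSum_integral_of_summable_integral_norm hi (Summable.of_nonneg_of_le
    (fun p => integral_nonneg fun q => norm_nonneg _) (fun p => ?_)
    ((hM.mul_right |B|).mul_right sphereArea))
  · refine this.congr_fun (fun p => rfl) |> fun t => ?_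
    have e : ∫ q : S2, ∑' p, ev (P p) (r • (q : E3)) * ev Q (q : E3) ∂area = coef (series P) Q r := by
      unfold coef series
      simp only [tsum_mul_right]
    rwa [e] at t
  · have h1 : ∀ q : S2, ‖ev (P p) (r • (q : E3)) * ev Q (q : E3)‖ ≤ M p * |B| := fun q => by
      rw [norm_mul]
      exact mul_le_mul (hb p _ (smul_mem_ball hr q)) ((hB q (mem_univ q)).trans (le_abs_self B))
        (norm_nonneg _) (hM0 p)
    calc _ ≤ ∫ q : S2, M p * |B| ∂area :=
          integral_mono (hi p).norm (integrable_const _) h1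
      _ = _ := by rw [integral_const, smul_eq_mul, mul_comm]; rfl

end series

/-! ### Extension of a boundary vector field -/

/-- Extend ζ constantly along rays and cut off near the origin: the transition function of 2|x|² - 1
is zero near 0 and one on the unit sphere. -/
theorem exists_smooth_extension {ζ : S2 → E3} (hζ : ContMDiff (𝓡 2) 𝓘(ℝ, E3) ∞ ζ) :
    ∃ Z : E3 → E3, ContDiff ℝ ∞ Z ∧ ∀ q : S2, Z (q : E3) = ζ q := by
  classical
  have : Fact (Module.finrank ℝ E3 = 2 + 1) := ⟨finrank_euclideanSpace_fin⟩
  let U : TopologicalSpace.Opens E3 := ⟨{0}ᶜ, isOpen_compl_singleton⟩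
  have hN : ContMDiff 𝓘(ℝ, E3) 𝓘(ℝ, E3) ∞ fun x : U => normal (x : E3) := fun x =>
    contMDiffAt_subtype_iff.2 (contDiffAt_normal x.2).contMDiffAt
  have hS : ∀ x : U, normal (x : E3) ∈ sphere (0 : E3) 1 := fun x => by
    rw [mem_sphere_zero_iff_norm, norm_normal x.2]
  let F : E3 → E3 := fun x => if h : x ≠ 0 then ζ ⟨normal x, by
    rw [mem_sphere_zero_iff_norm, norm_normal h]⟩ else 0
  have hF : ∀ x : E3, x ≠ 0 → ContDiffAt ℝ ∞ F x := by
    intro x hx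
    have h1 := hζ.comp (hN.codRestrict_sphere hS)
    have h2 : (fun x : U => F (x : E3)) = ζ ∘ Set.codRestrict _ _ hS := by
      funext y
      have hy : (y : E3) ≠ 0 := y.2
      simp only [F, dif_pos hy]
      rfl
    have h3 : ContMDiffAt 𝓘(ℝ, E3) 𝓘(ℝ, E3) ∞ (fun x : U => F (x : E3)) ⟨x, hx⟩ := by
      rw [h2]; exact h1 _
    exact (contMDiffAt_subtype_iff.1 h3).contDiffAt
  have hχ : ContDiff ℝ ∞ fun x : E3 => Real.smoothTransition (2 * ‖x‖ ^ 2 - 1) :=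
    Real.smoothTransition.contDiff.comp ((contDiff_const.mul (contDiff_norm_sq ℝ)).sub contDiff_const)
  refine ⟨fun x => Real.smoothTransition (2 * ‖x‖ ^ 2 - 1) • F x, ?_, fun q => ?_⟩
  · rw [contDiff_iff_contDiffAt]
    intro x
    rcases eq_or_ne x 0 with rfl | hx
    · refine (contDiffAt_const (c := (0 : E3))).congr_of_eventuallyEq ?_
      have : ∀ᶠ x : E3 in 𝓝 0, 2 * ‖x‖ ^ 2 - 1 < 0 := by
        have hc : Continuous fun x : E3 => 2 * ‖x‖ ^ 2 - 1 := by fun_prop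
        exact hc.continuousAt.eventually_lt continuousAt_const (by simp)
      filter_upwards [this] with x hx
      rw [Real.smoothTransition.zero_of_nonpos hx.le, zero_smul]
    · exact hχ.contDiffAt.smul (hF x hx)
  · have hq : (q : E3) ≠ 0 := by rw [← norm_ne_zero_iff, norm_S2]; exact one_ne_zero
    have h1 : Real.smoothTransition (2 * ‖(q : E3)‖ ^ 2 - 1) = 1 :=
      Real.smoothTransition.one_of_one_le (by rw [norm_S2]; norm_num)
    simp only [h1, one_smul, F, dif_pos hq]
    congr 1
    exact Subtype.ext (normal_S2 q)

/-- Integration by parts turns the moment with x × ∇P into an ordinary moment of the smooth function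
-∑ L_k Z_k, to which `exists_decay` applies. -/
theorem exists_rotPair_decay {Z : E3 → E3} (hZ : ContDiff ℝ ∞ Z) (n : ℕ) : ∃ A, 0 ≤ A ∧
    ∀ (l : ℕ) (P : Poly), IsSolidHarmonic l P → sip P P = 1 →
      |rotPair (fun q => Z (q : E3)) P| ≤ A / ((l : ℝ) + 1) ^ n := by
  have hs : ∀ k, Smooth 1 fun x => Z x k := contDiffOn_iff_smooth.1 hZ.contDiffOn
  have hr : (1 : ℝ) ∈ Icc (-1 : ℝ) 1 := by constructor <;> norm_num
  have hu : Smooth 1 fun x => - ∑ k, rotd 1 k (fun x => Z x k) x :=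
    (Smooth.sum' fun k _ => (hs k).rotd one_pos k).neg'
  obtain ⟨A, hA, hb⟩ := exists_decay one_pos hu n
  refine ⟨A, hA, fun l P hP h1 => ?_⟩
  have e : rotPair (fun q => Z (q : E3)) P = coef (fun x => - ∑ k, rotd 1 k (fun x => Z x k) x) P 1 := by
    rw [coef_neg, coef_sum (fun k _ => ((hs k).rotd one_pos k).continuousOn) P hr]
    simp only [coef_rotd one_pos (hs _) hr, Finset.sum_neg_distrib, neg_neg]
    unfold coef
    rw [← integral_finsetSum _ fun k _ => integrable_coef (hs k).continuousOn _ hr, rotPair]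
    congr 1; ext q
    simp only [inner_eq_sum, rotV_apply, one_smul]
  rw [e]
  exact (hb l P hP h1 1 ⟨zero_le_one, le_rfl⟩).1

/-! ### Every tangent field is the boundary value of a solution -/

section extension
variable {R : ℝ} (hR : 0 < R) {Y : (ℓ : ℕ) → Fin (2 * ℓ + 1) → Poly} (hY : IsHarmonicBasis Y)
include hR hY

theorem rapidFamily_of_coeff {c : ModeIdx → ℝ}
    (hc : ∀ n : ℕ, ∃ A, 0 ≤ A ∧ ∀ p, |c p| ≤ A / ((p.1 : ℝ) + 1) ^ n) :
    RapidFamily R 0 fun p => (c p * (R ^ p.1)⁻¹) • Y p.1 p.2 := by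
  refine ⟨fun p => ?_, fun n => ?_⟩
  · exact mem_harm.1 ((harm p.1).smul_mem _ (mem_harm.2 (hY.harmonic _ _)))
  · obtain ⟨A, hA, hb⟩ := hc n
    refine ⟨A, hA, fun p => ?_⟩
    have h1 : sip (Y p.1 p.2) (Y p.1 p.2) = 1 := by simpa using hY.sip_eq p p
    rw [sip_smul_left, sip_comm, sip_smul_left, h1, mul_one, Real.sqrt_mul_self_eq_abs, abs_mul,
      abs_inv, abs_of_pos (pow_pos hR _), Nat.sub_zero, mul_left_comm,
      mul_inv_cancel₀ (pow_pos hR _).ne', mul_one]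
    exact hb p

theorem coef_series_coeff {c : ModeIdx → ℝ}
    (hc : ∀ n : ℕ, ∃ A, 0 ≤ A ∧ ∀ p, |c p| ≤ A / ((p.1 : ℝ) + 1) ^ n) (p₀ : ModeIdx) {r : ℝ}
    (hr : r ∈ Icc (-R) R) :
    coef (series fun p => (c p * (R ^ p.1)⁻¹) • Y p.1 p.2) (Y p₀.1 p₀.2) r =
      c p₀ * (R ^ p₀.1)⁻¹ * r ^ p₀.1 := by
  have h := (rapidFamily_of_coeff hR hY hc).hasSum_coef hR (Y p₀.1 p₀.2) hr
  have e : ∀ p : ModeIdx, coef (ev ((c p * (R ^ p.1)⁻¹) • Y p.1 p.2)) (Y p₀.1 p₀.2) r =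
      c p * (R ^ p.1)⁻¹ * (r ^ p.1 * if p = p₀ then 1 else 0) := fun p => by
    have : ev ((c p * (R ^ p.1)⁻¹) • Y p.1 p.2) = fun x => c p * (R ^ p.1)⁻¹ * ev (Y p.1 p.2) x := by
      funext x; simp
    rw [this, coef_const_mul, coef_ev (hY.harmonic _ _).1, hY.sip_eq]
  simp only [e] at h
  rw [← (hasSum_single (f := fun p : ModeIdx => c p * (R ^ p.1)⁻¹ *
    (r ^ p.1 * if p = p₀ then 1 else 0)) p₀ (fun p hp => by rw [if_neg hp]; ring)).unique h]
  simp

omit hR hY in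
theorem rapid_of_le {c d : ModeIdx → ℝ} (k : ℕ) (h : ∀ p, |d p| ≤ ((p.1 : ℝ) + 1) ^ k * |c p|)
    (hc : ∀ n : ℕ, ∃ A, 0 ≤ A ∧ ∀ p, |c p| ≤ A / ((p.1 : ℝ) + 1) ^ n) :
    ∀ n : ℕ, ∃ A, 0 ≤ A ∧ ∀ p, |d p| ≤ A / ((p.1 : ℝ) + 1) ^ n := by
  intro n
  obtain ⟨A, hA, hb⟩ := hc (n + k)
  refine ⟨A, hA, fun p => (h p).trans ?_⟩
  have hl : (0 : ℝ) < (p.1 : ℝ) + 1 := by positivity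
  calc _ ≤ ((p.1 : ℝ) + 1) ^ k * (A / ((p.1 : ℝ) + 1) ^ (n + k)) :=
        mul_le_mul_of_nonneg_left (hb p) (by positivity)
    _ = _ := by rw [pow_add]; field_simp

omit hR hY in
theorem rapid_inv_eigenvalue_mul {c : ModeIdx → ℝ}
    (hc : ∀ n : ℕ, ∃ A, 0 ≤ A ∧ ∀ p, |c p| ≤ A / ((p.1 : ℝ) + 1) ^ n) :
    ∀ n : ℕ, ∃ A, 0 ≤ A ∧ ∀ p : ModeIdx, |((p.1 : ℝ) * (p.1 + 1))⁻¹ * c p| ≤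
      A / ((p.1 : ℝ) + 1) ^ n := by
  refine rapid_of_le 0 (fun p => ?_) hc
  rw [abs_mul, pow_zero]
  refine mul_le_mul_of_nonneg_right ?_ (abs_nonneg _)
  rcases Nat.eq_zero_or_pos p.1 with h0 | hl
  · rw [h0]; simp
  · have hl' : (1 : ℝ) ≤ p.1 := by exact_mod_cast hl
    rw [abs_inv, abs_of_pos (by positivity)]
    exact inv_le_one_of_one_le₀ (by nlinarith)

omit hY in
theorem exists_isSolution_of_tangentField {ζ : S2 → E3} (hζ : IsTangentField ζ) :
    ∃ σ, IsSolution R σ ∧ HasBoundaryValue R σ ζ := by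
  obtain ⟨Y, hY⟩ := exists_isHarmonicBasis
  have hRI : R ∈ Icc (-R) R := ⟨by linarith, le_rfl⟩
  have hRR : R ∈ Ioc 0 R := ⟨hR, le_rfl⟩
  obtain ⟨Z, hZ, hZζ⟩ := exists_smooth_extension hζ.1
  have hζ1 : (fun q : S2 => Z (q : E3)) = ζ := funext hZζ
  have hζc : Continuous ζ := hζ.1.continuous
  have hsip : ∀ p : ModeIdx, sip (Y p.1 p.2) (Y p.1 p.2) = 1 := fun p => by
    simpa using hY.sip_eq p p
  have hZ2 : ContDiff ℝ ∞ fun x => cross x (Z x) := by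
    have hz := contDiff_euclidean.1 hZ
    refine contDiff_euclidean.2 fun k => ?_
    simp only [cross_apply']
    exact ((by fun_prop : ContDiff ℝ ∞ fun x : E3 => x (k + 1)).mul (hz _)).sub
      ((by fun_prop : ContDiff ℝ ∞ fun x : E3 => x (k + 2)).mul (hz _))
  -- In degree zero the inverse of the eigenvalue is 0, consistently with the vanishing of the
  -- tangential moments there.
  let t : ModeIdx → ℝ := fun p => ((p.1 : ℝ) * (p.1 + 1))⁻¹ * rotPair ζ (Y p.1 p.2)
  let s : ModeIdx → ℝ := fun p => ((p.1 : ℝ) * (p.1 + 1))⁻¹ * gradPair ζ (Y p.1 p.2)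
  have ht : ∀ n : ℕ, ∃ A, 0 ≤ A ∧ ∀ p, |t p| ≤ A / ((p.1 : ℝ) + 1) ^ n :=
    rapid_inv_eigenvalue_mul fun n => by
      obtain ⟨A, hA, hb⟩ := exists_rotPair_decay hZ n
      rw [hζ1] at hb
      exact ⟨A, hA, fun p => hb p.1 _ (hY.harmonic _ _) (hsip p)⟩
  have hs : ∀ n : ℕ, ∃ A, 0 ≤ A ∧ ∀ p, |s p| ≤ A / ((p.1 : ℝ) + 1) ^ n :=
    rapid_inv_eigenvalue_mul fun n => by
      obtain ⟨A, hA, hb⟩ := exists_rotPair_decay hZ2 n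
      refine ⟨A, hA, fun p => ?_⟩
      have := hb p.1 _ (hY.harmonic p.1 p.2) (hsip p)
      simp only [rotPair, hZζ] at this
      exact this
  -- The profile of u will be R s ((l+2)/2 (r/R)^l - l/2 (r/R)^(l+2)): its value at R is R s, and
  -- its derivative there vanishes, which makes the field boundary preserving.
  let s1 : ModeIdx → ℝ := fun p => s p * ((p.1 + 2) / 2)
  let s2 : ModeIdx → ℝ := fun p => s p * (p.1 / 2)
  have hs1 : ∀ n : ℕ, ∃ A, 0 ≤ A ∧ ∀ p, |s1 p| ≤ A / ((p.1 : ℝ) + 1) ^ n :=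
    rapid_of_le 1 (fun p => by
      have hl : (0 : ℝ) ≤ p.1 := Nat.cast_nonneg _
      rw [abs_mul, mul_comm, pow_one]
      refine mul_le_mul_of_nonneg_right ?_ (abs_nonneg _)
      rw [abs_of_nonneg (by positivity)]
      linarith) hs
  have hs2 : ∀ n : ℕ, ∃ A, 0 ≤ A ∧ ∀ p, |s2 p| ≤ A / ((p.1 : ℝ) + 1) ^ n :=
    rapid_of_le 1 (fun p => by
      have hl : (0 : ℝ) ≤ p.1 := Nat.cast_nonneg _
      rw [abs_mul, mul_comm, pow_one]
      refine mul_le_mul_of_nonneg_right ?_ (abs_nonneg _)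
      rw [abs_of_nonneg (by positivity)]
      linarith) hs
  have fA := rapidFamily_of_coeff hR hY ht
  have f1 := rapidFamily_of_coeff hR hY hs1
  have f2 := rapidFamily_of_coeff hR hY hs2
  set A := series fun p => (t p * (R ^ p.1)⁻¹) • Y p.1 p.2
  set S1 := series fun p => (s1 p * (R ^ p.1)⁻¹) • Y p.1 p.2 with hS1
  set S2 := series fun p => (s2 p * (R ^ p.1)⁻¹) • Y p.1 p.2 with hS2
  let u : E3 → ℝ := fun x => R * S1 x - (∑ k, x k * x k) * (R⁻¹ * S2 x)
  have sq : Smooth R fun x => ∑ k, x k * x k :=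
    Smooth.sum' fun k _ => (Smooth.coord k).mul' (Smooth.coord k)
  have su1 : Smooth R fun x => R * S1 x := (Smooth.const R).mul' (f1.smooth hR)
  have su2 : Smooth R fun x => (∑ k, x k * x k) * (R⁻¹ * S2 x) :=
    sq.mul' ((Smooth.const R⁻¹).mul' (f2.smooth hR))
  have hu : Smooth R u := su1.sub' su2
  have hA : Smooth R A := fA.smooth hR
  have hcu : ∀ p : ModeIdx, ∀ r ∈ Icc (-R) R, coef u (Y p.1 p.2) r =
      R * (s1 p * (R ^ p.1)⁻¹ * r ^ p.1) - r ^ 2 * (R⁻¹ * (s2 p * (R ^ p.1)⁻¹ * r ^ p.1)) := by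
    intro p r hr
    have e : coef (fun x => (∑ k, x k * x k) * (R⁻¹ * S2 x)) (Y p.1 p.2) r =
        r ^ 2 * (R⁻¹ * coef S2 (Y p.1 p.2) r) := by
      unfold coef
      rw [← integral_const_mul, ← integral_const_mul]
      congr 1; ext q
      have := sum_sq_S2 q
      have h2 : ∑ k, (r • (q : E3)) k * (r • (q : E3)) k = r ^ 2 := by
        simp only [Fin.sum_univ_three, PiLp.smul_apply, smul_eq_mul]
        linear_combination r ^ 2 * this
      beta_reduce
      rw [h2]; ring
    rw [coef_sub su1.continuousOn su2.continuousOn _ hr, coef_const_mul, e, hS1, hS2,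
      coef_series_coeff hR hY hs1 p hr, coef_series_coeff hR hY hs2 p hr]
  have hR0 := hR.ne'
  have hcuR : ∀ p : ModeIdx, coef u (Y p.1 p.2) R = R * s p := by
    intro p
    rw [hcu p R hRI]
    have := (pow_pos hR p.1).ne'
    simp only [s1, s2]
    field_simp
    ring
  have hcd : ∀ p : ModeIdx, ∑ i, coef (pd R i u) (X i * Y p.1 p.2) R = 0 := by
    intro p
    have d1 := hasDerivWithinAt_coef hR hu hRI (Y p.1 p.2)
    have d2 := (((hasDerivAt_pow p.1 R).const_mul (s1 p * (R ^ p.1)⁻¹)).const_mul R).sub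
      ((hasDerivAt_pow 2 R).mul (((hasDerivAt_pow p.1 R).const_mul
        (s2 p * (R ^ p.1)⁻¹)).const_mul R⁻¹))
    have d3 := (d2.hasDerivWithinAt (s := Icc (-R) R)).congr (hcu p) (hcu p R hRI)
    rw [(uniqueDiffOn_Icc (show -R < R by linarith) R hRI).eq_deriv _ d1 d3]
    obtain ⟨l, m⟩ := p
    have := (pow_pos hR l).ne'
    simp only [s1, s2]
    rcases Nat.eq_zero_or_pos l with rfl | hl
    · simp
    · obtain ⟨j, rfl⟩ : ∃ j, l = j + 1 := ⟨l - 1, by omega⟩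
      have := (pow_pos hR j).ne'
      simp only [Nat.add_sub_cancel, pow_succ]
      push_cast
      field_simp
      ring
  have hσs := contDiffOn_potField hR hA hu
  have hbd : ∀ q : RoundBall.S2, potField R A u (R • (q : E3)) = ζ q := by
    have c1 := continuous_comp_smul hσs.continuousOn hRI
    have hz := eq_zero_of_basis_moments hY
      (V := fun q : RoundBall.S2 => potField R A u (R • (q : E3)) - ζ q) (c1.sub hζc)
      (fun l m => by
        rw [radPair_eq]
        simp only [inner_sub_left]
        rw [integral_sub (integrable_inner_S2 c1 (continuous_radW _))
          (integrable_inner_S2 hζc (continuous_radW _)), ← radPair_eq, ← radPair_eq,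
          radPair_potField hR hu hRR, hcd ⟨l, m⟩]
        simp [radPair, hζ.2])
      (fun l m => by
        unfold rotPair
        simp only [inner_sub_left]
        rw [integral_sub (integrable_inner_S2 c1 (continuous_rotV_S2 _))
          (integrable_inner_S2 hζc (continuous_rotV_S2 _)), sub_eq_zero]
        change rotPair _ _ = rotPair ζ _
        rw [rotPair_potField hR hA hu hRR (hY.harmonic l m),
          coef_series_coeff hR hY ht ⟨l, m⟩ hRI]
        have := (pow_pos hR l).ne'
        simp only [t]
        rcases Nat.eq_zero_or_pos l with rfl | hl
        · simp [rotPair, rotV_of_degree_zero (hY.harmonic 0 m).1]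
        · have hl' : (0 : ℝ) < l := by exact_mod_cast hl
          field_simp)
      (fun l m => by
        rw [gradPair_eq]
        simp only [inner_sub_left]
        rw [integral_sub (integrable_inner_S2 c1 (continuous_gradW _))
          (integrable_inner_S2 hζc (continuous_gradW _)), sub_eq_zero, ← gradPair_eq, ← gradPair_eq,
          gradPair_potField hR hA hu hRR (hY.harmonic l m), hcuR ⟨l, m⟩]
        simp only [s]
        rcases Nat.eq_zero_or_pos l with rfl | hl
        · simp [gradPair, rotV_of_degree_zero (hY.harmonic 0 m).1]
        · have hl' : (0 : ℝ) < l := by exact_mod_cast hl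
          field_simp)
    exact fun q => sub_eq_zero.1 (congrFun hz q)
  exact ⟨potField R A u, ⟨hσs, momentum_potField hR hA hu fun x hx => fA.laplace_series hR hx,
    fun q => by rw [hbd]; exact hζ.2 q⟩, hbd⟩

end extension

end RoundBall

namespace RoundBall
open MvPolynomial (X C pderiv)

/-! ### The isometries of the ball and the space of vacua -/

theorem inner_act (A : SO3) (u v : E3) : ⟪act A u, act A v⟫_ℝ = ⟪u, v⟫_ℝ := by
  have h0 : star (A : Matrix (Fin 3) (Fin 3) ℝ) * A = 1 :=
    (Matrix.mem_unitaryGroup_iff').1 (Matrix.mem_specialOrthogonalGroup_iff.1 A.2).1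
  have h1 : star (act A) * act A = 1 := by rw [← map_star, ← map_mul, h0, map_one]
  rw [← ContinuousLinearMap.adjoint_inner_right, ← ContinuousLinearMap.star_eq_adjoint,
    ← mul_apply_eq_comp, h1, one_apply_eq_self]

theorem norm_act (A : SO3) (u : E3) : ‖act A u‖ = ‖u‖ := by
  have h := inner_act A u u
  rw [real_inner_self_eq_norm_sq, real_inner_self_eq_norm_sq] at h
  exact (sq_eq_sq₀ (norm_nonneg _) (norm_nonneg _)).1 h

theorem act_one (x : E3) : act 1 x = x := by simp [act]

theorem act_inv_act (A : SO3) (x : E3) :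
    act (A⁻¹ : SO3) (act A x) = x := by
  rw [← act_mul, ← Submonoid.coe_mul, inv_mul_cancel]
  exact act_one x

theorem act_act_inv (A : SO3) (x : E3) :
    act A (act (A⁻¹ : SO3) x) = x := by
  rw [← act_mul, ← Submonoid.coe_mul, mul_inv_cancel]
  exact act_one x

theorem act_apply (A : Matrix (Fin 3) (Fin 3) ℝ) (x : E3) (i : Fin 3) :
    act A x i = ∑ j, A i j * x j := by
  change (A.mulVec x.ofLp) i = _
  simp [Matrix.mulVec, dotProduct]

theorem det_act (A : Matrix (Fin 3) (Fin 3) ℝ) : (act A).det = A.det := by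
  have h : ((act A : E3 →L[ℝ] E3) : E3 →ₗ[ℝ] E3) =
      Matrix.toLin (EuclideanSpace.basisFun (Fin 3) ℝ).toBasis
        (EuclideanSpace.basisFun (Fin 3) ℝ).toBasis A := by
    refine LinearMap.ext fun x => ?_
    ext i
    rw [ContinuousLinearMap.coe_coe, act_apply, Matrix.toLin_apply]
    fin_cases i <;> simp [Matrix.mulVec, dotProduct, Fin.sum_univ_three]
  rw [ContinuousLinearMap.det, h, LinearMap.det_toLin]

theorem rot_apply (A : SO3) (q : S2) : ((rot A q : S2) : E3) = act A (q : E3) := rfl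

theorem act_mem_ball (A : SO3) {R : ℝ} {x : E3} (hx : x ∈ ball R) : act A x ∈ ball R := by
  rw [mem_closedBall_zero_iff, norm_act]
  exact mem_closedBall_zero_iff.1 hx

theorem bijOn_act (A : SO3) (R : ℝ) : BijOn (act A) (ball R) (ball R) :=
  ⟨fun _ => act_mem_ball A, fun x _ y _ h => by rw [← act_inv_act A x, h, act_inv_act],
    fun x hx => ⟨act (A⁻¹ : SO3) x, act_mem_ball _ hx, act_act_inv A x⟩⟩

/-- The standard basis vectors as points of the sphere. -/
noncomputable def basisPt (i : Fin 3) : S2 := ⟨basisVec i, by simp [basisVec]⟩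

theorem inner_basisVec (v : E3) (i : Fin 3) : ⟪v, basisVec i⟫_ℝ = v i := by
  simp [basisVec, EuclideanSpace.inner_single_right]

/-- A map of the sphere that preserves inner products is linear. -/
theorem exists_orthogonal_of_inner {φ : S2 → S2}
    (h : ∀ p q, ⟪(φ p : E3), (φ q : E3)⟫_ℝ = ⟪(p : E3), (q : E3)⟫_ℝ) :
    ∃ A ∈ Matrix.orthogonalGroup (Fin 3) ℝ, ∀ q : S2, (φ q : E3) = act A (q : E3) := by
  have hb : ∀ i j, ⟪(φ (basisPt i) : E3), (φ (basisPt j) : E3)⟫_ℝ = if i = j then 1 else 0 := by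
    intro i j
    rw [h]
    change ⟪basisVec i, basisVec j⟫_ℝ = _
    rw [inner_basisVec, basisVec_apply]
    simp [eq_comm]
  have hq : ∀ (q : S2) i, ⟪(φ q : E3), (φ (basisPt i) : E3)⟫_ℝ = (q : E3) i := by
    intro q i
    rw [h]
    exact inner_basisVec _ _
  refine ⟨Matrix.of fun i j => (φ (basisPt j) : E3) i, ?_, fun q => ?_⟩
  · rw [Matrix.mem_orthogonalGroup_iff']
    ext i j
    have := hb i j
    rw [inner_eq_sum] at this
    simp only [Matrix.mul_apply, Matrix.of_apply, Matrix.one_apply]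
    rw [← this]
    rfl
  · have e : act (Matrix.of fun i j => (φ (basisPt j) : E3) i) (q : E3) =
        ∑ j, (q : E3) j • (φ (basisPt j) : E3) := by
      ext i
      rw [act_apply]
      simp [mul_comm, Fin.sum_univ_three]
    -- The squared distance from φ(q) to ∑ q_j φ(e_j) is expanded with the preserved inner products
    -- and equals 1 - 2|q|² + |q|² = 0.
    rw [e, ← sub_eq_zero, ← norm_eq_zero, ← sq_eq_zero_iff, ← real_inner_self_eq_norm_sq]
    have h1 : ⟪(φ q : E3), (φ q : E3)⟫_ℝ = 1 := by
      rw [real_inner_self_eq_norm_sq, norm_S2]; norm_num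
    have h2 := sum_sq_S2 q
    simp only [Fin.sum_univ_three] at h2 ⊢
    simp only [inner_sub_left, inner_sub_right, inner_add_left, inner_add_right,
      real_inner_smul_left, real_inner_smul_right, hb, hq, h1, real_inner_comm (φ q : E3)]
    simp
    nlinarith [h2]

/-- Not increasing distances means not decreasing inner products. By surjectivity some point is
mapped to -φ(q), and its inner product with q is at most -1, so it is -q. Thus φ respects antipodes,
and replacing q by -q reverses the inequality. -/
theorem inner_eq_of_dist_le (φ : DiffS2)
    (h : ∀ p q : S2, ‖(φ p : E3) - φ q‖ ≤ ‖(p : E3) - q‖) (p q : S2) :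
    ⟪(φ p : E3), (φ q : E3)⟫_ℝ = ⟪(p : E3), (q : E3)⟫_ℝ := by
  have key : ∀ p q : S2, ⟪(p : E3), (q : E3)⟫_ℝ ≤ ⟪(φ p : E3), (φ q : E3)⟫_ℝ := by
    intro p q
    have h1 := pow_le_pow_left₀ (norm_nonneg _) (h p q) 2
    rw [norm_sub_sq_real, norm_sub_sq_real] at h1
    simp only [norm_S2] at h1
    linarith
  have anti : ∀ q : S2, φ (-q) = -φ q := by
    intro q
    have h1 := key (φ.symm (-φ q)) q
    rw [φ.apply_symm_apply] at h1
    have h2 : ⟪((-φ q : S2) : E3), (φ q : E3)⟫_ℝ = -1 := by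
      rw [coe_neg_sphere, inner_neg_left, real_inner_self_eq_norm_sq, norm_S2]; norm_num
    rw [h2] at h1
    have h3 : ((φ.symm (-φ q) : S2) : E3) + q = 0 := by
      rw [← norm_eq_zero, ← sq_eq_zero_iff]
      refine le_antisymm ?_ (sq_nonneg _)
      rw [norm_add_sq_real]
      simp only [norm_S2]
      linarith
    have h4 : φ.symm (-φ q) = -q := Subtype.ext (by rw [coe_neg_sphere]; exact eq_neg_of_add_eq_zero_left h3)
    rw [← h4, φ.apply_symm_apply]
  refine le_antisymm ?_ (key p q)
  have h1 := key p (-q)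
  rw [anti] at h1
  simp only [coe_neg_sphere, inner_neg_right] at h1
  linarith

/-- A contraction of the ball that maps the endpoints of a diameter to those of another one maps
the first diameter isometrically to the second one. -/
theorem eq_smul_of_dist_le {R t : ℝ} (hR : 0 < R) (ht : t ≤ R) {a b : E3}
    (hb : ‖b‖ = 1) (h1 : ‖a - R • b‖ ≤ R - t) (h2 : ‖a + R • b‖ ≤ R + t) : a = t • b := by
  have g1 := pow_le_pow_left₀ (norm_nonneg _) h1 2
  have g2 := pow_le_pow_left₀ (norm_nonneg _) h2 2
  rw [norm_sub_sq_real, norm_smul, hb, real_inner_smul_right, mul_one, Real.norm_eq_abs, sq_abs] at g1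
  rw [norm_add_sq_real, norm_smul, hb, real_inner_smul_right, mul_one, Real.norm_eq_abs, sq_abs] at g2
  rw [← sub_eq_zero, ← norm_eq_zero, ← sq_eq_zero_iff]
  refine le_antisymm ?_ (sq_nonneg _)
  rw [norm_sub_sq_real, norm_smul, hb, real_inner_smul_right, mul_one, Real.norm_eq_abs, sq_abs]
  set s := ⟪a, b⟫_ℝ
  have h3 : R * (‖a‖ ^ 2 - 2 * (t * s) + t ^ 2) ≤ 0 := by
    nlinarith [mul_nonneg (sub_nonneg.2 ht) (sub_nonneg.2 g2),
      mul_nonneg (by linarith [norm_nonneg (a + R • b)] : 0 ≤ R + t) (sub_nonneg.2 g1)]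
  exact nonpos_of_mul_nonpos_right h3 hR

/-- Isometric derivatives make Φ a contraction of the convex ball, and that suffices. The boundary
map is then orthogonal by `exists_orthogonal_of_inner`, and orientation at the origin selects
determinant one. -/
theorem biso_eq {R : ℝ} (hR : 0 < R) : biso R = (rot.range : Set DiffS2) := by
  ext φ
  constructor
  · rintro ⟨Φ, hΦ, hbij, hiso, hdet, hbd⟩
    have hnorm : ∀ x ∈ ball R, ‖fderivWithin ℝ Φ (ball R) x‖ ≤ 1 := by
      intro x hx
      refine ContinuousLinearMap.opNorm_le_bound _ zero_le_one fun v => ?_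
      have := hiso x hx v v
      rw [real_inner_self_eq_norm_sq, real_inner_self_eq_norm_sq] at this
      rw [one_mul, (sq_eq_sq₀ (norm_nonneg _) (norm_nonneg _)).1 this]
    have hlip : ∀ x ∈ ball R, ∀ y ∈ ball R, ‖Φ y - Φ x‖ ≤ ‖y - x‖ := by
      intro x hx y hy
      have := Convex.norm_image_sub_le_of_norm_fderivWithin_le (𝕜 := ℝ)
        (hΦ.differentiableOn (by simp)) hnorm (convex_closedBall _ _) hx hy
      rwa [one_mul] at this
    have hmem : ∀ q : S2, R • (q : E3) ∈ ball R := fun q =>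
      mem_closedBall_zero_iff.2 (norm_smul_S2 hR.le q).le
    have hdist : ∀ p q : S2, ‖(φ p : E3) - φ q‖ ≤ ‖(p : E3) - q‖ := by
      intro p q
      have := hlip _ (hmem q) _ (hmem p)
      rw [hbd, hbd, ← smul_sub, ← smul_sub, norm_smul, norm_smul] at this
      exact le_of_mul_le_mul_left this (by simpa using hR.ne')
    obtain ⟨A, hA, hAφ⟩ := exists_orthogonal_of_inner (inner_eq_of_dist_le φ hdist)
    -- A point of a diameter is determined by its distances to the endpoints, so the contraction is
    -- forced to be linear along each diameter.
    have hΦA : ∀ x ∈ ball R, Φ x = act A x := by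
      intro x hx
      obtain ⟨t, q, ht0, htR, rfl⟩ : ∃ (t : ℝ) (q : S2), 0 ≤ t ∧ t ≤ R ∧ x = t • (q : E3) := by
        rcases eq_or_ne x 0 with rfl | h0
        · exact ⟨0, basisPt 0, le_rfl, hR.le, by simp⟩
        · exact ⟨‖x‖, ⟨‖x‖⁻¹ • x, by simp [norm_smul, h0]⟩, norm_nonneg _,
            mem_closedBall_zero_iff.1 hx, by simp [smul_smul, h0]⟩
      rw [map_smul, ← hAφ]
      refine eq_smul_of_dist_le hR htR (norm_S2 _) ?_ ?_
      · have := hlip _ (hmem q) _ hx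
        rwa [hbd, ← sub_smul, norm_smul, norm_S2, mul_one, Real.norm_eq_abs, abs_sub_comm,
          abs_of_nonneg (by linarith)] at this
      · have := hlip _ (hmem (-q)) _ hx
        have h4 : (φ (-q) : E3) = -φ q := by rw [hAφ, hAφ, coe_neg_sphere, map_neg]
        rwa [hbd, h4, coe_neg_sphere, smul_neg, smul_neg, sub_neg_eq_add, sub_neg_eq_add, ← add_smul,
          norm_smul, norm_S2, mul_one, Real.norm_eq_abs, abs_of_nonneg (by linarith),
          add_comm t] at this
    have h0 : (0 : E3) ∈ ball R := by simp [hR.le]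
    have hfd : fderivWithin ℝ Φ (ball R) 0 = act A := by
      rw [fderivWithin_congr hΦA (hΦA 0 h0)]
      exact (act A).hasFDerivWithinAt.fderivWithin (uniqueDiffOn_ball hR 0 h0)
    have hpos := hdet 0 h0
    rw [hfd, det_act] at hpos
    have h1 : A.det = 1 := by
      have h2 := congrArg Matrix.det ((Matrix.mem_orthogonalGroup_iff' (Fin 3) ℝ).1 hA)
      rw [Matrix.det_mul, Matrix.det_transpose, Matrix.det_one] at h2
      nlinarith
    exact ⟨⟨A, Matrix.mem_specialOrthogonalGroup_iff.2 ⟨hA, h1⟩⟩,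
      Diffeomorph.ext fun q => Subtype.ext (hAφ q).symm⟩
  · rintro ⟨A, rfl⟩
    have hfd : ∀ x ∈ ball R, fderivWithin ℝ (act A) (ball R) x = act A := fun x hx =>
      (act A).hasFDerivWithinAt.fderivWithin (uniqueDiffOn_ball hR x hx)
    refine ⟨act A, (act A).contDiff.contDiffOn, bijOn_act A R, fun x hx u v => ?_, fun x hx => ?_,
      fun q => ?_⟩
    · rw [hfd x hx, inner_act]
    · rw [hfd x hx, det_act, (Matrix.mem_specialOrthogonalGroup_iff.1 A.2).2]
      exact one_pos
    · rw [map_smul, rot_apply]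

theorem rot_injective : Function.Injective rot := by
  intro A B h
  refine Subtype.ext (Matrix.ext fun i j => ?_)
  have h1 := congrArg (fun φ : DiffS2 => (φ (basisPt j) : E3) i) h
  simp only [rot_apply, act_apply] at h1
  simpa [basisPt, basisVec_apply, Fin.sum_univ_three] using h1

theorem exists_vacua_equiv {R : ℝ} (hR : 0 < R) : ∃ e : Vacua R ≃ DiffModSO3, ∀ φ : DiffS2,
    e (Quot.mk _ φ) = Quotient.mk (QuotientGroup.rightRel rot.range) φ := by
  refine ⟨Quot.congr (Equiv.refl _) fun φ ψ => ?_, fun φ => rfl⟩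
  rw [biso_eq hR]
  refine Iff.trans ?_ QuotientGroup.rightRel_apply.symm
  constructor
  · rintro ⟨S, hS, rfl⟩
    simpa using hS
  · intro h
    exact ⟨_, h, by simp⟩

end RoundBall

namespace RoundBall
open MvPolynomial (X C pderiv)

/-! ### Rotated fields -/

section rotated
variable {R : ℝ} (hR : 0 < R) (A : SO3)

theorem inv_coe (i j : Fin 3) :
    ((A⁻¹ : SO3) : Matrix (Fin 3) (Fin 3) ℝ) i j = (A : Matrix (Fin 3) (Fin 3) ℝ) j i := rfl

theorem sum_mul_col (k l : Fin 3) :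
    ∑ i, (A : Matrix (Fin 3) (Fin 3) ℝ) i k * (A : Matrix (Fin 3) (Fin 3) ℝ) i l =
      if k = l then 1 else 0 := by
  have h := congrFun (congrFun (congrArg Subtype.val (inv_mul_cancel A)) k) l
  simp only [Submonoid.coe_mul, Matrix.mul_apply, inv_coe] at h
  rw [h, Submonoid.coe_one, Matrix.one_apply]

/-- The field `A ∘ σ ∘ A⁻¹`. -/
noncomputable def rotField (σ : E3 → E3) (x : E3) : E3 := act A (σ (act (A⁻¹ : SO3) x))

theorem rotField_apply (σ : E3 → E3) (x : E3) (j : Fin 3) :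
    rotField A σ x j =
      ∑ l, (A : Matrix (Fin 3) (Fin 3) ℝ) j l * σ (act (A⁻¹ : SO3) x) l := act_apply _ _ _

theorem Smooth.comp_act {u : E3 → ℝ} (hu : Smooth R u) :
    Smooth R fun y => u (act (A⁻¹ : SO3) y) :=
  ContDiffOn.comp hu (act _).contDiff.contDiffOn fun _ hx => act_mem_ball _ hx

include hR

theorem pd_comp_act {u : E3 → ℝ} (hu : Smooth R u) {x : E3} (hx : x ∈ ball R) (i : Fin 3) :
    pd R i (fun y => u (act (A⁻¹ : SO3) y)) x =
      ∑ k, (A : Matrix (Fin 3) (Fin 3) ℝ) i k * pd R k u (act (A⁻¹ : SO3) x) := by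
  have hx' : act (A⁻¹ : SO3) x ∈ ball R := act_mem_ball _ hx
  have h := ((hu.differentiableWithinAt hx').hasFDerivWithinAt).comp x
    ((act (A⁻¹ : SO3)).hasFDerivWithinAt (s := ball R)) (fun _ hy => act_mem_ball _ hy)
  have h2 := pd_of_hasFDerivWithinAt hR hx i h
  refine h2.trans ?_
  rw [ContinuousLinearMap.comp_apply, fderivWithin_eq_sum_pd]
  refine Finset.sum_congr rfl fun k _ => ?_
  rw [act_apply]
  simp [basisVec_apply, inv_coe]

theorem dcomp_rotField {σ : E3 → E3} (hσ : ContDiffOn ℝ ∞ σ (ball R)) {x : E3} (hx : x ∈ ball R)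
    (i j : Fin 3) :
    dcomp R (rotField A σ) i j x = ∑ k, ∑ l, (A : Matrix (Fin 3) (Fin 3) ℝ) i k *
      (A : Matrix (Fin 3) (Fin 3) ℝ) j l * dcomp R σ k l (act (A⁻¹ : SO3) x) := by
  have s := contDiffOn_iff_smooth.1 hσ
  unfold dcomp
  simp only [rotField_apply]
  rw [pd_sum hR (fun l _ => (Smooth.const _).mul' ((s l).comp_act A)) hx, Finset.sum_comm]
  refine Finset.sum_congr rfl fun l _ => ?_
  rw [pd_const_mul hR ((s l).comp_act A) hx, pd_comp_act hR A (s l) hx, Finset.mul_sum]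
  exact Finset.sum_congr rfl fun k _ => by ring

omit hR in
theorem contDiffOn_rotField {σ : E3 → E3} (hσ : ContDiffOn ℝ ∞ σ (ball R)) :
    ContDiffOn ℝ ∞ (rotField A σ) (ball R) :=
  (act _).contDiff.comp_contDiffOn
    (hσ.comp (act _).contDiff.contDiffOn fun _ hx => act_mem_ball _ hx)

theorem IsSolution.rotField {σ : E3 → E3} (hσ : IsSolution R σ) :
    IsSolution R (rotField A σ) := by
  refine ⟨contDiffOn_rotField A hσ.smooth, fun x hx j => ?_, fun q => ?_⟩
  · have hx' : act (A⁻¹ : SO3) x ∈ ball R := act_mem_ball _ hx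
    set F : Fin 3 → Fin 3 → E3 → ℝ := fun k l y => (1 / 2) * (dcomp R σ k l y - dcomp R σ l k y)
      with hF
    have sF : ∀ k l, Smooth R (F k l) := fun k l =>
      (Smooth.const _).mul' ((Smooth.dcomp hR hσ.smooth k l).sub' (Smooth.dcomp hR hσ.smooth l k))
    have hm : ∀ l, ∑ k, pd R k (F k l) (act (A⁻¹ : SO3) x) = 0 := hσ.momentum _ hx'
    have e : ∀ i, pd R i (fun y => (1 / 2) * (dcomp R (RoundBall.rotField A σ) i j y -
        dcomp R (RoundBall.rotField A σ) j i y)) x =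
        ∑ k, ∑ l, (A : Matrix (Fin 3) (Fin 3) ℝ) i k * (A : Matrix (Fin 3) (Fin 3) ℝ) j l *
          ∑ m, (A : Matrix (Fin 3) (Fin 3) ℝ) i m * pd R m (F k l) (act (A⁻¹ : SO3) x) := by
      intro i
      rw [pd_congr (v := fun y => ∑ k, ∑ l, (A : Matrix (Fin 3) (Fin 3) ℝ) i k *
        (A : Matrix (Fin 3) (Fin 3) ℝ) j l * F k l (act (A⁻¹ : SO3) y)) ?_ hx]
      · rw [pd_sum hR (fun k _ => Smooth.sum' fun l _ =>
          (Smooth.const _).mul' ((sF k l).comp_act A)) hx]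
        refine Finset.sum_congr rfl fun k _ => ?_
        rw [pd_sum hR (fun l _ => (Smooth.const _).mul' ((sF k l).comp_act A)) hx]
        refine Finset.sum_congr rfl fun l _ => ?_
        rw [pd_const_mul hR ((sF k l).comp_act A) hx, pd_comp_act hR A (sF k l) hx]
      · intro y hy
        simp only [dcomp_rotField hR A hσ.smooth hy, hF]
        rw [Finset.sum_comm (f := fun k l => (A : Matrix (Fin 3) (Fin 3) ℝ) j k *
          (A : Matrix (Fin 3) (Fin 3) ℝ) i l * dcomp R σ k l (act (A⁻¹ : SO3) y)),
          ← Finset.sum_sub_distrib, Finset.mul_sum]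
        refine Finset.sum_congr rfl fun k _ => ?_
        rw [← Finset.sum_sub_distrib, Finset.mul_sum]
        exact Finset.sum_congr rfl fun l _ => by ring
    have c := sum_mul_col A
    simp only [e]
    calc _ = ∑ l, (A : Matrix (Fin 3) (Fin 3) ℝ) j l * ∑ k, ∑ m,
          (∑ i, (A : Matrix (Fin 3) (Fin 3) ℝ) i k * (A : Matrix (Fin 3) (Fin 3) ℝ) i m) *
          pd R m (F k l) (act (A⁻¹ : SO3) x) := by
          simp only [Fin.sum_univ_three]; ring
      _ = 0 := by
          refine Finset.sum_eq_zero fun l _ => ?_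
          simp only [c, ite_mul, one_mul, zero_mul, Finset.sum_ite_eq, Finset.mem_univ, if_true, hm,
            mul_zero]
  · have h : act (A⁻¹ : SO3) (R • (q : E3)) = R • ((rot A⁻¹ q : S2) : E3) := by
      rw [map_smul, rot_apply]
    have h2 : (q : E3) = act A ((rot A⁻¹ q : S2) : E3) := by rw [rot_apply, act_act_inv]
    rw [RoundBall.rotField, h, h2, inner_act]
    exact hσ.boundary _

theorem deltaH_rotField {σ : E3 → E3} (hσ : ContDiffOn ℝ ∞ σ (ball R)) {x : E3} (hx : x ∈ ball R)
    (i j : Fin 3) :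
    deltaH R (rotField A σ) i j x = ∑ k, ∑ l, (A : Matrix (Fin 3) (Fin 3) ℝ) i k *
      (A : Matrix (Fin 3) (Fin 3) ℝ) j l * deltaH R σ k l (act (A⁻¹ : SO3) x) := by
  unfold deltaH
  rw [dcomp_rotField hR A hσ hx, dcomp_rotField hR A hσ hx]
  simp only [Fin.sum_univ_three]
  ring

theorem trace_deltaH_rotField {σ : E3 → E3} (hσ : ContDiffOn ℝ ∞ σ (ball R)) {x : E3}
    (hx : x ∈ ball R) :
    ∑ i, deltaH R (rotField A σ) i i x = ∑ i, deltaH R σ i i (act (A⁻¹ : SO3) x) := by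
  have c := sum_mul_col A
  simp only [deltaH_rotField hR A hσ hx]
  calc _ = ∑ k, ∑ l, (∑ i, (A : Matrix (Fin 3) (Fin 3) ℝ) i k *
        (A : Matrix (Fin 3) (Fin 3) ℝ) i l) * deltaH R σ k l (act (A⁻¹ : SO3) x) := by
        simp only [Fin.sum_univ_three]; ring
    _ = _ := by
        simp only [c, ite_mul, one_mul, zero_mul, Finset.sum_ite_eq, Finset.mem_univ, if_true]

theorem sum_deltaH_rotField {σ τ : E3 → E3} (hσ : ContDiffOn ℝ ∞ σ (ball R))
    (hτ : ContDiffOn ℝ ∞ τ (ball R)) {x : E3} (hx : x ∈ ball R) :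
    ∑ i, ∑ j, deltaH R (rotField A σ) i j x * deltaH R (rotField A τ) i j x =
      ∑ i, ∑ j, deltaH R σ i j (act (A⁻¹ : SO3) x) * deltaH R τ i j (act (A⁻¹ : SO3) x) := by
  set M := (A : Matrix (Fin 3) (Fin 3) ℝ)
  have hM : M.transpose * M = 1 := by
    ext k l
    rw [Matrix.mul_apply, Matrix.one_apply, ← sum_mul_col A k l]
    rfl
  let S := Matrix.of fun k l => deltaH R σ k l (act (A⁻¹ : SO3) x)
  let T := Matrix.of fun k l => deltaH R τ k l (act (A⁻¹ : SO3) x)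
  have hrot : ∀ (Q : Matrix (Fin 3) (Fin 3) ℝ) (i j : Fin 3),
      ∑ k, ∑ l, M i k * M j l * Q k l = (M * Q * M.transpose) i j := by
    intro Q i j
    simp only [Matrix.mul_apply, Matrix.transpose_apply, Fin.sum_univ_three]
    ring
  have htr : ∀ P Q : Matrix (Fin 3) (Fin 3) ℝ, ∑ i, ∑ j, P i j * Q i j =
      (P * Q.transpose).trace := by
    intro P Q
    simp [Matrix.trace, Matrix.mul_apply]
  calc _ = ∑ i, ∑ j, (M * S * M.transpose) i j * (M * T * M.transpose) i j := by
        simp only [deltaH_rotField hR A hσ hx, deltaH_rotField hR A hτ hx, ← hrot]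
        rfl
    _ = ((M * S * M.transpose) * (M * T * M.transpose).transpose).trace := htr _ _
    _ = (S * T.transpose).trace := by
        rw [Matrix.transpose_mul, Matrix.transpose_mul, Matrix.transpose_transpose,
          show M * S * M.transpose * (M * (T.transpose * M.transpose)) =
            M * (S * (M.transpose * M) * T.transpose * M.transpose) by
            simp only [Matrix.mul_assoc], hM, Matrix.trace_mul_comm, Matrix.mul_one,
          Matrix.mul_assoc, hM, Matrix.mul_one]
    _ = _ := (htr S T).symm

omit hR in
theorem measurePreserving_act : MeasurePreserving (act A) (volume : Measure E3) volume := by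
  have h : (act A : E3 → E3) = LinearIsometryEquiv.mk
    (LinearEquiv.ofBijective (act A : E3 →ₗ[ℝ] E3)
      ⟨fun x y h => by rw [← act_inv_act A x]; exact (congrArg _ h).trans (act_inv_act A y),
        fun x => ⟨act (A⁻¹ : SO3) x, act_act_inv A x⟩⟩) (norm_act A) := rfl
  rw [h]
  exact LinearIsometryEquiv.measurePreserving _

/-- The variation of the metric transforms as a tensor, its contractions are invariant under
orthogonal matrices, and rotations preserve the ball and its volume. -/
theorem vacuaMetric_rotField {σ τ : E3 → E3} (hσ : ContDiffOn ℝ ∞ σ (ball R))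
    (hτ : ContDiffOn ℝ ∞ τ (ball R)) :
    vacuaMetric R (rotField A σ) (rotField A τ) = vacuaMetric R σ τ := by
  unfold vacuaMetric
  congr 1
  rw [setIntegral_congr_fun measurableSet_closedBall fun x hx => by
    rw [sum_deltaH_rotField hR A hσ hτ hx, trace_deltaH_rotField hR A hσ hx,
      trace_deltaH_rotField hR A hτ hx]]
  have hpre : (act (A⁻¹ : SO3)) ⁻¹' ball R = ball R := by
    ext x
    simp [norm_act]
  have hemb : MeasurableEmbedding (act (A⁻¹ : SO3) : E3 → E3) :=
    (act (A⁻¹ : SO3)).continuous.measurableEmbedding fun x y h => by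
      rw [← act_act_inv A x, h, act_act_inv]
  have := (measurePreserving_act A⁻¹).setIntegral_preimage_emb hemb
    (fun x => (∑ i, ∑ j, deltaH R σ i j x * deltaH R τ i j x) -
      (∑ i, deltaH R σ i i x) * ∑ j, deltaH R τ j j x) (ball R)
  rw [hpre] at this
  exact this

end rotated

/-! ### The metric on the tangent spaces of the space of vacua -/

section metric
variable {R : ℝ} (hR : 0 < R)

theorem vacuaMetric_comm (R : ℝ) (σ τ : E3 → E3) : vacuaMetric R σ τ = vacuaMetric R τ σ := by
  unfold vacuaMetric
  simp only [mul_comm]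

include hR

theorem vacuaMetric_congr {σ σ' τ τ' : E3 → E3} (hσ : IsSolution R σ) (hσ' : IsSolution R σ')
    (hτ : IsSolution R τ) (hτ' : IsSolution R τ')
    (h : ∀ q : S2, σ (R • (q : E3)) = σ' (R • (q : E3)))
    (h' : ∀ q : S2, τ (R • (q : E3)) = τ' (R • (q : E3))) :
    vacuaMetric R σ τ = vacuaMetric R σ' τ' := by
  rw [vacuaMetric_eq hR hσ.smooth hσ.boundary hτ, vacuaMetric_eq hR hσ'.smooth hσ'.boundary hτ',
    opD_eq_of_boundary_eq hR hτ hτ' h']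
  simp only [h]

theorem vacuaMetric_add_smul {σ σ' τ : E3 → E3} (hσ : IsSolution R σ) (hσ' : IsSolution R σ')
    (hτ : IsSolution R τ) (c : ℝ) :
    vacuaMetric R (fun x => σ x + c • σ' x) τ = vacuaMetric R σ τ + c * vacuaMetric R σ' τ := by
  have hs := hσ.add_smul hR hσ' c
  have hRI : R ∈ Icc (-R) R := ⟨by linarith, le_rfl⟩
  have hc := continuous_opD hR hτ.smooth hτ.boundary
  rw [vacuaMetric_eq hR hs.smooth hs.boundary hτ, vacuaMetric_eq hR hσ.smooth hσ.boundary hτ,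
    vacuaMetric_eq hR hσ'.smooth hσ'.boundary hτ]
  simp only [inner_add_left, real_inner_smul_left]
  rw [integral_add (integrable_inner_S2 (continuous_comp_smul hσ.smooth.continuousOn hRI) hc)
    ((integrable_inner_S2 (continuous_comp_smul hσ'.smooth.continuousOn hRI) hc).const_mul c),
    integral_const_mul]
  ring

theorem IsSolution.isTangentField {σ : E3 → E3} (hσ : IsSolution R σ) :
    IsTangentField fun q => σ (R • (q : E3)) := by
  have hfact : Fact (Module.finrank ℝ E3 = 2 + 1) := ⟨finrank_euclideanSpace_fin⟩
  refine ⟨?_, hσ.boundary⟩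
  have h1 : ContMDiff (𝓡 2) 𝓘(ℝ, E3) ∞ fun q : S2 => R • (q : E3) :=
    (contDiff_const_smul R).contMDiff.comp (contMDiff_coe_sphere (n := 2))
  exact hσ.smooth.contMDiffOn.comp_contMDiff h1 fun q =>
    mem_closedBall_zero_iff.2 (norm_smul_S2 hR.le q).le

/-- The space of solutions is nondegenerate up to rotations of the boundary. -/
theorem exists_cross_of_vacuaMetric_eq_zero {τ : E3 → E3} (hτ : IsSolution R τ)
    (h : ∀ σ, IsSolution R σ → vacuaMetric R σ τ = 0) :
    ∃ w : E3, ∀ q : S2, τ (R • (q : E3)) = cross w (R • (q : E3)) := by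
  obtain ⟨Y, hY⟩ := exists_isHarmonicBasis
  have hc := continuous_opD hR hτ.smooth hτ.boundary
  -- Every tangent field is the boundary value of a solution, so 𝔻τ is orthogonal to all of them, in
  -- particular to the test fields of the moments.
  have key : ∀ ζ : S2 → E3, IsTangentField ζ → ∫ q : S2, ⟪ζ q, opD R τ q⟫_ℝ ∂area = 0 := by
    intro ζ hζ
    obtain ⟨σ, hσ, hb⟩ := exists_isSolution_of_tangentField hR hζ
    have h1 := h σ hσ
    rw [vacuaMetric_eq hR hσ.smooth hσ.boundary hτ] at h1
    simp only [hb _] at h1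
    exact (mul_eq_zero.1 h1).resolve_left (by positivity)
  have hfact : Fact (Module.finrank ℝ E3 = 2 + 1) := ⟨finrank_euclideanSpace_fin⟩
  have htan : ∀ {F : E3 → E3}, ContDiff ℝ ∞ F → (∀ q : S2, ⟪F q, (q : E3)⟫_ℝ = 0) →
      IsTangentField fun q : S2 => F q := fun hF h0 =>
    ⟨hF.contMDiff.comp (contMDiff_coe_sphere (n := 2)), h0⟩
  have hrotV : ∀ Z : Poly, ContDiff ℝ ∞ (rotV Z) := fun Z =>
    contDiff_euclidean.2 fun k => contDiff_ev (rotP k Z)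
  have hcross : ∀ Z : Poly, ContDiff ℝ ∞ fun x => cross (rotV Z x) x := by
    intro Z
    refine contDiff_euclidean.2 fun k => ?_
    have h1 := fun k => contDiff_euclidean.1 (hrotV Z) k
    have h2 : ∀ k : Fin 3, ContDiff ℝ ∞ fun x : E3 => x k := fun k =>
      contDiff_euclidean.1 contDiff_id k
    simp only [cross_apply']
    exact ((h1 _).mul (h2 _)).sub ((h1 _).mul (h2 _))
  have h0 : opD R τ = 0 := by
    refine eq_zero_of_basis_moments hY hc (fun l m => ?_) (fun l m => ?_) (fun l m => ?_)
    · simp only [radPair, inner_opD hR hτ.smooth hτ.boundary, zero_mul, integral_zero]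
    · have := key _ (htan (hrotV (Y l m)) fun q => by
        exact inner_rotV_self _ _)
      simpa only [rotPair, real_inner_comm] using this
    · have := key _ (htan (hcross (Y l m)) fun q => by
        rw [real_inner_comm]; exact inner_cross_self _ _)
      rw [gradPair_eq]
      simpa only [gradW, real_inner_comm] using this
  have hk : (fun q : S2 => τ (R • (q : E3))) ∈ kerD R := by
    exact ⟨hτ.isTangentField hR, τ, hτ, fun _ => rfl, congrFun h0⟩
  rw [kerD_eq_rotations hR] at hk
  exact hk

omit hR in
theorem isTangentField_tangentDiff (R : ℝ) (φ : DiffS2) (V : tangentDiff φ) :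
    IsTangentField fun q => R • (V : S2 → E3) (φ.symm q) := by
  refine ⟨(contMDiff_const : ContMDiff (𝓡 2) 𝓘(ℝ, ℝ) ∞ (fun _ : S2 => R)).smul
    (V.2.1.comp φ.symm.contMDiff), fun q => ?_⟩
  have := V.2.2 (φ.symm q)
  rw [φ.apply_symm_apply] at this
  rw [real_inner_smul_left, this, mul_zero]

/-- A solution whose boundary value is the vector field `V` along `φ`, scaled to radius `R`. -/
noncomputable def extend (φ : DiffS2) (V : tangentDiff φ) : E3 → E3 :=
  (exists_isSolution_of_tangentField hR (isTangentField_tangentDiff R φ V)).choose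

theorem isSolution_extend (φ : DiffS2) (V : tangentDiff φ) : IsSolution R (extend hR φ V) :=
  (exists_isSolution_of_tangentField hR (isTangentField_tangentDiff R φ V)).choose_spec.1

theorem extend_apply (φ : DiffS2) (V : tangentDiff φ) (q : S2) :
    extend hR φ V (R • (φ q : E3)) = R • (V : S2 → E3) q := by
  have h := (exists_isSolution_of_tangentField hR
    (isTangentField_tangentDiff R φ V)).choose_spec.2 (φ q)
  refine h.trans ?_
  beta_reduce
  rw [φ.symm_apply_apply]

/-- Solutions whose boundary values are the vector fields `V`, `W` along `φ` have the same inner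
product as the chosen ones. -/
theorem vacuaMetric_extend (φ : DiffS2) (V W : tangentDiff φ) {σ τ : E3 → E3}
    (hσ : IsSolution R σ) (hτ : IsSolution R τ)
    (h : ∀ q : S2, σ (R • (φ q : E3)) = R • (V : S2 → E3) q)
    (h' : ∀ q : S2, τ (R • (φ q : E3)) = R • (W : S2 → E3) q) :
    vacuaMetric R (extend hR φ V) (extend hR φ W) = vacuaMetric R σ τ := by
  refine vacuaMetric_congr hR (isSolution_extend hR φ V) hσ (isSolution_extend hR φ W) hτ ?_ ?_
  · intro q
    have h1 := h (φ.symm q)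
    rwa [← extend_apply hR, φ.apply_symm_apply, eq_comm] at h1
  · intro q
    have h1 := h' (φ.symm q)
    rwa [← extend_apply hR, φ.apply_symm_apply, eq_comm] at h1

/-- The metric as a bilinear form on the vector fields along `φ`. -/
noncomputable def tangentForm (φ : DiffS2) : tangentDiff φ →ₗ[ℝ] tangentDiff φ →ₗ[ℝ] ℝ :=
  -- The chosen extensions are not linear in V, but the metric depends only on boundary values, so a
  -- sum of extensions may replace the extension of a sum.
  have hadd : ∀ V V' W : tangentDiff φ,
      vacuaMetric R (extend hR φ (V + V')) (extend hR φ W) =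
        vacuaMetric R (extend hR φ V) (extend hR φ W) +
          vacuaMetric R (extend hR φ V') (extend hR φ W) := fun V V' W => by
    have h := isSolution_extend hR φ
    rw [vacuaMetric_extend hR φ (V + V') W ((h V).add_smul hR (h V') 1) (h W)
      (fun q => by simp [extend_apply]) (extend_apply hR φ W),
      vacuaMetric_add_smul hR (h V) (h V') (h W), one_mul]
  have hsmul : ∀ (c : ℝ) (V W : tangentDiff φ),
      vacuaMetric R (extend hR φ (c • V)) (extend hR φ W) =
        c * vacuaMetric R (extend hR φ V) (extend hR φ W) := fun c V W => by
    have h := isSolution_extend hR φ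
    -- The multiple cV is written as V + (c - 1)V to fit the form of the linearity lemma.
    have e := vacuaMetric_add_smul hR (h V) (h V) (h W) (c - 1)
    rw [← vacuaMetric_extend hR φ (c • V) W ((h V).add_smul hR (h V) (c - 1)) (h W)
      (fun q => by simp [extend_apply]; module) (extend_apply hR φ W)] at e
    rw [e]; ring
  LinearMap.mk₂ ℝ (fun V W => vacuaMetric R (extend hR φ V) (extend hR φ W)) hadd hsmul
    (fun V W W' => by simp only [vacuaMetric_comm R (extend hR φ V), hadd])
    (fun c V W => by simp only [vacuaMetric_comm R (extend hR φ V), hsmul, smul_eq_mul])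

theorem tangentForm_apply (φ : DiffS2) (V W : tangentDiff φ) :
    tangentForm hR φ V W = vacuaMetric R (extend hR φ V) (extend hR φ W) := rfl

theorem tangentForm_comm (φ : DiffS2) (V W : tangentDiff φ) :
    tangentForm hR φ V W = tangentForm hR φ W V := vacuaMetric_comm _ _ _

/-- Every solution has the boundary value of some field along φ, so the kernel consists of the V
whose extension is orthogonal to all solutions, and these have rotations as boundary values.
Conversely 𝔻 annihilates rotations. -/
theorem ker_tangentForm (φ : DiffS2) : LinearMap.ker (tangentForm hR φ) = vertical φ := by
  ext V
  rw [LinearMap.mem_ker]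
  constructor
  · intro h
    have key : ∀ σ, IsSolution R σ → vacuaMetric R σ (extend hR φ V) = 0 := by
      intro σ hσ
      let W : tangentDiff φ := ⟨fun q => R⁻¹ • σ (R • (φ q : E3)),
        (contMDiff_const : ContMDiff (𝓡 2) 𝓘(ℝ, ℝ) ∞ (fun _ : S2 => R⁻¹)).smul
          ((hσ.isTangentField hR).1.comp φ.contMDiff), fun q => by
        rw [real_inner_smul_left, hσ.boundary (φ q), mul_zero]⟩
      have h1 := congrArg (fun L => L W) h
      rw [vacuaMetric_comm]
      rwa [tangentForm_apply, vacuaMetric_extend hR φ V W (isSolution_extend hR φ V) hσ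
        (extend_apply hR φ V) fun q => by simp [W, smul_smul, hR.ne']] at h1
    obtain ⟨w, hw⟩ := exists_cross_of_vacuaMetric_eq_zero hR (isSolution_extend hR φ V) key
    refine ⟨w, fun q => ?_⟩
    have := hw (φ q)
    rw [extend_apply, cross_smul] at this
    exact smul_right_injective _ hR.ne' this
  · rintro ⟨w, hw⟩
    refine LinearMap.ext fun W => ?_
    rw [tangentForm_comm, tangentForm_apply, vacuaMetric_extend hR φ W V (isSolution_extend hR φ W)
      (isSolution_cross hR w) (extend_apply hR φ W) (fun q => by rw [hw, cross_smul]),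
      vacuaMetric_eq hR (isSolution_extend hR φ W).smooth (isSolution_extend hR φ W).boundary
      (isSolution_cross hR w)]
    simp [opD_cross hR]

/-- The metric on the tangent space of `Diff(S²) / SO(3)` at the class of `φ`. -/
noncomputable def quotientForm (φ : DiffS2) : LinearMap.BilinForm ℝ (tangentVacua φ) :=
  LinearMap.liftQ₂ (vertical φ) (vertical φ) (tangentForm hR φ) (ker_tangentForm hR φ).ge
    fun V hV => by
      rw [← ker_tangentForm hR] at hV
      refine LinearMap.ext fun W => ?_
      rw [LinearMap.flip_apply, tangentForm_comm, LinearMap.mem_ker.1 hV]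

theorem quotientForm_tangentClass (φ : DiffS2) (V W : tangentDiff φ) :
    quotientForm hR φ (tangentClass φ V) (tangentClass φ W) =
      vacuaMetric R (extend hR φ V) (extend hR φ W) := rfl

theorem isSymm_quotientForm (φ : DiffS2) : (quotientForm hR φ).IsSymm := by
  refine ⟨fun V W => ?_⟩
  obtain ⟨V, rfl⟩ := (vertical φ).mkQ_surjective V
  obtain ⟨W, rfl⟩ := (vertical φ).mkQ_surjective W
  exact tangentForm_comm hR φ V W

theorem nondegenerate_quotientForm (φ : DiffS2) : (quotientForm hR φ).Nondegenerate := by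
  have hl : ∀ V, (∀ W, quotientForm hR φ V W = 0) → V = 0 := by
    intro V h
    obtain ⟨V, rfl⟩ := (vertical φ).mkQ_surjective V
    rw [Submodule.mkQ_apply, Submodule.Quotient.mk_eq_zero, ← ker_tangentForm hR]
    exact LinearMap.ext fun W => h (tangentClass φ W)
  exact ⟨hl, fun V h => hl V fun W => by rw [← (isSymm_quotientForm hR φ).eq]; exact h W⟩

/-- Conjugating the extensions by A gives solutions with the rotated boundary values, and this
leaves the metric unchanged. -/
theorem quotientForm_rot (A : SO3) (φ : DiffS2) (V W : tangentDiff φ)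
    (V' W' : tangentDiff (rot A * φ)) (hV : ∀ q, (V' : S2 → E3) q = act A ((V : S2 → E3) q))
    (hW : ∀ q, (W' : S2 → E3) q = act A ((W : S2 → E3) q)) :
    quotientForm hR (rot A * φ) (tangentClass _ V') (tangentClass _ W') =
      quotientForm hR φ (tangentClass φ V) (tangentClass φ W) := by
  have hb : ∀ (U : tangentDiff φ) (q : S2), rotField A (extend hR φ U)
      (R • ((rot A * φ) q : E3)) = R • act A ((U : S2 → E3) q) := by
    intro U q
    have e : act (A⁻¹ : SO3) (R • ((rot A * φ) q : E3)) = R • (φ q : E3) := by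
      rw [map_smul]
      congr 1
      exact act_inv_act A _
    rw [rotField, e, extend_apply, map_smul]
  rw [quotientForm_tangentClass, quotientForm_tangentClass,
    vacuaMetric_extend hR _ V' W' ((isSolution_extend hR φ V).rotField hR A)
      ((isSolution_extend hR φ W).rotField hR A) (fun q => by rw [hb, hV])
      (fun q => by rw [hb, hW]),
    vacuaMetric_rotField hR A (isSolution_extend hR φ V).smooth (isSolution_extend hR φ W).smooth]

end metric

end RoundBall

/-! ### Assembly of the statements. -/

theorem mainTheorem5 (R : ℝ) (hR : 0 < R) :
    (∃ Y : (ℓ : ℕ) → Fin (2 * ℓ + 1) → MvPolynomial (Fin 3) ℝ, RoundBall.IsHarmonicBasis Y) ∧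
    -- statements in terms of the mode expansion, for every choice of real spherical harmonics
    (∀ Y : (ℓ : ℕ) → Fin (2 * ℓ + 1) → MvPolynomial (Fin 3) ℝ, RoundBall.IsHarmonicBasis Y →
      -- solutions of the momentum constraint are the superpositions of modes
      (∀ σ : RoundBall.E3 → RoundBall.E3, ContDiffOn ℝ ∞ σ (RoundBall.ball R) →
        (RoundBall.MomentumConstraint R σ ↔ ∃ a f, RoundBall.HasModeExpansion R Y σ a f)) ∧
      -- boundary preservation in terms of the modes
      (∀ σ a f, ContDiffOn ℝ ∞ σ (RoundBall.ball R) → RoundBall.HasModeExpansion R Y σ a f →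
        (RoundBall.BoundaryPreserving R σ ↔
          ∀ ℓ m, derivWithin (f ℓ m) (Icc 0 R) R = 0)) ∧
      -- the metric
      (∀ σ τ a b f g, RoundBall.IsSolution R σ → RoundBall.IsSolution R τ →
        RoundBall.HasModeExpansion R Y σ a f → RoundBall.HasModeExpansion R Y τ b g →
        HasSum (fun p : RoundBall.ModeIdx =>
          R ^ 3 * (((p.1 : ℝ) * ((p.1 : ℝ) + 1)) *
            (((p.1 : ℝ) - 1) *
                ((R ^ ((p.1 : ℤ) - 1) * a p.1 p.2) * (R ^ ((p.1 : ℤ) - 1) * b p.1 p.2))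
              - 2 * ((f p.1 p.2 R / R ^ 2) * (g p.1 p.2 R / R ^ 2)))))
          (RoundBall.vacuaMetric R σ τ)) ∧
      -- null solutions mix both towers
      (∀ σ a f, RoundBall.IsSolution R σ → RoundBall.HasModeExpansion R Y σ a f →
        RoundBall.vacuaMetric R σ σ = 0 →
        (¬ ∃ w : RoundBall.E3, ∀ q : RoundBall.S2,
          σ (R • (q : RoundBall.E3)) = RoundBall.cross w (R • (q : RoundBall.E3))) →
        RoundBall.BothTowers R a f) ∧
      -- solutions of both constraints mix both towers
      (∀ σ a f, RoundBall.IsSolution R σ → RoundBall.HasModeExpansion R Y σ a f →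
        RoundBall.HamiltonianConstraint R σ →
        (¬ ∃ w : RoundBall.E3, ∀ x ∈ RoundBall.ball R, σ x = RoundBall.cross w x) →
        RoundBall.BothTowers R a f) ∧
      -- the kernel of `𝔻` in terms of the modes
      (∀ σ a f, RoundBall.IsSolution R σ → RoundBall.HasModeExpansion R Y σ a f →
        ((∀ q, RoundBall.opD R σ q = 0) ↔
          (∀ ℓ m, 1 < ℓ → a ℓ m = 0) ∧ (∀ ℓ m, 1 ≤ ℓ → f ℓ m R = 0))) ∧
      RoundBall.kerD R =
        {ζ | ∃ c : Fin (2 * 1 + 1) → ℝ, ∀ q : RoundBall.S2,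
          ζ q = ∑ m, (c m * R) •
            RoundBall.coexactHarmonic (Y 1 m) (R • (q : RoundBall.E3))}) ∧
    -- the momentum constraint in vector calculus form
    (∀ σ : RoundBall.E3 → RoundBall.E3, ContDiffOn ℝ ∞ σ (RoundBall.ball R) →
      (RoundBall.MomentumConstraint R σ ↔
        ∀ x ∈ RoundBall.ball R, RoundBall.curl R (RoundBall.curl R σ) x = 0)) ∧
    -- the Hamiltonian constraint forces solutions to be null
    (∀ σ, RoundBall.IsSolution R σ → RoundBall.HamiltonianConstraint R σ →
      RoundBall.vacuaMetric R σ σ = 0) ∧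
    -- `𝔻` is a well-defined operator on boundary vector fields, and it represents the metric
    (∀ ζ, RoundBall.IsTangentField ζ →
      ∃ σ, RoundBall.IsSolution R σ ∧ RoundBall.HasBoundaryValue R σ ζ) ∧
    (∀ σ τ ζ, RoundBall.IsSolution R σ → RoundBall.IsSolution R τ →
      RoundBall.HasBoundaryValue R σ ζ → RoundBall.HasBoundaryValue R τ ζ →
      RoundBall.opD R σ = RoundBall.opD R τ) ∧
    (∀ σ τ, RoundBall.IsSolution R σ → RoundBall.IsSolution R τ →
      RoundBall.vacuaMetric R σ τ =
        R ^ 2 * ∫ q : RoundBall.S2,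
          (⟪σ (R • (q : RoundBall.E3)), RoundBall.opD R τ q⟫_ℝ) ∂(RoundBall.area)) ∧
    -- the kernel of `𝔻` consists of the infinitesimal rotations
    RoundBall.kerD R =
      {ζ | ∃ w : RoundBall.E3, ∀ q : RoundBall.S2,
        ζ q = RoundBall.cross w (R • (q : RoundBall.E3))} ∧
    -- the isotropy group is `SO(3)`, and the space of vacua is `Diff(S²) / SO(3)`
    RoundBall.biso R = (RoundBall.rot.range : Set RoundBall.DiffS2) ∧
    Function.Injective RoundBall.rot ∧
    (∃ e : RoundBall.Vacua R ≃ RoundBall.DiffModSO3, ∀ φ : RoundBall.DiffS2,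
      e (Quot.mk _ φ) = Quotient.mk (QuotientGroup.rightRel RoundBall.rot.range) φ) ∧
    -- the metric descends to a nondegenerate metric on `Diff(S²) / SO(3)`
    (∃ B : (φ : RoundBall.DiffS2) → LinearMap.BilinForm ℝ (RoundBall.tangentVacua φ),
      (∀ φ, (B φ).IsSymm ∧ (B φ).Nondegenerate) ∧
      (∀ φ (V W : RoundBall.tangentDiff φ) (σ τ : RoundBall.E3 → RoundBall.E3),
        RoundBall.IsSolution R σ → RoundBall.IsSolution R τ →
        (∀ q : RoundBall.S2, σ (R • (φ q : RoundBall.E3)) = R • (V : RoundBall.S2 → RoundBall.E3) q) →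
        (∀ q : RoundBall.S2, τ (R • (φ q : RoundBall.E3)) = R • (W : RoundBall.S2 → RoundBall.E3) q) →
        B φ (RoundBall.tangentClass φ V) (RoundBall.tangentClass φ W) =
          RoundBall.vacuaMetric R σ τ) ∧
      (∀ (A : RoundBall.SO3) (φ : RoundBall.DiffS2) (V W : RoundBall.tangentDiff φ)
        (V' W' : RoundBall.tangentDiff (RoundBall.rot A * φ)),
        (∀ q, (V' : RoundBall.S2 → RoundBall.E3) q = RoundBall.act A ((V : RoundBall.S2 → RoundBall.E3) q)) →
        (∀ q, (W' : RoundBall.S2 → RoundBall.E3) q = RoundBall.act A ((W : RoundBall.S2 → RoundBall.E3) q)) →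
        B (RoundBall.rot A * φ) (RoundBall.tangentClass _ V') (RoundBall.tangentClass _ W') =
          B φ (RoundBall.tangentClass φ V) (RoundBall.tangentClass φ W))) := by
  open RoundBall in
  refine ⟨exists_isHarmonicBasis, fun Y hY => ⟨fun σ hσ => ⟨fun hm => ?_, ?_⟩, ?_, ?_, ?_, ?_, ?_,
    kerD_eq_modes hR hY⟩, fun σ hσ => momentumConstraint_iff_curl hR hσ, ?_,
    fun ζ hζ => exists_isSolution_of_tangentField hR hζ, ?_, ?_, kerD_eq_rotations hR, biso_eq hR,
    rot_injective, exists_vacua_equiv hR, fun φ => quotientForm hR φ, ?_, ?_, ?_⟩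
  · exact exists_hasModeExpansion hR hY hσ hm
  · rintro ⟨a, f, h⟩
    exact h.momentumConstraint hR hY hσ
  · intro σ a f hσ h
    exact h.boundaryPreserving_iff hR hY
  · intro σ τ a b f g hσ hτ h h'
    exact hasSum_vacuaMetric hR hY hσ hτ h h'
  · intro σ a f hσ h h0 hrot
    exact bothTowers_of_null hR hY hσ h h0 hrot
  · intro σ a f hσ h hH hrot
    -- Here σ is only known not to be a rotation on the ball; under the Hamiltonian constraint a
    -- rotation on the boundary would be one inside as well.
    refine bothTowers_of_null hR hY hσ h (vacuaMetric_eq_zero_of_hamiltonian hH) ?_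
    rintro ⟨w, hw⟩
    exact hrot ⟨w, eq_cross_of_hamiltonian hR hσ hH hw⟩
  · intro σ a f hσ h
    exact opD_eq_zero_iff hR hY hσ h
  · intro σ hσ hH
    exact vacuaMetric_eq_zero_of_hamiltonian hH
  · intro σ τ ζ hσ hτ hσζ hτζ
    exact opD_eq_of_boundary_eq hR hσ hτ fun q => (hσζ q).trans (hτζ q).symm
  · intro σ τ hσ hτ
    exact vacuaMetric_eq hR hσ.smooth hσ.boundary hτ
  · exact fun φ => ⟨isSymm_quotientForm hR φ, nondegenerate_quotientForm hR φ⟩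
  · intro φ V W σ τ hσ hτ h h'
    rw [quotientForm_tangentClass]
    exact vacuaMetric_extend hR φ V W hσ hτ h h'
  · exact fun A φ V W V' W' => quotientForm_rot hR A φ V W V' W'
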